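/- Let $n,d\ge 1$ be the numbers of customers and resources. An *ordered norm* on $\mathbb{R}^d$ is a norm of the form $\|x\|_\beta=\sum_{i=1}^d\beta_i\,(|x|^{\downarrow})_i$ with $\beta_1\ge\dots\ge\beta_d\ge 0$, $\beta\neq 0$, where $|x|^{\downarrow}$ lists the absolute values of the entries of $x$ in non-increasing order. For each customer $c\in\{1,\dots,n\}$ let $X_c\subseteq\mathbb{R}^d_{\ge 0}$ be a closed convex set, and let $X=\sum_c X_c$ (Minkowski sum). The sets $X_c$ are accessible only through $\tau$-approximate linear minimization oracles, $\tau\ge 1$: functions $f_c:\mathbb{R}^d_{\ge 0}\to X_c$ with $\langle f_c(y),y\rangle\le\tau\,\langle x,y\rangle$ for all $y\in\mathbb{R}^d_{\ge 0}$ and $x\in X_c$ (for $\tau=1$ these are exact minimizers of linear functions with non-negative coefficients). The model of computation is a randomized real RAM: exact real arithmetic with $\exp$ and $\log$, comparisons, integer additions, subtractions and halvings, indirect addressing, and drawing a uniform real from $[0,1]$ or a uniform integer from $\{0,\dots,m-1\}$ take unit time; there is no rounding of reals to integers. **Theorem.** There is one program for this machine which, given $n$, $d$, $\beta$, $\tau$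 and any $\varepsilon>0$, and access to the oracles $f_c$, always terminates with some $x\in X$ such that $$\|x\|_\beta\ \le\ \tau(1+\varepsilon)\,\|z\|_\beta\qquad\text{for all } z\in X .$$ In particular $x$ is a $(1+\varepsilon)$-approximate minimizer of $\|\cdot\|_\beta$ over $X$ if the oracles are exact. Moreover, for every $\tau\ge 1$ there is a constant $K$, depending only on $\tau$, such that - with probability at least $1-(nd)^{-18}$ the program makes at most $K\,(n+d)\,\bigl(\varepsilon^{-2}+\log\log\max\{d,3\}\bigr)\,\log(n+d)$ oracle calls; - in every run, the total time spent outside the oracles is at most $K\,(1+d\log d)$ times the number of oracle calls made in this run. -/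

import Mathlib

open MeasureTheory

noncomputable section

/-! ## Ordered norms and the fractional load balancing problem -/

/-- `∑ i, β i * (x↓) i`, where `x↓` lists the absolute values of the entries of `x` in
non-increasing order (`Tuple.sort` sorts `-|x|` in non-decreasing order). -/
def orderedNorm {d : ℕ} (β x : Fin d → ℝ) : ℝ :=
  ∑ i, β i * |x (Tuple.sort (fun j => -|x j|) i)|

/-- Weight vectors that define an ordered norm. -/
structure IsOrderedWeight {d : ℕ} (β : Fin d → ℝ) : Prop where
  antitone : Antitone β
  nonneg : ∀ i, 0 ≤ β i
  ne_zero : β ≠ 0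

/-- The feasible set `∑ c, X c` (Minkowski sum). -/
def feasibleSet {n d : ℕ} (X : Fin n → Set (Fin d → ℝ)) : Set (Fin d → ℝ) :=
  {x | ∃ z : Fin n → Fin d → ℝ, (∀ c, z c ∈ X c) ∧ x = ∑ c, z c}

/-- `x` is a feasible point whose ordered norm is at most `α` times the optimum. -/
def IsApproxSolution {n d : ℕ} (β : Fin d → ℝ) (X : Fin n → Set (Fin d → ℝ)) (α : ℝ)
    (x : Fin d → ℝ) : Prop :=
  x ∈ feasibleSet X ∧ ∀ z ∈ feasibleSet X, orderedNorm β x ≤ α * orderedNorm β z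

/-- `f` is a `τ`-approximate linear minimization oracle over `Y` for non-negative prices `y`;
for `τ = 1` it returns an exact minimizer. -/
def IsLinMinOracle {d : ℕ} (τ : ℝ) (Y : Set (Fin d → ℝ)) (f : (Fin d → ℝ) → Fin d → ℝ) : Prop :=
  ∀ y : Fin d → ℝ, (∀ j, 0 ≤ y j) →
    f y ∈ Y ∧ ∀ x ∈ Y, ∑ j, f y j * y j ≤ τ * ∑ j, x j * y j

/-! ## Randomized real RAM with linear minimization oracles

A program is a fixed finite text. It works on countably many arrays of natural numbers and
countably many arrays of real numbers, all entries of which can be addressed indirectly. Exact real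
arithmetic, `exp`, `log`, comparisons, integer addition, truncated subtraction and halving, drawing
a uniform real from `[0,1]` and drawing a uniform integer from `{0,…,m-1}` take unit time. There is
no conversion from reals to integers. The only literals are natural numbers. -/

namespace RealRAM

structure State where
  /-- `nat a i` is entry `i` of the integer array `a`. -/
  nat : ℕ → ℕ → ℕ
  /-- `real a i` is entry `i` of the real array `a`. -/
  real : ℕ → ℕ → ℝ
  /-- Number of random values drawn so far. -/
  drawn : ℕ
  /-- Number of oracle calls so far. -/
  calls : ℕ
  /-- Number of elementary steps so far, without the time spent inside the oracles. -/
  time : ℕ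

inductive NExpr where
  | const (k : ℕ)
  | get (a : ℕ) (i : NExpr)
  | add (e₁ e₂ : NExpr)
  | sub (e₁ e₂ : NExpr)
  | half (e : NExpr)

namespace NExpr

def eval (s : State) : NExpr → ℕ
  | const k => k
  | get a i => s.nat a (i.eval s)
  | add e₁ e₂ => e₁.eval s + e₂.eval s
  | sub e₁ e₂ => e₁.eval s - e₂.eval s
  | half e => e.eval s / 2

/-- Number of steps needed to evaluate the expression. -/
def cost : NExpr → ℕ
  | const _ => 1
  | get _ i => i.cost + 1
  | add e₁ e₂ => e₁.cost + e₂.cost + 1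
  | sub e₁ e₂ => e₁.cost + e₂.cost + 1
  | half e => e.cost + 1

end NExpr

inductive RExpr where
  | ofNat (e : NExpr)
  | get (a : ℕ) (i : NExpr)
  | add (e₁ e₂ : RExpr)
  | sub (e₁ e₂ : RExpr)
  | mul (e₁ e₂ : RExpr)
  | div (e₁ e₂ : RExpr)
  | exp (e : RExpr)
  | log (e : RExpr)

namespace RExpr

def eval (s : State) : RExpr → ℝ
  | ofNat e => (e.eval s : ℝ)
  | get a i => s.real a (i.eval s)
  | add e₁ e₂ => e₁.eval s + e₂.eval s
  | sub e₁ e₂ => e₁.eval s - e₂.eval s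
  | mul e₁ e₂ => e₁.eval s * e₂.eval s
  | div e₁ e₂ => e₁.eval s / e₂.eval s
  | exp e => Real.exp (e.eval s)
  | log e => Real.log (e.eval s)

/-- Number of steps needed to evaluate the expression. -/
def cost : RExpr → ℕ
  | ofNat e => e.cost + 1
  | get _ i => i.cost + 1
  | add e₁ e₂ => e₁.cost + e₂.cost + 1
  | sub e₁ e₂ => e₁.cost + e₂.cost + 1
  | mul e₁ e₂ => e₁.cost + e₂.cost + 1
  | div e₁ e₂ => e₁.cost + e₂.cost + 1
  | exp e => e.cost + 1
  | log e => e.cost + 1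

end RExpr

inductive Cond where
  | natLe (e₁ e₂ : NExpr)
  | natLt (e₁ e₂ : NExpr)
  | realLe (e₁ e₂ : RExpr)
  | realLt (e₁ e₂ : RExpr)

namespace Cond

def Holds (s : State) : Cond → Prop
  | natLe e₁ e₂ => e₁.eval s ≤ e₂.eval s
  | natLt e₁ e₂ => e₁.eval s < e₂.eval s
  | realLe e₁ e₂ => e₁.eval s ≤ e₂.eval s
  | realLt e₁ e₂ => e₁.eval s < e₂.eval s

/-- Number of steps needed to evaluate the condition. -/
def cost : Cond → ℕ
  | natLe e₁ e₂ => e₁.cost + e₂.cost + 1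
  | natLt e₁ e₂ => e₁.cost + e₂.cost + 1
  | realLe e₁ e₂ => e₁.cost + e₂.cost + 1
  | realLt e₁ e₂ => e₁.cost + e₂.cost + 1

end Cond

inductive Prog where
  | skip
  /-- Entry `i` of the integer array `a` becomes `e`. -/
  | setNat (a : ℕ) (i e : NExpr)
  /-- Entry `i` of the real array `a` becomes `e`. -/
  | setReal (a : ℕ) (i : NExpr) (e : RExpr)
  /-- Entry `i` of the integer array `a` becomes uniform in `{0,…,m-1}`. -/
  | randNat (a : ℕ) (i m : NExpr)
  /-- Entry `i` of the real array `a` becomes uniform in `[0,1]`. -/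
  | randReal (a : ℕ) (i : NExpr)
  /-- Calls the oracle of customer `k` with the first `d` entries of the real array `src` as prices
  and stores its answer in the first `d` entries of the real array `dst`. -/
  | query (k : NExpr) (src dst : ℕ)
  | seq (p q : Prog)
  | ite (b : Cond) (p q : Prog)
  | while (b : Cond) (p : Prog)

/-- `upd m a i v` is the memory `m` after `v` has been written to entry `i` of array `a`. -/
def upd {α : Type} (m : ℕ → ℕ → α) (a i : ℕ) (v : α) : ℕ → ℕ → α :=
  Function.update m a (Function.update (m a) i v)

/-- The memory `m` after the vector `v` has been written to the first `d` entries of array `a`. -/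
def updVec {d : ℕ} (m : ℕ → ℕ → ℝ) (a : ℕ) (v : Fin d → ℝ) : ℕ → ℕ → ℝ :=
  Function.update m a (fun j => if h : j < d then v ⟨j, h⟩ else m a j)

/-- The uniform element of `{0,…,m-1}` obtained from a uniform element of `[0,1]`. -/
def uniformNat (m : ℕ) (u : unitInterval) : ℕ :=
  min ⌊(u : ℝ) * m⌋₊ (m - 1)

/-- `Exec f ω p s s'`: with oracles `f` and random values `ω 0, ω 1, …`, the program `p` started in
state `s` terminates in state `s'`. A query for a customer that does not exist or
with a negative price has no terminating execution. -/
inductive Exec {n d : ℕ} (f : Fin n → (Fin d → ℝ) → Fin d → ℝ) (ω : ℕ → unitInterval) :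
    Prog → State → State → Prop
  | skip (s : State) : Exec f ω .skip s s
  | setNat (a : ℕ) (i e : NExpr) (s : State) :
      Exec f ω (.setNat a i e) s
        { s with nat := upd s.nat a (i.eval s) (e.eval s), time := s.time + (i.cost + e.cost + 1) }
  | setReal (a : ℕ) (i : NExpr) (e : RExpr) (s : State) :
      Exec f ω (.setReal a i e) s
        { s with
          real := upd s.real a (i.eval s) (e.eval s)
          time := s.time + (i.cost + e.cost + 1) }
  | randNat (a : ℕ) (i m : NExpr) (s : State) :
      Exec f ω (.randNat a i m) s
        { s with
          nat := upd s.nat a (i.eval s) (uniformNat (m.eval s) (ω s.drawn))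
          drawn := s.drawn + 1
          time := s.time + (i.cost + m.cost + 1) }
  | randReal (a : ℕ) (i : NExpr) (s : State) :
      Exec f ω (.randReal a i) s
        { s with
          real := upd s.real a (i.eval s) (ω s.drawn)
          drawn := s.drawn + 1
          time := s.time + (i.cost + 1) }
  | query (k : NExpr) (src dst : ℕ) (s : State) (c : Fin n) (hc : k.eval s = c)
      (hy : ∀ j : Fin d, 0 ≤ s.real src j) :
      Exec f ω (.query k src dst) s
        { s with
          real := updVec s.real dst (f c (fun j => s.real src j))
          calls := s.calls + 1
          time := s.time + (k.cost + d + 1) }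
  | seq {p q : Prog} {s s' s'' : State} (hp : Exec f ω p s s') (hq : Exec f ω q s' s'') :
      Exec f ω (.seq p q) s s''
  | iteTrue {b : Cond} {p q : Prog} {s s' : State} (hb : b.Holds s)
      (hp : Exec f ω p { s with time := s.time + b.cost } s') : Exec f ω (.ite b p q) s s'
  | iteFalse {b : Cond} {p q : Prog} {s s' : State} (hb : ¬ b.Holds s)
      (hq : Exec f ω q { s with time := s.time + b.cost } s') : Exec f ω (.ite b p q) s s'
  | whileTrue {b : Cond} {p : Prog} {s s' s'' : State} (hb : b.Holds s)
      (hp : Exec f ω p { s with time := s.time + b.cost } s')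
      (hw : Exec f ω (.while b p) s' s'') : Exec f ω (.while b p) s s''
  | whileFalse {b : Cond} {p : Prog} {s : State} (hb : ¬ b.Holds s) :
      Exec f ω (.while b p) s { s with time := s.time + b.cost }

/-- For fixed random values, the final state is unique. -/
theorem Exec.unique {n d : ℕ} {f : Fin n → (Fin d → ℝ) → Fin d → ℝ} {ω : ℕ → unitInterval}
    {p : Prog} {s s₁ s₂ : State} (h₁ : Exec f ω p s s₁) (h₂ : Exec f ω p s s₂) : s₁ = s₂ := by
  induction h₁ generalizing s₂ with
  | query k src dst s c hc hy =>
    cases h₂ with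
    | query _ _ _ _ c' hc' _ =>
      have : c = c' := Fin.ext (hc.symm.trans hc')
      subst this
      rfl
  | seq _ _ ihp ihq =>
    cases h₂ with
    | seq hp hq =>
      cases ihp hp
      exact ihq hq
  | iteTrue hb _ ih =>
    cases h₂ with
    | iteTrue _ hp => exact ih hp
    | iteFalse hb' _ => exact absurd hb hb'
  | iteFalse hb _ ih =>
    cases h₂ with
    | iteTrue hb' _ => exact absurd hb' hb
    | iteFalse _ hq => exact ih hq
  | whileTrue hb _ _ ihp ihw =>
    cases h₂ with
    | whileTrue _ hp hw =>
      cases ihp hp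
      exact ihw hw
    | whileFalse hb' => exact absurd hb hb'
  | whileFalse hb =>
    cases h₂ with
    | whileTrue hb' _ _ => exact absurd hb' hb
    | whileFalse _ => rfl
  | _ => cases h₂; rfl

/-- The input: `n` and `d` in integer array `0`, the weights `β` in real array `0`, and `ε`
and `τ` in real array `1`. All other entries are `0`. -/
def inputState (n : ℕ) {d : ℕ} (β : Fin d → ℝ) (ε τ : ℝ) : State where
  nat := fun a i => if a = 0 ∧ i = 0 then n else if a = 0 ∧ i = 1 then d else 0
  real := fun a i =>
    if a = 0 then (if h : i < d then β ⟨i, h⟩ else 0)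
    else if a = 1 ∧ i = 0 then ε else if a = 1 ∧ i = 1 then τ else 0
  drawn := 0
  calls := 0
  time := 0

/-- The output: the first `d` entries of real array `2`. -/
def State.output (d : ℕ) (s : State) : Fin d → ℝ := fun j => s.real 2 j

/-- The law of a sequence of independent random values that are uniform in `[0,1]`. -/
def tapeMeasure : Measure (ℕ → unitInterval) :=
  Measure.infinitePi (fun _ : ℕ => (volume : Measure unitInterval))

end RealRAM

end

/-! Smoothing. For a non-negative load x the ordered norm is the maximum of ⟨y, x⟩ over the convex
hull of the permutations of β (`DualFeasible`). Subtracting 1/A times the relative entropy of y with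
respect to the mean weight gives a smooth substitute, whose unique maximizer y serves as a price
vector (`IsPrice`). The smoothed value is at most 0 at x = 0 and undercuts the norm by at most (∑
β)(log d)/A (`IsPrice.le_entropicValue`). Adding a load l of small enough value increases it by at
most ⟨l, y + w⟩, where a small uniform surcharge w on the prices pays for the second order term
(`IsPrice.entropicValue_step`). At the surcharged prices a feasible z costs at most (1+δ)‖z‖, so all
oracle answers together cost at most τ(1+δ) times the optimum. Depositing oracle answers until every
customer has reached total weight T, and dividing by T, therefore gives a nearly optimal load. The
prices are computed by sorting x and pooling adjacent violators: they are read off the slopes of the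
greatest convex minorant of the curve of partial sums.

Sampling. Calling all oracles before every small deposit would be too expensive. The customers are
divided into p ≤ d groups, and an active group g has a multiplicity m g, a power of two. One
iteration draws group g with weight m g, and with weight 1 a check that calls all oracles. A visit
typically deposits 1/m g times the answer of the group. So between two checks each active group
advances by about 1 in expectation, and the expected deposited value is about the value of a check.
The multiplicity doubles if the value of a visit would exceed a cap and halves if it is far below
the cap; an amortized count bounds the number of visits by the progress plus a multiple of the
deposited value divided by the cap (`Core.choice_spec`). An exponential potential is a
supermartingale (`Core.sum_pot_le`). If it ends below 1, then the deposited value is at most about T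
times the largest check value L, and few calls have been made (`Core.bounds_of_pot_lt`,
`Core.cnt_le_of_bounds`).

Certificates. In every run L is at most τ(1+δ)‖z‖ for all feasible z, and the norm of a finished
mean load is at most a number that the program computes. Correctness is thus tested and never left
to chance; randomness only affects the number of calls. The core procedure needs a guess of the
optimum up to a constant factor. It is found by bisection on a logarithmic scale between two bounds
with ratio at most dτ, which takes O(log log d) rounds for fixed τ (`Prob.searchProg`). One accurate
run follows, and if its test fails, a deterministic procedure finishes the computation
(`Prob.finalProg`). Each round of oracle calls is accompanied by work O(1 + d log d) per call, which
bounds the running time in all runs. -/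

noncomputable section

namespace RealRAM

/-! ## Finite random computations -/

/-- A finite tree of random draws; `draw m k` draws a uniform element of `{0,…,m}`. -/
inductive Rnd (α : Type) where
  | ret (a : α)
  | draw (m : ℕ) (k : ℕ → Rnd α)

namespace Rnd

variable {α β : Type}

/-- The leaf reached when the draws are read off `ω` from position `i` on. -/
def eval (ω : ℕ → unitInterval) : Rnd α → ℕ → α
  | ret a, _ => a
  | draw m k, i => eval ω (k (uniformNat (m + 1) (ω i))) (i + 1)

/-- The number of draws on the path that is taken. -/
def depth (ω : ℕ → unitInterval) : Rnd α → ℕ → ℕ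
  | ret _, _ => 0
  | draw m k, i => depth ω (k (uniformNat (m + 1) (ω i))) (i + 1) + 1

def All (Q : α → Prop) : Rnd α → Prop
  | ret a => Q a
  | draw m k => ∀ r ≤ m, All Q (k r)

open Classical in
/-- The probability of the leaves that satisfy `bad`. -/
def prob (bad : α → Prop) : Rnd α → ℝ
  | ret a => if bad a then 1 else 0
  | draw m k => (∑ r ∈ Finset.range (m + 1), prob bad (k r)) / (m + 1)

def bind (k : α → Rnd β) : Rnd α → Rnd β
  | ret a => k a
  | draw m l => draw m (fun r => bind k (l r))

theorem uniformNat_le (m : ℕ) (u : unitInterval) : uniformNat (m + 1) u ≤ m := by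
  unfold uniformNat
  exact min_le_right _ _

theorem eval_of_all {Q : α → Prop} {t : Rnd α} (h : t.All Q) (ω : ℕ → unitInterval) (i : ℕ) :
    Q (t.eval ω i) := by
  induction t generalizing i with
  | ret a => exact h
  | draw m k ih => exact ih _ (h _ (uniformNat_le _ _)) _

theorem All.mono {Q R : α → Prop} (hQR : ∀ a, Q a → R a) {t : Rnd α} (h : t.All Q) : t.All R := by
  induction t with
  | ret a => exact hQR _ h
  | draw m k ih => exact fun r hr => ih r (h r hr)

theorem eval_bind (k : α → Rnd β) (t : Rnd α) (ω : ℕ → unitInterval) (i : ℕ) :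
    (t.bind k).eval ω i = (k (t.eval ω i)).eval ω (i + t.depth ω i) := by
  induction t generalizing i with
  | ret a => rfl
  | draw m l ih =>
    simp only [bind, eval, depth]
    rw [ih]
    congr 1
    ring

theorem depth_bind (k : α → Rnd β) (t : Rnd α) (ω : ℕ → unitInterval) (i : ℕ) :
    (t.bind k).depth ω i = t.depth ω i + (k (t.eval ω i)).depth ω (i + t.depth ω i) := by
  induction t generalizing i with
  | ret a => simp [bind, eval, depth]
  | draw m l ih =>
    simp only [bind, eval, depth]
    rw [ih]
    have : i + (depth ω (l (uniformNat (m + 1) (ω i))) (i + 1) + 1)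
      = i + 1 + depth ω (l (uniformNat (m + 1) (ω i))) (i + 1) := by ring
    rw [this]
    ring

theorem all_bind {Q : α → Prop} {R : β → Prop} {k : α → Rnd β} {t : Rnd α} (h : t.All Q)
    (hk : ∀ a, Q a → (k a).All R) : (t.bind k).All R := by
  induction t with
  | ret a => exact hk _ h
  | draw m l ih => exact fun r hr => ih r (h r hr)

theorem prob_nonneg (bad : α → Prop) (t : Rnd α) : 0 ≤ t.prob bad := by
  induction t with
  | ret a => simp only [prob]; split_ifs <;> norm_num
  | draw m k ih => exact div_nonneg (Finset.sum_nonneg fun r _ => ih r) (by positivity)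

theorem prob_le_one (bad : α → Prop) (t : Rnd α) : t.prob bad ≤ 1 := by
  induction t with
  | ret a => simp only [prob]; split_ifs <;> norm_num
  | draw m k ih =>
    simp only [prob]
    rw [div_le_one (by positivity)]
    calc _ ≤ ∑ r ∈ Finset.range (m + 1), (1 : ℝ) := Finset.sum_le_sum fun r _ => ih r
      _ = _ := by simp

theorem prob_draw_le {bad : α → Prop} {m : ℕ} {k : ℕ → Rnd α} {v : ℕ → ℝ} {w : ℝ}
    (h : ∀ r ≤ m, (k r).prob bad ≤ v r) (hv : ∑ r ∈ Finset.range (m + 1), v r ≤ (m + 1) * w) :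
    (draw m k).prob bad ≤ w := by
  simp only [prob]
  rw [div_le_iff₀ (by positivity)]
  calc _ ≤ ∑ r ∈ Finset.range (m + 1), v r :=
        Finset.sum_le_sum fun r hr => h r (Nat.lt_succ_iff.1 (Finset.mem_range.1 hr))
    _ ≤ _ := by linarith

/-- Union bound over two stages: either the first stage is bad, or the second fails with probability
at most `w`. The invariant `Q` is available when the second stage is analysed. -/
theorem prob_bind_le {Q : α → Prop} {bad : α → Prop} {bad' : β → Prop} {k : α → Rnd β} {t : Rnd α}
    {w : ℝ} (hw : 0 ≤ w) (h : t.All Q) (hk : ∀ a, Q a → ¬ bad a → (k a).prob bad' ≤ w) :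
    (t.bind k).prob bad' ≤ t.prob bad + w := by
  induction t with
  | ret a =>
    simp only [bind, prob]
    split_ifs with hb
    · linarith [prob_le_one bad' (k a)]
    · simpa using hk a h hb
  | draw m l ih =>
    simp only [bind, prob]
    rw [div_add' _ _ _ (by positivity)]
    gcongr
    calc _ ≤ ∑ r ∈ Finset.range (m + 1), ((l r).prob bad + w) :=
          Finset.sum_le_sum fun r hr => ih r (h r (Nat.lt_succ_iff.1 (Finset.mem_range.1 hr)))
      _ = _ := by rw [Finset.sum_add_distrib]; simp; ring

theorem prob_mono {bad bad' : α → Prop} (h : ∀ a, bad a → bad' a) (t : Rnd α) :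
    t.prob bad ≤ t.prob bad' := by
  induction t with
  | ret a =>
    simp only [prob]
    split_ifs with h1 h2 <;> first | exact absurd (h _ h1) h2 | norm_num
  | draw m k ih =>
    simp only [prob]
    gcongr with r hr
    exact ih r

end Rnd

/-! ### Transfer of tree probabilities to the measure on the tape -/

theorem measurable_uniformNat (m : ℕ) : Measurable (uniformNat m) := by
  unfold uniformNat
  exact (Nat.measurable_floor.comp (by fun_prop)).min measurable_const

/-- The value r is only taken on [r/(m+1), (r+1)/(m+1)]; the truncation in `uniformNat` matters at u
= 1 alone. An upper bound is enough, because only failure probabilities are transferred to the tape.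
-/
theorem volume_uniformNat_eq_le (m r : ℕ) :
    (volume : Measure unitInterval) {u | uniformNat (m + 1) u = r} ≤
      ENNReal.ofReal (1 / (m + 1)) := by
  have hsub : ((↑) : unitInterval → ℝ) '' {u | uniformNat (m + 1) u = r} ⊆
      Set.Icc ((r : ℝ) / (m + 1)) ((r + 1) / (m + 1)) := by
    rintro _ ⟨u, hu, rfl⟩
    have hm : (0 : ℝ) < (m : ℝ) + 1 := by positivity
    simp only [Set.mem_ofPred_eq, uniformNat] at hu
    have hu0 : (0 : ℝ) ≤ u := u.2.1
    have hu1 : (u : ℝ) ≤ 1 := u.2.2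
    push_cast at hu
    rw [Set.mem_Icc, div_le_iff₀ hm, le_div_iff₀ hm]
    have h0 : (0 : ℝ) ≤ (u : ℝ) * (m + 1) := by positivity
    have h1 := Nat.floor_le h0
    have h2 := Nat.lt_floor_add_one ((u : ℝ) * (m + 1))
    rcases le_total ⌊(u : ℝ) * (m + 1)⌋₊ m with h | h
    · rw [min_eq_left h] at hu
      rw [← hu]
      exact ⟨h1, h2.le⟩
    · rw [min_eq_right h] at hu
      have hr : r = m := by omega
      subst hr
      refine ⟨le_trans ?_ h1, by nlinarith⟩
      exact_mod_cast h
  rw [MeasureTheory.Measure.Subtype.volume_def, MeasureTheory.Measure.comap_apply₀]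
  · refine (measure_mono hsub).trans ?_
    rw [Real.volume_Icc]
    apply le_of_eq
    congr 1
    field_simp
    ring
  · exact Subtype.val_injective
  · intro s hs
    exact (MeasurableSet.subtype_image (measurableSet_Icc) hs).nullMeasurableSet
  · exact ((measurable_uniformNat _) (measurableSet_singleton r)).nullMeasurableSet

/-- The sigma-algebra of the random values from position `i` on. -/
@[reducible] def tapeFrom (i : ℕ) : MeasurableSpace (ℕ → unitInterval) :=
  ⨆ k ∈ Set.Ici i, MeasurableSpace.comap (fun ω : ℕ → unitInterval => ω k) inferInstance

theorem tapeFrom_anti {i j : ℕ} (h : i ≤ j) : tapeFrom j ≤ tapeFrom i :=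
  biSup_mono fun _ hk => le_trans h hk

theorem comap_le_tapeFrom (i : ℕ) :
    MeasurableSpace.comap (fun ω : ℕ → unitInterval => ω i) inferInstance ≤ tapeFrom i :=
  le_biSup (fun k => MeasurableSpace.comap (fun ω : ℕ → unitInterval => ω k) inferInstance)
    (Set.mem_Ici.2 le_rfl)

namespace Rnd

variable {α : Type}

theorem setOf_draw (bad : α → Prop) (m : ℕ) (k : ℕ → Rnd α) (i : ℕ) :
    {ω | bad ((draw m k).eval ω i)} = ⋃ r ∈ Finset.range (m + 1),
      ({ω | uniformNat (m + 1) (ω i) = r} ∩ {ω | bad ((k r).eval ω (i + 1))}) := by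
  ext ω
  simp only [eval, Set.mem_ofPred_eq, Set.mem_iUnion, Set.mem_inter_iff, Finset.mem_range]
  constructor
  · exact fun h => ⟨_, Nat.lt_succ_iff.2 (uniformNat_le m (ω i)), rfl, h⟩
  · rintro ⟨r, _, rfl, h⟩
    exact h

/-- Measurability with respect to the draws from position `i` on, rather than all draws, is what
makes the event of a subtree independent of the draw at its root. -/
theorem measurableSet_eval (bad : α → Prop) (t : Rnd α) (i : ℕ) :
    MeasurableSet[tapeFrom i] {ω | bad (t.eval ω i)} := by
  induction t generalizing i with
  | ret a =>
    simp only [eval]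
    exact @MeasurableSet.const _ (tapeFrom i) _
  | draw m k ih =>
    rw [setOf_draw]
    refine @Finset.measurableSet_biUnion _ _ (tapeFrom i) _ _ fun r _ => ?_
    refine @MeasurableSet.inter _ (tapeFrom i) _ _ ?_ (tapeFrom_anti (Nat.le_succ i) _ (ih r _))
    exact comap_le_tapeFrom i _
      ⟨{u | uniformNat (m + 1) u = r}, measurable_uniformNat _ (measurableSet_singleton r), rfl⟩

instance : IsProbabilityMeasure tapeMeasure := by
  unfold tapeMeasure
  infer_instance

theorem indep_tapeFrom (i : ℕ) : ProbabilityTheory.Indep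
    (MeasurableSpace.comap (fun ω : ℕ → unitInterval => ω i) inferInstance) (tapeFrom (i + 1))
    tapeMeasure := by
  have h : ProbabilityTheory.iIndepFun (fun (k : ℕ) (ω : ℕ → unitInterval) => ω k) tapeMeasure :=
    ProbabilityTheory.iIndepFun_infinitePi (X := fun _ u => u) (by fun_prop)
  have h2 := ProbabilityTheory.indep_iSup_of_disjoint
    (fun k => (measurable_pi_apply (X := fun _ : ℕ => unitInterval) k).comap_le) h.iIndep
    (S := {i}) (T := Set.Ici (i + 1)) (by simp)
  simpa [tapeFrom] using h2

/-- Induction on the tree: the first draw is independent of all later ones, so each branch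
contributes at most 1/(m+1) times the probability of its subtree. -/
theorem measure_eval_le (bad : α → Prop) (t : Rnd α) (i : ℕ) :
    tapeMeasure {ω | bad (t.eval ω i)} ≤ ENNReal.ofReal (t.prob bad) := by
  induction t generalizing i with
  | ret a =>
    simp only [eval, prob]
    split_ifs with h <;> simp [h]
  | draw m k ih =>
    rw [setOf_draw]
    refine (measure_biUnion_finset_le _ _).trans ?_
    simp only [prob]
    rw [Finset.sum_div, ENNReal.ofReal_sum_of_nonneg
      fun r _ => div_nonneg (prob_nonneg _ _) (by positivity)]
    refine Finset.sum_le_sum fun r _ => ?_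
    have hind := (ProbabilityTheory.Indep_iff _ _ _).1 (indep_tapeFrom i)
      {ω | uniformNat (m + 1) (ω i) = r} {ω | bad ((k r).eval ω (i + 1))}
      ⟨{u | uniformNat (m + 1) u = r}, measurable_uniformNat _ (measurableSet_singleton r), rfl⟩
      (measurableSet_eval _ _ _)
    rw [hind, div_eq_mul_one_div, mul_comm,
      ENNReal.ofReal_mul (prob_nonneg _ _)]
    refine mul_le_mul' (ih r _) ?_
    refine le_trans (le_of_eq ?_) (volume_uniformNat_eq_le m r)
    exact (measurePreserving_eval_infinitePi (fun _ : ℕ => (volume : Measure unitInterval))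
      i).measure_preimage
      (measurable_uniformNat _ (measurableSet_singleton r)).nullMeasurableSet

end Rnd
end RealRAM

namespace RealRAM

/-! ## Program logic -/

theorem updVec_apply {d : ℕ} (m : ℕ → ℕ → ℝ) (a : ℕ) (v : Fin d → ℝ) (b j : ℕ) :
    updVec m a v b j = if b = a then (if h : j < d then v ⟨j, h⟩ else m a j) else m b j := by
  unfold updVec
  rw [Function.update_apply]
  split_ifs with h1 h2
  · simp [h2]
  · simp [h2]
  · rfl

instance : Nonempty State := ⟨⟨fun _ _ => 0, fun _ _ => 0, 0, 0, 0⟩⟩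

instance : Nonempty (Rnd State) := ⟨.ret (Classical.arbitrary State)⟩

/-- The state after `c` further time steps. -/
def State.tick (s : State) (c : ℕ) : State := { s with time := s.time + c }

@[simp] theorem State.tick_nat (s : State) (c : ℕ) : (s.tick c).nat = s.nat := rfl
@[simp] theorem State.tick_real (s : State) (c : ℕ) : (s.tick c).real = s.real := rfl
@[simp] theorem State.tick_drawn (s : State) (c : ℕ) : (s.tick c).drawn = s.drawn := rfl
@[simp] theorem State.tick_calls (s : State) (c : ℕ) : (s.tick c).calls = s.calls := rfl
@[simp] theorem State.tick_time (s : State) (c : ℕ) : (s.tick c).time = s.time + c := rfl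

variable {n d : ℕ} {f : Fin n → (Fin d → ℝ) → Fin d → ℝ}

/-- Started in `s`, the program `p` terminates, without drawing random values, in a state
that satisfies `Q`. -/
def Total (f : Fin n → (Fin d → ℝ) → Fin d → ℝ) (p : Prog) (s : State) (Q : State → Prop) : Prop :=
  ∃ s', (∀ ω, Exec f ω p s s') ∧ s'.drawn = s.drawn ∧ Q s'

namespace Total

theorem mono {p : Prog} {s : State} {Q R : State → Prop} (h : Total f p s Q)
    (hQR : ∀ s', Q s' → R s') : Total f p s R := by
  obtain ⟨s', h1, h2, h3⟩ := h
  exact ⟨s', h1, h2, hQR _ h3⟩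

theorem skip {s : State} {Q : State → Prop} (h : Q s) : Total f .skip s Q :=
  ⟨s, fun _ => .skip s, rfl, h⟩

theorem setNat {a : ℕ} {i e : NExpr} {s : State} {Q : State → Prop}
    (h : Q { s with nat := upd s.nat a (i.eval s) (e.eval s)
                    time := s.time + (i.cost + e.cost + 1) }) : Total f (.setNat a i e) s Q :=
  ⟨_, fun _ => .setNat a i e s, rfl, h⟩

theorem setReal {a : ℕ} {i : NExpr} {e : RExpr} {s : State} {Q : State → Prop}
    (h : Q { s with real := upd s.real a (i.eval s) (e.eval s)
                    time := s.time + (i.cost + e.cost + 1) }) : Total f (.setReal a i e) s Q :=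
  ⟨_, fun _ => .setReal a i e s, rfl, h⟩

theorem query {k : NExpr} {src dst : ℕ} {s : State} {Q : State → Prop} (c : Fin n)
    (hc : k.eval s = c) (hy : ∀ j : Fin d, 0 ≤ s.real src j)
    (h : Q { s with real := updVec s.real dst (f c (fun j => s.real src j))
                    calls := s.calls + 1
                    time := s.time + (k.cost + d + 1) }) : Total f (.query k src dst) s Q :=
  ⟨_, fun _ => .query k src dst s c hc hy, rfl, h⟩

theorem seq {p q : Prog} {s : State} {Q : State → Prop}
    (h : Total f p s fun s' => Total f q s' Q) : Total f (.seq p q) s Q := by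
  obtain ⟨s', h1, h2, s'', h3, h4, h5⟩ := h
  exact ⟨s'', fun ω => .seq (h1 ω) (h3 ω), h4.trans h2, h5⟩

theorem ite {b : Cond} {p q : Prog} {s : State} {Q : State → Prop}
    (ht : b.Holds s → Total f p (s.tick b.cost) Q)
    (hf : ¬ b.Holds s → Total f q (s.tick b.cost) Q) : Total f (.ite b p q) s Q := by
  by_cases hb : b.Holds s
  · obtain ⟨s', h1, h2, h3⟩ := ht hb
    exact ⟨s', fun ω => .iteTrue hb (h1 ω), h2, h3⟩
  · obtain ⟨s', h1, h2, h3⟩ := hf hb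
    exact ⟨s', fun ω => .iteFalse hb (h1 ω), h2, h3⟩

/-- The index `k` of the invariant is a termination measure that decreases with each iteration; the
invariant usually also contains a time budget proportional to `k`. -/
theorem while_measure {I : ℕ → State → Prop} {b : Cond} {p : Prog} {Q : State → Prop}
    (step : ∀ k s, I k s → b.Holds s → Total f p (s.tick b.cost) fun s' => ∃ k' < k, I k' s')
    (exit : ∀ k s, I k s → ¬ b.Holds s → Q (s.tick b.cost)) :
    ∀ (k : ℕ) (s : State), I k s → Total f (.while b p) s Q := by
  intro k
  induction k using Nat.strong_induction_on with
  | _ k ih =>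
    intro s hs
    by_cases hb : b.Holds s
    · obtain ⟨s', h1, h2, k', hk', h3⟩ := step k s hs hb
      obtain ⟨s'', h4, h5, h6⟩ := ih k' hk' s' h3
      exact ⟨s'', fun ω => .whileTrue hb (h1 ω) (h4 ω), h5.trans h2, h6⟩
    · exact ⟨_, fun ω => .whileFalse hb, rfl, exit k s hs hb⟩

/-- A loop with `k` iterations left. -/
theorem while_count {I : ℕ → State → Prop} {b : Cond} {p : Prog} {Q : State → Prop}
    (step : ∀ k s, I (k + 1) s → b.Holds s ∧ Total f p (s.tick b.cost) (I k))
    (exit : ∀ s, I 0 s → ¬ b.Holds s ∧ Q (s.tick b.cost)) (k : ℕ) (s : State) (hs : I k s) :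
    Total f (.while b p) s Q := by
  refine while_measure (I := I) ?_ ?_ k s hs
  · intro k s hs hb
    cases k with
    | zero => exact absurd hb (exit s hs).1
    | succ k => exact (step k s hs).2.mono fun s' h => ⟨k, Nat.lt_succ_self k, h⟩
  · intro k s hs hb
    cases k with
    | zero => exact (exit s hs).2
    | succ k => exact absurd (step k s hs).1 hb

end Total

/-! ### Randomized programs and their failure probabilities -/

/-- `t` is the tree of the possible final states of the program `p` started in `s`. -/
def Runs (f : Fin n → (Fin d → ℝ) → Fin d → ℝ) (p : Prog) (s : State) (t : Rnd State) : Prop :=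
  ∀ ω, Exec f ω p s (t.eval ω s.drawn) ∧
    (t.eval ω s.drawn).drawn = s.drawn + t.depth ω s.drawn

/-- Started in `s`, the program `p` always terminates in a state that satisfies `Q`, and with
probability at least `1 - w` in a state that satisfies `G`. -/
def Prob (f : Fin n → (Fin d → ℝ) → Fin d → ℝ) (p : Prog) (s : State) (Q G : State → Prop)
    (w : ℝ) : Prop :=
  ∃ t : Rnd State, Runs f p s t ∧ t.All Q ∧ t.prob (fun s' => ¬ G s') ≤ w

/-- Started in `s`, the program `p` draws one element `r` of `{0,…,m}` and terminates in a state
that satisfies `Q r`. -/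
def Branch (f : Fin n → (Fin d → ℝ) → Fin d → ℝ) (p : Prog) (s : State) (m : ℕ)
    (Q : ℕ → State → Prop) : Prop :=
  ∃ g : ℕ → State, Runs f p s (.draw m fun r => .ret (g r)) ∧ ∀ r ≤ m, Q r (g r)

/-- The part before the draw is deterministic, so the tree has exactly one inner node; the part
after the draw is deterministic for each of the m + 1 outcomes. -/
theorem Branch.intro {p q : Prog} {a m : ℕ} {i e : NExpr} {s : State} {Q : ℕ → State → Prop}
    (h : Total f p s fun s' => e.eval s' = m + 1 ∧ ∀ r ≤ m, Total f q
      { s' with nat := upd s'.nat a (i.eval s') r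
                drawn := s'.drawn + 1
                time := s'.time + (i.cost + e.cost + 1) } (Q r)) :
    Branch f (.seq p (.seq (.randNat a i e) q)) s m Q := by
  obtain ⟨s', h1, h2, h3, h4⟩ := h
  choose! g hg using h4
  refine ⟨g, fun ω => ?_, fun r hr => (hg r hr).2.2⟩
  simp only [Rnd.eval, Rnd.depth]
  set r := uniformNat (m + 1) (ω s.drawn) with hr
  have hr' := hg r (Rnd.uniformNat_le _ _)
  refine ⟨.seq (h1 ω) (.seq (.randNat a i e s') ?_), ?_⟩
  · have := hr'.1 ω
    rw [h3, h2, ← hr]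
    rwa [h2] at this
  · rw [hr'.2.1]
    simp [h2]

namespace Prob

/-- The implication between the good events may use the invariant `Q`. This is the two-stage bound
`Rnd.prob_bind_le` with a trivial second stage that fails with probability 0. -/
theorem mono {p : Prog} {s : State} {Q Q' G G' : State → Prop} {w w' : ℝ} (h : Prob f p s Q G w)
    (hQ : ∀ s', Q s' → Q' s') (hG : ∀ s', Q s' → G s' → G' s') (hw : w ≤ w') :
    Prob f p s Q' G' w' := by
  obtain ⟨t, h1, h2, h3⟩ := h
  refine ⟨t, h1, h2.mono hQ, ?_⟩
  have := Rnd.prob_bind_le (bad' := fun s' => ¬ G' s') (k := Rnd.ret) (w := 0)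
    (bad := fun s' => ¬ G s') le_rfl h2 fun a ha hb => by
      simp only [Rnd.prob]
      rw [if_neg]
      simpa using hG a ha (not_not.1 hb)
  have hbind : ∀ t : Rnd State, t.bind Rnd.ret = t := fun t => by
    induction t with
    | ret a => rfl
    | draw m k ih => simp only [Rnd.bind]; congr 1; funext r; exact ih r
  rw [hbind] at this
  linarith

theorem of_total {p : Prog} {s : State} {Q G : State → Prop} {w : ℝ} (hw : 0 ≤ w)
    (h : Total f p s fun s' => Q s' ∧ G s') : Prob f p s Q G w := by
  obtain ⟨s', h1, h2, h3, h4⟩ := h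
  refine ⟨.ret s', fun ω => ⟨h1 ω, ?_⟩, h3, ?_⟩
  · simpa [Rnd.eval, Rnd.depth] using h2
  · simpa [Rnd.prob, h4] using hw

/-- The second program only has to succeed if the first one did, so the good event of the second
stage is an implication and the failure probabilities add up. -/
theorem seq {p q : Prog} {s : State} {Q Q' G G' : State → Prop} {w w' : ℝ} (hw' : 0 ≤ w')
    (h : Prob f p s Q G w) (hq : ∀ s', Q s' → Prob f q s' Q' (fun s'' => G s' → G' s'') w') :
    Prob f (.seq p q) s Q' G' (w + w') := by
  obtain ⟨t, h1, h2, h3⟩ := h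
  choose! k hk using hq
  refine ⟨t.bind k, fun ω => ?_, Rnd.all_bind h2 fun a ha => (hk a ha).2.1, ?_⟩
  · rw [Rnd.eval_bind, Rnd.depth_bind, ← (h1 ω).2]
    have hQ := Rnd.eval_of_all h2 ω s.drawn
    have := (hk _ hQ).1 ω
    refine ⟨.seq (h1 ω).1 this.1, ?_⟩
    rw [this.2, (h1 ω).2]
    ring
  · refine (Rnd.prob_bind_le (bad := fun s' => ¬ G s') hw' h2 fun a ha hb => ?_).trans
      (by linarith)
    refine (Rnd.prob_mono (fun s'' hs => ?_) _).trans (hk a ha).2.2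
    exact fun hG => hs (hG (not_not.1 hb))

theorem total_seq {p q : Prog} {s : State} {Q' G' : State → Prop} {w' : ℝ} (hw' : 0 ≤ w')
    (h : Total f p s fun s' => Prob f q s' Q' G' w') :
    Prob f (.seq p q) s Q' G' w' := by
  have h' : Prob f p s (fun s' => Prob f q s' Q' G' w') (fun _ => True) 0 :=
    of_total le_rfl (h.mono fun s' hs => ⟨hs, trivial⟩)
  have := seq (G' := G') hw' h' fun s' hs => hs.mono (fun _ h => h) (fun _ _ h _ => h) le_rfl
  simpa using this

theorem ite {b : Cond} {p q : Prog} {s : State} {Q G : State → Prop} {w : ℝ}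
    (ht : b.Holds s → Prob f p (s.tick b.cost) Q G w)
    (hf : ¬ b.Holds s → Prob f q (s.tick b.cost) Q G w) : Prob f (.ite b p q) s Q G w := by
  by_cases hb : b.Holds s
  · obtain ⟨t, h1, h2, h3⟩ := ht hb
    exact ⟨t, fun ω => ⟨.iteTrue hb (h1 ω).1, (h1 ω).2⟩, h2, h3⟩
  · obtain ⟨t, h1, h2, h3⟩ := hf hb
    exact ⟨t, fun ω => ⟨.iteFalse hb (h1 ω).1, (h1 ω).2⟩, h2, h3⟩

/-- A loop whose body makes one draw, with a potential `φ` that is a supermartingale and is at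
least `1` whenever the loop ends in a state that is not good. -/
theorem while_potential {A : Type} {R : A → State → Prop} {φ : A → ℝ} {μ : A → ℕ} {b : Cond}
    {p : Prog} {Q G : State → Prop} (hφ : ∀ a s, R a s → 0 ≤ φ a)
    (step : ∀ a s, R a s → b.Holds s → ∃ (m : ℕ) (a' : ℕ → A),
      Branch f p (s.tick b.cost) m (fun r s' => R (a' r) s' ∧ μ (a' r) < μ a) ∧
      ∑ r ∈ Finset.range (m + 1), φ (a' r) ≤ (m + 1) * φ a)
    (exit : ∀ a s, R a s → ¬ b.Holds s →
      Q (s.tick b.cost) ∧ (G (s.tick b.cost) ∨ 1 ≤ φ a)) :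
    ∀ (k : ℕ) (a : A) (s : State), μ a ≤ k → R a s → Prob f (.while b p) s Q G (φ a) := by
  intro k
  induction k using Nat.strong_induction_on with
  | _ k ih =>
    intro a s hk hR
    by_cases hb : b.Holds s
    · obtain ⟨m, a', ⟨g, hg1, hg2⟩, hsum⟩ := step a s hR hb
      -- By induction the failure probability after outcome r is at most the potential there. The
      -- supermartingale property averages these bounds to the current potential, which is optional
      -- stopping for a finite tree.
      have hrec : ∀ r ≤ m, Prob f (.while b p) (g r) Q G (φ (a' r)) := fun r hr =>
        ih (μ (a' r)) (lt_of_lt_of_le (hg2 r hr).2 hk) (a' r) (g r) le_rfl (hg2 r hr).1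
      choose! t ht using hrec
      refine ⟨.draw m t, fun ω => ?_, fun r hr => (ht r hr).2.1, ?_⟩
      · have h1 := hg1 ω
        simp only [Rnd.eval, Rnd.depth, State.tick_drawn] at h1 ⊢
        have hr := Rnd.uniformNat_le m (ω s.drawn)
        have h2 := (ht _ hr).1 ω
        rw [h1.2] at h2
        refine ⟨.whileTrue hb h1.1 h2.1, ?_⟩
        rw [h2.2]
        ring
      · exact Rnd.prob_draw_le (fun r hr => (ht r hr).2.2) hsum
    · obtain ⟨h1, h2⟩ := exit a s hR hb
      refine ⟨.ret (s.tick b.cost), fun ω => ⟨.whileFalse hb, rfl⟩, h1, ?_⟩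
      rcases h2 with h2 | h2
      · simpa [Rnd.prob, h2] using hφ a s hR
      · exact (Rnd.prob_le_one _ _).trans h2

/-- A loop with random bodies. -/
theorem while_count {I G : ℕ → State → Prop} {b : Cond} {p : Prog} {Q G' : State → Prop} {w : ℝ}
    (hw : 0 ≤ w)
    (step : ∀ k s, I (k + 1) s → b.Holds s →
      Prob f p (s.tick b.cost) (I k) (fun s' => G (k + 1) s → G k s') w)
    (exit : ∀ k s, I k s → (k = 0 ∨ ¬ b.Holds s) →
      ¬ b.Holds s ∧ Q (s.tick b.cost) ∧ (G k s → G' (s.tick b.cost))) :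
    ∀ (k : ℕ) (s : State), I k s →
      Prob f (.while b p) s Q (fun s' => G k s → G' s') (k * w) := by
  have hex : ∀ k s, I k s → ¬ b.Holds s →
      Prob f (.while b p) s Q (fun s' => G k s → G' s') (k * w) := fun k s hs hb => by
    obtain ⟨_, h1, h2⟩ := exit k s hs (.inr hb)
    exact of_total (by positivity) ⟨_, fun ω => .whileFalse hb, rfl, h1, h2⟩
  intro k
  induction k with
  | zero => exact fun s hs => hex 0 s hs (exit 0 s hs (.inl rfl)).1
  | succ k ih =>
    intro s hs
    by_cases hb : b.Holds s
    · have h := seq (p := p) (q := .while b p) (G' := fun s'' => G (k + 1) s → G' s'')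
        (by positivity) (step k s hs hb) (w' := k * w) fun s' hs' =>
          (ih s' hs').mono (fun _ h => h) (fun s'' _ h hG hG2 => h (hG hG2)) le_rfl
      obtain ⟨t, h1, h2, h3⟩ := h
      refine ⟨t, fun ω => ?_, h2, h3.trans (by push_cast; linarith)⟩
      obtain ⟨h4, h5⟩ := h1 ω
      refine ⟨?_, h5⟩
      simp only [State.tick_drawn] at h4 ⊢
      cases h4 with
      | seq hp hq => exact .whileTrue hb hp hq
    · exact hex _ s hs hb

/-- Executions are unique for a fixed tape, so every execution ends in the leaf that the tape
selects. -/
theorem sound {p : Prog} {s : State} {Q G : State → Prop} {w : ℝ} (h : Prob f p s Q G w) :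
    (∀ ω, ∃ s', Exec f ω p s s' ∧ Q s') ∧
    tapeMeasure {ω | ∃ s', Exec f ω p s s' ∧ ¬ G s'} ≤ ENNReal.ofReal w := by
  obtain ⟨t, h1, h2, h3⟩ := h
  refine ⟨fun ω => ⟨_, (h1 ω).1, Rnd.eval_of_all h2 ω _⟩, ?_⟩
  refine (measure_mono fun ω hω => ?_).trans ((Rnd.measure_eval_le (fun s' => ¬ G s') t
    s.drawn).trans (ENNReal.ofReal_le_ofReal h3))
  obtain ⟨s', h4, h5⟩ := hω
  have := Exec.unique h4 (h1 ω).1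
  subst this
  exact h5

end Prob
end RealRAM

/-! ## Ordered norms and their dual norms -/

/-- Summation by parts for a sequence with sign conditions on its partial sums. -/
theorem mul_le_sum_mul_of_partialSums (a g : ℕ → ℝ) (N : ℕ)
    (h : ∀ k < N, 0 ≤ (∑ i ∈ Finset.range (k + 1), a i) * (g k - g (k + 1))) :
    (∑ i ∈ Finset.range (N + 1), a i) * g N ≤ ∑ i ∈ Finset.range (N + 1), a i * g i := by
  induction N with
  | zero => simp
  | succ N ih =>
    rw [Finset.sum_range_succ _ (N + 1), Finset.sum_range_succ _ (N + 1)]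
    have h1 := ih fun k hk => h k (by omega)
    have h2 := h N (by omega)
    nlinarith

/-- If the total vanishes, the boundary term of the summation by parts drops out, and `g` may have
any sign. -/
theorem sum_mul_nonneg_of_partialSums (a g : ℕ → ℝ) (N : ℕ) (h0 : ∑ i ∈ Finset.range N, a i = 0)
    (h : ∀ k, k + 1 < N → 0 ≤ (∑ i ∈ Finset.range (k + 1), a i) * (g k - g (k + 1))) :
    0 ≤ ∑ i ∈ Finset.range N, a i * g i := by
  cases N with
  | zero => simp
  | succ N =>
    have := mul_le_sum_mul_of_partialSums a g N fun k hk => h k (by omega)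
    rwa [h0, zero_mul] at this

variable {d : ℕ}

/-- The sequence `β 0, …, β (d-1), 0, 0, …`. -/
def extendZero (β : Fin d → ℝ) (i : ℕ) : ℝ := if h : i < d then β ⟨i, h⟩ else 0

@[simp] theorem extendZero_coe (β : Fin d → ℝ) (i : Fin d) : extendZero β i = β i := by
  simp [extendZero]

theorem sum_extendZero (β : Fin d → ℝ) : ∑ i ∈ Finset.range d, extendZero β i = ∑ i, β i := by
  rw [Finset.sum_range]
  simp

/-- The sum of the first `k` weights. -/
def weightSum (β : Fin d → ℝ) (k : ℕ) : ℝ := ∑ i ∈ Finset.range k, extendZero β i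

/-- The vectors in the convex hull of the permutations of `β`. -/
structure DualFeasible (β y : Fin d → ℝ) : Prop where
  sum_eq : ∑ j, y j = ∑ j, β j
  sum_le : ∀ S : Finset (Fin d), ∑ j ∈ S, y j ≤ weightSum β S.card

/-- Ties make the sorting permutation ambiguous, but two sorted rearrangements of a vector agree as
sequences. -/
theorem orderedNorm_eq_of_antitone (β x : Fin d → ℝ) (σ : Equiv.Perm (Fin d))
    (h : Antitone fun i => |x (σ i)|) : orderedNorm β x = ∑ i, β i * |x (σ i)| := by
  unfold orderedNorm
  have h1 : Monotone ((fun j => -|x j|) ∘ σ) := fun i j hij => neg_le_neg (h hij)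
  have h2 := (Tuple.comp_sort_eq_comp_iff_monotone (f := fun j => -|x j|) (σ := σ)).2 h1
  refine Finset.sum_congr rfl fun i _ => ?_
  have := congrFun h2 i
  simp only [Function.comp_apply, neg_inj] at this
  rw [this]

theorem antitone_abs_sort (x : Fin d → ℝ) :
    Antitone fun i => |x (Tuple.sort (fun j => -|x j|) i)| := fun i j hij => by
  have := Tuple.monotone_sort (fun j => -|x j|) hij
  simpa using this

theorem orderedNorm_smul (β x : Fin d → ℝ) {c : ℝ} (hc : 0 ≤ c) :
    orderedNorm β (c • x) = c * orderedNorm β x := by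
  rw [orderedNorm_eq_of_antitone β (c • x) (Tuple.sort fun j => -|x j|)]
  · simp only [orderedNorm, Pi.smul_apply, smul_eq_mul, abs_mul, abs_of_nonneg hc, Finset.mul_sum]
    exact Finset.sum_congr rfl fun i _ => by ring
  · intro i j hij
    have := antitone_abs_sort x hij
    simp only [Pi.smul_apply, smul_eq_mul, abs_mul] at this ⊢
    exact mul_le_mul_of_nonneg_left this (abs_nonneg c)

theorem exists_sort (z : Fin d → ℝ) (hz : ∀ j, 0 ≤ z j) (β : Fin d → ℝ) :
    ∃ σ : Equiv.Perm (Fin d), Antitone (z ∘ σ) ∧ orderedNorm β z = ∑ i, β i * z (σ i) := by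
  refine ⟨Tuple.sort fun j => -|z j|, ?_, ?_⟩
  · intro i j hij
    have := antitone_abs_sort z hij
    simpa [abs_of_nonneg (hz _)] using this
  · simp only [orderedNorm, abs_of_nonneg (hz _)]

/-- Majorization: since `g` is non-increasing and non-negative, summation by parts writes the
difference as a non-negative combination of differences of partial sums. -/
theorem sum_le_sum_of_partialSums (hd : 0 < d) (b y g : Fin d → ℝ) (hg : Antitone g)
    (hg0 : ∀ j, 0 ≤ g j)
    (h : ∀ k ≤ d, ∑ i ∈ Finset.range k, extendZero y i ≤ ∑ i ∈ Finset.range k, extendZero b i) :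
    ∑ i, y i * g i ≤ ∑ i, b i * g i := by
  obtain ⟨N, rfl⟩ : ∃ N, d = N + 1 := ⟨d - 1, by omega⟩
  have h1 := mul_le_sum_mul_of_partialSums (fun i => extendZero b i - extendZero y i)
    (extendZero g) N fun k hk => by
      refine mul_nonneg ?_ ?_
      · rw [Finset.sum_sub_distrib]
        linarith [h (k + 1) (by omega)]
      · have : g ⟨k + 1, by omega⟩ ≤ g ⟨k, by omega⟩ := hg (by simp [Fin.le_def])
        simp only [extendZero]
        rw [dif_pos (by omega), dif_pos (by omega)]
        linarith
  have h2 : 0 ≤ (∑ i ∈ Finset.range (N + 1), (extendZero b i - extendZero y i)) *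
      extendZero g N := by
    refine mul_nonneg ?_ ?_
    · rw [Finset.sum_sub_distrib]
      linarith [h (N + 1) le_rfl]
    · simp only [extendZero]
      rw [dif_pos (by omega)]
      exact hg0 _
  have h3 := h2.trans h1
  rw [Finset.sum_range] at h3
  simp only [extendZero_coe, sub_mul, Finset.sum_sub_distrib] at h3
  linarith

theorem sum_range_extendZero_comp (y : Fin d → ℝ) (σ : Equiv.Perm (Fin d)) {k : ℕ} (hk : k ≤ d) :
    ∃ S : Finset (Fin d), S.card = k ∧
      ∑ i ∈ Finset.range k, extendZero (y ∘ σ) i = ∑ j ∈ S, y j := by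
  refine ⟨(Finset.univ : Finset (Fin k)).map
    ((Fin.castLEEmb hk).trans σ.toEmbedding), by simp, ?_⟩
  rw [Finset.sum_map, Finset.sum_range]
  refine Finset.sum_congr rfl fun i _ => ?_
  simp [extendZero, i.2.trans_le hk, Fin.castLEEmb, Fin.castLE]

/-- One half of the duality: along the sorted order of z, the partial sums of y are sums over sets,
hence bounded by partial sums of β. -/
theorem DualFeasible.sum_mul_le {β y : Fin d → ℝ} (hy : DualFeasible β y) {z : Fin d → ℝ}
    (hz : ∀ j, 0 ≤ z j) : ∑ j, y j * z j ≤ orderedNorm β z := by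
  rcases Nat.eq_zero_or_pos d with rfl | hd
  · simp [orderedNorm]
  obtain ⟨σ, hσ, hn⟩ := exists_sort z hz β
  rw [hn, ← Equiv.sum_comp σ]
  refine sum_le_sum_of_partialSums hd β (y ∘ σ) (z ∘ σ) hσ (fun j => hz _) fun k hk => ?_
  obtain ⟨S, rfl, hS⟩ := sum_range_extendZero_comp y σ hk
  rw [hS]
  exact hy.sum_le S

theorem sum_finset_le_sum_range (g : Fin d → ℝ) (hg : Antitone g) (S : Finset (Fin d)) :
    ∑ j ∈ S, g j ≤ ∑ i ∈ Finset.range S.card, extendZero g i := by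
  classical
  have hcard : S.card ≤ d := by simpa using Finset.card_le_univ S
  set T := S.map Fin.valEmbedding with hT
  have hTd : ∀ i ∈ T, i < d := fun i hi => by
    obtain ⟨j, _, rfl⟩ := Finset.mem_map.1 hi
    exact j.2
  have hTc : T.card = S.card := by simp [hT]
  have hTr : T ⊆ Finset.range d := fun i hi => Finset.mem_range.2 (hTd i hi)
  -- Summation by parts for the difference of the indicators of [0, |S|) and S. Its partial sums are
  -- non-negative because S has at most min (k+1) |S| elements up to k, and its total is 0.
  have key := sum_mul_nonneg_of_partialSums
    (fun i => (if i < S.card then (1 : ℝ) else 0) - if i ∈ T then 1 else 0) (extendZero g) d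
    (by
      rw [Finset.sum_sub_distrib, Finset.sum_boole, Finset.sum_boole, Finset.filter_mem_eq_inter,
        Finset.inter_eq_right.2 hTr, hTc]
      have : Finset.filter (fun i => i < S.card) (Finset.range d) = Finset.range S.card := by
        ext i; simp; omega
      rw [this]; simp)
    (fun k hk => by
      refine mul_nonneg ?_ ?_
      · rw [Finset.sum_sub_distrib, Finset.sum_boole, Finset.sum_boole, Finset.filter_mem_eq_inter,
          sub_nonneg, Nat.cast_le]
        have : Finset.filter (fun i => i < S.card) (Finset.range (k + 1))
            = Finset.range (min (k + 1) S.card) := by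
          ext i; simp
        rw [this, Finset.card_range]
        refine le_min ?_ ?_
        · exact (Finset.card_le_card Finset.inter_subset_left).trans (by simp)
        · exact (Finset.card_le_card Finset.inter_subset_right).trans hTc.le
      · have : g ⟨k + 1, hk⟩ ≤ g ⟨k, by omega⟩ := hg (by simp [Fin.le_def])
        simp only [extendZero]
        rw [dif_pos (by omega), dif_pos (by omega)]
        linarith)
  simp only [sub_mul, Finset.sum_sub_distrib, ite_mul, one_mul, zero_mul, ← Finset.sum_filter]
    at key
  have h1 : Finset.filter (fun i => i < S.card) (Finset.range d) = Finset.range S.card := by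
    ext i; simp; omega
  rw [h1, Finset.filter_mem_eq_inter, Finset.inter_eq_right.2 hTr, hT, Finset.sum_map] at key
  simp only [Fin.valEmbedding_apply, extendZero_coe] at key
  linarith

/-- A vector whose rearrangement along `σ` is non-increasing and dominated by `β`. -/
theorem DualFeasible.of_antitone {β y : Fin d → ℝ} (σ : Equiv.Perm (Fin d))
    (hσ : Antitone (y ∘ σ)) (hsum : ∑ j, y j = ∑ j, β j)
    (h : ∀ k ≤ d, ∑ i ∈ Finset.range k, extendZero (y ∘ σ) i ≤ weightSum β k) :
    DualFeasible β y := by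
  refine ⟨hsum, fun S => ?_⟩
  have hcard : S.card ≤ d := by simpa using Finset.card_le_univ S
  have h1 := sum_finset_le_sum_range (y ∘ σ) hσ (S.map σ.symm.toEmbedding)
  rw [Finset.sum_map, Finset.card_map] at h1
  simp only [Equiv.coe_toEmbedding, Function.comp_apply, Equiv.apply_symm_apply] at h1
  exact h1.trans (h _ hcard)

/-- The other half of the duality: the maximum is attained by the weights themselves, arranged in
the order of z. -/
theorem exists_dualFeasible_eq {β : Fin d → ℝ} (hβ : IsOrderedWeight β) {z : Fin d → ℝ}
    (hz : ∀ j, 0 ≤ z j) : ∃ y, DualFeasible β y ∧ (∀ j, 0 ≤ y j) ∧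
      ∑ j, y j * z j = orderedNorm β z := by
  obtain ⟨σ, hσ, hn⟩ := exists_sort z hz β
  have hcomp : (β ∘ σ.symm) ∘ σ = β := by ext; simp
  refine ⟨β ∘ σ.symm, .of_antitone σ ?_ ?_ ?_, fun j => hβ.nonneg _, ?_⟩
  · rw [hcomp]; exact hβ.antitone
  · exact Equiv.sum_comp σ.symm β
  · rw [hcomp]; exact fun k _ => le_rfl
  · rw [hn, ← Equiv.sum_comp σ]
    simp

theorem IsOrderedWeight.sum_pos {β : Fin d → ℝ} (hβ : IsOrderedWeight β) : 0 < ∑ j, β j := by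
  obtain ⟨j, hj⟩ := Function.ne_iff.1 hβ.ne_zero
  exact Finset.sum_pos' (fun i _ => hβ.nonneg i)
    ⟨j, Finset.mem_univ j, lt_of_le_of_ne (hβ.nonneg j) (Ne.symm hj)⟩

theorem IsOrderedWeight.first_pos {β : Fin d → ℝ} (hβ : IsOrderedWeight β) (hd : 0 < d) :
    0 < β ⟨0, hd⟩ := by
  obtain ⟨j, hj⟩ := Function.ne_iff.1 hβ.ne_zero
  have h1 : 0 < β j := lt_of_le_of_ne (hβ.nonneg j) (Ne.symm hj)
  exact h1.trans_le (hβ.antitone (by simp [Fin.le_def]))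

/-- The mean of the first k weights is at least the mean of all weights, because they are
non-increasing. This vector is the centre of the entropy and the reason why a uniform surcharge on
the prices is cheap. -/
theorem dualFeasible_const {β : Fin d → ℝ} (hβ : IsOrderedWeight β) (hd : 0 < d) :
    DualFeasible β fun _ => (∑ j, β j) / d := by
  have hd' : (0 : ℝ) < d := by exact_mod_cast hd
  refine .of_antitone (Equiv.refl _) (fun _ _ _ => le_rfl) ?_ fun k hk => ?_
  · rw [Finset.sum_const, Finset.card_univ, Fintype.card_fin, nsmul_eq_mul]
    field_simp
  · have h1 : ∑ i ∈ Finset.range k, extendZero ((fun _ : Fin d => (∑ j, β j) / d) ∘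
        (Equiv.refl (Fin d))) i = k * ((∑ j, β j) / d) := by
      rw [Finset.sum_congr rfl (g := fun _ => (∑ j, β j) / d)]
      · simp
      · intro i hi
        have : i < d := (Finset.mem_range.1 hi).trans_le hk
        simp [extendZero, this]
    rw [h1, mul_div_assoc', div_le_iff₀ hd', ← sum_extendZero]
    rcases Nat.eq_zero_or_pos k with rfl | hk0
    · simp [weightSum]
    have hanti : ∀ i j, i ≤ j → j < d → extendZero β j ≤ extendZero β i := fun i j hij hj => by
      simp only [extendZero]
      rw [dif_pos hj, dif_pos (by omega)]
      exact hβ.antitone (by simpa [Fin.le_def] using hij)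
    have hsplit : ∑ i ∈ Finset.range d, extendZero β i = weightSum β k +
        ∑ i ∈ Finset.Ico k d, extendZero β i := by
      rw [weightSum, Finset.sum_range_add_sum_Ico _ hk]
    have h2 : ∑ i ∈ Finset.Ico k d, extendZero β i ≤ (d - k : ℕ) * extendZero β (k - 1) := by
      rw [← nsmul_eq_mul, ← Nat.card_Ico]
      refine Finset.sum_le_card_nsmul _ _ _ fun i hi => ?_
      rw [Finset.mem_Ico] at hi
      exact hanti _ _ (by omega) hi.2
    have h3 : (k : ℝ) * extendZero β (k - 1) ≤ weightSum β k := by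
      have := Finset.card_nsmul_le_sum (Finset.range k) (extendZero β) (extendZero β (k - 1))
        fun i hi => hanti _ _ (by have := Finset.mem_range.1 hi; omega) (by omega)
      simpa [weightSum] using this
    rw [Nat.cast_sub hk] at h2
    have hk' : (0 : ℝ) ≤ k := Nat.cast_nonneg k
    have hkd : (k : ℝ) ≤ d := by exact_mod_cast hk
    rw [hsplit]
    -- With b the k-th weight, k times the tail is at most k (d - k) b, and this is at most d - k
    -- times the sum of the first k weights.
    nlinarith [mul_le_mul_of_nonneg_left h2 hk',
      mul_le_mul_of_nonneg_left h3 (sub_nonneg.2 hkd)]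

theorem mean_mul_sum_le_orderedNorm {β : Fin d → ℝ} (hβ : IsOrderedWeight β) (hd : 0 < d)
    {z : Fin d → ℝ} (hz : ∀ j, 0 ≤ z j) : (∑ j, β j) / d * ∑ j, z j ≤ orderedNorm β z := by
  have := (dualFeasible_const hβ hd).sum_mul_le hz
  rwa [← Finset.mul_sum] at this

theorem orderedNorm_le_mul_sum {β : Fin d → ℝ} (hβ : IsOrderedWeight β) (hd : 0 < d)
    {z : Fin d → ℝ} (hz : ∀ j, 0 ≤ z j) : orderedNorm β z ≤ β ⟨0, hd⟩ * ∑ j, z j := by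
  obtain ⟨σ, _, hn⟩ := exists_sort z hz β
  rw [hn, ← Equiv.sum_comp σ z, Finset.mul_sum]
  refine Finset.sum_le_sum fun i _ => mul_le_mul_of_nonneg_right ?_ (hz _)
  exact hβ.antitone (by simp [Fin.le_def])

/-! ## Entropic prices -/

variable {d : ℕ}

/-- `y` maximizes `⟨y, x⟩ - (1/A) ∑ j, y j * log (y j)` over the dual feasible vectors. -/
structure IsPrice (β : Fin d → ℝ) (A : ℝ) (x y : Fin d → ℝ) : Prop where
  feasible : DualFeasible β y
  pos : ∀ j, 0 < y j
  optimal : ∀ y', DualFeasible β y' → 0 ≤ ∑ j, (y' j - y j) * (Real.log (y j) - A * x j)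

/-- `⟨y, x⟩ - (1/A) ∑ j, y j * log (y j / u)` with the mean weight `u`. -/
def entropicValue (β : Fin d → ℝ) (A : ℝ) (x y : Fin d → ℝ) : ℝ :=
  ∑ j, y j * x j - (∑ j, y j * Real.log (y j / ((∑ j, β j) / d))) / A

namespace IsPrice

variable {β : Fin d → ℝ} {A : ℝ} {x y : Fin d → ℝ}

theorem mul_log_div_le {a b : ℝ} (ha : 0 < a) (hb : 0 < b) : a * Real.log (b / a) ≤ b - a := by
  have := Real.log_le_sub_one_of_pos (div_pos hb ha)
  calc a * Real.log (b / a) ≤ a * (b / a - 1) := mul_le_mul_of_nonneg_left this ha.le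
    _ = b - a := by field_simp

/-- Adding the two variational inequalities gives ∑ (y' - y)(log y' - log y) ≤ 0, while strict
monotonicity of the logarithm makes each summand positive unless the entries agree. Uniqueness later
identifies the prices in memory with those of the analysis. -/
theorem unique {y' : Fin d → ℝ} (h : IsPrice β A x y) (h' : IsPrice β A x y') : y = y' := by
  have h1 := h.optimal y' h'.feasible
  have h2 := h'.optimal y h.feasible
  have h3 : ∀ j, (y' j - y j) * (Real.log (y' j) - Real.log (y j)) ≥ 0 := fun j => by
    rcases le_total (y j) (y' j) with hle | hle
    · exact mul_nonneg (sub_nonneg.2 hle) (sub_nonneg.2 (Real.log_le_log (h.pos j) hle))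
    · exact mul_nonneg_of_nonpos_of_nonpos (sub_nonpos.2 hle)
        (sub_nonpos.2 (Real.log_le_log (h'.pos j) hle))
  have h4 : ∑ j, (y' j - y j) * (Real.log (y' j) - Real.log (y j)) ≤ 0 := by
    have : ∑ j, (y' j - y j) * (Real.log (y' j) - Real.log (y j)) =
        -(∑ j, (y' j - y j) * (Real.log (y j) - A * x j)) -
        ∑ j, (y j - y' j) * (Real.log (y' j) - A * x j) := by
      rw [← Finset.sum_neg_distrib, ← Finset.sum_sub_distrib]
      exact Finset.sum_congr rfl fun j _ => by ring
    linarith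
  have h5 := (Finset.sum_eq_zero_iff_of_nonneg fun j _ => h3 j).1
    (le_antisymm h4 (Finset.sum_nonneg fun j _ => h3 j))
  funext j
  rcases mul_eq_zero.1 (h5 j (Finset.mem_univ j)) with h6 | h6
  · linarith
  · exact Real.log_injOn_pos (h.pos j) (h'.pos j) (by linarith)

/-- This replaces a smoothness estimate for the smoothed norm. The new maximizer is compared with
the old one: the linear term has the right sign by optimality of `y`, and the remaining relative
entropy term is bounded by log t ≤ t - 1. -/
theorem entropicValue_add_le {y' Δ : Fin d → ℝ} (hA : 0 < A) (hβ : IsOrderedWeight β)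
    (h : IsPrice β A x y) (h' : IsPrice β A (x + Δ) y') :
    entropicValue β A (x + Δ) y' ≤
      entropicValue β A x y + (∑ j, y j * (Real.exp (A * Δ j) - 1)) / A := by
  rcases Nat.eq_zero_or_pos d with rfl | hd
  · simp [entropicValue]
  have hu : 0 < (∑ j, β j) / d := div_pos hβ.sum_pos (by exact_mod_cast hd)
  have h1 := h.optimal y' h'.feasible
  have hs : ∑ j, y' j = ∑ j, y j := h'.feasible.sum_eq.trans h.feasible.sum_eq.symm
  have h2 : ∑ j, y' j * Real.log (y j * Real.exp (A * Δ j) / y' j) ≤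
      ∑ j, (y j * Real.exp (A * Δ j) - y' j) :=
    Finset.sum_le_sum fun j _ => mul_log_div_le (h'.pos j)
      (mul_pos (h.pos j) (Real.exp_pos _))
  -- An exact identity; the mean weight only enters through the difference of the totals of y' and
  -- y, which vanishes.
  have h3 : A * entropicValue β A (x + Δ) y' - A * entropicValue β A x y =
      ∑ j, y' j * Real.log (y j * Real.exp (A * Δ j) / y' j) -
      ∑ j, (y' j - y j) * (Real.log (y j) - A * x j) +
      (∑ j, y' j - ∑ j, y j) * Real.log ((∑ j, β j) / d) := by
    simp only [entropicValue, mul_sub, mul_div_cancel₀ _ hA.ne', Finset.mul_sum, Finset.sum_mul,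
      ← Finset.sum_sub_distrib, ← Finset.sum_add_distrib]
    refine Finset.sum_congr rfl fun j _ => ?_
    rw [Real.log_div (h'.pos j).ne' hu.ne', Real.log_div (h.pos j).ne' hu.ne',
      Real.log_div (mul_pos (h.pos j) (Real.exp_pos _)).ne' (h'.pos j).ne',
      Real.log_mul (h.pos j).ne' (Real.exp_pos _).ne', Real.log_exp, Pi.add_apply]
    ring
  rw [hs, sub_self, zero_mul, add_zero] at h3
  have h4 : ∑ j, (y j * Real.exp (A * Δ j) - y' j) = ∑ j, y j * (Real.exp (A * Δ j) - 1) := by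
    simp only [mul_sub, mul_one, Finset.sum_sub_distrib, hs]
  rw [← sub_le_iff_le_add', le_div_iff₀ hA]
  nlinarith

/-- The second order term of a step is paid for by a price increase of `w`. -/
theorem entropicValue_step {y' l : Fin d → ℝ} {a w c : ℝ} (hA : 0 < A)
    (hβ : IsOrderedWeight β) (h : IsPrice β A x y) (h' : IsPrice β A (x + a • l) y')
    (hl : ∀ j, 0 ≤ l j) (ha : 0 ≤ a) (hw : 0 < w) (hc : a * ∑ j, l j * (y j + w) ≤ c)
    (hAc : A * c ≤ w) :
    entropicValue β A (x + a • l) y' ≤ entropicValue β A x y + a * ∑ j, l j * (y j + w) := by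
  refine (entropicValue_add_le hA hβ h h').trans ?_
  have hj : ∀ j, a * (l j * (y j + w)) ≤ c := fun j => by
    refine le_trans ?_ hc
    refine mul_le_mul_of_nonneg_left ?_ ha
    exact Finset.single_le_sum (f := fun j => l j * (y j + w))
      (fun i _ => mul_nonneg (hl i) (add_nonneg (h.pos i).le hw.le)) (Finset.mem_univ j)
  -- With t = A a (l j), the estimate exp t - 1 ≤ t + t² leaves the error t² (y j). It is at most t
  -- w because A a (l j) (y j) ≤ A c ≤ w. The requirement t ≤ 1 follows in the same way from A a (l
  -- j) w ≤ A c ≤ w.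
  have hstep : ∀ j, y j * (Real.exp (A * (a • l) j) - 1) ≤ A * (a * (l j * (y j + w))) := fun j => by
    have hyj := (h.pos j).le
    have hs : (a • l) j = a * l j := rfl
    rw [hs]
    have hal : 0 ≤ a * l j := mul_nonneg ha (hl j)
    have h0 : 0 ≤ A * (a * l j) := by positivity
    have h2 : a * l j * y j + a * l j * w ≤ c := by have := hj j; linarith
    have h1 : A * (a * l j) ≤ 1 := by
      by_contra hcon
      push Not at hcon
      have : a * l j * w ≤ c := by nlinarith [mul_nonneg hal hyj]
      nlinarith [mul_le_mul_of_nonneg_left this hA.le]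
    have h3 := Real.abs_exp_sub_one_sub_id_le (x := A * (a * l j)) (by rwa [abs_of_nonneg h0])
    have h4 := (abs_le.1 h3).2
    have h5 : a * l j * y j ≤ c := by nlinarith [mul_nonneg hal hw.le]
    have h6 : A * (a * l j * y j) ≤ w := (mul_le_mul_of_nonneg_left h5 hA.le).trans hAc
    calc y j * (Real.exp (A * (a * l j)) - 1)
        ≤ y j * (A * (a * l j) + (A * (a * l j)) ^ 2) :=
          mul_le_mul_of_nonneg_left (by linarith) hyj
      _ = A * (a * l j) * y j + A * (a * l j) * (A * (a * l j * y j)) := by ring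
      _ ≤ A * (a * l j) * y j + A * (a * l j) * w := by
          linarith [mul_le_mul_of_nonneg_left h6 h0]
      _ = _ := by ring
  have := Finset.sum_le_sum fun j (_ : j ∈ Finset.univ) => hstep j
  rw [← Finset.mul_sum, ← Finset.mul_sum] at this
  have h7 := (div_le_iff₀' hA).2 this
  linarith

/-- The price is compared with a dual vector that attains the norm. The entropy loss is at most (∑
β) log d, since no price exceeds the sum ∑ β, which is d times the mean weight. -/
theorem le_entropicValue (hA : 0 < A) (hβ : IsOrderedWeight β) (h : IsPrice β A x y)
    (hx : ∀ j, 0 ≤ x j) :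
    orderedNorm β x ≤ entropicValue β A x y + (∑ j, β j) * Real.log d / A := by
  rcases Nat.eq_zero_or_pos d with rfl | hd
  · simp [entropicValue, orderedNorm]
  have hd' : (0 : ℝ) < d := by exact_mod_cast hd
  have hB := hβ.sum_pos
  have hu : 0 < (∑ j, β j) / d := div_pos hB hd'
  obtain ⟨y', h1, h2, h3⟩ := exists_dualFeasible_eq hβ hx
  have h4 := h.optimal y' h1
  have hle : ∀ j, Real.log (y j / ((∑ j, β j) / d)) ≤ Real.log d := fun j => by
    refine Real.log_le_log (div_pos (h.pos j) hu) ?_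
    rw [div_le_iff₀ hu, mul_div_cancel₀ _ hd'.ne', ← h.feasible.sum_eq]
    exact Finset.single_le_sum (fun i _ => (h.pos i).le) (Finset.mem_univ j)
  have h5 : ∑ j, y' j * Real.log (y j / ((∑ j, β j) / d)) ≤ (∑ j, β j) * Real.log d := by
    have := Finset.sum_le_sum fun j (_ : j ∈ Finset.univ) =>
      mul_le_mul_of_nonneg_left (hle j) (h2 j)
    rwa [← Finset.sum_mul, h1.sum_eq] at this
  have h6 : A * entropicValue β A x y = A * ∑ j, y' j * x j +
      ∑ j, (y' j - y j) * (Real.log (y j) - A * x j) -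
      ∑ j, y' j * Real.log (y j / ((∑ j, β j) / d)) -
      (∑ j, y j - ∑ j, y' j) * (- Real.log ((∑ j, β j) / d)) := by
    simp only [entropicValue, mul_sub, mul_div_cancel₀ _ hA.ne', Finset.mul_sum, Finset.sum_mul,
      ← Finset.sum_sub_distrib, ← Finset.sum_add_distrib]
    refine Finset.sum_congr rfl fun j _ => ?_
    rw [Real.log_div (h.pos j).ne' hu.ne']
    ring
  rw [h1.sum_eq, h.feasible.sum_eq, sub_self, zero_mul, sub_zero, h3] at h6
  rw [← sub_le_iff_le_add, ← mul_le_mul_iff_right₀ hA, mul_sub, mul_div_cancel₀ _ hA.ne']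
  linarith

/-- Gibbs' inequality: relative entropy between vectors of equal total is non-negative. -/
theorem entropicValue_zero_le (hA : 0 < A) (hβ : IsOrderedWeight β) (h : IsPrice β A 0 y) :
    entropicValue β A 0 y ≤ 0 := by
  rcases Nat.eq_zero_or_pos d with rfl | hd
  · simp [entropicValue]
  have hd' : (0 : ℝ) < d := by exact_mod_cast hd
  have hu : 0 < (∑ j, β j) / d := div_pos hβ.sum_pos hd'
  have h1 : ∑ j, (y j - (∑ j, β j) / d) ≤ ∑ j, y j * Real.log (y j / ((∑ j, β j) / d)) := by
    refine Finset.sum_le_sum fun j _ => ?_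
    have := mul_log_div_le (h.pos j) hu
    rw [← inv_div, Real.log_inv] at this
    linarith
  rw [Finset.sum_sub_distrib, h.feasible.sum_eq, Finset.sum_const, Finset.card_univ,
    Fintype.card_fin, nsmul_eq_mul, mul_div_cancel₀ _ hd'.ne', sub_self] at h1
  simp only [entropicValue, Pi.zero_apply, mul_zero, Finset.sum_const_zero, zero_sub,
    Left.neg_nonpos_iff]
  positivity

/-- The value of a non-negative load with respect to a price increased by `w`. -/
theorem sum_mul_add_le {z : Fin d → ℝ} {δ : ℝ} (hβ : IsOrderedWeight β) (hd : 0 < d)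
    (h : IsPrice β A x y) (hz : ∀ j, 0 ≤ z j) (hδ : 0 ≤ δ) :
    ∑ j, z j * (y j + δ * ((∑ j, β j) / d)) ≤ (1 + δ) * orderedNorm β z := by
  have h1 := h.feasible.sum_mul_le hz
  have h2 := mul_le_mul_of_nonneg_left (mean_mul_sum_le_orderedNorm hβ hd hz) hδ
  have h3 : ∑ j, z j * (y j + δ * ((∑ j, β j) / d)) =
      ∑ j, y j * z j + δ * ((∑ j, β j) / d * ∑ j, z j) := by
    rw [Finset.mul_sum, Finset.mul_sum, ← Finset.sum_add_distrib]
    exact Finset.sum_congr rfl fun j _ => by ring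
  linarith

end IsPrice

/-! ## Pooling adjacent violators -/

/-- `s k * w k` are the weights of the entropic price along a sorted order, with weights `b`. -/
structure IsSlopes (w b : ℕ → ℝ) (N : ℕ) (s : ℕ → ℝ) : Prop where
  pos : ∀ k < N, 0 < s k
  mono : ∀ k, k + 1 < N → s k ≤ s (k + 1)
  sum_le : ∀ k ≤ N, ∑ i ∈ Finset.range k, s i * w i ≤ ∑ i ∈ Finset.range k, b i
  sum_eq : ∑ i ∈ Finset.range N, s i * w i = ∑ i ∈ Finset.range N, b i
  tight : ∀ k, k + 1 < N → s k < s (k + 1) →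
    ∑ i ∈ Finset.range (k + 1), s i * w i = ∑ i ∈ Finset.range (k + 1), b i

/-- Along the sorted order, log y - A x is the logarithm of the slopes, which is non-decreasing.
Wherever it strictly increases, the partial sum of y equals that of β and so is at least that of any
feasible y'. Summation by parts turns this into the optimality condition. -/
theorem IsSlopes.isPrice {β x y : Fin d → ℝ} {A : ℝ} {w s : ℕ → ℝ} (hβ : IsOrderedWeight β)
    (hA : 0 < A) (σ : Equiv.Perm (Fin d)) (hσ : Antitone (x ∘ σ))
    (hw : ∀ k : Fin d, w k = Real.exp (A * x (σ k))) (hs : IsSlopes w (extendZero β) d s)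
    (hy : ∀ k : Fin d, y (σ k) = s k * w k) : IsPrice β A x y := by
  have hext : ∀ k < d, extendZero (y ∘ σ) k = s k * w k := fun k hk => by
    simp only [extendZero, dif_pos hk, Function.comp_apply]
    exact hy ⟨k, hk⟩
  have hext' : ∀ k ≤ d, ∑ i ∈ Finset.range k, extendZero (y ∘ σ) i =
      ∑ i ∈ Finset.range k, s i * w i := fun k hk =>
    Finset.sum_congr rfl fun i hi => hext i ((Finset.mem_range.1 hi).trans_le hk)
  have hwpos : ∀ k < d, 0 < w k := fun k hk => by
    rw [hw ⟨k, hk⟩]; exact Real.exp_pos _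
  have hwanti : ∀ k, k + 1 < d → w (k + 1) ≤ w k := fun k hk => by
    rw [hw ⟨k + 1, hk⟩, hw ⟨k, by omega⟩]
    refine Real.exp_le_exp.2 (mul_le_mul_of_nonneg_left (hσ ?_) hA.le)
    simp [Fin.le_def]
  -- The price is non-increasing along the order: within a block because w is, and at the end of a
  -- block because tightness there gives y (k+1) ≤ β (k+1) ≤ β k ≤ y k in sorted positions.
  have hsucc : ∀ k, k + 1 < d → s (k + 1) * w (k + 1) ≤ s k * w k := fun k hk => by
    rcases (hs.mono k hk).eq_or_lt with h | h
    · rw [← h]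
      exact mul_le_mul_of_nonneg_left (hwanti k hk) (hs.pos k (by omega)).le
    · have h1 := hs.tight k hk h
      have h2 := hs.sum_le (k + 1 + 1) (by omega)
      have h3 := hs.sum_le k (by omega)
      rw [Finset.sum_range_succ _ (k + 1), Finset.sum_range_succ _ (k + 1), h1] at h2
      rw [Finset.sum_range_succ, Finset.sum_range_succ] at h1
      have h4 : extendZero β (k + 1) ≤ extendZero β k := by
        simp only [extendZero]
        rw [dif_pos hk, dif_pos (by omega)]
        exact hβ.antitone (by simp [Fin.le_def])
      linarith
  have hanti' : ∀ i j, i ≤ j → j < d → s j * w j ≤ s i * w i := fun i j hij => by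
    induction j, hij using Nat.le_induction with
    | base => exact fun _ => le_rfl
    | succ j hij ih => exact fun hj => (hsucc j hj).trans (ih (by omega))
  have hanti : Antitone (y ∘ σ) := fun i j hij => by
    simp only [Function.comp_apply, hy]
    exact hanti' i j hij j.2
  refine ⟨.of_antitone σ hanti ?_ ?_, ?_, ?_⟩
  · rw [← Equiv.sum_comp σ, ← sum_extendZero β, ← hs.sum_eq, ← hext' d le_rfl, sum_extendZero]
    rfl
  · intro k hk
    rw [hext' k hk]
    exact hs.sum_le k hk
  · intro j
    obtain ⟨k, rfl⟩ := σ.surjective j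
    rw [hy]
    exact mul_pos (hs.pos k k.2) (hwpos k k.2)
  · intro y' hy'
    have h1 := sum_mul_nonneg_of_partialSums
      (fun i => extendZero (y' ∘ σ) i - extendZero (y ∘ σ) i) (fun i => Real.log (s i)) d
      (by
        rw [Finset.sum_sub_distrib, sum_extendZero, hext' d le_rfl, hs.sum_eq, sum_extendZero]
        simp only [Function.comp_apply]
        rw [Equiv.sum_comp σ y', hy'.sum_eq, sub_self])
      (fun k hk => by
        rcases (hs.mono k hk).eq_or_lt with h | h
        · rw [h]; simp
        · refine mul_nonneg_of_nonpos_of_nonpos ?_ ?_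
          · rw [Finset.sum_sub_distrib, hext' _ hk.le, hs.tight k hk h]
            obtain ⟨S, hS, hS'⟩ := sum_range_extendZero_comp y' σ hk.le
            have := hy'.sum_le S
            rw [hS] at this
            rw [hS']
            exact sub_nonpos.2 this
          · exact sub_nonpos.2 (Real.log_le_log (hs.pos k (by omega)) h.le))
    rw [Finset.sum_range] at h1
    rw [← Equiv.sum_comp σ]
    refine h1.trans (le_of_eq (Finset.sum_congr rfl fun k _ => ?_))
    have hsk := hs.pos k k.2
    rw [extendZero_coe, extendZero_coe, hy, hw, Real.log_mul hsk.ne' (Real.exp_pos _).ne',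
      Real.log_exp]
    simp [hy, hw]

/-- The blocks `[e i, e (i+1))`, `i < t`, of `[0,k)`: within each block the partial sums `B` lie
above the line through the end points, and the slopes of all blocks but possibly the last
increase. -/
structure IsBlocks (W B : ℕ → ℝ) (k t : ℕ) (e : ℕ → ℕ) : Prop where
  zero : e 0 = 0
  last : e t = k
  lt : ∀ i < t, e i < e (i + 1)
  above : ∀ i < t, ∀ j, e i ≤ j → j ≤ e (i + 1) →
    (B (e (i + 1)) - B (e i)) * (W j - W (e i)) ≤ (B j - B (e i)) * (W (e (i + 1)) - W (e i))
  slope : ∀ i, i + 2 < t →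
    (B (e (i + 1)) - B (e i)) * (W (e (i + 2)) - W (e (i + 1))) <
      (B (e (i + 2)) - B (e (i + 1))) * (W (e (i + 1)) - W (e i))

namespace IsBlocks

variable {W B : ℕ → ℝ} {k t : ℕ} {e : ℕ → ℕ}

theorem empty : IsBlocks W B 0 0 fun _ => 0 :=
  ⟨rfl, rfl, fun i hi => absurd hi (Nat.not_lt_zero i), fun i hi => absurd hi (Nat.not_lt_zero i),
    fun _ hi => absurd hi (Nat.not_lt_zero _)⟩

theorem congr {e' : ℕ → ℕ} (h : IsBlocks W B k t e) (he : ∀ i ≤ t, e' i = e i) :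
    IsBlocks W B k t e' := by
  refine ⟨?_, ?_, fun i hi => ?_, fun i hi => ?_, fun i hi => ?_⟩
  · rw [he 0 (Nat.zero_le t), h.zero]
  · rw [he t le_rfl, h.last]
  · rw [he i hi.le, he (i + 1) hi]; exact h.lt i hi
  · rw [he i hi.le, he (i + 1) hi]; exact h.above i hi
  · rw [he i (by omega), he (i + 1) (by omega), he (i + 2) (by omega)]; exact h.slope i hi

/-- A new block has length 1, so the condition on its interior is trivial. Only the slopes of the
previous two blocks, exempt while the last one was being merged, have to be in order by now. -/
theorem push (h : IsBlocks W B k t e)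
    (hs : ∀ i, i + 2 = t → (B (e (i + 1)) - B (e i)) * (W (e (i + 2)) - W (e (i + 1))) <
      (B (e (i + 2)) - B (e (i + 1))) * (W (e (i + 1)) - W (e i))) :
    IsBlocks W B (k + 1) (t + 1) (Function.update e (t + 1) (k + 1)) := by
  have hu : ∀ i ≤ t, Function.update e (t + 1) (k + 1) i = e i := fun i hi =>
    Function.update_of_ne (by omega) _ _
  have hu' : Function.update e (t + 1) (k + 1) (t + 1) = k + 1 := Function.update_self _ _ _
  refine ⟨?_, hu', fun i hi => ?_, fun i hi j h1 h2 => ?_, fun i hi => ?_⟩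
  · rw [hu 0 (Nat.zero_le t), h.zero]
  · rcases Nat.lt_succ_iff_lt_or_eq.1 hi with hi | rfl
    · rw [hu i hi.le, hu (i + 1) hi]; exact h.lt i hi
    · rw [hu i le_rfl, hu', h.last]; exact Nat.lt_succ_self k
  · rcases Nat.lt_succ_iff_lt_or_eq.1 hi with hi | rfl
    · rw [hu i hi.le, hu (i + 1) hi] at *; exact h.above i hi j h1 h2
    · rw [hu i le_rfl, hu', h.last] at *
      obtain rfl | rfl : j = k ∨ j = k + 1 := by omega
      · simp
      · exact le_of_eq (by ring)
  · rw [hu i (by omega), hu (i + 1) (by omega), hu (i + 2) (by omega)]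
    rcases Nat.lt_succ_iff_lt_or_eq.1 hi with hi | hi
    · exact h.slope i hi
    · exact hs i hi

/-- If the slope does not increase from one block to the next, then the two chords lie above the
chord of their union, and so do all points above them. The inequalities are cross-multiplied to
avoid quotients. -/
theorem merge (h : IsBlocks W B k (t + 2) e) (hW : ∀ i < k, W i < W (i + 1))
    (hv : (B (e (t + 2)) - B (e (t + 1))) * (W (e (t + 1)) - W (e t)) ≤
      (B (e (t + 1)) - B (e t)) * (W (e (t + 2)) - W (e (t + 1)))) :
    IsBlocks W B k (t + 1) (Function.update e (t + 1) (e (t + 2))) := by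
  have hu : ∀ i ≤ t, Function.update e (t + 1) (e (t + 2)) i = e i := fun i hi =>
    Function.update_of_ne (by omega) _ _
  have hu' : Function.update e (t + 1) (e (t + 2)) (t + 1) = e (t + 2) := Function.update_self _ _ _
  have hmono : ∀ i j, i ≤ j → j ≤ k → W i ≤ W j := fun i j hij => by
    induction j, hij using Nat.le_induction with
    | base => exact fun _ => le_rfl
    | succ j hij ih => exact fun hj => (ih (by omega)).trans (hW j hj).le
  have hstrict : ∀ i j, i < j → j ≤ k → W i < W j := fun i j hij hj =>
    (hW i (by omega)).trans_le (hmono (i + 1) j hij hj)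
  have e1 : e t < e (t + 1) := h.lt t (by omega)
  have e2 : e (t + 1) < e (t + 2) := h.lt (t + 1) (by omega)
  have e3 : e (t + 2) = k := h.last
  refine ⟨?_, ?_, fun i hi => ?_, fun i hi j h1 h2 => ?_, fun i hi => ?_⟩
  · rw [hu 0 (Nat.zero_le t), h.zero]
  · rw [hu', h.last]
  · rcases Nat.lt_succ_iff_lt_or_eq.1 hi with hi | rfl
    · rw [hu i hi.le, hu (i + 1) hi]; exact h.lt i (by omega)
    · rw [hu i le_rfl, hu']; exact e1.trans e2
  · rcases Nat.lt_succ_iff_lt_or_eq.1 hi with hi | rfl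
    · rw [hu i hi.le, hu (i + 1) hi] at *; exact h.above i (by omega) j h1 h2
    · rw [hu i le_rfl] at h1 ⊢
      rw [hu'] at h2 ⊢
      have w1 : 0 < W (e (i + 1)) - W (e i) := sub_pos.2 (hstrict _ _ e1 (by omega))
      have w2 : 0 < W (e (i + 2)) - W (e (i + 1)) := sub_pos.2 (hstrict _ _ e2 (by omega))
      rcases le_total j (e (i + 1)) with hj | hj
      · have h3 := h.above i (by omega) j h1 hj
        have w3 : 0 ≤ W j - W (e i) := sub_nonneg.2 (hmono _ _ h1 (by omega))
        refine le_of_mul_le_mul_right ?_ w1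
        nlinarith [mul_le_mul_of_nonneg_right hv w3,
          mul_le_mul_of_nonneg_right h3 (add_pos w1 w2).le]
      · have h3 : (B (e (i + 2)) - B (e (i + 1))) * (W j - W (e (i + 1))) ≤
            (B j - B (e (i + 1))) * (W (e (i + 2)) - W (e (i + 1))) :=
          h.above (i + 1) (by omega) j hj h2
        have w3 : 0 ≤ W (e (i + 2)) - W j := sub_nonneg.2 (hmono _ _ h2 (by omega))
        refine le_of_mul_le_mul_right ?_ w2
        nlinarith [mul_le_mul_of_nonneg_right hv w3,
          mul_le_mul_of_nonneg_right h3 (add_pos w1 w2).le]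
  · rw [hu i (by omega), hu (i + 1) (by omega), hu (i + 2) (by omega)]
    exact h.slope i (by omega)

theorem exists_block (h : IsBlocks W B k t e) {j : ℕ} (hj : j < k) :
    ∃ i < t, e i ≤ j ∧ j < e (i + 1) := by
  have key : ∀ m ≤ t, j < e m → ∃ i < m, e i ≤ j ∧ j < e (i + 1) := fun m => by
    induction m with
    | zero => intro _ h0; rw [h.zero] at h0; omega
    | succ m ih =>
      intro hm hjm
      by_cases hc : j < e m
      · obtain ⟨i, h1, h2⟩ := ih (by omega) hc
        exact ⟨i, by omega, h2⟩
      · exact ⟨m, by omega, by omega, hjm⟩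
  exact key t le_rfl (by rwa [h.last])

theorem le_last (h : IsBlocks W B k t e) {i : ℕ} (hi : i ≤ t) : e i ≤ k := by
  have key : ∀ m, i ≤ m → m ≤ t → e i ≤ e m := fun m him => by
    induction m, him using Nat.le_induction with
    | base => exact fun _ => le_rfl
    | succ m _ ih => exact fun hm => (ih (by omega)).trans (h.lt m hm).le
  exact (key t hi le_rfl).trans h.last.le

/-- The hypothesis `hl` supplies the one slope inequality that `IsBlocks` leaves open. Then the
slopes increase over all blocks, and the first is positive because `b 0` is, so all are positive.
The piecewise linear curve through the block ends is convex and lies below B. -/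
theorem isSlopes {w b s : ℕ → ℝ}
    (h : IsBlocks (fun j => ∑ i ∈ Finset.range j, w i) (fun j => ∑ i ∈ Finset.range j, b i) k t e)
    (hl : ∀ i, i + 2 = t →
      (∑ j ∈ Finset.range (e (i + 1)), b j - ∑ j ∈ Finset.range (e i), b j) *
        (∑ j ∈ Finset.range (e (i + 2)), w j - ∑ j ∈ Finset.range (e (i + 1)), w j) <
      (∑ j ∈ Finset.range (e (i + 2)), b j - ∑ j ∈ Finset.range (e (i + 1)), b j) *
        (∑ j ∈ Finset.range (e (i + 1)), w j - ∑ j ∈ Finset.range (e i), w j))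
    (hw : ∀ i < k, 0 < w i) (hb : ∀ i, 0 ≤ b i) (hb0 : 0 < b 0)
    (hs : ∀ i < t, ∀ j, e i ≤ j → j < e (i + 1) → s j =
      (∑ j ∈ Finset.range (e (i + 1)), b j - ∑ j ∈ Finset.range (e i), b j) /
        (∑ j ∈ Finset.range (e (i + 1)), w j - ∑ j ∈ Finset.range (e i), w j)) :
    IsSlopes w b k s := by
  set W : ℕ → ℝ := fun j => ∑ i ∈ Finset.range j, w i with hWdef
  set B : ℕ → ℝ := fun j => ∑ i ∈ Finset.range j, b i with hBdef
  have hslope : ∀ i, i + 2 ≤ t → (B (e (i + 1)) - B (e i)) * (W (e (i + 2)) - W (e (i + 1))) <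
      (B (e (i + 2)) - B (e (i + 1))) * (W (e (i + 1)) - W (e i)) := fun i hi =>
    hi.lt_or_eq.elim (h.slope i) (hl i)
  have hWs : ∀ i < k, W i < W (i + 1) := fun i hi => by
    simp only [hWdef, Finset.sum_range_succ]; linarith [hw i hi]
  have hmono : ∀ i j, i ≤ j → j ≤ k → W i ≤ W j := fun i j hij => by
    induction j, hij using Nat.le_induction with
    | base => exact fun _ => le_rfl
    | succ j hij ih => exact fun hj => (ih (by omega)).trans (hWs j hj).le
  have hD : ∀ i < t, 0 < W (e (i + 1)) - W (e i) := fun i hi => by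
    have h1 := h.lt i hi
    have h2 : e (i + 1) ≤ k := h.le_last hi
    exact sub_pos.2 ((hWs _ (by omega)).trans_le (hmono _ _ h1 h2))
  set q : ℕ → ℝ := fun i => (B (e (i + 1)) - B (e i)) / (W (e (i + 1)) - W (e i)) with hq
  have hs' : ∀ i < t, ∀ j, e i ≤ j → j < e (i + 1) → s j = q i := hs
  have hqs : ∀ i, i + 2 ≤ t → q i < q (i + 1) := fun i hi => by
    simp only [hq]
    rw [div_lt_div_iff₀ (hD i (by omega)) (hD (i + 1) (by omega))]
    exact hslope i hi
  have hqpos : ∀ i < t, 0 < q i := fun i => by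
    induction i with
    | zero =>
      intro h0
      refine div_pos (sub_pos.2 ?_) (hD 0 h0)
      have h1 := h.lt 0 h0
      rw [h.zero] at h1 ⊢
      obtain ⟨m, hm⟩ := Nat.exists_eq_succ_of_ne_zero h1.ne'
      simp only [hBdef, hm, Finset.sum_range_zero, Finset.sum_range_succ']
      exact add_pos_of_nonneg_of_pos (Finset.sum_nonneg fun j _ => hb _) hb0
    | succ i ih => exact fun hi => (ih (by omega)).trans (hqs i (by omega))
  have hblock : ∀ i < t, ∑ j ∈ Finset.range (e i), s j * w j = B (e i) → ∀ j, e i ≤ j →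
      j ≤ e (i + 1) → ∑ m ∈ Finset.range j, s m * w m = B (e i) + q i * (W j - W (e i)) :=
    fun i hi h0 j hij => by
      induction j, hij using Nat.le_induction with
      | base => intro _; rw [h0]; ring
      | succ j hij ih =>
        intro hj
        rw [Finset.sum_range_succ, ih (by omega), hs' i hi j hij hj]
        simp only [hWdef, Finset.sum_range_succ]
        ring
  have hend : ∀ i ≤ t, ∑ j ∈ Finset.range (e i), s j * w j = B (e i) := fun i => by
    induction i with
    | zero => intro _; simp [h.zero, hBdef]
    | succ i ih =>
      intro hi
      rw [hblock i hi (ih (by omega)) _ (h.lt i hi).le le_rfl]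
      simp only [hq]
      rw [div_mul_cancel₀ _ (hD i hi).ne']
      ring
  have hsum : ∀ j < k, ∑ i ∈ Finset.range j, s i * w i ≤ B j := fun j hj => by
    obtain ⟨i, hi, h1, h2⟩ := h.exists_block hj
    rw [hblock i hi (hend i hi.le) j h1 h2.le]
    have h3 := h.above i hi j h1 h2.le
    have h4 : q i * (W j - W (e i)) ≤ B j - B (e i) := by
      simp only [hq]
      rw [div_mul_eq_mul_div, div_le_iff₀ (hD i hi)]
      exact h3
    linarith
  have heq : ∑ i ∈ Finset.range k, s i * w i = B k := by
    have := hend t le_rfl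
    rwa [h.last] at this
  refine ⟨fun j hj => ?_, fun j hj => ?_, fun j hj => ?_, heq, fun j hj hlt => ?_⟩
  · obtain ⟨i, hi, h1, h2⟩ := h.exists_block hj
    rw [hs' i hi j h1 h2]
    exact hqpos i hi
  · obtain ⟨i, hi, h1, h2⟩ := h.exists_block (Nat.lt_of_succ_lt hj)
    rw [hs' i hi j h1 h2]
    rcases Nat.lt_or_ge (j + 1) (e (i + 1)) with h3 | h3
    · rw [hs' i hi (j + 1) (by omega) h3]
    · have h4 : e (i + 1) = j + 1 := by omega
      have h5 : i + 1 < t := by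
        refine lt_of_le_of_ne hi fun h6 => ?_
        rw [h6, h.last] at h4
        omega
      rw [hs' (i + 1) h5 (j + 1) h4.le (h4 ▸ h.lt (i + 1) h5)]
      exact (hqs i h5).le
  · rcases hj.lt_or_eq with hj | rfl
    · exact hsum j hj
    · exact heq.le
  · obtain ⟨i, hi, h1, h2⟩ := h.exists_block (Nat.lt_of_succ_lt hj)
    rcases Nat.lt_or_ge (j + 1) (e (i + 1)) with h3 | h3
    · rw [hs' i hi j h1 h2, hs' i hi (j + 1) (by omega) h3] at hlt
      exact absurd hlt (lt_irrefl _)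
    · have h4 : e (i + 1) = j + 1 := by omega
      rw [← h4]
      exact hend (i + 1) hi

end IsBlocks

/-! ## Sampling a group -/

theorem sum_range_eq_add_of_eq_off {p g : ℕ} {f f' : ℕ → ℝ} (hg : g < p)
    (h : ∀ i, i ≠ g → f' i = f i) :
    ∑ i ∈ Finset.range p, f' i = ∑ i ∈ Finset.range p, f i + (f' g - f g) := by
  have hmem := Finset.mem_range.2 hg
  rw [← Finset.add_sum_erase _ f' hmem, ← Finset.add_sum_erase _ f hmem,
    Finset.sum_congr rfl fun i hi => h i (Finset.ne_of_mem_erase hi)]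
  ring

/-- The index of the interval that contains `r` if `[0, ∑ i < p, m i)` is cut into intervals of
lengths `m i`. -/
def pick (m : ℕ → ℕ) : ℕ → ℕ → ℕ
  | 0, _ => 0
  | p + 1, r => if r < ∑ i ∈ Finset.range p, m i then pick m p r else p

theorem pick_spec {m : ℕ → ℕ} {p r : ℕ} (hr : r < ∑ i ∈ Finset.range p, m i) :
    pick m p r < p ∧ ∑ i ∈ Finset.range (pick m p r), m i ≤ r ∧
      r < ∑ i ∈ Finset.range (pick m p r), m i + m (pick m p r) := by
  induction p with
  | zero => simp at hr
  | succ p ih =>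
    simp only [pick]
    split_ifs with h
    · exact ⟨(ih h).1.trans (Nat.lt_succ_self p), (ih h).2⟩
    · rw [Finset.sum_range_succ] at hr
      exact ⟨Nat.lt_succ_self p, not_lt.1 h, hr⟩

theorem eq_pick {m : ℕ → ℕ} {p r g : ℕ} (hr : r < ∑ i ∈ Finset.range p, m i)
    (h1 : ∑ i ∈ Finset.range g, m i ≤ r) (h2 : r < ∑ i ∈ Finset.range g, m i + m g) :
    g = pick m p r := by
  obtain ⟨-, h4, h5⟩ := pick_spec hr
  have hmono : ∀ {i j : ℕ}, i ≤ j → ∑ k ∈ Finset.range i, m k ≤ ∑ k ∈ Finset.range j, m k :=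
    fun hij => Finset.sum_le_sum_of_subset (Finset.range_mono hij)
  rw [← Finset.sum_range_succ] at h2 h5
  refine le_antisymm (not_lt.1 fun h => ?_) (not_lt.1 fun h => ?_)
  · exact absurd (h5.trans_le (hmono h)) (not_lt.2 h1)
  · exact absurd (h2.trans_le (hmono h)) (not_lt.2 h4)

/-- Among the outcomes below the total, group `g` occurs `m g` times; this converts averages over
the draw into sums weighted by multiplicities. -/
theorem sum_pick (m : ℕ → ℕ) (p : ℕ) (h : ℕ → ℝ) :
    ∑ r ∈ Finset.range (∑ i ∈ Finset.range p, m i), h (pick m p r) =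
      ∑ g ∈ Finset.range p, m g * h g := by
  induction p with
  | zero => simp
  | succ p ih =>
    rw [Finset.sum_range_succ, Finset.sum_range_succ (fun g => (m g : ℝ) * h g), Finset.sum_range_add,
      ← ih]
    congr 1
    · refine Finset.sum_congr rfl fun r hr => ?_
      simp only [pick]
      rw [if_pos (Finset.mem_range.1 hr)]
    · rw [Finset.sum_congr rfl (g := fun _ => h p), Finset.sum_const, Finset.card_range,
        nsmul_eq_mul]
      intro k _
      simp [pick]

/-! ## The core procedure -/

/-- The indicator of a finished group. -/
def doneInd (m : ℕ) : ℝ := if m = 0 then 1 else 0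

theorem doneInd_zero : doneInd 0 = 1 := if_pos rfl

theorem doneInd_of_ne {m : ℕ} (hm : m ≠ 0) : doneInd m = 0 := if_neg hm

theorem doneInd_le (m : ℕ) : doneInd m ≤ 1 := by
  unfold doneInd; split_ifs <;> norm_num

/-- Approximate oracles `F g`, `g < p`, over the summands `Y g` of `X`. -/
structure IsGroupOracle {d : ℕ} (τ : ℝ) (X : Set (Fin d → ℝ)) (p : ℕ) (Y : ℕ → Set (Fin d → ℝ))
    (F : ℕ → (Fin d → ℝ) → Fin d → ℝ) : Prop where
  mem : ∀ g < p, ∀ y : Fin d → ℝ, (∀ j, 0 ≤ y j) → F g y ∈ Y g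
  convex : ∀ g < p, Convex ℝ (Y g)
  nonneg : ∀ g < p, ∀ x ∈ Y g, ∀ j, 0 ≤ x j
  sum_mem : ∀ z : ℕ → Fin d → ℝ, (∀ g < p, z g ∈ Y g) → ∑ g ∈ Finset.range p, z g ∈ X
  le : ∀ y : Fin d → ℝ, (∀ j, 0 ≤ y j) → ∀ z ∈ X,
    ∑ g ∈ Finset.range p, ∑ j, F g y j * y j ≤ τ * ∑ j, z j * y j
  nonneg' : ∀ z ∈ X, ∀ j, 0 ≤ z j

/-- The data of a run of the core procedure with `p` groups of at most `q` of the `n` customers. -/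
structure CoreData (d : ℕ) where
  n : ℕ
  p : ℕ
  q : ℕ
  size : ℕ → ℕ
  F : ℕ → (Fin d → ℝ) → Fin d → ℝ
  price : (Fin d → ℝ) → Fin d → ℝ
  floor : ℝ
  cap : ℝ
  T : ℝ

/-- `x` is the current load, `m g` the multiplicity of group `g` (`0` if the group has finished),
`pr g` its progress, `dep` an upper bound on the entropic value of `x`, `L` the largest value of a
check and `cnt` the number of oracle calls. The other fields only serve the analysis. -/
structure Core (d : ℕ) where
  x : Fin d → ℝ
  m : ℕ → ℕ
  pr : ℕ → ℝ
  dep : ℝ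
  L : ℝ
  cnt : ℕ
  S : ℝ
  chk : ℝ
  nf : ℕ → ℕ
  prog : ℕ → ℝ
  nev : ℕ
  nc : ℕ

namespace Core

open scoped Pointwise

variable {d : ℕ}

def init (d : ℕ) : Core d where
  x := 0
  m := fun _ => 1
  pr := fun _ => 0
  dep := 0
  L := 0
  cnt := 0
  S := 0
  chk := 0
  nf := fun _ => 0
  prog := fun _ => 0
  nev := 0
  nc := 0

variable (P : CoreData d)

def total (c : Core d) : ℕ := ∑ g ∈ Finset.range P.p, c.m g

def y (c : Core d) : Fin d → ℝ := fun j => P.price c.x j + P.floor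

def val (c : Core d) (g : ℕ) : ℝ := ∑ j, P.F g (c.y P) j * c.y P j

def checkVal (c : Core d) : ℝ := ∑ g ∈ Finset.range P.p, c.val P g

def check (c : Core d) : Core d :=
  { c with
    L := max c.L (c.checkVal P)
    cnt := c.cnt + P.n
    chk := c.chk + c.checkVal P
    nf := fun g => if c.m g = 0 then c.nf g else c.nf g + 1
    nc := c.nc + 1 }

/-- The deposit for group `g` and its new multiplicity. -/
def choice (c : Core d) (g : ℕ) : ℝ × ℕ :=
  if P.cap * c.m g < c.val P g then (0, 2 * c.m g)
  else if 2 ≤ c.m g ∧ 4 * c.val P g ≤ P.cap * c.m g then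
    (if P.T - c.pr g ≤ 3 / c.m g then (P.T - c.pr g, 0) else (3 / c.m g, c.m g / 2))
  else (if P.T - c.pr g ≤ 1 / c.m g then (P.T - c.pr g, 0) else (1 / c.m g, c.m g))

def event (c : Core d) (g : ℕ) : Core d :=
  { c with
    x := c.x + (c.choice P g).1 • P.F g (c.y P)
    m := Function.update c.m g (c.choice P g).2
    pr := Function.update c.pr g (c.pr g + (c.choice P g).1)
    dep := c.dep + (c.choice P g).1 * c.val P g
    cnt := c.cnt + P.size g
    S := c.S + c.val P g / c.m g
    prog := Function.update c.prog g (c.prog g + 1 / c.m g)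
    nev := c.nev + 1 }

def step (c : Core d) (r : ℕ) : Core d :=
  if r < c.total P then c.event P (pick c.m P.p r) else c.check P

/-- The invariant of the core procedure. -/
structure Inv (β : Fin d → ℝ) (A κ : ℝ) (X : Set (Fin d → ℝ)) (Y : ℕ → Set (Fin d → ℝ))
    (c : Core d) : Prop where
  pow : ∀ g < P.p, c.m g ≠ 0 → ∃ k, c.m g = 2 ^ k
  pr_nonneg : ∀ g < P.p, 0 ≤ c.pr g
  pr_le : ∀ g < P.p, c.pr g ≤ P.T
  fin : ∀ g < P.p, c.m g = 0 → c.pr g = P.T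
  prog_eq : ∀ g < P.p, c.m g ≠ 0 → c.prog g = c.pr g + 2 - 2 / c.m g
  prog_le : ∀ g < P.p, c.prog g ≤ P.T + 3
  nf_eq : ∀ g < P.p, c.m g ≠ 0 → c.nf g = c.nc
  exists_nf : ∃ g < P.p, c.nf g = c.nc
  value : entropicValue β A c.x (P.price c.x) ≤ c.dep
  -- The next two fields are amortized bounds with the sum of the logarithms of the multiplicities
  -- as credit. A doubling visit deposits nothing, but its contribution to `S` exceeds the cap,
  -- which pays for the credit. A halving visit is paid for by released credit.
  dep_le : c.dep + P.cap * ∑ g ∈ Finset.range P.p, (Nat.log 2 (c.m g) : ℝ) ≤ c.S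
  nev_le : c.nev + ∑ g ∈ Finset.range P.p, (Nat.log 2 (c.m g) : ℝ) ≤
    ∑ g ∈ Finset.range P.p, c.pr g + ∑ g ∈ Finset.range P.p, doneInd (c.m g) +
      8 / P.cap * c.S
  cnt_le : c.cnt ≤ P.q * c.nev + P.n * c.nc
  chk_le : c.chk ≤ c.nc * c.L
  L_nonneg : 0 ≤ c.L
  L_le : ∀ z ∈ X, c.L ≤ κ * orderedNorm β z
  mem : ∃ z : ℕ → Fin d → ℝ, (∀ g < P.p, z g ∈ c.pr g • Y g) ∧
    c.x = ∑ g ∈ Finset.range P.p, z g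

variable {P}

/-- All facts about one visit. The deposit 3/m in the case of halving is forced by the relation
between `prog`, which grows by 1/m per visit, and the true progress: the quantity pr + 2 - 2/m also
grows by 1/m in each of the three cases, since 3/m - 4/m + 2/m = 1/m when m is halved and -1/m + 2/m
= 1/m when it is doubled.

The last two facts are the amortized bounds on the deposited value and on the number of visits. A
visit that keeps m ≥ 2 has val/m > cap/4 and is paid for by the term 8/cap; one that keeps m = 1 is
paid for by its progress 1; a finishing visit is paid for by the indicator of finished groups. -/
theorem choice_spec {c : Core d} {g : ℕ} (hcap : 0 < P.cap) (hv : 0 ≤ c.val P g)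
    {k : ℕ} (hk : c.m g = 2 ^ k) (hpr : c.pr g ≤ P.T) :
    0 ≤ (c.choice P g).1 ∧ (c.choice P g).1 * c.val P g ≤ P.cap ∧
    c.pr g + (c.choice P g).1 ≤ P.T ∧
    ((c.choice P g).2 = 0 → c.pr g + (c.choice P g).1 = P.T) ∧
    ((c.choice P g).2 ≠ 0 → (∃ k', (c.choice P g).2 = 2 ^ k') ∧
      c.pr g + (c.choice P g).1 + 2 - 2 / (c.choice P g).2 =
        c.pr g + 2 - 2 / c.m g + 1 / c.m g) ∧
    (c.choice P g).1 * c.val P g + P.cap * (Nat.log 2 (c.choice P g).2 - Nat.log 2 (c.m g)) ≤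
      c.val P g / c.m g ∧
    (1 + Nat.log 2 (c.choice P g).2 : ℝ) ≤ Nat.log 2 (c.m g) + (c.choice P g).1 +
      doneInd (c.choice P g).2 + 8 / P.cap * (c.val P g / c.m g) := by
  have hm0 : (0 : ℝ) < c.m g := by rw [hk]; positivity
  have hm1 : (1 : ℝ) ≤ c.m g := by rw [hk]; exact_mod_cast Nat.one_le_two_pow
  have hvm : 0 ≤ c.val P g / c.m g := div_nonneg hv hm0.le
  have h8 : 0 ≤ 8 / P.cap * (c.val P g / c.m g) := by positivity
  have hmv : c.val P g = c.val P g / c.m g * c.m g := (div_mul_cancel₀ _ hm0.ne').symm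
  have hinv : 1 / (c.m g : ℝ) * c.m g = 1 := div_mul_cancel₀ _ hm0.ne'
  have hlog : Nat.log 2 (c.m g) = k := by rw [hk]; exact Nat.log_pow (by norm_num) k
  have hinvle : 1 / (c.m g : ℝ) ≤ 1 := by rw [div_le_one hm0]; exact hm1
  generalize hvv : c.val P g = v at *
  generalize hww : v / (c.m g : ℝ) = w at *
  unfold choice
  rw [hvv]
  by_cases h1 : P.cap * c.m g < v
  · rw [if_pos h1]
    have hw : P.cap < w := by rw [hmv] at h1; exact lt_of_mul_lt_mul_right h1 hm0.le
    have hl : Nat.log 2 (2 * c.m g) = k + 1 := by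
      rw [hk, ← pow_succ']; exact Nat.log_pow (by norm_num) _
    refine ⟨le_rfl, by simpa using hcap.le, by simpa using hpr, fun h => ?_, fun _ => ⟨⟨k + 1, ?_⟩, ?_⟩,
      ?_, ?_⟩
    · exact absurd h (by rw [hk]; positivity)
    · simp [hk, pow_succ']
    · push_cast; field_simp; ring
    · rw [hl, hlog]; push_cast; linarith
    · rw [hl, hlog, doneInd_of_ne (by rw [hk]; positivity)]
      have : 8 ≤ 8 / P.cap * w := by
        rw [div_mul_eq_mul_div, le_div_iff₀ hcap]; linarith
      push_cast; linarith
  rw [if_neg h1]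
  have hw : w ≤ P.cap := by
    rw [not_lt, hmv] at h1
    exact le_of_mul_le_mul_right h1 hm0
  by_cases h2 : 2 ≤ c.m g ∧ 4 * v ≤ P.cap * c.m g
  · rw [if_pos h2]
    obtain ⟨h2, h4⟩ := h2
    by_cases h3 : P.T - c.pr g ≤ 3 / c.m g
    · rw [if_pos h3]
      have hk1 : 1 ≤ k := by
        by_contra hcon
        rw [hk, show k = 0 by omega] at h2
        norm_num at h2
      have hk1' : (1 : ℝ) ≤ k := by exact_mod_cast hk1
      have hw4 : 4 * w ≤ P.cap := by
        rw [hmv, ← mul_assoc] at h4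
        exact le_of_mul_le_mul_right h4 hm0
      have h5 : (P.T - c.pr g) * v ≤ 3 * w := by
        calc _ ≤ 3 / (c.m g : ℝ) * v := mul_le_mul_of_nonneg_right h3 hv
          _ = 3 * w := by rw [← hww]; ring
      refine ⟨by simpa using hpr, by dsimp only; linarith, by simp, fun _ => by simp, fun h => absurd rfl h,
        ?_, ?_⟩
      · simp only [Nat.log_zero_right, Nat.cast_zero, hlog]; nlinarith
      · simp only [Nat.log_zero_right, Nat.cast_zero, hlog, doneInd_zero]; linarith
    · rw [if_neg h3]
      obtain ⟨k, rfl⟩ : ∃ k', k = k' + 1 := by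
        rcases k with _ | k
        · rw [hk] at h2; norm_num at h2
        · exact ⟨k, rfl⟩
      have hw4 : 4 * w ≤ P.cap := by
        rw [hmv, ← mul_assoc] at h4
        exact le_of_mul_le_mul_right h4 hm0
      have hhalf : c.m g / 2 = 2 ^ k := by rw [hk, pow_succ]; simp
      have h5 : 3 / (c.m g : ℝ) * v = 3 * w := by rw [← hww]; ring
      have hl : Nat.log 2 (c.m g / 2) = k := by rw [hhalf]; exact Nat.log_pow (by norm_num) _
      have h6 : (0 : ℝ) < 3 / c.m g := by positivity
      refine ⟨h6.le, by dsimp only; linarith, by dsimp only; linarith,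
        fun h => ?_, fun _ => ⟨⟨k, hhalf⟩, ?_⟩, ?_, ?_⟩
      · exact absurd h (by rw [hhalf]; positivity)
      · simp only [hhalf]
        rw [hk]; push_cast; field_simp; ring
      · dsimp only
        rw [hl, hlog, h5]; push_cast; linarith
      · dsimp only
        rw [hl, hlog, doneInd_of_ne (by rw [hhalf]; positivity)]; push_cast; linarith
  · rw [if_neg h2]
    by_cases h4 : P.T - c.pr g ≤ 1 / c.m g
    · rw [if_pos h4]
      have h5 : (P.T - c.pr g) * v ≤ w := by
        calc _ ≤ 1 / (c.m g : ℝ) * v := mul_le_mul_of_nonneg_right h4 hv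
          _ = w := by rw [← hww]; ring
      have hk0 : (0 : ℝ) ≤ k := Nat.cast_nonneg k
      refine ⟨by simpa using hpr, by dsimp only; linarith, by simp, fun _ => by simp, fun h => absurd rfl h,
        ?_, ?_⟩
      · simp only [Nat.log_zero_right, Nat.cast_zero, hlog]; nlinarith
      · simp only [Nat.log_zero_right, Nat.cast_zero, hlog, doneInd_zero]; linarith
    · rw [if_neg h4]
      have h5 : 1 / (c.m g : ℝ) * v = w := by rw [← hww]; ring
      have h4' := not_le.1 h4
      have h6 : (0 : ℝ) < 1 / c.m g := by positivity
      have hne : c.m g ≠ 0 := by rw [hk]; positivity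
      refine ⟨h6.le, by dsimp only; linarith, by dsimp only; linarith, fun h => absurd h hne,
        fun _ => ⟨⟨k, hk⟩, by ring⟩, ?_, ?_⟩
      · dsimp only; rw [h5]; linarith
      · dsimp only
        rw [doneInd_of_ne hne]
        by_cases hm2 : 2 ≤ c.m g
        · have : P.cap < 4 * w := by
            by_contra hcon
            refine h2 ⟨hm2, ?_⟩
            push Not at hcon
            rw [hmv, ← mul_assoc]
            exact mul_le_mul_of_nonneg_right hcon hm0.le
          have : 2 ≤ 8 / P.cap * w := by
            rw [div_mul_eq_mul_div, le_div_iff₀ hcap]; linarith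
          linarith
        · have : c.m g = 1 := by omega
          rw [this]; push_cast; linarith


end Core

/-! ### Invariants of the core procedure -/

namespace Core
open scoped Pointwise

variable {d : ℕ}

/-- The conditions on the data of the core procedure. -/
structure Valid (P : CoreData d) (β : Fin d → ℝ) (A δ τ : ℝ) (X : Set (Fin d → ℝ))
    (Y : ℕ → Set (Fin d → ℝ)) : Prop where
  weight : IsOrderedWeight β
  dim : 0 < d
  oracle : IsGroupOracle τ X P.p Y P.F
  price : ∀ x, IsPrice β A x (P.price x)
  A_pos : 0 < A
  δ_pos : 0 < δ
  τ_nonneg : 0 ≤ τ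
  cap_pos : 0 < P.cap
  T_pos : 0 < P.T
  floor_eq : P.floor = A * P.cap
  floor_eq' : P.floor = δ * ((∑ j, β j) / d)
  p_pos : 0 < P.p
  size_le : ∀ g < P.p, P.size g ≤ P.q

variable {P : CoreData d} {β : Fin d → ℝ} {A δ τ : ℝ} {X : Set (Fin d → ℝ)}
  {Y : ℕ → Set (Fin d → ℝ)} {c : Core d} {g : ℕ}

namespace Valid

theorem floor_pos (V : Valid P β A δ τ X Y) : 0 < P.floor := by
  rw [V.floor_eq]; exact mul_pos V.A_pos V.cap_pos

theorem y_pos (V : Valid P β A δ τ X Y) (c : Core d) (j : Fin d) : 0 < c.y P j :=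
  add_pos ((V.price c.x).pos j) V.floor_pos

theorem load_mem (V : Valid P β A δ τ X Y) (c : Core d) (hg : g < P.p) : P.F g (c.y P) ∈ Y g :=
  V.oracle.mem g hg _ fun j => (V.y_pos c j).le

theorem load_nonneg (V : Valid P β A δ τ X Y) (c : Core d) (hg : g < P.p) (j : Fin d) :
    0 ≤ P.F g (c.y P) j :=
  V.oracle.nonneg g hg _ (V.load_mem c hg) j

theorem val_nonneg (V : Valid P β A δ τ X Y) (c : Core d) (hg : g < P.p) : 0 ≤ c.val P g :=
  Finset.sum_nonneg fun j _ => mul_nonneg (V.load_nonneg c hg j) (V.y_pos c j).le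

theorem checkVal_nonneg (V : Valid P β A δ τ X Y) (c : Core d) : 0 ≤ c.checkVal P :=
  Finset.sum_nonneg fun _ hg => V.val_nonneg c (Finset.mem_range.1 hg)

/-- A check value is a multiple of a lower bound on the optimum: the answers cost at most τ times as
much as z at the current prices, and the surcharge costs only a factor 1 + δ. -/
theorem checkVal_le (V : Valid P β A δ τ X Y) (c : Core d) {z : Fin d → ℝ} (hz : z ∈ X) :
    c.checkVal P ≤ τ * (1 + δ) * orderedNorm β z := by
  refine (V.oracle.le (c.y P) (fun j => (V.y_pos c j).le) z hz).trans ?_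
  rw [mul_assoc]
  refine mul_le_mul_of_nonneg_left ?_ V.τ_nonneg
  have := IsPrice.sum_mul_add_le V.weight V.dim (V.price c.x) (V.oracle.nonneg' z hz) V.δ_pos.le
  rwa [← V.floor_eq'] at this

end Valid

theorem mem_nonneg (V : Valid P β A δ τ X Y) {κ : ℝ} (h : c.Inv P β A κ X Y) (j : Fin d) :
    0 ≤ c.x j := by
  obtain ⟨z, hz, hx⟩ := h.mem
  rw [hx, Finset.sum_apply]
  refine Finset.sum_nonneg fun g hg => ?_
  have hg := Finset.mem_range.1 hg
  obtain ⟨w, hw, hwz⟩ := hz g hg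
  rw [← hwz]
  exact mul_nonneg (h.pr_nonneg g hg) (V.oracle.nonneg g hg w hw j)

theorem inv_init (V : Valid P β A δ τ X Y) (hX : ∀ z ∈ X, 0 ≤ orderedNorm β z) :
    (init d).Inv P β A (τ * (1 + δ)) X Y where
  pow := fun g _ _ => ⟨0, by simp [init]⟩
  pr_nonneg := fun g _ => le_rfl
  pr_le := fun g _ => V.T_pos.le
  fin := fun g _ h => absurd h (by simp [init])
  prog_eq := fun g _ _ => by simp [init]
  prog_le := fun g _ => by simp only [init]; linarith [V.T_pos]
  nf_eq := fun g _ _ => rfl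
  exists_nf := ⟨0, V.p_pos, rfl⟩
  value := IsPrice.entropicValue_zero_le V.A_pos V.weight (V.price 0)
  dep_le := by simp [init]
  nev_le := by simp [init, doneInd]
  cnt_le := by simp [init]
  chk_le := by simp [init]
  L_nonneg := le_rfl
  L_le := fun z hz => mul_nonneg (mul_nonneg V.τ_nonneg (by linarith [V.δ_pos])) (hX z hz)
  mem := by
    refine ⟨fun _ => 0, fun g hg => ?_, by simp [init]⟩
    exact ⟨_, V.load_mem (init d) hg, by simp [init]⟩

theorem inv_check (V : Valid P β A δ τ X Y) (h : c.Inv P β A (τ * (1 + δ)) X Y)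
    (hm : c.total P ≠ 0) : (c.check P).Inv P β A (τ * (1 + δ)) X Y where
  pow := h.pow
  pr_nonneg := h.pr_nonneg
  pr_le := h.pr_le
  fin := h.fin
  prog_eq := h.prog_eq
  prog_le := h.prog_le
  nf_eq := fun g hg hmg => by
    simp only [check] at hmg ⊢
    rw [if_neg hmg, h.nf_eq g hg hmg]
  exists_nf := by
    obtain ⟨g, hg, hmg⟩ : ∃ g < P.p, c.m g ≠ 0 := by
      by_contra! hcon
      exact hm (Finset.sum_eq_zero fun g hg => hcon g (Finset.mem_range.1 hg))
    refine ⟨g, hg, ?_⟩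
    simp only [check]
    rw [if_neg hmg, h.nf_eq g hg hmg]
  value := h.value
  dep_le := h.dep_le
  nev_le := h.nev_le
  cnt_le := by
    have := h.cnt_le
    simp only [check]
    linarith
  chk_le := by
    have h1 := h.chk_le
    have h2 : (c.nc : ℝ) * c.L ≤ c.nc * max c.L (c.checkVal P) :=
      mul_le_mul_of_nonneg_left (le_max_left _ _) (Nat.cast_nonneg _)
    have h3 := le_max_right c.L (c.checkVal P)
    simp only [check]
    push_cast
    linarith
  L_nonneg := h.L_nonneg.trans (le_max_left _ _)
  L_le := fun z hz => max_le (h.L_le z hz) (V.checkVal_le c hz)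
  mem := h.mem

/-- Only the entries of the visited group change, so each sum changes by one difference, and
`choice_spec` supplies the inequality for it. -/
theorem inv_event (V : Valid P β A δ τ X Y) (h : c.Inv P β A (τ * (1 + δ)) X Y)
    (hg : g < P.p) (hm : c.m g ≠ 0) : (c.event P g).Inv P β A (τ * (1 + δ)) X Y := by
  obtain ⟨k, hk⟩ := h.pow g hg hm
  obtain ⟨c1, c2, c3, c4, c5, c6, c7⟩ :=
    choice_spec V.cap_pos (V.val_nonneg c hg) hk (h.pr_le g hg)
  have hv := V.val_nonneg c hg
  set a := (c.choice P g).1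
  set m' := (c.choice P g).2
  have hm1 : (1 : ℝ) ≤ c.m g := by exact_mod_cast Nat.one_le_iff_ne_zero.2 hm
  have hself : ∀ {α : Type} (f : ℕ → α) (v : α), Function.update f g v g = v := fun f v =>
    Function.update_self _ _ _
  have hoff : ∀ {α : Type} (f : ℕ → α) (v : α) (i : ℕ), i ≠ g → Function.update f g v i = f i :=
    fun f v i hi => Function.update_of_ne hi _ _
  have hlog := sum_range_eq_add_of_eq_off (f := fun i => (Nat.log 2 (c.m i) : ℝ))
    (f' := fun i => (Nat.log 2 (Function.update c.m g m' i) : ℝ)) hg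
    fun i hi => by simp only [hoff _ _ i hi]
  have hpr := sum_range_eq_add_of_eq_off (f := c.pr) (f' := Function.update c.pr g (c.pr g + a)) hg
    fun i hi => hoff _ _ i hi
  have hdone := sum_range_eq_add_of_eq_off (f := fun i => doneInd (c.m i))
    (f' := fun i => doneInd (Function.update c.m g m' i)) hg
    fun i hi => by simp only [hoff _ _ i hi]
  simp only [hself] at hlog hpr hdone
  rw [doneInd_of_ne hm] at hdone
  refine ⟨fun i hi => ?_, fun i hi => ?_, fun i hi => ?_, fun i hi => ?_, fun i hi => ?_,
    fun i hi => ?_, fun i hi => ?_, h.exists_nf, ?_, ?_, ?_, ?_, h.chk_le, h.L_nonneg, h.L_le, ?_⟩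
  · simp only [event]
    rcases eq_or_ne i g with rfl | hne
    · rw [hself]; exact fun hh => (c5 hh).1
    · rw [hoff _ _ i hne]; exact h.pow i hi
  · simp only [event]
    rcases eq_or_ne i g with rfl | hne
    · rw [hself]; exact add_nonneg (h.pr_nonneg i hi) c1
    · rw [hoff _ _ i hne]; exact h.pr_nonneg i hi
  · simp only [event]
    rcases eq_or_ne i g with rfl | hne
    · rw [hself]; exact c3
    · rw [hoff _ _ i hne]; exact h.pr_le i hi
  · simp only [event]
    rcases eq_or_ne i g with rfl | hne
    · rw [hself, hself]; exact c4
    · rw [hoff _ _ i hne, hoff _ _ i hne]; exact h.fin i hi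
  · simp only [event]
    rcases eq_or_ne i g with rfl | hne
    · rw [hself, hself, hself]
      intro hh
      rw [h.prog_eq i hi hm]
      exact ((c5 hh).2).symm
    · rw [hoff _ _ i hne, hoff _ _ i hne, hoff _ _ i hne]; exact h.prog_eq i hi
  · simp only [event]
    rcases eq_or_ne i g with rfl | hne
    · rw [hself, h.prog_eq i hi hm]
      have := h.pr_le i hi
      have h2 : 1 / (c.m i : ℝ) ≤ 1 := by rw [div_le_one (by linarith)]; exact hm1
      have h3 : (0 : ℝ) ≤ 2 / c.m i := by positivity
      linarith
    · rw [hoff _ _ i hne]; exact h.prog_le i hi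
  · simp only [event]
    rcases eq_or_ne i g with rfl | hne
    · exact fun _ => h.nf_eq i hi hm
    · rw [hoff _ _ i hne]; exact h.nf_eq i hi
  -- The value of a deposit is at most the cap, and the surcharge is A times the cap; this is the
  -- condition under which the surcharge absorbs the second order term.
  · refine (IsPrice.entropicValue_step V.A_pos V.weight (V.price c.x) (V.price _)
      (V.load_nonneg c hg) c1 V.floor_pos c2 V.floor_eq.ge).trans ?_
    exact add_le_add_left h.value _
  · have := h.dep_le
    simp only [event]
    rw [hlog]
    linarith
  · have := h.nev_le
    simp only [event]
    rw [hlog, hpr, hdone]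
    push_cast
    rw [mul_add]
    linarith
  · have := h.cnt_le
    have h2 := V.size_le g hg
    simp only [event]
    linarith
  · obtain ⟨z, hz, hx⟩ := h.mem
    refine ⟨Function.update z g (z g + a • P.F g (c.y P)), fun i hi => ?_, ?_⟩
    · simp only [event]
      rcases eq_or_ne i g with rfl | hne
      · rw [hself, hself, (V.oracle.convex i hi).add_smul (h.pr_nonneg i hi) c1]
        exact Set.add_mem_add (hz i hi) (Set.smul_mem_smul_set (V.load_mem c hi))
      · rw [hoff _ _ i hne, hoff _ _ i hne]; exact hz i hi
    · simp only [event]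
      rw [Finset.sum_update_of_mem (Finset.mem_range.2 hg), hx,
        ← Finset.add_sum_erase _ z (Finset.mem_range.2 hg), Finset.sdiff_singleton_eq_erase]
      abel

theorem inv_step (V : Valid P β A δ τ X Y) (h : c.Inv P β A (τ * (1 + δ)) X Y)
    (hm : c.total P ≠ 0) (r : ℕ) : (c.step P r).Inv P β A (τ * (1 + δ)) X Y := by
  unfold step
  split_ifs with hr
  · obtain ⟨h1, h2, h3⟩ := pick_spec hr
    exact inv_event V h h1 (by omega)
  · exact inv_check V h hm

theorem cnt_step_gt (hn : 0 < P.n) (hs : ∀ g < P.p, 0 < P.size g) (r : ℕ) :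
    c.cnt < (c.step P r).cnt := by
  unfold step
  split_ifs with hr
  · have := hs _ (pick_spec hr).1
    simp only [event]; omega
  · simp only [check]; omega

/-! ### The potential -/

/-- The exponential potential of the core procedure; `η` and `δ` are the rates of its terms. -/
def pot (P : CoreData d) (η δ Z : ℝ) (c : Core d) : ℝ :=
  (Real.exp (η * (c.S - (1 + 3 * δ) * c.chk)) +
    ∑ g ∈ Finset.range P.p, Real.exp (δ * (c.nf g - (1 + 3 * δ) * c.prog g))) / Z

theorem pot_nonneg {η Z : ℝ} (hZ : 0 ≤ Z) : 0 ≤ c.pot P η δ Z := by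
  unfold pot; positivity

theorem pot_init {η Z : ℝ} : (init d).pot P η δ Z = (1 + P.p) / Z := by
  simp [pot, init]

theorem exp_le_quadratic {t : ℝ} (ht : |t| ≤ 1) : Real.exp t ≤ 1 + t + t ^ 2 := by
  have := (abs_le.1 (Real.abs_exp_sub_one_sub_id_le ht)).2
  linarith

theorem sum_step (c : Core d) (h : Core d → ℝ) :
    ∑ r ∈ Finset.range (c.total P + 1), h (c.step P r) =
      ∑ g ∈ Finset.range P.p, c.m g * h (c.event P g) + h (c.check P) := by
  rw [Finset.sum_range_succ, ← sum_pick c.m P.p fun g => h (c.event P g)]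
  congr 1
  · refine Finset.sum_congr rfl fun r hr => ?_
    simp only [step]
    rw [if_pos (show r < c.total P from Finset.mem_range.1 hr)]
  · simp [step]

/-- Group g has weight m g and increases S by val/m g, so the first order terms of all visits sum to
t = η · checkVal, and their second order terms add at most δ t. The check contributes exp(-(1+3δ)t)
- 1 ≤ -(1+3δ)t + 2δ t. The total is at most 0, which is where the factor 1 + 3δ comes from. -/
theorem sum_exp_value_le (V : Valid P β A δ τ X Y) {η : ℝ} (hη : 0 ≤ η) (hδ : δ ≤ 1 / 8)
    (hηV : η * c.checkVal P ≤ δ) :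
    ∑ r ∈ Finset.range (c.total P + 1),
      Real.exp (η * ((c.step P r).S - (1 + 3 * δ) * (c.step P r).chk)) ≤
    (c.total P + 1) * Real.exp (η * (c.S - (1 + 3 * δ) * c.chk)) := by
  have hδ0 := V.δ_pos
  rw [sum_step c fun c' => Real.exp (η * (c'.S - (1 + 3 * δ) * c'.chk))]
  set E := Real.exp (η * (c.S - (1 + 3 * δ) * c.chk)) with hE
  have hE0 : 0 ≤ E := (Real.exp_pos _).le
  have hV0 := V.checkVal_nonneg c
  have h1 : ∀ g ∈ Finset.range P.p, c.m g * Real.exp (η * ((c.event P g).S -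
      (1 + 3 * δ) * (c.event P g).chk)) ≤ (c.m g + (1 + δ) * η * c.val P g) * E := fun g hg => by
    have hg := Finset.mem_range.1 hg
    have hv := V.val_nonneg c hg
    rcases Nat.eq_zero_or_pos (c.m g) with hm | hm
    · rw [hm]; simp only [Nat.cast_zero, zero_mul, zero_add]; positivity
    have hm1 : (1 : ℝ) ≤ c.m g := by exact_mod_cast hm
    have hm0 : (0 : ℝ) < c.m g := by linarith
    have hle : c.val P g ≤ c.checkVal P :=
      Finset.single_le_sum (f := fun g => c.val P g)
        (fun i hi => V.val_nonneg c (Finset.mem_range.1 hi)) (Finset.mem_range.2 hg)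
    have ht0 : 0 ≤ η * (c.val P g / c.m g) := by positivity
    have hvd : η * c.val P g ≤ δ := (mul_le_mul_of_nonneg_left hle hη).trans hηV
    have ht : η * (c.val P g / c.m g) ≤ δ := by
      refine le_trans (mul_le_mul_of_nonneg_left (div_le_self hv hm1) hη) hvd
    have hexp := exp_le_quadratic (t := η * (c.val P g / c.m g))
      (by rw [abs_of_nonneg ht0]; linarith)
    have heq : Real.exp (η * ((c.event P g).S - (1 + 3 * δ) * (c.event P g).chk)) =
        Real.exp (η * (c.val P g / c.m g)) * E := by
      rw [hE, ← Real.exp_add]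
      simp only [event]
      ring_nf
    rw [heq, ← mul_assoc]
    refine mul_le_mul_of_nonneg_right ?_ hE0
    have hmul : (c.m g : ℝ) * (η * (c.val P g / c.m g)) = η * c.val P g := by
      field_simp
    calc (c.m g : ℝ) * Real.exp (η * (c.val P g / c.m g))
        ≤ c.m g * (1 + η * (c.val P g / c.m g) + (η * (c.val P g / c.m g)) ^ 2) :=
          mul_le_mul_of_nonneg_left hexp hm0.le
      _ = c.m g + η * c.val P g + η * c.val P g * (η * (c.val P g / c.m g)) := by
          rw [← hmul]; ring
      _ ≤ c.m g + η * c.val P g + η * c.val P g * δ := by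
          have := mul_le_mul_of_nonneg_left ht (mul_nonneg hη hv); linarith
      _ = _ := by ring
  have h2 := Finset.sum_le_sum h1
  rw [← Finset.sum_mul, Finset.sum_add_distrib, ← Finset.mul_sum] at h2
  have h3 : Real.exp (η * ((c.check P).S - (1 + 3 * δ) * (c.check P).chk)) =
      Real.exp (-((1 + 3 * δ) * (η * c.checkVal P))) * E := by
    rw [hE, ← Real.exp_add]
    simp only [check]
    ring_nf
  have ht0 : 0 ≤ η * c.checkVal P := mul_nonneg hη hV0
  set t := η * c.checkVal P with ht
  have h5 : (1 + 3 * δ) * t ≤ 1 := by nlinarith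
  have h4 := exp_le_quadratic (t := -((1 + 3 * δ) * t))
    (by rw [abs_neg, abs_of_nonneg (by positivity)]; exact h5)
  have h6 : (1 + δ) * t + Real.exp (-((1 + 3 * δ) * t)) ≤ 1 := by
    have : (1 + 3 * δ) ^ 2 * t ≤ 2 * δ := by
      have : (1 + 3 * δ) ^ 2 ≤ 2 := by nlinarith
      nlinarith
    nlinarith
  have h7 : ∑ i ∈ Finset.range P.p, (c.m i : ℝ) = c.total P := by
    simp only [total]; push_cast; rfl
  have h8 : (1 + δ) * η * ∑ i ∈ Finset.range P.p, c.val P i = (1 + δ) * t := by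
    rw [ht, checkVal]; ring
  rw [h7, h8] at h2
  rw [h3]
  nlinarith

/-- Visits of other groups do not matter, and once a group has finished, its term is frozen. For an
active group put s = δ(1+3δ): its visits contribute at most -s + s², the check at most δ + δ², and
s² ≤ 2δ² makes the sum non-positive. -/
theorem sum_exp_progress_le (hδ0 : 0 ≤ δ) (hδ : δ ≤ 1 / 8) (hg : g < P.p) :
    ∑ r ∈ Finset.range (c.total P + 1),
      Real.exp (δ * ((c.step P r).nf g - (1 + 3 * δ) * (c.step P r).prog g)) ≤
    (c.total P + 1) * Real.exp (δ * (c.nf g - (1 + 3 * δ) * c.prog g)) := by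
  rw [sum_step c fun c' => Real.exp (δ * (c'.nf g - (1 + 3 * δ) * c'.prog g))]
  set E := Real.exp (δ * (c.nf g - (1 + 3 * δ) * c.prog g)) with hE
  have hE0 : 0 ≤ E := (Real.exp_pos _).le
  have hoff : ∀ i, i ≠ g → (c.m i : ℝ) *
      Real.exp (δ * ((c.event P i).nf g - (1 + 3 * δ) * (c.event P i).prog g)) = c.m i * E :=
    fun i hi => by
      simp only [event]
      rw [Function.update_of_ne hi.symm]
  have h7 : ∑ i ∈ Finset.range P.p, (c.m i : ℝ) * E = c.total P * E := by
    simp only [total]; rw [← Finset.sum_mul]; push_cast; rfl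
  rw [sum_range_eq_add_of_eq_off hg hoff, h7]
  rcases Nat.eq_zero_or_pos (c.m g) with hm | hm
  · simp only [check, hm, if_true, Nat.cast_zero, zero_mul, sub_zero, add_zero]
    rw [← hE]
    linarith
  have hm1 : (1 : ℝ) ≤ c.m g := by exact_mod_cast hm
  have hm0 : (0 : ℝ) < c.m g := by linarith
  set s := δ * (1 + 3 * δ) with hs
  have hs0 : 0 ≤ s := by positivity
  have hs1 : s ≤ 1 := by nlinarith
  have h1 : Real.exp (δ * ((c.event P g).nf g - (1 + 3 * δ) * (c.event P g).prog g)) =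
      Real.exp (-(s / c.m g)) * E := by
    rw [hE, ← Real.exp_add]
    simp only [event]
    rw [Function.update_self, hs]
    ring_nf
  have h2 : Real.exp (δ * ((c.check P).nf g - (1 + 3 * δ) * (c.check P).prog g)) =
      Real.exp δ * E := by
    rw [hE, ← Real.exp_add]
    simp only [check]
    rw [if_neg hm.ne']
    push_cast
    ring_nf
  have hsm : s / c.m g ≤ s := div_le_self hs0 hm1
  have hsm0 : 0 ≤ s / c.m g := by positivity
  have h3 := exp_le_quadratic (t := -(s / c.m g))
    (by rw [abs_neg, abs_of_nonneg hsm0]; exact hsm.trans hs1)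
  have h4 := exp_le_quadratic (t := δ) (by rw [abs_of_nonneg hδ0]; linarith)
  have h5 : (c.m g : ℝ) * Real.exp (-(s / c.m g)) ≤ c.m g - s + s ^ 2 := by
    have hmul : (c.m g : ℝ) * (s / c.m g) = s := by field_simp
    calc _ ≤ c.m g * (1 + -(s / c.m g) + (-(s / c.m g)) ^ 2) :=
          mul_le_mul_of_nonneg_left h3 hm0.le
      _ = c.m g - c.m g * (s / c.m g) + c.m g * (s / c.m g) * (s / c.m g) := by ring
      _ ≤ _ := by rw [hmul]; nlinarith
  have h6 : c.m g * Real.exp (-(s / c.m g)) + Real.exp δ ≤ c.m g + 1 := by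
    have : s ^ 2 ≤ 2 * δ ^ 2 := by
      have : (1 + 3 * δ) ^ 2 ≤ 2 := by nlinarith
      rw [hs, mul_pow]
      nlinarith [sq_nonneg δ]
    nlinarith
  rw [h1, h2, ← mul_assoc]
  nlinarith

/-- The potential is a supermartingale. -/
theorem sum_pot_le (V : Valid P β A δ τ X Y) {η Z : ℝ} (hη : 0 ≤ η) (hδ : δ ≤ 1 / 8)
    (hηV : η * c.checkVal P ≤ δ) (hZ : 0 < Z) :
    ∑ r ∈ Finset.range (c.total P + 1), (c.step P r).pot P η δ Z ≤
      (c.total P + 1) * c.pot P η δ Z := by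
  unfold pot
  rw [← Finset.sum_div, Finset.sum_add_distrib, Finset.sum_comm, mul_div_assoc',
    div_le_div_iff_of_pos_right hZ, mul_add, Finset.mul_sum]
  exact add_le_add (sum_exp_value_le V hη hδ hηV) (Finset.sum_le_sum fun g hg =>
    sum_exp_progress_le V.δ_pos.le hδ (Finset.mem_range.1 hg))

/-! ### Outcome -/

theorem total_eq_zero_iff : c.total P = 0 ↔ ∀ g < P.p, c.m g = 0 := by
  simp [total, Finset.sum_eq_zero_iff]

/-- If all groups have finished, then the mean load is feasible. -/
theorem mem_of_finished (V : Valid P β A δ τ X Y) {κ : ℝ} (h : c.Inv P β A κ X Y)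
    (h0 : c.total P = 0) : P.T⁻¹ • c.x ∈ X := by
  rw [total_eq_zero_iff] at h0
  obtain ⟨z, hz, hx⟩ := h.mem
  rw [hx, Finset.smul_sum]
  refine V.oracle.sum_mem _ fun g hg => ?_
  have := hz g hg
  rw [h.fin g hg (h0 g hg)] at this
  exact (Set.mem_smul_set_iff_inv_smul_mem₀ V.T_pos.ne' _ _).1 this

/-- The right-hand side only involves parameters and the recorded deposit, so the program can
compute it; it holds in every run. -/
theorem norm_le (V : Valid P β A δ τ X Y) {κ : ℝ} (h : c.Inv P β A κ X Y) :
    orderedNorm β (P.T⁻¹ • c.x) ≤ ((∑ j, β j) * Real.log d / A + c.dep) / P.T := by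
  rw [orderedNorm_smul β c.x (inv_nonneg.2 V.T_pos.le), inv_mul_eq_div,
    div_le_div_iff_of_pos_right V.T_pos]
  have := IsPrice.le_entropicValue V.A_pos V.weight (V.price c.x) (mem_nonneg V h)
  linarith [h.value]

theorem dep_le_S (V : Valid P β A δ τ X Y) {κ : ℝ} (h : c.Inv P β A κ X Y) : c.dep ≤ c.S := by
  have h1 := h.dep_le
  have h2 : 0 ≤ P.cap * ∑ g ∈ Finset.range P.p, (Nat.log 2 (c.m g) : ℝ) :=
    mul_nonneg V.cap_pos.le (Finset.sum_nonneg fun _ _ => Nat.cast_nonneg _)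
  linarith

/-- A potential below 1 bounds each of its exponents by δ² T. The group that was active in all
checks has progress at most T + 3, so it bounds the number of checks; the first term bounds S by the
check values, each of which is at most L. -/
theorem bounds_of_pot_lt (V : Valid P β A δ τ X Y) {κ Λ : ℝ} (h : c.Inv P β A κ X Y)
    (hδ : δ ≤ 1 / 40) (hT : 4 ≤ δ * P.T) (hΛ : 0 < Λ)
    (hpot : c.pot P (δ / Λ) δ (Real.exp (δ ^ 2 * P.T)) < 1) :
    c.nc ≤ (1 + 5 * δ) * P.T ∧ c.S ≤ (1 + 9 * δ) * P.T * c.L + δ * P.T * Λ := by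
  have hδ0 := V.δ_pos
  have hT0 := V.T_pos
  unfold pot at hpot
  rw [div_lt_one (Real.exp_pos _)] at hpot
  have hE : 0 ≤ ∑ g ∈ Finset.range P.p, Real.exp (δ * (c.nf g - (1 + 3 * δ) * c.prog g)) :=
    Finset.sum_nonneg fun _ _ => (Real.exp_pos _).le
  have h1 : δ / Λ * (c.S - (1 + 3 * δ) * c.chk) < δ ^ 2 * P.T :=
    Real.exp_lt_exp.1 (by linarith)
  obtain ⟨g, hg, hnf⟩ := h.exists_nf
  have h2 : δ * (c.nf g - (1 + 3 * δ) * c.prog g) < δ ^ 2 * P.T := by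
    refine Real.exp_lt_exp.1 (lt_of_le_of_lt ?_ hpot)
    have := Finset.single_le_sum (f := fun g => Real.exp (δ * (c.nf g - (1 + 3 * δ) * c.prog g)))
      (fun _ _ => (Real.exp_pos _).le) (Finset.mem_range.2 hg)
    have h3 := Real.exp_pos (δ / Λ * (c.S - (1 + 3 * δ) * c.chk))
    linarith
  have h3 := h.prog_le g hg
  rw [hnf, pow_two, mul_assoc] at h2
  have h4 := lt_of_mul_lt_mul_left h2 hδ0.le
  have hnc : c.nc ≤ (1 + 5 * δ) * P.T := by
    have : (1 + 3 * δ) * c.prog g ≤ (1 + 3 * δ) * (P.T + 3) :=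
      mul_le_mul_of_nonneg_left h3 (by positivity)
    nlinarith
  refine ⟨hnc, ?_⟩
  have h5 : c.S - (1 + 3 * δ) * c.chk < δ * P.T * Λ := by
    have h6 : δ * (c.S - (1 + 3 * δ) * c.chk) < δ * (δ * P.T * Λ) := by
      rw [div_mul_eq_mul_div, div_lt_iff₀ hΛ] at h1
      linarith
    exact lt_of_mul_lt_mul_left h6 hδ0.le
  have h6 : c.chk ≤ (1 + 5 * δ) * P.T * c.L :=
    h.chk_le.trans (mul_le_mul_of_nonneg_right hnc h.L_nonneg)
  have h7 : (1 + 3 * δ) * c.chk ≤ (1 + 3 * δ) * ((1 + 5 * δ) * P.T * c.L) :=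
    mul_le_mul_of_nonneg_left h6 (by positivity)
  have h8 : (1 + 3 * δ) * ((1 + 5 * δ) * P.T * c.L) ≤ (1 + 9 * δ) * P.T * c.L := by
    have : (1 + 3 * δ) * (1 + 5 * δ) ≤ 1 + 9 * δ := by nlinarith
    have := mul_le_mul_of_nonneg_right this (mul_nonneg hT0.le h.L_nonneg)
    linarith
  linarith

/-- Here S ≤ 5/4 · TΛ, as 9/40 + 1/40 = 1/4. Visits paid for by S cost q · (8/cap) · (5/4) TΛ ≤ 10 W
T calls, visits paid for by progress and finishing at most 4nT, and checks at most 2nT. -/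
theorem cnt_le_of_bounds (V : Valid P β A δ τ X Y) {κ Λ W : ℝ} (h : c.Inv P β A κ X Y)
    (hδ : δ ≤ 1 / 40) (hT : 1 ≤ P.T) (hL : c.L ≤ Λ) (hqp : P.q * P.p ≤ 2 * P.n)
    (hW : P.q * Λ ≤ W * P.cap) (hnc : c.nc ≤ (1 + 5 * δ) * P.T)
    (hS : c.S ≤ (1 + 9 * δ) * P.T * c.L + δ * P.T * Λ) :
    (c.cnt : ℝ) ≤ (6 * P.n + 10 * W) * P.T := by
  have hδ0 := V.δ_pos
  have hcap := V.cap_pos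
  have hΛ : 0 ≤ Λ := h.L_nonneg.trans hL
  have h1 : c.S ≤ 5 / 4 * (P.T * Λ) := by
    have h2 : (1 + 9 * δ) * P.T * c.L ≤ (1 + 9 * δ) * P.T * Λ :=
      mul_le_mul_of_nonneg_left hL (by positivity)
    have h3 : δ * (P.T * Λ) ≤ 1 / 40 * (P.T * Λ) :=
      mul_le_mul_of_nonneg_right hδ (by positivity)
    linarith
  have h2 : ∑ g ∈ Finset.range P.p, c.pr g ≤ P.p * P.T := by
    have := Finset.sum_le_sum fun g (hg : g ∈ Finset.range P.p) =>
      h.pr_le g (Finset.mem_range.1 hg)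
    simpa using this
  have h3 : ∑ g ∈ Finset.range P.p, doneInd (c.m g) ≤ P.p := by
    have := Finset.sum_le_sum fun g (_ : g ∈ Finset.range P.p) => doneInd_le (c.m g)
    simpa using this
  have h4 : (0 : ℝ) ≤ ∑ g ∈ Finset.range P.p, (Nat.log 2 (c.m g) : ℝ) :=
    Finset.sum_nonneg fun _ _ => Nat.cast_nonneg _
  have h5 : (c.nev : ℝ) ≤ P.p * P.T + P.p + 8 / P.cap * c.S := by linarith [h.nev_le]
  have h6 : (c.cnt : ℝ) ≤ P.q * c.nev + P.n * c.nc := by exact_mod_cast h.cnt_le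
  have hq : (0 : ℝ) ≤ P.q := Nat.cast_nonneg _
  have hn : (0 : ℝ) ≤ P.n := Nat.cast_nonneg _
  have hqp' : (P.q : ℝ) * P.p ≤ 2 * P.n := by exact_mod_cast hqp
  have h7 : P.q * (8 / P.cap * c.S) ≤ 10 * W * P.T := by
    have h8 : P.q * (8 / P.cap * c.S) ≤ P.q * (8 / P.cap * (5 / 4 * (P.T * Λ))) := by gcongr
    have h9 : P.q * (8 / P.cap * (5 / 4 * (P.T * Λ))) = 10 / P.cap * P.T * (P.q * Λ) := by ring
    have h10 : 10 / P.cap * P.T * (P.q * Λ) ≤ 10 / P.cap * P.T * (W * P.cap) := by gcongr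
    have h11 : 10 / P.cap * P.T * (W * P.cap) = 10 * W * P.T := by field_simp
    linarith
  have h8 : (P.q : ℝ) * c.nev ≤ P.q * (P.p * P.T + P.p + 8 / P.cap * c.S) :=
    mul_le_mul_of_nonneg_left h5 hq
  have h9 : (P.n : ℝ) * c.nc ≤ P.n * ((1 + 5 * δ) * P.T) := mul_le_mul_of_nonneg_left hnc hn
  have h10 : P.q * (P.p * P.T + P.p) ≤ 2 * P.n * (2 * P.T) := by
    have : (P.q : ℝ) * (P.p * P.T + P.p) = P.q * P.p * (P.T + 1) := by ring
    rw [this]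
    exact mul_le_mul hqp' (by linarith) (by linarith) (by positivity)
  have h11 : (P.n : ℝ) * ((1 + 5 * δ) * P.T) ≤ P.n * (2 * P.T) := by
    refine mul_le_mul_of_nonneg_left ?_ hn
    nlinarith
  linarith

end Core

namespace RealRAM

/-! ## Verification of straight-line code and counting loops -/

variable {n d : ℕ} {f : Fin n → (Fin d → ℝ) → Fin d → ℝ}

@[simp] theorem upd_same {α : Type} (m : ℕ → ℕ → α) (a i : ℕ) (v : α) :
    upd m a i v a = Function.update (m a) i v := Function.update_self _ _ _

@[simp] theorem upd_of_ne {α : Type} (m : ℕ → ℕ → α) (a i : ℕ) (v : α) {b : ℕ} (h : b ≠ a) :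
    upd m a i v b = m b := Function.update_of_ne h _ _

/-- `s'` differs from `s` only in the integer arrays `N` and the real arrays `R`. -/
structure Frame (N R : List ℕ) (s s' : State) : Prop where
  nat : ∀ a, a ∉ N → s'.nat a = s.nat a
  real : ∀ a, a ∉ R → s'.real a = s.real a

namespace Frame

variable {N R N' R' : List ℕ} {s s' s'' : State}

theorem refl : Frame N R s s := ⟨fun _ _ => rfl, fun _ _ => rfl⟩

theorem trans (h : Frame N R s s') (h' : Frame N' R' s' s'') (hN : N' ⊆ N := by simp)
    (hR : R' ⊆ R := by simp) : Frame N R s s'' :=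
  ⟨fun a ha => (h'.nat a fun hm => ha (hN hm)).trans (h.nat a ha),
    fun a ha => (h'.real a fun hm => ha (hR hm)).trans (h.real a ha)⟩

theorem tick {c : ℕ} (h : Frame N R s s') : Frame N R s (s'.tick c) := ⟨h.nat, h.real⟩

theorem of_tick {c : ℕ} (h : Frame N R (s.tick c) s') : Frame N R s s' := ⟨h.nat, h.real⟩

theorem setNat (h : Frame N R s s') {a i v t : ℕ} (ha : a ∈ N := by simp) :
    Frame N R s { s' with nat := upd s'.nat a i v, time := t } :=
  ⟨fun b hb => by
    simp only
    rw [upd_of_ne _ _ _ _ (show b ≠ a by rintro rfl; exact hb ha), h.nat b hb], h.real⟩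

theorem setReal (h : Frame N R s s') {a i t : ℕ} {v : ℝ} (ha : a ∈ R := by simp) :
    Frame N R s { s' with real := upd s'.real a i v, time := t } :=
  ⟨h.nat, fun b hb => by
    simp only
    rw [upd_of_ne _ _ _ _ (show b ≠ a by rintro rfl; exact hb ha), h.real b hb]⟩

end Frame

/-- The integer variable `a`, which is entry `0` of array `a`. -/
def nvar (a : ℕ) : NExpr := .get a (.const 0)

/-- The real variable `a`, which is entry `0` of array `a`. -/
def rvar (a : ℕ) : RExpr := .get a (.const 0)

/-- A numeral as a real expression. -/
def rnum (k : ℕ) : RExpr := .ofNat (.const k)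

@[simp] theorem eval_nvar (a : ℕ) (s : State) : (nvar a).eval s = s.nat a 0 := rfl
@[simp] theorem eval_rvar (a : ℕ) (s : State) : (rvar a).eval s = s.real a 0 := rfl
@[simp] theorem eval_rnum (k : ℕ) (s : State) : (rnum k).eval s = k := rfl
@[simp] theorem cost_nvar (a : ℕ) : (nvar a).cost = 2 := rfl
@[simp] theorem cost_rvar (a : ℕ) : (rvar a).cost = 2 := rfl
@[simp] theorem cost_rnum (k : ℕ) : (rnum k).cost = 2 := rfl

/-- The body is executed for `i = e₀, …, e - 1`. -/
def forLoop (i : ℕ) (e₀ e : NExpr) (body : Prog) : Prog :=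
  .seq (.setNat i (.const 0) e₀)
    (.while (.natLt (nvar i) e) (.seq body (.setNat i (.const 0) (.add (nvar i) (.const 1)))))

theorem upd_self {α : Type} (m : ℕ → ℕ → α) (a i : ℕ) : upd m a i (m a i) = m := by
  unfold upd; simp

/-- A counting loop whose running time is amortized by the potential `φ`. -/
theorem Total.forLoop_amortized {i a N c : ℕ} {e₀ e : NExpr} {body : Prog} {I : ℕ → State → Prop}
    {s : State} {φ : State → ℕ} (ha : e₀.eval s = a) (haN : a ≤ N)
    (hφ : ∀ s v t, φ { s with nat := upd s.nat i 0 v, time := t } = φ s)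
    (hinv : ∀ k s v t, I k s → I k { s with nat := upd s.nat i 0 v, time := t })
    (he : ∀ k s, I k s → e.eval s = N)
    (hbody : ∀ k s, a ≤ k → k < N → I k s → s.nat i 0 = k → Total f body s fun s' =>
      I (k + 1) s' ∧ s'.nat i 0 = k ∧ s'.time + φ s' ≤ s.time + φ s + c)
    (hs : I a s) :
    Total f (forLoop i e₀ e body) s fun s' =>
      I N s' ∧ s'.nat i 0 = N ∧ s'.time + φ s' ≤
        s.time + φ s + (N - a) * (c + e.cost + 20) + (e₀.cost + e.cost + 20) := by
  -- Writing the counter's own value back leaves memory unchanged, so insensitivity to counter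
  -- updates implies insensitivity to the passage of time.
  have htick : ∀ (s : State) t, { s with nat := upd s.nat i 0 (s.nat i 0), time := t } =
      { s with time := t } := fun s t => by rw [upd_self]
  have hI : ∀ k s c, I k s → I k (s.tick c) := fun k s c h => by
    have := hinv k s (s.nat i 0) (s.time + c) h
    rwa [htick] at this
  have hφt : ∀ s c, φ (s.tick c) = φ s := fun s c => by
    have := hφ s (s.nat i 0) (s.time + c)
    rwa [htick] at this
  refine .seq (.setNat ?_)
  set t1 := s.time + φ s + (N - a) * (c + e.cost + 20) + (e₀.cost + e.cost + 20) with ht1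
  refine Total.while_count (I := fun k s' => k ≤ N - a ∧ I (N - k) s' ∧ s'.nat i 0 = N - k ∧
    s'.time + φ s' + k * (c + e.cost + 20) + (e.cost + 10) ≤ t1) (fun k s' => ?_) (fun s' => ?_)
    (N - a) _ ⟨le_rfl, ?_, ?_, ?_⟩
  · rintro ⟨h0, h1, h2, h3⟩
    have hk : N - k = N - (k + 1) + 1 := by omega
    refine ⟨?_, .seq ((hbody (N - (k + 1)) (s'.tick _) (by omega) (by omega) (hI _ _ _ h1)
      h2).mono ?_)⟩
    · simp only [Cond.Holds, eval_nvar, h2, he _ _ h1]; omega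
    · rintro s'' ⟨h4, h5, h6⟩
      refine .setNat ⟨by omega, ?_, ?_, ?_⟩
      · rw [hk]; exact hinv _ _ _ _ h4
      · simp [NExpr.eval, h5]; omega
      · have h7 := hφ s'' (s''.nat i 0 + 1) (s''.time + ((NExpr.const 0).cost +
          (NExpr.add (nvar i) (.const 1)).cost + 1))
        simp only [NExpr.cost, NExpr.eval, Cond.cost, State.tick_time, cost_nvar, eval_nvar,
          hφt] at h6 h7 ⊢
        rw [h7]
        rw [Nat.succ_mul] at h3
        omega
  · rintro ⟨h0, h1, h2, h3⟩
    rw [Nat.sub_zero] at h1 h2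
    refine ⟨?_, hI _ _ _ h1, h2, ?_⟩
    · simp only [Cond.Holds, eval_nvar, h2, he _ _ h1]; omega
    · simp only [Cond.cost, State.tick_time, cost_nvar, hφt] at h3 ⊢
      omega
  · rw [Nat.sub_sub_self haN]; exact hinv _ _ _ _ hs
  · simp [NExpr.eval, ha]; omega
  · simp only [NExpr.cost, NExpr.eval, hφ]; omega

theorem Total.forLoop {i a N c : ℕ} {e₀ e : NExpr} {body : Prog} {I : ℕ → State → Prop} {s : State}
    (ha : e₀.eval s = a) (haN : a ≤ N)
    (hinv : ∀ k s v t, I k s → I k { s with nat := upd s.nat i 0 v, time := t })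
    (he : ∀ k s, I k s → e.eval s = N)
    (hbody : ∀ k s, a ≤ k → k < N → I k s → s.nat i 0 = k → Total f body s fun s' =>
      I (k + 1) s' ∧ s'.nat i 0 = k ∧ s'.time ≤ s.time + c)
    (hs : I a s) :
    Total f (forLoop i e₀ e body) s fun s' =>
      I N s' ∧ s'.nat i 0 = N ∧
      s'.time ≤ s.time + (N - a) * (c + e.cost + 20) + (e₀.cost + e.cost + 20) :=
  Total.forLoop_amortized (φ := fun _ => 0) ha haN (fun _ _ _ => rfl) hinv he hbody hs

/-! ## Sorting with a tournament tree -/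

/-- `TR` is a tournament tree for the keys of `0, …, d - 1`, with leaves `d, …, 2 d - 1`, except at
the nodes `ex`. -/
structure Tournament (d : ℕ) (key : ℕ → ℝ) (TR : ℕ → ℕ) (ex : ℕ → Prop) : Prop where
  leaf : ∀ j < d, TR (d + j) = j
  lt : ∀ v, 1 ≤ v → v < 2 * d → ¬ ex v → TR v < d
  node : ∀ v, 1 ≤ v → v < d → ¬ ex v → (TR v = TR (2 * v) ∨ TR v = TR (2 * v + 1)) ∧
    key (TR (2 * v)) ≤ key (TR v) ∧ key (TR (2 * v + 1)) ≤ key (TR v)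

namespace Tournament

variable {key : ℕ → ℝ} {TR : ℕ → ℕ} {ex ex' : ℕ → Prop}

theorem mono (h : Tournament d key TR ex) (hex : ∀ u, 1 ≤ u → ex u → ex' u) :
    Tournament d key TR ex' :=
  ⟨h.leaf, fun v h1 h2 h3 => h.lt v h1 h2 fun h4 => h3 (hex v h1 h4),
    fun v h1 h2 h3 => h.node v h1 h2 fun h4 => h3 (hex v h1 h4)⟩

/-- Repairing a node may invalidate its parent, so the parent must already be among the exceptions.
-/
theorem recompute (h : Tournament d key TR ex) {v b : ℕ} (hv1 : 1 ≤ v) (hvd : v < d)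
    (hl : ¬ ex (2 * v)) (hr : ¬ ex (2 * v + 1)) (hp : ∀ u, 1 ≤ u → u = v / 2 → ex u)
    (hb : b = TR (2 * v) ∨ b = TR (2 * v + 1)) (hbl : key (TR (2 * v)) ≤ key b)
    (hbr : key (TR (2 * v + 1)) ≤ key b) :
    Tournament d key (Function.update TR v b) (fun u => ex u ∧ u ≠ v) := by
  have hu : ∀ w, w ≠ v → Function.update TR v b w = TR w := fun w hw =>
    Function.update_of_ne hw _ _
  refine ⟨fun j hj => ?_, fun w h1 h2 h3 => ?_, fun w h1 h2 h3 => ?_⟩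
  · rw [hu _ (by omega), h.leaf j hj]
  · by_cases hw : w = v
    · rw [hw, Function.update_self]
      rcases hb with hb | hb <;> rw [hb]
      · exact h.lt _ (by omega) (by omega) hl
      · exact h.lt _ (by omega) (by omega) hr
    · rw [hu w hw]
      exact h.lt w h1 h2 fun h4 => h3 ⟨h4, hw⟩
  · by_cases hw : w = v
    · subst hw
      rw [hu (2 * w) (by omega), hu (2 * w + 1) (by omega), Function.update_self]
      exact ⟨hb, hbl, hbr⟩
    · have hnex : ¬ ex w := fun h4 => h3 ⟨h4, hw⟩
      have h5 : 2 * w ≠ v := fun h6 => hnex (hp w h1 (by omega))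
      have h7 : 2 * w + 1 ≠ v := fun h6 => hnex (hp w h1 (by omega))
      rw [hu w hw, hu _ h5, hu _ h7]
      exact h.node w h1 h2 hnex

theorem le_root (h : Tournament d key TR fun _ => False) {u : ℕ} (h1 : 1 ≤ u) (h2 : u < 2 * d) :
    key (TR u) ≤ key (TR 1) := by
  induction u using Nat.strong_induction_on with
  | _ u ih =>
    rcases Nat.eq_or_lt_of_le h1 with rfl | hlt
    · exact le_rfl
    · have h3 := h.node (u / 2) (by omega) (by omega) not_false
      have h4 := ih (u / 2) (by omega) (by omega) (by omega)
      rcases Nat.even_or_odd' u with ⟨k, hk | hk⟩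
      · rw [show 2 * (u / 2) = u by omega] at h3
        exact h3.2.1.trans h4
      · rw [show 2 * (u / 2) + 1 = u by omega] at h3
        exact h3.2.2.trans h4

/-- A node stores `j` only if it lies on the path from the leaf `d + j` to the root, and the nodes
on this path are the iterated halves of d + j. -/
theorem exists_eq_div (h : Tournament d key TR fun _ => False) {j : ℕ} :
    ∀ k u, 2 * d - u ≤ k → 1 ≤ u → u < 2 * d → TR u = j → ∃ i, u = (d + j) / 2 ^ i := by
  intro k
  induction k with
  | zero => intro u h0 _ h2 _; omega
  | succ k ih =>
    intro u h0 h1 h2 h3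
    rcases Nat.lt_or_ge u d with hud | hud
    · rcases (h.node u h1 hud not_false).1 with h4 | h4
      · obtain ⟨i, hi⟩ := ih (2 * u) (by omega) (by omega) (by omega) (h4.symm.trans h3)
        refine ⟨i + 1, ?_⟩
        rw [pow_succ, ← Nat.div_div_eq_div_mul, ← hi]
        omega
      · obtain ⟨i, hi⟩ := ih (2 * u + 1) (by omega) (by omega) (by omega) (h4.symm.trans h3)
        refine ⟨i + 1, ?_⟩
        rw [pow_succ, ← Nat.div_div_eq_div_mul, ← hi]
        omega
    · have h4 := h.leaf (u - d) (by omega)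
      rw [show d + (u - d) = u by omega, h3] at h4
      exact ⟨0, by rw [pow_zero, Nat.div_one]; omega⟩

/-- Hence a changed key affects only comparisons at proper ancestors of its leaf. -/
theorem update_key (h : Tournament d key TR fun _ => False) {j : ℕ} (c : ℝ) :
    Tournament d (Function.update key j c) TR fun u => ∃ i, u = (d + j) / 2 / 2 ^ i := by
  have hpar : ∀ u i, u = (d + j) / 2 ^ i → ∃ i, u / 2 = (d + j) / 2 / 2 ^ i := fun u i hu =>
    ⟨i, by rw [hu, Nat.div_div_eq_div_mul, Nat.div_div_eq_div_mul, mul_comm]⟩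
  refine ⟨h.leaf, fun v h1 h2 _ => h.lt v h1 h2 not_false, fun v h1 h2 h3 => ?_⟩
  have h4 := h.node v h1 h2 not_false
  have hne : ∀ u, u < 2 * d → 1 ≤ u → u / 2 = v → TR u ≠ j := fun u hu hu1 huv hj => by
    obtain ⟨i, hi⟩ := h.exists_eq_div _ u le_rfl hu1 hu hj
    exact h3 (huv ▸ hpar u i hi)
  have hl := hne (2 * v) (by omega) (by omega) (by omega)
  have hr := hne (2 * v + 1) (by omega) (by omega) (by omega)
  have hv : TR v ≠ j := by
    rcases h4.1 with h5 | h5 <;> rw [h5] <;> assumption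
  rw [Function.update_of_ne hl, Function.update_of_ne hr, Function.update_of_ne hv]
  exact h4

end Tournament

/-- Recomputes node `v` of the tournament tree. -/
def recomputeNode : Prog :=
  .ite (.realLe (.get 4 (.get 2 (.add (.add (nvar 7) (nvar 7)) (.const 1))))
      (.get 4 (.get 2 (.add (nvar 7) (nvar 7)))))
    (.setNat 2 (nvar 7) (.get 2 (.add (nvar 7) (nvar 7))))
    (.setNat 2 (nvar 7) (.get 2 (.add (.add (nvar 7) (nvar 7)) (.const 1))))

theorem Total.recomputeNode {s : State} {ex : ℕ → Prop} {v : ℕ}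
    (h : Tournament d (s.real 4) (s.nat 2) ex) (hv : s.nat 7 0 = v) (hv1 : 1 ≤ v) (hvd : v < d)
    (hl : ¬ ex (2 * v)) (hr : ¬ ex (2 * v + 1)) (hp : ∀ u, 1 ≤ u → u = v / 2 → ex u) :
    Total f recomputeNode s fun s' =>
      Tournament d (s'.real 4) (s'.nat 2) (fun u => ex u ∧ u ≠ v) ∧ Frame [2] [] s s' ∧
      s'.calls = s.calls ∧ s'.time ≤ s.time + 50 := by
  refine .ite (fun hb => .setNat ⟨?_, ?_, rfl, ?_⟩) (fun hb => .setNat ⟨?_, ?_, rfl, ?_⟩)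
  · simp only [Cond.Holds, RExpr.eval, NExpr.eval, eval_nvar, hv, ← two_mul] at hb
    simp only [NExpr.eval, eval_nvar, hv, ← two_mul, State.tick_nat, State.tick_real, upd_same]
    exact h.recompute hv1 hvd hl hr hp (.inl rfl) le_rfl hb
  · exact Frame.refl.tick.setNat
  · simp [NExpr.cost, RExpr.cost, Cond.cost]
  · simp only [Cond.Holds, RExpr.eval, NExpr.eval, eval_nvar, hv, ← two_mul, not_le] at hb
    simp only [NExpr.eval, eval_nvar, hv, ← two_mul, State.tick_nat, State.tick_real, upd_same]
    exact h.recompute hv1 hvd hl hr hp (.inr rfl) hb.le le_rfl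
  · exact Frame.refl.tick.setNat
  · simp [NExpr.cost, RExpr.cost, Cond.cost]

/-- Builds the tournament tree for the keys `X`. -/
def buildTree : Prog :=
  .seq (forLoop 8 (.const 0) (.get 0 (.const 1)) (.seq
      (.setReal 4 (nvar 8) (.get 3 (nvar 8)))
      (.setNat 2 (.add (.get 0 (.const 1)) (nvar 8)) (nvar 8))))
    (.seq (.setNat 7 (.const 0) (.get 0 (.const 1)))
      (.while (.natLt (.const 1) (nvar 7))
        (.seq (.setNat 7 (.const 0) (.sub (nvar 7) (.const 1))) recomputeNode)))

/-- The inner nodes are computed from d - 1 down to 1, children before parents; the nodes below the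
current one are the exceptions. Exceptions at node 0 are harmless because it is not part of the
tree. -/
theorem Total.buildTree {s : State} (hd : s.nat 0 1 = d) :
    Total f buildTree s fun s' =>
      Tournament d (s'.real 4) (s'.nat 2) (fun _ => False) ∧ (∀ j < d, s'.real 4 j = s.real 3 j) ∧
      Frame [2, 7, 8] [4] s s' ∧ s'.calls = s.calls ∧ s'.time ≤ s.time + 200 * (d + 1) := by
  refine .seq ((Total.forLoop (c := 30) (a := 0) (N := d) (I := fun k s' => Frame [2, 7, 8] [4] s s' ∧
    (∀ j < k, s'.real 4 j = s.real 3 j ∧ s'.nat 2 (d + j) = j) ∧ s'.calls = s.calls) rfl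
    (Nat.zero_le _) ?_ ?_ ?_ ?_).mono ?_)
  · rintro k s' v t ⟨h1, h2, h3⟩
    exact ⟨h1.setNat, by simpa using h2, h3⟩
  · rintro k s' ⟨h1, -, -⟩
    simp only [NExpr.eval, h1.nat 0 (by simp), hd]
  · rintro k s' - hk ⟨h1, h2, h3⟩ h4
    have h5 := h1.nat 0 (by simp)
    have h6 := h1.real 3 (by simp)
    refine .seq (.setReal (.setNat ⟨⟨h1.setReal.setNat, fun j hj => ?_, h3⟩, ?_, ?_⟩))
    · simp only [NExpr.eval, RExpr.eval, eval_nvar, h4, h5, h6, hd, upd_same]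
      rcases Nat.lt_succ_iff_lt_or_eq.1 hj with hj | rfl
      · rw [Function.update_of_ne (by omega), Function.update_of_ne (by omega)]
        exact h2 j hj
      · simp
    · simpa using h4
    · simp [NExpr.cost, RExpr.cost]
  · exact ⟨.refl, by simp, rfl⟩
  rintro s1 ⟨⟨h1, h2, h3⟩, -, h4⟩
  refine .seq (.setNat ?_)
  have h5 := h1.nat 0 (by simp)
  simp only [NExpr.eval, NExpr.cost, h5, hd] at h4 ⊢
  refine Total.while_measure (I := fun k s' => s'.nat 7 0 = k ∧ k ≤ d ∧
      Tournament d (s'.real 4) (s'.nat 2) (fun u => u < k) ∧ Frame [2, 7, 8] [4] s s' ∧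
      (∀ j < d, s'.real 4 j = s.real 3 j) ∧ s'.calls = s.calls ∧
      s'.time + k * 80 + 20 ≤ s.time + 200 * (d + 1)) (fun k s' => ?_) (fun k s' => ?_) d _ ?_
  · rintro ⟨i1, i2, i3, i4, i5, i6, i7⟩ hb
    simp only [Cond.Holds, NExpr.eval, eval_nvar, i1] at hb
    obtain ⟨k, rfl⟩ : ∃ k', k = k' + 1 := ⟨k - 1, by omega⟩
    refine .seq (.setNat ?_)
    refine (Total.recomputeNode (v := k) (ex := fun u => u < k + 1) (by simpa using i3)
      (by simp [NExpr.eval, i1]) (by omega) (by omega) (by omega) (by omega)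
      (fun u _ _ => by omega)).mono ?_
    rintro s'' ⟨j1, j2, j3, j4⟩
    have h7 := j2.nat 7 (by simp)
    have h8 := j2.real 4 (by simp)
    refine ⟨k, by omega, ?_, by omega, j1.mono fun u _ hu => by omega, i4.tick.setNat.trans j2,
      ?_, j3.trans i6, ?_⟩
    · rw [h7]; simp [NExpr.eval, i1]
    · rw [h8]; exact i5
    · simp only [NExpr.cost, Cond.cost, State.tick_time, cost_nvar] at j4
      omega
  · rintro ⟨i1, i2, i3, i4, i5, i6, i7⟩ hb
    simp only [Cond.Holds, NExpr.eval, eval_nvar, i1] at hb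
    refine ⟨i3.mono fun u hu1 hu => by omega, i5, i4.tick, i6, ?_⟩
    simp only [Cond.cost, NExpr.cost, State.tick_time, cost_nvar]
    omega
  · refine ⟨by simp, le_rfl, ⟨fun j hj => ?_, fun v hv1 hv2 hv3 => ?_, fun v hv1 hv2 hv3 => ?_⟩,
      h1.setNat, fun j hj => ?_, h3, ?_⟩
    · simpa using (h2 j hj).2
    · have := (h2 (v - d) (by omega)).2
      rw [show d + (v - d) = v by omega] at this
      simp only [upd_of_ne _ _ _ _ (show (2 : ℕ) ≠ 7 by norm_num), this]
      omega
    · omega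
    · exact (h2 j hj).1
    · simp only; omega

end RealRAM

/-! ### Extracting the sorted order from the tournament tree -/

namespace RealRAM

variable {n d : ℕ} {f : Fin n → (Fin d → ℝ) → Fin d → ℝ}

/-- Recomputes the path from node `v` to the root of the tournament tree. -/
def recomputePath : Prog :=
  .while (.natLe (.const 1) (nvar 7))
    (.seq recomputeNode (.setNat 7 (.const 0) (.half (nvar 7))))

/-- Each round repairs the lowest exceptional node and moves to its parent, so after at most log d +
1 halvings no exception is left. -/
theorem Total.recomputePath {s : State} (hv : s.nat 7 0 < d)
    (h : Tournament d (s.real 4) (s.nat 2) fun u => ∃ i, u = s.nat 7 0 / 2 ^ i) :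
    Total f recomputePath s fun s' => Tournament d (s'.real 4) (s'.nat 2) (fun _ => False) ∧
      Frame [2, 7] [] s s' ∧ s'.calls = s.calls ∧
      s'.time ≤ s.time + 80 * (Nat.log 2 d + 1) + 20 := by
  refine Total.while_measure (I := fun k s' => s'.nat 7 0 < 2 ^ k ∧ s'.nat 7 0 < d ∧
    Tournament d (s'.real 4) (s'.nat 2) (fun u => ∃ i, u = s'.nat 7 0 / 2 ^ i) ∧
    Frame [2, 7] [] s s' ∧ s'.calls = s.calls ∧
    s'.time + 80 * k + 20 ≤ s.time + 80 * (Nat.log 2 d + 1) + 20)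
    (fun k s' => ?_) (fun k s' => ?_) (Nat.log 2 d + 1) s ?_
  · rintro ⟨i1, i2, i3, i4, i5, i6⟩ hb
    simp only [Cond.Holds, NExpr.eval, eval_nvar] at hb
    rcases k with _ | k
    · rw [pow_zero] at i1; omega
    set v := s'.nat 7 0 with hvdef
    have hdiv : ∀ i, v / 2 ^ i ≤ v := fun i => Nat.div_le_self _ _
    refine .seq ((Total.recomputeNode (s := s'.tick _) (v := v) i3 rfl hb i2 ?_ ?_ ?_).mono ?_)
    · rintro ⟨i, hi⟩; have := hdiv i; omega
    · rintro ⟨i, hi⟩; have := hdiv i; omega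
    · rintro u - hu; exact ⟨1, by rw [pow_one]; exact hu⟩
    rintro s'' ⟨j1, j2, j3, j4⟩
    have h7 := j2.nat 7 (by simp)
    simp only [State.tick_nat] at h7
    refine .setNat ⟨k, Nat.lt_succ_self k, ?_, ?_, ?_, (i4.tick.trans j2).setNat, j3.trans i5, ?_⟩
    · simp only [NExpr.eval, eval_nvar, upd_same, Function.update_self, h7]
      rw [pow_succ] at i1
      omega
    · simp only [NExpr.eval, eval_nvar, upd_same, Function.update_self, h7]
      omega
    · simp only [NExpr.eval, eval_nvar, upd_same, Function.update_self, h7,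
        upd_of_ne _ _ _ _ (show (2 : ℕ) ≠ 7 by norm_num)]
      refine j1.mono ?_
      rintro u - ⟨⟨i, hi⟩, hne⟩
      rcases i with _ | i
      · simp only [pow_zero, Nat.div_one] at hi; exact absurd hi hne
      · exact ⟨i, by rw [hi, ← hvdef, pow_succ', Nat.div_div_eq_div_mul]⟩
    · simp only [NExpr.cost, Cond.cost, State.tick_time, cost_nvar] at j4 ⊢
      omega
  · rintro ⟨i1, i2, i3, i4, i5, i6⟩ hb
    simp only [Cond.Holds, NExpr.eval, eval_nvar] at hb
    refine ⟨i3.mono ?_, i4.tick, i5, ?_⟩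
    · rintro u hu1 ⟨i, hi⟩
      have := Nat.div_le_self (s'.nat 7 0) (2 ^ i)
      omega
    · simp only [Cond.cost, NExpr.cost, State.tick_time, cost_nvar]
      omega
  · exact ⟨hv.trans (Nat.lt_pow_succ_log_self (by norm_num) d), hv, h, .refl, rfl, le_rfl⟩

/-- The entries `P 0, …, P (k - 1)` are distinct elements of `[0, d)` with the largest values of
`x`, in non-increasing order; `key` is `-1` there and `x` elsewhere. -/
structure Extracted (d : ℕ) (x key : ℕ → ℝ) (P : ℕ → ℕ) (k : ℕ) : Prop where
  lt : ∀ i < k, P i < d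
  inj : ∀ i < k, ∀ i' < k, P i = P i' → i = i'
  key_eq : ∀ i < k, key (P i) = -1
  key_or : ∀ j < d, key j = x j ∨ ∃ i < k, P i = j
  antitone : ∀ i i', i ≤ i' → i' < k → x (P i') ≤ x (P i)
  le : ∀ i < k, ∀ j < d, key j ≤ x (P i)

theorem Extracted.exists_key_nonneg {x key : ℕ → ℝ} {P : ℕ → ℕ} {k : ℕ}
    (h : Extracted d x key P k) (hx : ∀ j < d, 0 ≤ x j) (hk : k < d) : ∃ j < d, 0 ≤ key j := by
  have hcard : ((Finset.range k).image P).card < (Finset.range d).card := by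
    refine Finset.card_image_le.trans_lt ?_
    simpa using hk
  obtain ⟨j, hj, hjn⟩ := Finset.exists_mem_notMem_of_card_lt_card hcard
  have hj := Finset.mem_range.1 hj
  refine ⟨j, hj, ?_⟩
  rcases h.key_or j hj with h1 | ⟨i, hi, h1⟩
  · rw [h1]; exact hx j hj
  · exact absurd (Finset.mem_image.2 ⟨i, Finset.mem_range.2 hi, h1⟩) hjn

/-- Loads are non-negative, so the key -1 marks extracted entries: as long as an entry is left, the
maximal key is non-negative and therefore belongs to an entry not yet extracted. -/
theorem Extracted.succ {x key : ℕ → ℝ} {P : ℕ → ℕ} {k j : ℕ} (h : Extracted d x key P k)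
    (hx : ∀ j < d, 0 ≤ x j) (hk : k < d) (hj : j < d) (hmax : ∀ i < d, key i ≤ key j) :
    Extracted d x (Function.update key j (-1)) (Function.update P k j) (k + 1) := by
  obtain ⟨j0, hj0, h0⟩ := h.exists_key_nonneg hx hk
  have hkj : 0 ≤ key j := h0.trans (hmax j0 hj0)
  have hnot : ∀ i < k, P i ≠ j := fun i hi hij => by
    have := h.key_eq i hi
    rw [hij] at this
    linarith
  have hkx : key j = x j := by
    rcases h.key_or j hj with h1 | ⟨i, hi, h1⟩
    · exact h1
    · exact absurd h1 (hnot i hi)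
  have hP : ∀ i < k, Function.update P k j i = P i := fun i hi =>
    Function.update_of_ne (by omega) _ _
  have hPk : Function.update P k j k = j := Function.update_self _ _ _
  refine ⟨fun i hi => ?_, fun i hi i' hi' => ?_, fun i hi => ?_, fun i hi => ?_,
    fun i i' hii hi' => ?_, fun i hi i' hi' => ?_⟩
  · rcases Nat.lt_succ_iff_lt_or_eq.1 hi with hi | rfl
    · rw [hP i hi]; exact h.lt i hi
    · rw [hPk]; exact hj
  · rcases Nat.lt_succ_iff_lt_or_eq.1 hi with hi | rfl <;>
      rcases Nat.lt_succ_iff_lt_or_eq.1 hi' with hi' | rfl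
    · rw [hP i hi, hP i' hi']; exact h.inj i hi i' hi'
    · rw [hP i hi, hPk]; exact fun hh => absurd hh (hnot i hi)
    · rw [hP i' hi', hPk]; exact fun hh => absurd hh.symm (hnot i' hi')
    · exact fun _ => rfl
  · rcases Nat.lt_succ_iff_lt_or_eq.1 hi with hi | rfl
    · rw [hP i hi, Function.update_of_ne (hnot i hi)]; exact h.key_eq i hi
    · rw [hPk, Function.update_self]
  · by_cases hij : i = j
    · exact .inr ⟨k, Nat.lt_succ_self k, by rw [hPk, hij]⟩
    · rw [Function.update_of_ne hij]
      refine (h.key_or i hi).imp id ?_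
      rintro ⟨m, hm, hm'⟩
      exact ⟨m, hm.trans (Nat.lt_succ_self k), by rw [hP m hm, hm']⟩
  · rcases Nat.lt_succ_iff_lt_or_eq.1 hi' with hi' | rfl
    · rw [hP i' hi', hP i (hii.trans_lt hi')]; exact h.antitone i i' hii hi'
    · rw [hPk]
      rcases hii.lt_or_eq with hii | rfl
      · rw [hP i hii, ← hkx]; exact h.le i hii j hj
      · rw [hPk]
  · have hle : Function.update key j (-1) i' ≤ key i' := by
      rcases eq_or_ne i' j with rfl | hij
      · rw [Function.update_self]; linarith
      · rw [Function.update_of_ne hij]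
    rcases Nat.lt_succ_iff_lt_or_eq.1 hi with hi | rfl
    · rw [hP i hi]; exact hle.trans (h.le i hi i' hi')
    · rw [hPk, ← hkx]; exact hle.trans (hmax i' hi')

/-- Writes the indices `0, …, d - 1` in the order of non-increasing `X` into integer array `3`. -/
def sortLoad : Prog :=
  .seq buildTree (forLoop 6 (.const 0) (.get 0 (.const 1))
    (.seq (.setNat 8 (.const 0) (.get 2 (.const 1)))
    (.seq (.setNat 3 (nvar 6) (nvar 8))
    (.seq (.setReal 4 (nvar 8) (.sub (rnum 0) (rnum 1)))
    (.seq (.setNat 7 (.const 0) (.half (.add (.get 0 (.const 1)) (nvar 8))))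
    recomputePath)))))

theorem Total.sortLoad {s : State} (hd : s.nat 0 1 = d) (hx : ∀ j < d, 0 ≤ s.real 3 j) :
    Total f sortLoad s fun s' =>
      Extracted d (s.real 3) (s'.real 4) (s'.nat 3) d ∧ Frame [2, 3, 6, 7, 8] [4] s s' ∧
      s'.calls = s.calls ∧ s'.time ≤ s.time + 500 * (d * (Nat.log 2 d + 1) + 1) := by
  refine .seq ((Total.buildTree hd).mono ?_)
  rintro s1 ⟨b1, b2, b3, b4, b5⟩
  refine (Total.forLoop (c := 80 * (Nat.log 2 d + 1) + 80) (a := 0) (N := d) (I := fun k s' =>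
    Tournament d (s'.real 4) (s'.nat 2) (fun _ => False) ∧
    Extracted d (s.real 3) (s'.real 4) (s'.nat 3) k ∧ Frame [2, 3, 6, 7, 8] [4] s s' ∧
      s'.calls = s.calls) rfl (Nat.zero_le _) ?_ ?_ ?_ ?_).mono ?_
  · rintro k s' v t ⟨h1, h2, h3, h4⟩
    exact ⟨h1, h2, h3.setNat, h4⟩
  · rintro k s' ⟨-, -, h1, -⟩
    simp only [NExpr.eval, h1.nat 0 (by simp), hd]
  · rintro k s' - hk ⟨h1, h2, h3, h4⟩ h5
    have h0 := h3.nat 0 (by simp)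
    have hj : s'.nat 2 1 < d := h1.lt 1 le_rfl (by omega) not_false
    set j := s'.nat 2 1 with hjdef
    refine .seq (.setNat (.seq (.setNat (.seq (.setReal (.seq (.setNat ?_)))))))
    have hfr := h3.setNat (a := 8) (i := 0) (v := j) (t := 0)
    refine (Total.recomputePath (d := d) ?_ ?_).mono ?_
    · simp [NExpr.eval, h0, hd]; omega
    · have := h1.update_key (j := j) (-1)
      simpa [NExpr.eval, RExpr.eval, h0, hd, ← hjdef] using this
    · rintro s'' ⟨i1, i2, i3, i4⟩
      have e4 := i2.real 4 (by simp)
      have e3 := i2.nat 3 (by simp)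
      have e6 := i2.nat 6 (by simp)
      refine ⟨⟨i1, ?_, ?_, i3.trans h4⟩, ?_, ?_⟩
      · have := h2.succ hx hk hj fun i hi => by
          have h6 := h1.le_root (u := d + i) (by omega) (by omega)
          rwa [h1.leaf i hi] at h6
        rw [e4, e3]
        simpa [NExpr.eval, RExpr.eval, h5, ← hjdef] using this
      · exact h3.setNat.setNat.setReal.setNat.trans i2
      · rw [e6]; simpa using h5
      · simp [NExpr.cost, RExpr.cost] at i4; omega
  · exact ⟨b1, ⟨by simp, by simp, by simp, fun j hj => .inl (b2 j hj), by simp, by simp⟩,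
      Frame.refl.trans b3, b4⟩
  · rintro s' ⟨⟨-, h2, h3, h4⟩, -, h5⟩
    refine ⟨h2, h3, h4, ?_⟩
    simp only [NExpr.cost, Nat.sub_zero] at h5
    have h6 : d ≤ d * (Nat.log 2 d + 1) := Nat.le_mul_of_pos_right _ (Nat.succ_pos _)
    have h7 : d * (80 * (Nat.log 2 d + 1) + 80 + (1 + 1) + 20) =
      80 * (d * (Nat.log 2 d + 1)) + 102 * d := by ring
    omega

end RealRAM

namespace RealRAM

variable {n d : ℕ} {f : Fin n → (Fin d → ℝ) → Fin d → ℝ}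

/-! ## Computing the entropic price -/

/-- The stack of blocks of the pooling procedure: block `i` ends at `EN (i + 1)` and has the
increments `BW (i + 1)` and `BB (i + 1)` of `W` and `B`. Entry `0` is a sentinel. -/
structure PoolStack (W B : ℕ → ℝ) (k t : ℕ) (EN : ℕ → ℕ) (BW BB : ℕ → ℝ) : Prop where
  blocks : IsBlocks W B k t EN
  bw_zero : BW 0 = 1
  bb_zero : BB 0 = -1
  bw : ∀ i < t, BW (i + 1) = W (EN (i + 1)) - W (EN i)
  bb : ∀ i < t, BB (i + 1) = B (EN (i + 1)) - B (EN i)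

/-- The slopes of the last two blocks increase. -/
def LastStrict (t : ℕ) (BW BB : ℕ → ℝ) : Prop :=
  ∀ i, i + 2 = t → BB (i + 1) * BW (i + 2) < BB (i + 2) * BW (i + 1)

namespace PoolStack

variable {W B : ℕ → ℝ} {k t : ℕ} {EN : ℕ → ℕ} {BW BB : ℕ → ℝ}

theorem push (h : PoolStack W B k t EN BW BB) (hs : LastStrict t BW BB) {w b : ℝ}
    (hw : w = W (k + 1) - W k) (hb : b = B (k + 1) - B k) :
    PoolStack W B (k + 1) (t + 1) (Function.update EN (t + 1) (k + 1))
      (Function.update BW (t + 1) w) (Function.update BB (t + 1) b) := by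
  have hu : ∀ {α : Type} (g : ℕ → α) (v : α), ∀ i ≤ t, Function.update g (t + 1) v i = g i :=
    fun g v i hi => Function.update_of_ne (by omega) _ _
  refine ⟨h.blocks.push fun i hi => ?_, ?_, ?_, fun i hi => ?_, fun i hi => ?_⟩
  · rw [← h.bb i (by omega), ← h.bw (i + 1) (by omega), ← h.bb (i + 1) (by omega),
      ← h.bw i (by omega)]
    exact hs i hi
  · rw [hu _ _ 0 (Nat.zero_le t), h.bw_zero]
  · rw [hu _ _ 0 (Nat.zero_le t), h.bb_zero]
  · rcases Nat.lt_succ_iff_lt_or_eq.1 hi with hi | rfl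
    · rw [hu _ _ (i + 1) hi, hu _ _ (i + 1) hi, hu _ _ i hi.le, h.bw i hi]
    · rw [Function.update_self, Function.update_self, hu _ _ i le_rfl, h.blocks.last, hw]
  · rcases Nat.lt_succ_iff_lt_or_eq.1 hi with hi | rfl
    · rw [hu _ _ (i + 1) hi, hu _ _ (i + 1) hi, hu _ _ i hi.le, h.bb i hi]
    · rw [Function.update_self, Function.update_self, hu _ _ i le_rfl, h.blocks.last, hb]

theorem merge (h : PoolStack W B k (t + 2) EN BW BB) (hW : ∀ i < k, W i < W (i + 1))
    (hs : BB (t + 2) * BW (t + 1) ≤ BB (t + 1) * BW (t + 2)) :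
    PoolStack W B k (t + 1) (Function.update EN (t + 1) (EN (t + 2)))
      (Function.update BW (t + 1) (BW (t + 1) + BW (t + 2)))
      (Function.update BB (t + 1) (BB (t + 1) + BB (t + 2))) := by
  have hu : ∀ {α : Type} (g : ℕ → α) (v : α), ∀ i ≤ t, Function.update g (t + 1) v i = g i :=
    fun g v i hi => Function.update_of_ne (by omega) _ _
  have b1 := h.bb t (by omega)
  have b2 := h.bb (t + 1) (by omega)
  have w1 := h.bw t (by omega)
  have w2 := h.bw (t + 1) (by omega)
  refine ⟨h.blocks.merge hW ?_, ?_, ?_, fun i hi => ?_, fun i hi => ?_⟩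
  · rw [← b1, ← w1]
    have e1 : B (EN (t + 2)) - B (EN (t + 1)) = BB (t + 2) := b2.symm
    have e2 : W (EN (t + 2)) - W (EN (t + 1)) = BW (t + 2) := w2.symm
    rw [e1, e2]
    exact hs
  · rw [hu _ _ 0 (Nat.zero_le t), h.bw_zero]
  · rw [hu _ _ 0 (Nat.zero_le t), h.bb_zero]
  · rcases Nat.lt_succ_iff_lt_or_eq.1 hi with hi | rfl
    · rw [hu _ _ (i + 1) hi, hu _ _ (i + 1) hi, hu _ _ i hi.le, h.bw i (by omega)]
    · rw [Function.update_self, Function.update_self, hu _ _ i le_rfl, w1,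
        show BW (i + 2) = _ from w2]
      ring
  · rcases Nat.lt_succ_iff_lt_or_eq.1 hi with hi | rfl
    · rw [hu _ _ (i + 1) hi, hu _ _ (i + 1) hi, hu _ _ i hi.le, h.bb i (by omega)]
    · rw [Function.update_self, Function.update_self, hu _ _ i le_rfl, b1,
        show BB (i + 2) = _ from b2]
      ring

theorem bw_pos (h : PoolStack W B k t EN BW BB) (hW : ∀ i < k, W i < W (i + 1)) {i : ℕ}
    (hi : i < t) : 0 < BW (i + 1) := by
  have hmono : ∀ i j, i ≤ j → j ≤ k → W i ≤ W j := fun i j hij => by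
    induction j, hij using Nat.le_induction with
    | base => exact fun _ => le_rfl
    | succ j hij ih => exact fun hj => (ih (by omega)).trans (hW j hj).le
  have h1 := h.blocks.lt i hi
  have h2 : EN (i + 1) ≤ k := h.blocks.le_last hi
  rw [h.bw i hi]
  exact sub_pos.2 ((hW _ (by omega)).trans_le (hmono _ _ h1 h2))

theorem bb_nonneg (h : PoolStack W B k t EN BW BB) (hB : Monotone B) {i : ℕ}
    (hi : i < t) : 0 ≤ BB (i + 1) := by
  rw [h.bb i hi]
  exact sub_nonneg.2 (hB (h.blocks.lt i hi).le)

theorem isSlopes {w b s : ℕ → ℝ}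
    (h : PoolStack (fun j => ∑ i ∈ Finset.range j, w i) (fun j => ∑ i ∈ Finset.range j, b i)
      k t EN BW BB) (hl : LastStrict t BW BB)
    (hw : ∀ i < k, 0 < w i) (hb : ∀ i, 0 ≤ b i) (hb0 : 0 < b 0)
    (hs : ∀ i < t, ∀ j, EN i ≤ j → j < EN (i + 1) → s j = BB (i + 1) / BW (i + 1)) :
    IsSlopes w b k s := by
  refine h.blocks.isSlopes (fun i hi => ?_) hw hb hb0 fun i hi j h1 h2 => ?_
  · have b1 := h.bb i (by omega)
    have b2 := h.bb (i + 1) (by omega)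
    have w1 := h.bw i (by omega)
    have w2 := h.bw (i + 1) (by omega)
    rw [← b1, ← w1, ← b2, ← w2]
    exact hl i hi
  · rw [hs i hi j h1 h2, h.bb i hi, h.bw i hi]

end PoolStack

/-- Merges the last blocks of the stack until their slopes increase. -/
def mergeBlocks : Prog :=
  .while (.realLe (.mul (.get 6 (nvar 5)) (.get 5 (.sub (nvar 5) (.const 1))))
      (.mul (.get 6 (.sub (nvar 5) (.const 1))) (.get 5 (nvar 5))))
    (.seq (.setReal 5 (.sub (nvar 5) (.const 1))
        (.add (.get 5 (.sub (nvar 5) (.const 1))) (.get 5 (nvar 5))))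
    (.seq (.setReal 6 (.sub (nvar 5) (.const 1))
        (.add (.get 6 (.sub (nvar 5) (.const 1))) (.get 6 (nvar 5))))
    (.seq (.setNat 4 (.sub (nvar 5) (.const 1)) (.get 4 (nvar 5)))
    (.setNat 5 (.const 0) (.sub (nvar 5) (.const 1))))))

/-- The height of the stack is the credit that pays for merging: each iteration removes one block,
so 100 times the height covers its time. -/
theorem Total.mergeBlocks {s : State} {W B : ℕ → ℝ} {k t : ℕ} (hW : ∀ i < k, W i < W (i + 1))
    (hB : Monotone B) (ht : s.nat 5 0 = t) (ht1 : 1 ≤ t)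
    (h : PoolStack W B k t (s.nat 4) (s.real 5) (s.real 6)) :
    Total f mergeBlocks s fun s' => ∃ t', s'.nat 5 0 = t' ∧
      PoolStack W B k t' (s'.nat 4) (s'.real 5) (s'.real 6) ∧
      LastStrict t' (s'.real 5) (s'.real 6) ∧ Frame [4, 5] [5, 6] s s' ∧ s'.calls = s.calls ∧
      s'.time + 100 * t' ≤ s.time + 100 * t + 40 := by
  refine Total.while_measure (I := fun m s' => s'.nat 5 0 = m ∧ 1 ≤ m ∧
    PoolStack W B k m (s'.nat 4) (s'.real 5) (s'.real 6) ∧ Frame [4, 5] [5, 6] s s' ∧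
    s'.calls = s.calls ∧ s'.time + 100 * m ≤ s.time + 100 * t) (fun m s' => ?_) (fun m s' => ?_)
    t s ⟨ht, ht1, h, .refl, rfl, le_rfl⟩
  · rintro ⟨i1, i2, i3, i4, i5, i6⟩ hb
    simp only [Cond.Holds, RExpr.eval, NExpr.eval, eval_nvar, i1] at hb
    -- With a single block left, the loop condition compares it with the sentinel of width 1 and
    -- increment -1. It fails because the increment of B over a block is non-negative and that of W
    -- is positive, so two blocks exist.
    obtain ⟨t, rfl⟩ : ∃ t, m = t + 2 := by
      rcases m with _ | _ | m
      · omega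
      · have h1 := i3.bw_pos hW (i := 0) (by omega)
        have h2 := i3.bb_nonneg hB (i := 0) (by omega)
        simp only [zero_add, Nat.sub_self, i3.bw_zero, i3.bb_zero] at hb h1 h2
        linarith
      · exact ⟨m, rfl⟩
    rw [show t + 2 - 1 = t + 1 by omega] at hb
    refine .seq (.setReal (.seq (.setReal (.seq (.setNat (.setNat ⟨t + 1, by omega, ?_, by omega,
      ?_, i4.tick.setReal.setReal.setNat.setNat, i5, ?_⟩))))))
    · simp [NExpr.eval, i1]
    · have := i3.merge hW hb
      simpa [NExpr.eval, RExpr.eval, i1] using this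
    · simp [NExpr.cost, RExpr.cost, Cond.cost]; omega
  · rintro ⟨i1, i2, i3, i4, i5, i6⟩ hb
    simp only [Cond.Holds, RExpr.eval, NExpr.eval, eval_nvar, i1, not_le] at hb
    refine ⟨m, i1, i3, ?_, i4.tick, i5, ?_⟩
    · rintro i rfl
      exact hb
    · simp [NExpr.cost, RExpr.cost, Cond.cost]; omega

/-- Pools the weights `β` along the order in integer array `3`. -/
def poolWeights : Prog :=
  .seq (.setNat 4 (.const 0) (.const 0))
  (.seq (.setNat 5 (.const 0) (.const 0))
  (.seq (.setReal 5 (.const 0) (rnum 1))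
  (.seq (.setReal 6 (.const 0) (.sub (rnum 0) (rnum 1)))
  (forLoop 6 (.const 0) (.get 0 (.const 1))
    (.seq (.setNat 5 (.const 0) (.add (nvar 5) (.const 1)))
    (.seq (.setReal 5 (nvar 5) (.exp (.mul (rvar 11) (.get 3 (.get 3 (nvar 6))))))
    (.seq (.setReal 6 (nvar 5) (.get 0 (nvar 6)))
    (.seq (.setNat 4 (nvar 5) (.add (nvar 6) (.const 1)))
    mergeBlocks))))))))

/-- Every position pushes one block, so the amortized cost per position is constant and pooling
takes linear time after sorting. -/
theorem Total.poolWeights {s : State} (hd : s.nat 0 1 = d) {w b : ℕ → ℝ}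
    (hw : ∀ k < d, w k = Real.exp (s.real 11 0 * s.real 3 (s.nat 3 k))) (hw0 : ∀ k, 0 < w k)
    (hb : ∀ k < d, b k = s.real 0 k) (hb0 : ∀ k, 0 ≤ b k) :
    Total f poolWeights s fun s' => ∃ t,
      PoolStack (fun j => ∑ i ∈ Finset.range j, w i) (fun j => ∑ i ∈ Finset.range j, b i) d t
        (s'.nat 4) (s'.real 5) (s'.real 6) ∧
      LastStrict t (s'.real 5) (s'.real 6) ∧ Frame [4, 5, 6] [5, 6] s s' ∧ s'.calls = s.calls ∧
      s'.time ≤ s.time + 400 * (d + 1) := by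
  have hW : ∀ k, ∀ i < k, ∑ j ∈ Finset.range i, w j < ∑ j ∈ Finset.range (i + 1), w j :=
    fun k i _ => by rw [Finset.sum_range_succ]; linarith [hw0 i]
  have hB : Monotone fun j => ∑ i ∈ Finset.range j, b i := monotone_nat_of_le_succ fun i => by
    simp only [Finset.sum_range_succ]; linarith [hb0 i]
  refine .seq (.setNat (.seq (.setNat (.seq (.setReal (.seq (.setReal ?_)))))))
  refine (Total.forLoop_amortized (φ := fun s' => 100 * s'.nat 5 0) (c := 250) (a := 0) (N := d)
    (I := fun k s' =>
      PoolStack (fun j => ∑ i ∈ Finset.range j, w i) (fun j => ∑ i ∈ Finset.range j, b i) k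
        (s'.nat 5 0) (s'.nat 4) (s'.real 5) (s'.real 6) ∧
      LastStrict (s'.nat 5 0) (s'.real 5) (s'.real 6) ∧ Frame [4, 5, 6] [5, 6] s s' ∧
      s'.calls = s.calls) rfl (Nat.zero_le _) ?_ ?_ ?_ ?_ ?_).mono ?_
  · intro s v t; simp
  · rintro k s' v t ⟨h1, h2, h3, h4⟩
    exact ⟨by simpa using h1, by simpa using h2, h3.setNat, h4⟩
  · rintro k s' ⟨-, -, h1, -⟩
    simp only [NExpr.eval, h1.nat 0 (by simp), hd]
  · rintro k s' - hk ⟨h1, h2, h3, h4⟩ h5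
    have e1 := h3.nat 3 (by simp)
    have e2 := h3.real 3 (by simp)
    have e3 := h3.real 11 (by simp)
    have e4 := h3.real 0 (by simp)
    set t := s'.nat 5 0 with ht
    refine .seq (.setNat (.seq (.setReal (.seq (.setReal (.seq (.setNat ?_)))))))
    have hp := h1.push h2 (w := w k) (b := b k)
      (by simp only [Finset.sum_range_succ]; ring) (by simp only [Finset.sum_range_succ]; ring)
    refine (Total.mergeBlocks (t := t + 1) (hW (k + 1)) hB ?_ (by omega) ?_).mono ?_
    · simp [NExpr.eval, ← ht]
    · rw [hw k hk, hb k hk] at hp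
      simpa [NExpr.eval, RExpr.eval, ← ht, h5, e1, e2, e3, e4] using hp
    · rintro s'' ⟨t', i1, i2, i3, i4, i5, i6⟩
      have e6 := i4.nat 6 (by simp)
      refine ⟨⟨by rw [i1]; exact i2, by rw [i1]; exact i3,
        h3.setNat.setReal.setReal.setNat.trans i4, i5.trans h4⟩, ?_, ?_⟩
      · rw [e6]; simpa using h5
      · simp [NExpr.cost, RExpr.cost] at i6 ⊢; omega
  · refine ⟨?_, ?_, Frame.refl.setNat.setNat.setReal.setReal, rfl⟩
    · have : PoolStack (fun j => ∑ i ∈ Finset.range j, w i) (fun j => ∑ i ∈ Finset.range j, b i) 0 0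
          (Function.update (s.nat 4) 0 0) (Function.update (s.real 5) 0 1)
          (Function.update (s.real 6) 0 (-1)) :=
        ⟨IsBlocks.empty.congr fun i hi => by
          rw [Nat.le_zero.1 hi, Function.update_self], Function.update_self _ _ _,
          Function.update_self _ _ _, by simp, by simp⟩
      simpa [NExpr.eval, RExpr.eval] using this
    · intro i hi
      simp [NExpr.eval] at hi
  · rintro s' ⟨⟨h1, h2, h3, h4⟩, -, h5⟩
    refine ⟨_, h1, h2, h3, h4, ?_⟩
    simp [NExpr.cost, RExpr.cost, NExpr.eval] at h5
    omega

/-- Writes the price of `X`, increased by the real variable `12`, into real array `7`. -/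
def assignPrice : Prog :=
  .seq (.setNat 6 (.const 0) (.const 0))
  (.seq (.setNat 9 (.const 0) (.const 0))
  (.while (.natLt (nvar 6) (.get 0 (.const 1)))
    (.ite (.natLe (.get 4 (.add (nvar 9) (.const 1))) (nvar 6))
      (.setNat 9 (.const 0) (.add (nvar 9) (.const 1)))
      (.seq (.setReal 7 (.get 3 (nvar 6))
        (.add (.mul (.div (.get 6 (.add (nvar 9) (.const 1))) (.get 5 (.add (nvar 9) (.const 1))))
          (.exp (.mul (rvar 11) (.get 3 (.get 3 (nvar 6)))))) (rvar 12)))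
      (.setNat 6 (.const 0) (.add (nvar 6) (.const 1)))))))

/-- Position k and block b advance in a merge-like scan; each iteration advances one of them, and
there are at most d blocks because they are non-empty. Injectivity of the order ensures that no
price is overwritten. -/
theorem Total.assignPrice {s : State} (hd : s.nat 0 1 = d) {W B : ℕ → ℝ} {t : ℕ}
    (h : IsBlocks W B d t (s.nat 4))
    (hinj : ∀ i < d, ∀ i' < d, s.nat 3 i = s.nat 3 i' → i = i') :
    Total f assignPrice s fun s' =>
      (∀ i < t, ∀ j, s.nat 4 i ≤ j → j < s.nat 4 (i + 1) → s'.real 7 (s.nat 3 j) =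
        s.real 6 (i + 1) / s.real 5 (i + 1) *
          Real.exp (s.real 11 0 * s.real 3 (s.nat 3 j)) + s.real 12 0) ∧
      Frame [6, 9] [7] s s' ∧ s'.calls = s.calls ∧ s'.time ≤ s.time + 200 * (d + 1) := by
  have hmono : ∀ i j, i ≤ j → j ≤ t → s.nat 4 i ≤ s.nat 4 j := fun i j hij => by
    induction j, hij using Nat.le_induction with
    | base => exact fun _ => le_rfl
    | succ j hij ih => exact fun hj => (ih (by omega)).trans (h.lt j hj).le
  have htd : t ≤ d := by
    have : ∀ i ≤ t, i ≤ s.nat 4 i := fun i => by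
      induction i with
      | zero => exact fun _ => Nat.zero_le _
      | succ i ih => intro hi; have := ih (by omega); have := h.lt i hi; omega
    have := this t le_rfl
    rwa [h.last] at this
  refine .seq (.setNat (.seq (.setNat ?_)))
  refine Total.while_measure (I := fun m s' => ∃ k b, s'.nat 6 0 = k ∧ s'.nat 9 0 = b ∧ k ≤ d ∧
    b ≤ t ∧ s.nat 4 b ≤ k ∧ (k < d → b < t ∧ k ≤ s.nat 4 (b + 1)) ∧ m = (d - k) + (t - b) ∧
    (∀ i < t, ∀ j < k, s.nat 4 i ≤ j → j < s.nat 4 (i + 1) → s'.real 7 (s.nat 3 j) =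
        s.real 6 (i + 1) / s.real 5 (i + 1) *
          Real.exp (s.real 11 0 * s.real 3 (s.nat 3 j)) + s.real 12 0) ∧
    Frame [6, 9] [7] s s' ∧ s'.calls = s.calls ∧ s'.time + 80 * m + 20 ≤ s.time + 200 * (d + 1))
    (fun m s' => ?_) (fun m s' => ?_) (d + t) _ ?_
  · rintro ⟨k, b, i1, i2, i3, i4, i5, i6, i7, i8, i9, i10, i11⟩ hb
    have e1 := i9.nat 3 (by simp)
    have e2 := i9.nat 4 (by simp)
    have e3 := i9.nat 0 (by simp)
    have e4 := i9.real 3 (by simp)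
    have e5 := i9.real 5 (by simp)
    have e6 := i9.real 6 (by simp)
    have e7 := i9.real 11 (by simp)
    have e8 := i9.real 12 (by simp)
    simp only [Cond.Holds, NExpr.eval, eval_nvar, i1, e3, hd] at hb
    obtain ⟨i6, i6'⟩ := i6 hb
    refine .ite (fun hc => .setNat ?_) (fun hc => .seq (.setReal (.setNat ?_)))
    · simp only [Cond.Holds, NExpr.eval, eval_nvar, i1, i2, e2, State.tick_nat] at hc
      have hbt : b + 1 < t := by
        refine lt_of_le_of_ne i6 fun hh => ?_
        rw [hh, h.last] at hc
        omega
      refine ⟨m - 1, by omega, k, b + 1, by simpa using i1, by simp [NExpr.eval, i2], i3, by omega, hc,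
        fun _ => ⟨hbt, ?_⟩, by omega, i8, i9.tick.tick.setNat, i10, ?_⟩
      · have := h.lt (b + 1) hbt
        omega
      · simp [NExpr.cost, Cond.cost]; omega
    · simp only [Cond.Holds, NExpr.eval, eval_nvar, i1, i2, e2, State.tick_nat, not_le] at hc
      refine ⟨m - 1, by omega, k + 1, b, by simp [NExpr.eval, i1], by simpa using i2, hb, i4,
        by omega, fun _ => ⟨i6, hc⟩, by omega, ?_, i9.tick.tick.setReal.setNat, i10, ?_⟩
      · intro i hi j hj h1 h2
        simp only [NExpr.eval, RExpr.eval, eval_nvar, eval_rvar, i1, i2, e1, State.tick_nat,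
          State.tick_real, upd_same, e4, e5, e6, e7, e8]
        rcases Nat.lt_succ_iff_lt_or_eq.1 hj with hj | rfl
        · rw [Function.update_of_ne fun hh => by
            have := hinj j (by omega) k hb hh; omega]
          exact i8 i hi j hj h1 h2
        · have hib : i = b := by
            by_contra hne
            rcases Nat.lt_or_gt_of_ne hne with hlt | hlt
            · have := hmono (i + 1) b hlt i4; omega
            · have := hmono (b + 1) i hlt hi.le; omega
          rw [Function.update_self, hib]
      · simp [NExpr.cost, RExpr.cost, Cond.cost]; omega
  · rintro ⟨k, b, i1, i2, i3, i4, i5, i6, i7, i8, i9, i10, i11⟩ hb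
    simp only [Cond.Holds, NExpr.eval, eval_nvar, i1, i9.nat 0 (by simp), hd] at hb
    refine ⟨fun i hi j h1 h2 => ?_, i9.tick, i10, ?_⟩
    · have : s.nat 4 (i + 1) ≤ d := h.le_last hi
      exact i8 i hi j (by omega) h1 h2
    · simp [NExpr.cost, Cond.cost]; omega
  · refine ⟨0, 0, by simp [NExpr.eval], by simp [NExpr.eval], Nat.zero_le _, Nat.zero_le _, h.zero.le,
      fun h0 => ⟨?_, Nat.zero_le _⟩, by omega, fun _ _ _ hj => absurd hj (Nat.not_lt_zero _),
      Frame.refl.setNat.setNat, rfl, ?_⟩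
    · rcases Nat.eq_zero_or_pos t with rfl | h1
      · rw [← h.last, h.zero] at h0; omega
      · exact h1
    · simp [NExpr.cost]; omega

/-- Writes the price of `X`, increased by the real variable `12`, into real array `7`. -/
def priceProg : Prog := .seq sortLoad (.seq poolWeights assignPrice)

/-- The running time of a price computation up to a constant factor. -/
def timeUnit (d : ℕ) : ℕ := d * (Nat.log 2 d + 1) + 1

/-- Sorting takes O(d log d) and pooling O(d). The result is a price, so this run also proves that
prices exist. -/
theorem Total.priceProg {s : State} {β : Fin d → ℝ} {x : Fin d → ℝ} (hdim : 0 < d)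
    (hβ : IsOrderedWeight β) (hA : 0 < s.real 11 0)
    (hd : s.nat 0 1 = d) (hs : ∀ j : Fin d, s.real 0 j = β j) (hx : ∀ j : Fin d, s.real 3 j = x j)
    (hx0 : ∀ j, 0 ≤ x j) :
    Total f priceProg s fun s' =>
      (∃ y, IsPrice β (s.real 11 0) x y ∧ ∀ j : Fin d, s'.real 7 j = y j + s.real 12 0) ∧
      Frame [2, 3, 4, 5, 6, 7, 8, 9] [4, 5, 6, 7] s s' ∧ s'.calls = s.calls ∧
      s'.time ≤ s.time + 2000 * timeUnit d := by
  refine .seq ((Total.sortLoad hd fun j hj => ?_).mono ?_)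
  · rw [hx ⟨j, hj⟩]; exact hx0 _
  rintro s1 ⟨a1, a2, a3, a4⟩
  set w : ℕ → ℝ := fun k => Real.exp (s.real 11 0 * s.real 3 (s1.nat 3 k)) with hw
  have hw0 : ∀ k, 0 < w k := fun k => Real.exp_pos _
  have hb0 : ∀ k, 0 ≤ extendZero β k := fun k => by
    unfold extendZero
    split_ifs with h
    · exact hβ.nonneg _
    · exact le_rfl
  have r0 := a2.real 0 (by simp)
  have r3 := a2.real 3 (by simp)
  have r11 := a2.real 11 (by simp)
  have r12 := a2.real 12 (by simp)
  refine .seq ((Total.poolWeights (s := s1) (w := w) (b := extendZero β)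
    (by rw [a2.nat 0 (by simp), hd]) (fun k _ => by rw [r11, r3]) hw0 (fun k hk => ?_)
    hb0).mono ?_)
  · rw [r0]
    simp only [extendZero, dif_pos hk]
    exact (hs ⟨k, hk⟩).symm
  rintro s2 ⟨t, b1, b2, b3, b4, b5⟩
  have n3 := b3.nat 3 (by simp)
  have q3 := b3.real 3 (by simp)
  have q11 := b3.real 11 (by simp)
  have q12 := b3.real 12 (by simp)
  refine (Total.assignPrice (s := s2) (by rw [b3.nat 0 (by simp), a2.nat 0 (by simp), hd])
    b1.blocks (by rw [n3]; exact a1.inj)).mono ?_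
  rintro s3 ⟨c1, c2, c3, c4⟩
  rw [n3, q3, q11, q12, r3, r11, r12] at c1
  refine ⟨?_, ((Frame.refl.trans a2).trans b3).trans c2, c3.trans (b4.trans a3), ?_⟩
  -- Distinctness of the d extracted indices makes the order a permutation. The slopes are recovered
  -- from the prices in memory by removing the surcharge and dividing by w.
  · let σ0 : Fin d → Fin d := fun k => ⟨s1.nat 3 k, a1.lt k k.2⟩
    have hσ : Function.Bijective σ0 := (Finite.injective_iff_bijective).1 fun i i' h => by
      have := congrArg Fin.val h
      exact Fin.ext (a1.inj i i.2 i' i'.2 this)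
    let σ : Equiv.Perm (Fin d) := Equiv.ofBijective σ0 hσ
    have hσv : ∀ k : Fin d, ((σ k : Fin d) : ℕ) = s1.nat 3 k := fun k => rfl
    refine ⟨fun j => s3.real 7 j - s.real 12 0, ?_, fun j => by ring⟩
    refine IsSlopes.isPrice (w := w) (s := fun k => (s3.real 7 (s1.nat 3 k) - s.real 12 0) / w k)
      hβ hA σ ?_ (fun k => ?_) (b1.isSlopes b2 (fun i _ => hw0 i) hb0 ?_ fun i hi j h1 h2 => ?_)
      fun k => ?_
    · intro i j hij
      simp only [Function.comp_apply]
      rw [← hx, ← hx, hσv, hσv]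
      exact a1.antitone i j hij j.2
    · rw [hw, ← hx, hσv]
    · simp only [extendZero, dif_pos hdim]
      exact hβ.first_pos hdim
    · rw [c1 i hi j h1 h2, add_sub_cancel_right, mul_div_assoc, div_self (hw0 j).ne', mul_one]
    · rw [hσv, div_mul_cancel₀ _ (hw0 k).ne']
  · unfold timeUnit
    have h6 : d ≤ d * (Nat.log 2 d + 1) := Nat.le_mul_of_pos_right _ (Nat.succ_pos _)
    omega

end RealRAM

/-- No compactness argument is needed: the verified program, run without customers, computes a price
for non-negative x. Adding a constant to all entries of x reduces the general case to this one,
since dual feasible vectors have equal totals and the optimality condition does not change. -/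
theorem exists_isPrice {d : ℕ} {β : Fin d → ℝ} {A : ℝ} (hdim : 0 < d) (hβ : IsOrderedWeight β)
    (hA : 0 < A) (x : Fin d → ℝ) : ∃ y, IsPrice β A x y := by
  have key : ∀ x : Fin d → ℝ, (∀ j, 0 ≤ x j) → ∃ y, IsPrice β A x y := fun x hx => by
    let s : RealRAM.State :=
      { nat := fun _ _ => d
        real := fun a i => if a = 0 then extendZero β i else if a = 3 then extendZero x i else A
        drawn := 0
        calls := 0
        time := 0 }
    obtain ⟨s', -, -, ⟨y, hy, -⟩, -⟩ := RealRAM.Total.priceProg (f := fun (_ : Fin 0) y => y)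
      (s := s) (β := β) (x := x) hdim hβ hA rfl (fun j => extendZero_coe β j)
      (fun j => extendZero_coe x j) hx
    exact ⟨y, hy⟩
  obtain ⟨y, hy⟩ := key (fun j => x j + ∑ i, |x i|) fun j => by
    have : |x j| ≤ ∑ i, |x i| :=
      Finset.single_le_sum (f := fun i => |x i|) (fun i _ => abs_nonneg _) (Finset.mem_univ j)
    have := neg_abs_le (x j)
    linarith
  refine ⟨y, hy.feasible, hy.pos, fun y' hy' => ?_⟩
  have h := hy.optimal y' hy'
  have h2 : ∑ j, (y' j - y j) * (Real.log (y j) - A * x j) =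
      ∑ j, (y' j - y j) * (Real.log (y j) - A * (x j + ∑ i, |x i|)) +
        (∑ j, y' j - ∑ j, y j) * (A * ∑ i, |x i|) := by
    rw [← Finset.sum_sub_distrib, Finset.sum_mul, ← Finset.sum_add_distrib]
    exact Finset.sum_congr rfl fun j _ => by ring
  rw [hy'.sum_eq, hy.feasible.sum_eq, sub_self, zero_mul, add_zero] at h2
  rw [h2]
  exact h

namespace RealRAM

variable {n d : ℕ} {f : Fin n → (Fin d → ℝ) → Fin d → ℝ}

/-! ## Calling the oracles of a range of customers -/

/-- The oracles as a function of the number of the customer. -/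
def oracleExt (f : Fin n → (Fin d → ℝ) → Fin d → ℝ) (c : ℕ) (y : Fin d → ℝ) : Fin d → ℝ :=
  if h : c < n then f ⟨c, h⟩ y else 0

/-- The sum of the answers of the oracles of the customers `lo, …, hi - 1`. -/
def rangeLoad (f : Fin n → (Fin d → ℝ) → Fin d → ℝ) (lo hi : ℕ) (y : Fin d → ℝ) : Fin d → ℝ :=
  ∑ c ∈ Finset.Ico lo hi, oracleExt f c y

theorem Frame.updVec {N R : List ℕ} {s s' : State} (h : Frame N R s s') {a c t : ℕ}
    {v : Fin d → ℝ} (ha : a ∈ R := by simp) :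
    Frame N R s { s' with real := updVec s'.real a v, calls := c, time := t } :=
  ⟨h.nat, fun b hb => by
    simp only
    rw [show RealRAM.updVec s'.real a v b = s'.real b from
      Function.update_of_ne (show b ≠ a by rintro rfl; exact hb ha) _ _, h.real b hb]⟩

/-- Adds up the answers of the oracles of the customers from integer variable `23` up to integer
variable `17` at the prices in real array `7`. -/
def callRange : Prog :=
  .seq (forLoop 8 (.const 0) (.get 0 (.const 1)) (.setReal 8 (nvar 8) (rnum 0)))
  (.seq (forLoop 16 (nvar 23) (nvar 17) (.seq (.query (nvar 16) 7 9)
    (forLoop 8 (.const 0) (.get 0 (.const 1))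
      (.setReal 8 (nvar 8) (.add (.get 8 (nvar 8)) (.get 9 (nvar 8)))))))
  (.seq (.setReal 10 (.const 0) (rnum 0))
  (forLoop 8 (.const 0) (.get 0 (.const 1))
    (.setReal 10 (.const 0) (.add (rvar 10) (.mul (.get 8 (nvar 8)) (.get 7 (nvar 8))))))))

theorem Total.addLoop {s : State} (hd : s.nat 0 1 = d) :
    Total f (RealRAM.forLoop 8 (.const 0) (.get 0 (.const 1))
      (.setReal 8 (nvar 8) (.add (.get 8 (nvar 8)) (.get 9 (nvar 8))))) s fun s' =>
      (∀ j < d, s'.real 8 j = s.real 8 j + s.real 9 j) ∧ Frame [8] [8] s s' ∧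
      s'.calls = s.calls ∧ s'.time ≤ s.time + 50 * (d + 1) := by
  refine (Total.forLoop (c := 20) (a := 0) (N := d) (I := fun k s' =>
    (∀ j < k, s'.real 8 j = s.real 8 j + s.real 9 j) ∧ (∀ j, k ≤ j → s'.real 8 j = s.real 8 j) ∧
    Frame [8] [8] s s' ∧ s'.calls = s.calls) rfl (Nat.zero_le _) ?_ ?_ ?_ ?_).mono ?_
  · rintro k s' v t ⟨h1, h2, h3, h4⟩
    exact ⟨h1, h2, h3.setNat, h4⟩
  · rintro k s' ⟨-, -, h1, -⟩
    simp only [NExpr.eval, h1.nat 0 (by simp), hd]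
  · rintro k s' - hk ⟨h1, h2, h3, h4⟩ h5
    have e9 := h3.real 9 (by simp)
    refine .setReal ⟨⟨fun j hj => ?_, fun j hj => ?_, h3.setReal, h4⟩, h5, ?_⟩
    · simp only [RExpr.eval, eval_nvar, h5, upd_same, e9]
      rcases Nat.lt_succ_iff_lt_or_eq.1 hj with hj | rfl
      · rw [Function.update_of_ne (by omega), h1 j hj]
      · rw [Function.update_self, h2 j le_rfl]
    · simp only [RExpr.eval, eval_nvar, h5, upd_same, e9]
      rw [Function.update_of_ne (by omega), h2 j (by omega)]
    · simp [RExpr.cost]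
  · exact ⟨by simp, fun _ _ => rfl, .refl, rfl⟩
  · rintro s' ⟨⟨h1, -, h2, h3⟩, -, h4⟩
    refine ⟨h1, h2, h3, ?_⟩
    simp only [NExpr.cost, Nat.sub_zero] at h4
    omega

theorem Total.callRange {s : State} {lo hi : ℕ} {y : Fin d → ℝ} (hd : s.nat 0 1 = d)
    (hlo : s.nat 23 0 = lo) (hhi : s.nat 17 0 = hi) (hle : lo ≤ hi) (hn : hi ≤ n)
    (hy : ∀ j : Fin d, s.real 7 j = y j) (hy0 : ∀ j, 0 ≤ y j) :
    Total f callRange s fun s' =>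
      (∀ j : Fin d, s'.real 8 j = rangeLoad f lo hi y j) ∧
      s'.real 10 0 = ∑ j, rangeLoad f lo hi y j * y j ∧
      Frame [8, 16] [8, 9, 10] s s' ∧ s'.calls = s.calls + (hi - lo) ∧
      s'.time ≤ s.time + 200 * ((hi - lo + 1) * (d + 1)) := by
  refine .seq ((Total.forLoop (c := 20) (a := 0) (N := d) (I := fun k s' =>
    (∀ j < k, s'.real 8 j = 0) ∧ Frame [8, 16] [8, 9, 10] s s' ∧ s'.calls = s.calls) rfl
      (Nat.zero_le _) ?_ ?_ ?_ ?_).mono ?_)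
  · rintro k s' v t ⟨h1, h2, h3⟩
    exact ⟨h1, h2.setNat, h3⟩
  · rintro k s' ⟨-, h1, -⟩
    simp only [NExpr.eval, h1.nat 0 (by simp), hd]
  · rintro k s' - hk ⟨h1, h2, h3⟩ h4
    refine .setReal ⟨⟨fun j hj => ?_, h2.setReal, h3⟩, h4, ?_⟩
    · simp only [eval_rnum, Nat.cast_zero, eval_nvar, h4, upd_same]
      rcases Nat.lt_succ_iff_lt_or_eq.1 hj with hj | rfl
      · rw [Function.update_of_ne (by omega), h1 j hj]
      · rw [Function.update_self]
    · simp
  · exact ⟨by simp, .refl, rfl⟩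
  rintro s1 ⟨⟨a1, a2, a3⟩, -, a4⟩
  refine .seq ((Total.forLoop (c := 60 * (d + 1)) (a := lo) (N := hi) (I := fun k s' =>
    (∀ j : Fin d, s'.real 8 j = rangeLoad f lo k y j) ∧ Frame [8, 16] [8, 9, 10] s s' ∧
      s'.calls = s.calls + (k - lo)) ?_ hle ?_ ?_ ?_ ?_).mono ?_)
  · rw [eval_nvar, a2.nat 23 (by simp), hlo]
  · rintro k s' v t ⟨h1, h2, h3⟩
    exact ⟨h1, h2.setNat, h3⟩
  · rintro k s' ⟨-, h1, -⟩
    rw [eval_nvar, h1.nat 17 (by simp), hhi]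
  · rintro k s' hk1 hk ⟨h1, h2, h3⟩ h4
    have e7 := h2.real 7 (by simp)
    have hprice : (fun j : Fin d => s'.real 7 j) = y := funext fun j => by rw [e7, hy]
    refine .seq (.query ⟨k, by omega⟩ h4 (fun j => by rw [e7, hy]; exact hy0 j) ?_)
    refine (Total.addLoop (by rw [h2.nat 0 (by simp), hd])).mono ?_
    rintro s'' ⟨i1, i2, i3, i4⟩
    refine ⟨⟨fun j => ?_, h2.updVec.trans i2, ?_⟩, ?_, ?_⟩
    · rw [i1 j j.2, hprice]
      simp only [updVec_apply, if_true, dif_pos j.2, if_neg (show (8 : ℕ) ≠ 9 by norm_num), h1]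
      rw [rangeLoad, rangeLoad, Finset.sum_Ico_succ_top hk1, Pi.add_apply]
      congr 1
      simp only [oracleExt, dif_pos (show k < n by omega)]
    · rw [i3]; simp only [h3]; omega
    · rw [i2.nat 16 (by simp)]; exact h4
    · simp only [cost_nvar] at i4
      omega
  · exact ⟨fun j => by rw [a1 j j.2]; simp [rangeLoad], a2, by rw [a3]; simp⟩
  rintro s2 ⟨⟨b1, b2, b3⟩, -, b4⟩
  refine .seq (.setReal ?_)
  have hext : ∀ (g : Fin d → ℝ) (k : ℕ) (hk : k < d), extendZero g k = g ⟨k, hk⟩ := fun g k hk => by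
    simp only [extendZero, dif_pos hk]
  refine (Total.forLoop (c := 25) (a := 0) (N := d) (I := fun k s' =>
    (∀ j : Fin d, s'.real 8 j = rangeLoad f lo hi y j) ∧
    s'.real 10 0 = ∑ j ∈ Finset.range k, extendZero (fun j => rangeLoad f lo hi y j * y j) j ∧
    Frame [8, 16] [8, 9, 10] s s' ∧ s'.calls = s.calls + (hi - lo)) rfl
      (Nat.zero_le _) ?_ ?_ ?_ ?_).mono ?_
  · rintro k s' v t ⟨h1, h2, h3, h4⟩
    exact ⟨h1, h2, h3.setNat, h4⟩
  · rintro k s' ⟨-, -, h1, -⟩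
    simp only [NExpr.eval, h1.nat 0 (by simp), hd]
  · rintro k s' - hk ⟨h1, h2, h3, h4⟩ h5
    have e7 := h3.real 7 (by simp)
    refine .setReal ⟨⟨fun j => ?_, ?_, h3.setReal, h4⟩, h5, ?_⟩
    · simpa using h1 j
    · have hl := h1 ⟨k, hk⟩
      have hyk := hy ⟨k, hk⟩
      simp only at hl hyk
      simp only [RExpr.eval, NExpr.eval, eval_nvar, eval_rvar, h5, upd_same, Function.update_self,
        h2, e7, hl, hyk]
      rw [Finset.sum_range_succ, hext _ k hk]
    · simp [NExpr.cost, RExpr.cost]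
  · refine ⟨by simpa using b1, by simp [NExpr.eval], b2.setReal, b3⟩
  · rintro s' ⟨⟨h1, h2, h3, h4⟩, -, h5⟩
    refine ⟨h1, ?_, h3, h4, ?_⟩
    · rw [h2, sum_extendZero]
    · simp only [NExpr.cost, Nat.sub_zero, cost_nvar, cost_rnum] at h5 a4 b4
      have h6 : (hi - lo) * (60 * (d + 1) + 2 + 20) ≤ 82 * ((hi - lo) * (d + 1)) := by
        have : hi - lo ≤ (hi - lo) * (d + 1) := Nat.le_mul_of_pos_right _ (Nat.succ_pos _)
        have h7 : (hi - lo) * (60 * (d + 1) + 2 + 20) = 60 * ((hi - lo) * (d + 1)) + 22 * (hi - lo) := by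
          ring
        omega
      have h8 : (hi - lo + 1) * (d + 1) = (hi - lo) * (d + 1) + (d + 1) := by ring
      omega

/-! ## Groups of customers -/

/-- The first customer of group `g` if the groups have size `q`. -/
def groupStart (n q g : ℕ) : ℕ := min (g * q) n

/-- The feasible set of the customers `lo, …, hi - 1`. -/
def rangeSet (X : Fin n → Set (Fin d → ℝ)) (lo hi : ℕ) : Set (Fin d → ℝ) :=
  {x | ∃ z : ℕ → Fin d → ℝ, (∀ c ∈ Finset.Ico lo hi, ∀ h : c < n, z c ∈ X ⟨c, h⟩) ∧
    x = ∑ c ∈ Finset.Ico lo hi, z c}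

theorem rangeLoad_mem {τ : ℝ} {X : Fin n → Set (Fin d → ℝ)} (hf : ∀ c, IsLinMinOracle τ (X c) (f c))
    {y : Fin d → ℝ} (hy : ∀ j, 0 ≤ y j) (lo hi : ℕ) : rangeLoad f lo hi y ∈ rangeSet X lo hi := by
  refine ⟨fun c => oracleExt f c y, fun c _ h => ?_, rfl⟩
  simp only [oracleExt, dif_pos h]
  exact (hf _ y hy).1

theorem sum_Ico_groupStart {M : Type*} [AddCommMonoid M] (n q p : ℕ) (g : ℕ → M) :
    ∑ i ∈ Finset.range p, ∑ c ∈ Finset.Ico (groupStart n q i) (groupStart n q (i + 1)), g c =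
      ∑ c ∈ Finset.Ico 0 (groupStart n q p), g c := by
  induction p with
  | zero => simp [groupStart]
  | succ p ih =>
    rw [Finset.sum_range_succ, ih, Finset.sum_Ico_consecutive _ (Nat.zero_le _)]
    exact min_le_min_right _ (Nat.mul_le_mul_right _ (Nat.le_succ p))

/-- The groups are consecutive intervals of length q, with customer c in group c / q, so choices for
the groups patch together to a choice for all customers. The oracle inequality is only needed summed
over all groups. -/
theorem isGroupOracle {τ : ℝ} {X : Fin n → Set (Fin d → ℝ)}
    (hc : ∀ c, Convex ℝ (X c)) (h0 : ∀ c, ∀ x ∈ X c, ∀ j, 0 ≤ x j)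
    (hf : ∀ c, IsLinMinOracle τ (X c) (f c)) {p q : ℕ} (hpq : n ≤ p * q) :
    IsGroupOracle τ (feasibleSet X) p
      (fun g => rangeSet X (groupStart n q g) (groupStart n q (g + 1)))
      (fun g => rangeLoad f (groupStart n q g) (groupStart n q (g + 1))) := by
  have hlt : ∀ g, ∀ c ∈ Finset.Ico (groupStart n q g) (groupStart n q (g + 1)), c < n :=
    fun g c hc => (Finset.mem_Ico.1 hc).2.trans_le (min_le_right _ _)
  have hp : groupStart n q p = n := min_eq_right hpq
  have hext : ∀ z : ℕ → Fin d → ℝ, ∑ c ∈ Finset.Ico 0 n, z c = ∑ c : Fin n, z c := fun z => by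
    rw [Nat.Ico_zero_eq_range, Finset.sum_range]
  refine ⟨fun g _ y hy => rangeLoad_mem hf hy _ _, fun g _ => ?_, fun g _ x hx j => ?_,
    fun z hz => ?_, fun y hy z hz => ?_, fun z hz j => ?_⟩
  · rintro x ⟨z, hz, rfl⟩ x' ⟨z', hz', rfl⟩ a b ha hb hab
    refine ⟨fun c => a • z c + b • z' c, fun c hcm h => hc _ (hz c hcm h) (hz' c hcm h) ha hb hab, ?_⟩
    rw [Finset.smul_sum, Finset.smul_sum, ← Finset.sum_add_distrib]
  · obtain ⟨z, hz, rfl⟩ := hx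
    rw [Finset.sum_apply]
    exact Finset.sum_nonneg fun c hcm => h0 _ _ (hz c hcm (hlt g c hcm)) j
  · choose! w hw hw' using hz
    let w' : ℕ → Fin d → ℝ := fun c => w (c / q) c
    have hdiv : ∀ g, ∀ c ∈ Finset.Ico (groupStart n q g) (groupStart n q (g + 1)), c / q = g :=
      fun g c hcm => by
        obtain ⟨h1, h2⟩ := Finset.mem_Ico.1 hcm
        have h3 := hlt g c hcm
        simp only [groupStart] at h1 h2
        exact Nat.div_eq_of_lt_le (by omega) (by omega)
    refine ⟨fun c => w' c, fun c => ?_, ?_⟩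
    · have hcp : (c : ℕ) < p * q := c.2.trans_le hpq
      have hq : 0 < q := Nat.pos_of_ne_zero fun h => by rw [h, mul_zero] at hcp; omega
      refine hw (c / q) ((Nat.div_lt_iff_lt_mul hq).2 hcp) c ?_ c.2
      have h1 := Nat.div_mul_le_self c q
      simp only [groupStart, Finset.mem_Ico]
      have := c.2
      refine ⟨by omega, lt_min ?_ this⟩
      exact (Nat.div_lt_iff_lt_mul hq).1 (Nat.lt_succ_self _)
    · rw [← hext w', ← hp, ← sum_Ico_groupStart]
      refine Finset.sum_congr rfl fun g hg => ?_
      rw [hw' g (Finset.mem_range.1 hg)]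
      exact Finset.sum_congr rfl fun c hcm => by simp only [w', hdiv g c hcm]
  · obtain ⟨w, hw, rfl⟩ := hz
    have h1 : ∑ g ∈ Finset.range p, ∑ j,
        rangeLoad f (groupStart n q g) (groupStart n q (g + 1)) y j * y j =
        ∑ c : Fin n, ∑ j, f c y j * y j := by
      have : ∀ g, ∑ j, rangeLoad f (groupStart n q g) (groupStart n q (g + 1)) y j * y j =
          ∑ c ∈ Finset.Ico (groupStart n q g) (groupStart n q (g + 1)),
            ∑ j, oracleExt f c y j * y j := fun g => by
        simp only [rangeLoad, Finset.sum_apply, Finset.sum_mul]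
        exact Finset.sum_comm
      rw [Finset.sum_congr rfl fun g _ => this g, sum_Ico_groupStart, hp,
        Nat.Ico_zero_eq_range, Finset.sum_range]
      exact Finset.sum_congr rfl fun c _ => by simp [oracleExt]
    have h2 : ∑ j, (∑ c, w c) j * y j = ∑ c, ∑ j, w c j * y j := by
      simp only [Finset.sum_apply, Finset.sum_mul]
      exact Finset.sum_comm
    rw [h1, h2, Finset.mul_sum]
    exact Finset.sum_le_sum fun c _ => (hf c y hy).2 _ (hw c)
  · obtain ⟨w, hw, rfl⟩ := hz
    rw [Finset.sum_apply]
    exact Finset.sum_nonneg fun c _ => h0 c _ (hw c) j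

end RealRAM

namespace RealRAM

variable {n d : ℕ} {f : Fin n → (Fin d → ℝ) → Fin d → ℝ}

/-! ## The core procedure as a program -/

/-- The core procedure for `p` groups of size `q` of customers with the oracles `f`. -/
def coreData (f : Fin n → (Fin d → ℝ) → Fin d → ℝ) (p q : ℕ) (price : (Fin d → ℝ) → Fin d → ℝ)
    (floor cap T : ℝ) : CoreData d where
  n := n
  p := p
  q := q
  size := fun g => groupStart n q (g + 1) - groupStart n q g
  F := fun g => rangeLoad f (groupStart n q g) (groupStart n q (g + 1))
  price := price
  floor := floor
  cap := cap
  T := T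

/-- The number `n` of customers, the dimension `d` and the weights `β` are in memory. -/
structure InputRep (n : ℕ) (β : Fin d → ℝ) (s : State) : Prop where
  count : s.nat 0 0 = n
  dim : s.nat 0 1 = d
  weight : ∀ j : Fin d, s.real 0 j = β j

/-- The parameters of the core procedure are in memory. -/
structure CoreEnv (P : CoreData d) (β : Fin d → ℝ) (A lim : ℝ) (s : State) : Prop where
  input : InputRep P.n β s
  A : s.real 11 0 = A
  floor : s.real 12 0 = P.floor
  cap : s.real 15 0 = P.cap
  T : s.real 16 0 = P.T
  lim : s.real 19 0 = lim
  start : ∀ g ≤ P.p, s.nat 22 g = groupStart P.n P.q g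

/-- The core procedure is in state `c`. -/
structure CoreRep (P : CoreData d) (c : Core d) (s : State) : Prop where
  x : ∀ j : Fin d, s.real 3 j = c.x j
  m : ∀ g < P.p, s.nat 12 g = c.m g
  pr : ∀ g < P.p, s.real 13 g = c.pr g
  total : s.nat 13 0 = c.total P
  dep : s.real 17 0 = c.dep
  L : s.real 18 0 = c.L
  cnt : s.nat 19 0 = c.cnt

/-- Only memory that is local to the core procedure has changed. -/
abbrev CoreFrame (s s' : State) : Prop :=
  Frame [2, 3, 4, 5, 6, 7, 8, 9, 12, 13, 14, 15, 16, 17, 19, 20, 23, 24]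
    [3, 4, 5, 6, 7, 8, 9, 10, 13, 14, 17, 18] s s'

theorem CoreEnv.of_frame {P : CoreData d} {β : Fin d → ℝ} {A lim : ℝ} {s s' : State}
    (h : CoreEnv P β A lim s) (hf : CoreFrame s s') : CoreEnv P β A lim s' := by
  have e1 := hf.nat 0 (by simp)
  have e2 := hf.real 0 (by simp)
  refine ⟨⟨?_, ?_, fun j => ?_⟩, ?_, ?_, ?_, ?_, ?_, fun g hg => ?_⟩
  · rw [e1, h.input.count]
  · rw [e1, h.input.dim]
  · rw [e2, h.input.weight]
  · rw [hf.real 11 (by simp), h.A]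
  · rw [hf.real 12 (by simp), h.floor]
  · rw [hf.real 15 (by simp), h.cap]
  · rw [hf.real 16 (by simp), h.T]
  · rw [hf.real 19 (by simp), h.lim]
  · rw [hf.nat 22 (by simp), h.start g hg]

/-- Sets integer variable `15` to the group that contains integer variable `14`. -/
def pickGroup : Prog :=
  .seq (.setNat 15 (.const 0) (.const 0))
    (.while (.natLe (.get 12 (nvar 15)) (nvar 14))
      (.seq (.setNat 14 (.const 0) (.sub (nvar 14) (.get 12 (nvar 15))))
        (.setNat 15 (.const 0) (.add (nvar 15) (.const 1)))))

theorem Total.pickGroup {s : State} {m : ℕ → ℕ} {p r : ℕ} (hm : ∀ g < p, s.nat 12 g = m g)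
    (hr : s.nat 14 0 = r) (hr' : r < ∑ i ∈ Finset.range p, m i) :
    Total f pickGroup s fun s' => s'.nat 15 0 = pick m p r ∧ Frame [14, 15] [] s s' ∧
      s'.calls = s.calls ∧ s'.time ≤ s.time + 50 * (p + 1) := by
  obtain ⟨h1, h2, h3⟩ := pick_spec hr'
  refine .seq (.setNat ?_)
  refine Total.while_measure (I := fun k s' => ∃ i r', s'.nat 15 0 = i ∧ s'.nat 14 0 = r' ∧
    ∑ j ∈ Finset.range i, m j + r' = r ∧ i ≤ pick m p r ∧ k = p - i ∧ Frame [14, 15] [] s s' ∧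
    s'.calls = s.calls ∧ s'.time + 40 * k + 20 ≤ s.time + 50 * (p + 1))
    (fun k s' => ?_) (fun k s' => ?_) p _ ?_
  · rintro ⟨i, r', i1, i2, i3, i4, i5, i6, i7, i8⟩ hb
    have e12 := i6.nat 12 (by simp)
    simp only [Cond.Holds, NExpr.eval, eval_nvar, i1, i2, e12, hm i (by omega)] at hb
    have hlt : i < pick m p r := by
      refine lt_of_le_of_ne i4 fun h => ?_
      rw [← h] at h3
      omega
    refine .seq (.setNat (.setNat ⟨k - 1, by omega, i + 1, r' - m i, by simp [NExpr.eval, i1], ?_, ?_,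
      hlt, by omega, i6.tick.setNat.setNat, i7, ?_⟩))
    · simp [NExpr.eval, i1, i2, e12, hm i (by omega)]
    · rw [Finset.sum_range_succ]; omega
    · simp [NExpr.cost, Cond.cost]; omega
  · rintro ⟨i, r', i1, i2, i3, i4, i5, i6, i7, i8⟩ hb
    have e12 := i6.nat 12 (by simp)
    simp only [Cond.Holds, NExpr.eval, eval_nvar, i1, i2, e12, hm i (by omega)] at hb
    refine ⟨?_, i6.tick, i7, ?_⟩
    · rw [State.tick_nat, i1]
      exact eq_pick hr' (by omega) (by omega)
    · simp [NExpr.cost, Cond.cost]; omega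
  · refine ⟨0, r, by simp [NExpr.eval], by simpa using hr, by simp, Nat.zero_le _, by simp,
      Frame.refl.setNat, rfl, ?_⟩
    simp [NExpr.cost]; omega

/-- The multiplicity of the current group. -/
def curMult : NExpr := .get 12 (nvar 15)

/-- Computes the deposit of the current group and its new multiplicity. -/
def chooseDeposit : Prog :=
  .ite (.realLt (.mul (rvar 15) (.ofNat curMult)) (rvar 10))
    (.seq (.setReal 14 (.const 0) (rnum 0)) (.setNat 24 (.const 0) (.add curMult curMult)))
    (.seq
      (.seq (.seq (.setReal 14 (.const 0) (.div (rnum 1) (.ofNat curMult)))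
          (.setNat 24 (.const 0) curMult))
        (.ite (.natLe (.const 2) curMult)
          (.ite (.realLe (.mul (rnum 4) (rvar 10)) (.mul (rvar 15) (.ofNat curMult)))
            (.seq (.setReal 14 (.const 0) (.div (rnum 3) (.ofNat curMult)))
              (.setNat 24 (.const 0) (.half curMult)))
            .skip)
          .skip))
      (.ite (.realLe (.sub (rvar 16) (.get 13 (nvar 15))) (rvar 14))
        (.seq (.setReal 14 (.const 0) (.sub (rvar 16) (.get 13 (nvar 15))))
          (.setNat 24 (.const 0) (.const 0)))
        .skip))

theorem Total.chooseDeposit {s : State} {P : CoreData d} {c : Core d} {g : ℕ}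
    (hg : s.nat 15 0 = g) (hm : s.nat 12 g = c.m g) (hv : s.real 10 0 = c.val P g)
    (hcap : s.real 15 0 = P.cap) (hT : s.real 16 0 = P.T) (hpr : s.real 13 g = c.pr g) :
    Total f chooseDeposit s fun s' => s'.real 14 0 = (c.choice P g).1 ∧
      s'.nat 24 0 = (c.choice P g).2 ∧ Frame [24] [14] s s' ∧ s'.calls = s.calls ∧
      s'.time ≤ s.time + 100 := by
  refine .ite (fun h1 => .seq (.setReal (.setNat ⟨?_, ?_, Frame.refl.tick.setReal.setNat, rfl, ?_⟩)))
    fun h1 => ?_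
  · simp only [Cond.Holds, RExpr.eval, NExpr.eval, eval_nvar, eval_rvar, curMult, hg, hm, hv,
      hcap] at h1
    simp [Core.choice, h1, NExpr.eval]
  · simp only [Cond.Holds, RExpr.eval, NExpr.eval, eval_nvar, eval_rvar, curMult, hg, hm, hv,
      hcap] at h1
    simp [Core.choice, h1, NExpr.eval, curMult, hg, hm, two_mul]
  · simp [NExpr.cost, RExpr.cost, Cond.cost, curMult]
  simp only [Cond.Holds, RExpr.eval, NExpr.eval, eval_nvar, eval_rvar, curMult, hg, hm, hv,
      hcap] at h1
  have key : Total f (.seq (.seq (.setReal 14 (.const 0) (.div (rnum 1) (.ofNat curMult)))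
          (.setNat 24 (.const 0) curMult))
        (.ite (.natLe (.const 2) curMult)
          (.ite (.realLe (.mul (rnum 4) (rvar 10)) (.mul (rvar 15) (.ofNat curMult)))
            (.seq (.setReal 14 (.const 0) (.div (rnum 3) (.ofNat curMult)))
              (.setNat 24 (.const 0) (.half curMult)))
            .skip)
          .skip)) (s.tick (Cond.realLt (.mul (rvar 15) (.ofNat curMult)) (rvar 10)).cost) fun s' =>
      s'.real 14 0 = (if 2 ≤ c.m g ∧ 4 * c.val P g ≤ P.cap * c.m g then 3 / (c.m g : ℝ)
        else 1 / c.m g) ∧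
      s'.nat 24 0 = (if 2 ≤ c.m g ∧ 4 * c.val P g ≤ P.cap * c.m g then c.m g / 2 else c.m g) ∧
      Frame [24] [14] s s' ∧ s'.calls = s.calls ∧ s'.time ≤ s.time + 70 := by
    refine .seq (.seq (.setReal (.setNat (.ite (fun h2 => .ite
      (fun h3 => .seq (.setReal (.setNat ?_))) fun h3 => .skip ?_) fun h2 => .skip ?_))))
    · simp [Cond.Holds, RExpr.eval, NExpr.eval, curMult, hg, hm, hv, hcap] at h2 h3
      refine ⟨?_, ?_, Frame.refl.tick.setReal.setNat.tick.tick.setReal.setNat, rfl, ?_⟩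
      · simp [NExpr.eval, RExpr.eval, curMult, hg, hm, h2, h3]
      · simp [NExpr.eval, curMult, hg, hm, h2, h3]
      · simp [NExpr.cost, RExpr.cost, Cond.cost, curMult]
    · simp [Cond.Holds, RExpr.eval, NExpr.eval, curMult, hg, hm, hv, hcap] at h2 h3
      have h4 : ¬ (2 ≤ c.m g ∧ 4 * c.val P g ≤ P.cap * c.m g) := fun h => absurd h.2 (not_le.2 h3)
      refine ⟨?_, ?_, Frame.refl.tick.setReal.setNat.tick.tick, rfl, ?_⟩
      · rw [if_neg h4]; simp [NExpr.eval, RExpr.eval, curMult, hg, hm]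
      · rw [if_neg h4]; simp [NExpr.eval, curMult, hg, hm]
      · simp [NExpr.cost, RExpr.cost, Cond.cost, curMult]
    · simp [Cond.Holds, NExpr.eval, curMult, hg, hm] at h2
      have h4 : ¬ (2 ≤ c.m g ∧ 4 * c.val P g ≤ P.cap * c.m g) := fun h => absurd h.1 (by omega)
      refine ⟨?_, ?_, Frame.refl.tick.setReal.setNat.tick, rfl, ?_⟩
      · rw [if_neg h4]; simp [NExpr.eval, RExpr.eval, curMult, hg, hm]
      · rw [if_neg h4]; simp [NExpr.eval, curMult, hg, hm]
      · simp [NExpr.cost, RExpr.cost, Cond.cost, curMult]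
  refine .seq (key.mono ?_)
  rintro s' ⟨i1, i2, i3, i4, i5⟩
  have e1 := i3.real 16 (by simp)
  have e2 := i3.real 13 (by simp)
  have e3 := i3.nat 15 (by simp)
  have hch : c.choice P g = if P.T - c.pr g ≤ s'.real 14 0 then (P.T - c.pr g, 0) else
      (s'.real 14 0, s'.nat 24 0) := by
    rw [i1, i2]
    unfold Core.choice
    rw [if_neg h1]
    by_cases h2 : 2 ≤ c.m g ∧ 4 * c.val P g ≤ P.cap * c.m g
    · simp only [if_pos h2]
    · simp only [if_neg h2]
  rw [hch]
  refine .ite (fun h2 => .seq (.setReal (.setNat ⟨?_, ?_, i3.tick.setReal.setNat, i4, ?_⟩)))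
    fun h2 => .skip ⟨?_, ?_, i3.tick, i4, ?_⟩
  · simp only [Cond.Holds, RExpr.eval, eval_rvar, eval_nvar, e1, e2, e3, hg, hpr, hT] at h2
    rw [if_pos h2]
    simp [NExpr.eval, RExpr.eval, e1, e2, e3, hg, hpr, hT]
  · simp only [Cond.Holds, RExpr.eval, eval_rvar, eval_nvar, e1, e2, e3, hg, hpr, hT] at h2
    rw [if_pos h2]
    simp [NExpr.eval]
  · simp [NExpr.cost, RExpr.cost, Cond.cost]; omega
  · simp only [Cond.Holds, RExpr.eval, eval_rvar, eval_nvar, e1, e2, e3, hg, hpr, hT] at h2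
    rw [if_neg h2]; rfl
  · simp only [Cond.Holds, RExpr.eval, eval_rvar, eval_nvar, e1, e2, e3, hg, hpr, hT] at h2
    rw [if_neg h2]; rfl
  · simp [RExpr.cost, Cond.cost]; omega

/-- Adds the multiple `a` of the current load to `X`, where `a` is real variable `14`. -/
def depositLoad : Prog :=
  forLoop 8 (.const 0) (.get 0 (.const 1))
    (.setReal 3 (nvar 8) (.add (.get 3 (nvar 8)) (.mul (rvar 14) (.get 8 (nvar 8)))))

theorem Total.depositLoad {s : State} (hd : s.nat 0 1 = d) :
    Total f depositLoad s fun s' =>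
      (∀ j < d, s'.real 3 j = s.real 3 j + s.real 14 0 * s.real 8 j) ∧ Frame [8] [3] s s' ∧
      s'.calls = s.calls ∧ s'.time ≤ s.time + 50 * (d + 1) := by
  refine (Total.forLoop (c := 20) (a := 0) (N := d) (I := fun k s' =>
    (∀ j < k, s'.real 3 j = s.real 3 j + s.real 14 0 * s.real 8 j) ∧
    (∀ j, k ≤ j → s'.real 3 j = s.real 3 j) ∧
    Frame [8] [3] s s' ∧ s'.calls = s.calls) rfl (Nat.zero_le _) ?_ ?_ ?_ ?_).mono ?_
  · rintro k s' v t ⟨h1, h2, h3, h4⟩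
    exact ⟨h1, h2, h3.setNat, h4⟩
  · rintro k s' ⟨-, -, h1, -⟩
    simp only [NExpr.eval, h1.nat 0 (by simp), hd]
  · rintro k s' - hk ⟨h1, h2, h3, h4⟩ h5
    have e8 := h3.real 8 (by simp)
    have e14 := h3.real 14 (by simp)
    refine .setReal ⟨⟨fun j hj => ?_, fun j hj => ?_, h3.setReal, h4⟩, h5, ?_⟩
    · simp only [RExpr.eval, eval_nvar, eval_rvar, h5, upd_same, e8, e14]
      rcases Nat.lt_succ_iff_lt_or_eq.1 hj with hj | rfl
      · rw [Function.update_of_ne (by omega), h1 j hj]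
      · rw [Function.update_self, h2 j le_rfl]
    · simp only [RExpr.eval, eval_nvar, h5, upd_same]
      rw [Function.update_of_ne (by omega), h2 j (by omega)]
    · simp [RExpr.cost]
  · exact ⟨by simp, fun _ _ => rfl, .refl, rfl⟩
  · rintro s' ⟨⟨h1, -, h2, h3⟩, -, h4⟩
    refine ⟨h1, h2, h3, ?_⟩
    simp only [NExpr.cost, Nat.sub_zero] at h4
    omega

/-- Processes the group that contains integer variable `14`. -/
def eventProg : Prog :=
  .seq pickGroup
  (.seq (.setNat 23 (.const 0) (.get 22 (nvar 15)))
  (.seq (.setNat 17 (.const 0) (.get 22 (.add (nvar 15) (.const 1))))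
  (.seq callRange
  (.seq chooseDeposit
  (.seq depositLoad
  (.seq (.setReal 17 (.const 0) (.add (rvar 17) (.mul (rvar 14) (rvar 10))))
  (.seq (.setReal 13 (nvar 15) (.add (.get 13 (nvar 15)) (rvar 14)))
  (.seq (.setNat 13 (.const 0) (.add (.sub (nvar 13) curMult) (nvar 24)))
  (.seq (.setNat 12 (nvar 15) (nvar 24))
  (.setNat 19 (.const 0) (.add (nvar 19) (.sub (nvar 17) (nvar 23)))))))))))))

theorem le_timeUnit (d : ℕ) : d + 1 ≤ timeUnit d := by
  unfold timeUnit
  have : d ≤ d * (Nat.log 2 d + 1) := Nat.le_mul_of_pos_right _ (Nat.succ_pos _)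
  omega

/-- The linear scan for the drawn group is affordable because p ≤ d. Since groups are non-empty, the
whole visit takes O(timeUnit) per oracle call. -/
theorem Total.eventProg {P : CoreData d} {β : Fin d → ℝ} {A lim : ℝ} {s : State} {c : Core d}
    {p q : ℕ} {price : (Fin d → ℝ) → Fin d → ℝ} {floor cap T : ℝ}
    (hP : P = coreData f p q price floor cap T) (hpd : P.p ≤ d)
    (hsize : ∀ g < P.p, 0 < P.size g) (env : CoreEnv P β A lim s) (rep : CoreRep P c s)
    (hy : ∀ j : Fin d, s.real 7 j = c.y P j) (hy0 : ∀ j, 0 ≤ c.y P j) {r : ℕ}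
    (hr : s.nat 14 0 = r) (hr' : r < c.total P) :
    Total f eventProg s fun s' => CoreRep P (c.event P (pick c.m P.p r)) s' ∧ CoreFrame s s' ∧
      s'.calls = s.calls + P.size (pick c.m P.p r) ∧
      s'.time ≤ s.time + 1000 * (timeUnit d * P.size (pick c.m P.p r)) := by
  have hg := (pick_spec hr').1
  refine .seq ((Total.pickGroup rep.m hr hr').mono ?_)
  rintro s1 ⟨a1, a2, a3, a4⟩
  generalize pick c.m P.p r = g at *
  have hFg : ∀ y, P.F g y = rangeLoad f (groupStart n q g) (groupStart n q (g + 1)) y := by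
    subst hP; exact fun _ => rfl
  have hsz : P.size g = groupStart n q (g + 1) - groupStart n q g := by subst hP; rfl
  have hn : P.n = n := by subst hP; rfl
  have hq : P.q = q := by subst hP; rfl
  have hs0 := hsize g hg
  refine .seq (.setNat (.seq (.setNat ?_)))
  have n0 := a2.nat 0 (by simp)
  have n22 := a2.nat 22 (by simp)
  have st1 := env.start g hg.le
  have st2 := env.start (g + 1) hg
  rw [hn, hq] at st1 st2
  have f1 : CoreFrame s s1 := Frame.refl.trans a2
  refine .seq ((Total.callRange (lo := groupStart n q g) (hi := groupStart n q (g + 1))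
    (y := c.y P) ?_ ?_ ?_ (by omega) (min_le_right _ _) (fun j => ?_) hy0).mono ?_)
  · simp [n0, env.input.dim]
  · simp [NExpr.eval, a1, n22, st1]
  · simp [NExpr.eval, a1, n22, st2]
  · simpa [a2.real 7 (by simp)] using hy j
  rintro s2 ⟨b1, b2, b3, b4, b5⟩
  have f2 : CoreFrame s s2 := f1.setNat.setNat.trans b3
  have g15 : s2.nat 15 0 = g := by rw [b3.nat 15 (by simp)]; simpa using a1
  have env2 := env.of_frame f2
  have m12 : s2.nat 12 = s.nat 12 := by
    rw [b3.nat 12 (by simp)]; simpa using a2.nat 12 (by simp)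
  have m13 : s2.nat 13 = s.nat 13 := by
    rw [b3.nat 13 (by simp)]; simpa using a2.nat 13 (by simp)
  have m19 : s2.nat 19 = s.nat 19 := by
    rw [b3.nat 19 (by simp)]; simpa using a2.nat 19 (by simp)
  have m17 : s2.nat 17 0 = groupStart n q (g + 1) := by
    rw [b3.nat 17 (by simp)]; simp [NExpr.eval, a1, n22, st2]
  have m23 : s2.nat 23 0 = groupStart n q g := by
    rw [b3.nat 23 (by simp)]; simp [NExpr.eval, a1, n22, st1]
  have r13 : s2.real 13 = s.real 13 := by
    rw [b3.real 13 (by simp)]; simpa using a2.real 13 (by simp)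
  have r17 : s2.real 17 = s.real 17 := by
    rw [b3.real 17 (by simp)]; simpa using a2.real 17 (by simp)
  have r18 : s2.real 18 = s.real 18 := by
    rw [b3.real 18 (by simp)]; simpa using a2.real 18 (by simp)
  have r3 : s2.real 3 = s.real 3 := by
    rw [b3.real 3 (by simp)]; simpa using a2.real 3 (by simp)
  have hval : s2.real 10 0 = c.val P g := by
    rw [b2]; simp only [Core.val, hFg]
  refine .seq ((Total.chooseDeposit (P := P) (c := c) g15 (by rw [m12, rep.m g hg]) hval env2.cap
    env2.T (by rw [r13, rep.pr g hg])).mono ?_)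
  rintro s3 ⟨c1, c2, c3, c4, c5⟩
  refine .seq ((Total.depositLoad (d := d) (by rw [c3.nat 0 (by simp), env2.input.dim])).mono ?_)
  rintro s4 ⟨d1, d2, d3, d4⟩
  have c34 : Frame [8, 24] [3, 14] s2 s4 := (Frame.refl.trans c3).trans d2
  have f4 : CoreFrame s s4 := f2.trans c34
  have k15 : s4.nat 15 0 = g := by rw [c34.nat 15 (by simp), g15]
  have k24 : s4.nat 24 0 = (c.choice P g).2 := by rw [d2.nat 24 (by simp), c2]
  have k12 : s4.nat 12 = s.nat 12 := by rw [c34.nat 12 (by simp), m12]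
  have k13 : s4.nat 13 = s.nat 13 := by rw [c34.nat 13 (by simp), m13]
  have k19 : s4.nat 19 = s.nat 19 := by rw [c34.nat 19 (by simp), m19]
  have k17 : s4.nat 17 0 = groupStart n q (g + 1) := by rw [c34.nat 17 (by simp), m17]
  have k23 : s4.nat 23 0 = groupStart n q g := by rw [c34.nat 23 (by simp), m23]
  have l13 : s4.real 13 = s.real 13 := by rw [c34.real 13 (by simp), r13]
  have l17 : s4.real 17 = s.real 17 := by rw [c34.real 17 (by simp), r17]
  have l18 : s4.real 18 = s.real 18 := by rw [c34.real 18 (by simp), r18]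
  have l14 : s4.real 14 0 = (c.choice P g).1 := by rw [d2.real 14 (by simp), c1]
  have l10 : s4.real 10 0 = c.val P g := by rw [c34.real 10 (by simp), hval]
  have hmle : c.m g ≤ c.total P :=
    Finset.single_le_sum (f := c.m) (fun _ _ => Nat.zero_le _) (Finset.mem_range.2 hg)
  refine .seq (.setReal (.seq (.setReal (.seq (.setNat (.seq (.setNat (.setNat
    ⟨⟨fun j => ?_, fun i hi => ?_, fun i hi => ?_, ?_, ?_, ?_, ?_⟩,
      f4.setReal.setReal.setNat.setNat.setNat, ?_, ?_⟩))))))))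
  · have h8 : s3.real 8 j = P.F g (c.y P) j := by
      rw [c3.real 8 (by simp), b1, hFg]
    have := d1 j j.2
    rw [c1, h8, c3.real 3 (by simp), r3, rep.x] at this
    simpa [Core.event] using this
  · simp only [NExpr.eval, eval_nvar, upd_same, k15, k24, k12, Core.event,
      upd_of_ne _ _ _ _ (show (12 : ℕ) ≠ 19 by norm_num),
      upd_of_ne _ _ _ _ (show (12 : ℕ) ≠ 13 by norm_num),
      upd_of_ne _ _ _ _ (show (15 : ℕ) ≠ 13 by norm_num),
      upd_of_ne _ _ _ _ (show (24 : ℕ) ≠ 13 by norm_num)]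
    rcases eq_or_ne i g with rfl | hne
    · rw [Function.update_self, Function.update_self]
    · rw [Function.update_of_ne hne, Function.update_of_ne hne, rep.m i hi]
  · simp only [RExpr.eval, eval_nvar, eval_rvar, upd_same, k15, l14, l13, Core.event,
      upd_of_ne _ _ _ _ (show (13 : ℕ) ≠ 17 by norm_num),
      upd_of_ne _ _ _ _ (show (14 : ℕ) ≠ 17 by norm_num)]
    rcases eq_or_ne i g with rfl | hne
    · rw [Function.update_self, Function.update_self, rep.pr i hi]
    · rw [Function.update_of_ne hne, Function.update_of_ne hne, rep.pr i hi]
  · have htot : (c.event P g).total P = c.total P - c.m g + (c.choice P g).2 := by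
      simp only [Core.total, Core.event]
      rw [Finset.sum_update_of_mem (Finset.mem_range.2 hg), Finset.sdiff_singleton_eq_erase,
        ← Finset.add_sum_erase _ c.m (Finset.mem_range.2 hg)]
      omega
    rw [htot]
    simp [NExpr.eval, curMult, k15, k24, k12, k13, rep.m g hg, rep.total]
  · simp [RExpr.eval, NExpr.eval, l17, l14, l10, rep.dep, Core.event]
  · simp [l18, rep.L, Core.event]
  · simp [NExpr.eval, k19, k17, k23, rep.cnt, Core.event, hsz]
  · simp only [d3, c4, b4, a3, hsz]
  · simp only [NExpr.cost, RExpr.cost, cost_nvar, cost_rvar, curMult] at *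
    rw [← hsz] at b5
    have h1 : (P.size g + 1) * (d + 1) ≤ 2 * (timeUnit d * P.size g) := by
      have : (P.size g + 1) * (d + 1) ≤ (2 * P.size g) * timeUnit d :=
        Nat.mul_le_mul (by omega) (le_timeUnit d)
      linarith
    have h2 : d + 1 ≤ timeUnit d * P.size g :=
      (le_timeUnit d).trans (Nat.le_mul_of_pos_right _ hs0)
    omega

end RealRAM

/-! ### Checks and the loop of the core procedure -/

namespace RealRAM

variable {n d : ℕ} {f : Fin n → (Fin d → ℝ) → Fin d → ℝ}

/-- Calls all oracles at the prices in real array `7`. -/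
def callAll : Prog :=
  .seq (.setNat 23 (.const 0) (.const 0))
  (.seq (.setNat 17 (.const 0) (.get 0 (.const 0)))
  callRange)

theorem Total.callAll {s : State} {y : Fin d → ℝ} (hn : s.nat 0 0 = n) (hd : s.nat 0 1 = d)
    (hn1 : 0 < n) (hy : ∀ j : Fin d, s.real 7 j = y j) (hy0 : ∀ j, 0 ≤ y j) :
    Total f callAll s fun s' =>
      (∀ j : Fin d, s'.real 8 j = rangeLoad f 0 n y j) ∧
      s'.real 10 0 = ∑ j, rangeLoad f 0 n y j * y j ∧
      Frame [8, 16, 17, 23] [8, 9, 10] s s' ∧ s'.calls = s.calls + n ∧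
      s'.time ≤ s.time + 450 * (timeUnit d * n) := by
  refine .seq (.setNat (.seq (.setNat ?_)))
  have f1 : Frame [8, 16, 17, 23] [8, 9, 10] s s := .refl
  refine (Total.callRange (lo := 0) (hi := n) (y := y) ?_ ?_ ?_ (Nat.zero_le _) le_rfl ?_ hy0).mono ?_
  · simpa using hd
  · simp [NExpr.eval]
  · simpa [NExpr.eval] using hn
  · exact hy
  rintro s' ⟨h1, h2, h3, h4, h5⟩
  refine ⟨h1, h2, f1.setNat.setNat.trans h3, h4, ?_⟩
  simp only [NExpr.cost] at h5
  have h6 : (n - 0 + 1) * (d + 1) ≤ 2 * (timeUnit d * n) := by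
    have : (n - 0 + 1) * (d + 1) ≤ (2 * n) * timeUnit d :=
      Nat.mul_le_mul (by omega) (le_timeUnit d)
    linarith
  have h7 : 1 ≤ timeUnit d * n := Nat.mul_pos (by have := le_timeUnit d; omega) hn1
  omega

/-- Calls all oracles and updates the largest value of a check. -/
def checkProg : Prog :=
  .seq callAll
  (.seq (.ite (.realLt (rvar 18) (rvar 10)) (.setReal 18 (.const 0) (rvar 10)) .skip)
  (.setNat 19 (.const 0) (.add (nvar 19) (.get 0 (.const 0)))))

theorem sum_rangeLoad {p q : ℕ} (hpq : n ≤ p * q) (y : Fin d → ℝ) :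
    ∑ g ∈ Finset.range p, rangeLoad f (groupStart n q g) (groupStart n q (g + 1)) y =
      rangeLoad f 0 n y := by
  simp only [rangeLoad]
  rw [sum_Ico_groupStart, show groupStart n q p = n from min_eq_right hpq]

theorem checkVal_coreData {p q : ℕ} {price : (Fin d → ℝ) → Fin d → ℝ} {floor cap T : ℝ}
    (hpq : n ≤ p * q) (c : Core d) :
    c.checkVal (coreData f p q price floor cap T) =
      ∑ j, rangeLoad f 0 n (c.y (coreData f p q price floor cap T)) j *
        c.y (coreData f p q price floor cap T) j := by
  simp only [← sum_rangeLoad hpq, Finset.sum_apply, Finset.sum_mul]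
  rw [Finset.sum_comm]
  rfl

theorem Total.checkProg {P : CoreData d} {β : Fin d → ℝ} {A lim : ℝ} {s : State} {c : Core d}
    {p q : ℕ} {price : (Fin d → ℝ) → Fin d → ℝ} {floor cap T : ℝ}
    (hP : P = coreData f p q price floor cap T) (hpq : n ≤ p * q) (hn1 : 0 < n)
    (env : CoreEnv P β A lim s) (rep : CoreRep P c s)
    (hy : ∀ j : Fin d, s.real 7 j = c.y P j) (hy0 : ∀ j, 0 ≤ c.y P j) :
    Total f checkProg s fun s' => CoreRep P (c.check P) s' ∧ CoreFrame s s' ∧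
      s'.calls = s.calls + n ∧ s'.time ≤ s.time + 500 * (timeUnit d * n) := by
  have hn : P.n = n := by subst hP; rfl
  have hcheck : c.checkVal P = ∑ j, rangeLoad f 0 n (c.y P) j * c.y P j := by
    subst hP; exact checkVal_coreData hpq c
  refine .seq ((Total.callAll (by rw [env.input.count, hn]) env.input.dim hn1 hy hy0).mono ?_)
  rintro s1 ⟨-, a2, a3, a4, a5⟩
  have f1 : CoreFrame s s1 := Frame.refl.trans a3
  have env1 := env.of_frame f1
  have h7 : 1 ≤ timeUnit d * n := Nat.mul_pos (by have := le_timeUnit d; omega) hn1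
  have key : Total f (.ite (.realLt (rvar 18) (rvar 10)) (.setReal 18 (.const 0) (rvar 10)) .skip)
      s1 fun s' => s'.real 18 0 = max c.L (c.checkVal P) ∧ Frame [] [18] s1 s' ∧
        s'.calls = s1.calls ∧ s'.time ≤ s1.time + 20 := by
    have e18 : s1.real 18 0 = c.L := by rw [a3.real 18 (by simp), rep.L]
    refine .ite (fun h => .setReal ⟨?_, Frame.refl.tick.setReal, rfl, ?_⟩)
      fun h => .skip ⟨?_, Frame.refl.tick, rfl, ?_⟩
    · simp only [Cond.Holds, eval_rvar, e18, a2, ← hcheck] at h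
      simp [NExpr.eval, a2, ← hcheck, max_eq_right h.le]
    · simp [NExpr.cost, Cond.cost]
    · simp only [Cond.Holds, eval_rvar, e18, a2, ← hcheck, not_lt] at h
      rw [max_eq_left h]; exact e18
    · simp [Cond.cost]
  refine .seq (key.mono ?_)
  rintro s2 ⟨b1, b2, b3, b4⟩
  have f2 : CoreFrame s s2 := f1.trans b2
  have g3 : s2.real 3 = s.real 3 := by rw [b2.real 3 (by simp), a3.real 3 (by simp)]
  have g12 : s2.nat 12 = s.nat 12 := by rw [b2.nat 12 (by simp), a3.nat 12 (by simp)]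
  have g13 : s2.real 13 = s.real 13 := by rw [b2.real 13 (by simp), a3.real 13 (by simp)]
  have g13' : s2.nat 13 = s.nat 13 := by rw [b2.nat 13 (by simp), a3.nat 13 (by simp)]
  have g17 : s2.real 17 = s.real 17 := by rw [b2.real 17 (by simp), a3.real 17 (by simp)]
  have g19 : s2.nat 19 = s.nat 19 := by rw [b2.nat 19 (by simp), a3.nat 19 (by simp)]
  have g0 : s2.nat 0 0 = P.n := by rw [b2.nat 0 (by simp), env1.input.count]
  refine .setNat ⟨⟨fun j => ?_, fun g hg => ?_, fun g hg => ?_, ?_, ?_, b1, ?_⟩, f2.setNat, ?_, ?_⟩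
  · rw [g3]; exact rep.x j
  · simpa [g12, Core.check] using rep.m g hg
  · rw [g13]; exact rep.pr g hg
  · simpa [g13', Core.check, Core.total] using rep.total
  · rw [g17]; exact rep.dep
  · simp [NExpr.eval, g19, g0, rep.cnt, Core.check]
  · simp only [b3, a4]
  · simp only [NExpr.cost, cost_nvar]
    omega

/-- One iteration of the core procedure. -/
def coreBody : Prog :=
  .seq priceProg (.seq (.randNat 14 (.const 0) (.add (nvar 13) (.const 1)))
    (.seq (.ite (.natLt (nvar 14) (nvar 13)) eventProg checkProg)
      (.ite (.realLe (.ofNat (nvar 19)) (rvar 19)) (.setNat 20 (.const 0) (nvar 13))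
        (.setNat 20 (.const 0) (.const 0)))))

open Classical in
/-- Integer variable `20` tells whether the core procedure continues. -/
def goFlag (P : CoreData d) (lim : ℝ) (c : Core d) : ℕ := if (c.cnt : ℝ) ≤ lim then c.total P else 0

/-- Every iteration makes at least one call, which also pays for the price computation. The slack of
100 covers the evaluation of the loop condition. -/
theorem Branch.coreBody {P : CoreData d} {β : Fin d → ℝ} {A δ τ lim : ℝ} {X : Set (Fin d → ℝ)}
    {Y : ℕ → Set (Fin d → ℝ)} {s : State} {c : Core d}
    {p q : ℕ} {price : (Fin d → ℝ) → Fin d → ℝ} {floor cap T : ℝ}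
    (hP : P = coreData f p q price floor cap T) (V : Core.Valid P β A δ τ X Y) (hpd : P.p ≤ d)
    (hpq : n ≤ p * q) (hn1 : 0 < n) (hsize : ∀ g < P.p, 0 < P.size g)
    (env : CoreEnv P β A lim s) (rep : CoreRep P c s) (hx : ∀ j, 0 ≤ c.x j) :
    Branch f coreBody s (c.total P) fun r s' => CoreRep P (c.step P r) s' ∧ CoreFrame s s' ∧
      s'.nat 20 0 = goFlag P lim (c.step P r) ∧ s'.calls + c.cnt = s.calls + (c.step P r).cnt ∧
      s'.time + 4000 * (timeUnit d * c.cnt) ≤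
        s.time + 4000 * (timeUnit d * (c.step P r).cnt) - 100 := by
  refine .intro ((Total.priceProg V.dim V.weight (by rw [env.A]; exact V.A_pos) env.input.dim
    env.input.weight rep.x hx).mono ?_)
  rintro s1 ⟨⟨y, a1, a2⟩, a3, a4, a5⟩
  rw [env.A] at a1
  -- The program produces some price; by uniqueness it is the one fixed in the abstract procedure.
  have hyP : y = P.price c.x := a1.unique (V.price c.x)
  have hy : ∀ j : Fin d, s1.real 7 j = c.y P j := fun j => by
    rw [a2, env.floor, hyP]; rfl
  have hy0 : ∀ j, 0 ≤ c.y P j := fun j => (V.y_pos c j).le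
  have f1 : CoreFrame s s1 := Frame.refl.trans a3
  have e3 : ∀ j : Fin d, s1.real 3 j = c.x j := fun j => by rw [a3.real 3 (by simp)]; exact rep.x j
  have e12 := a3.nat 12 (by simp)
  have e13 := a3.real 13 (by simp)
  have e13' := a3.nat 13 (by simp)
  have e17 := a3.real 17 (by simp)
  have e18 := a3.real 18 (by simp)
  have e19 := a3.nat 19 (by simp)
  refine ⟨by simp [NExpr.eval, e13', rep.total], fun r hr => ?_⟩
  set s2 : State := { s1 with nat := upd s1.nat 14 ((NExpr.const 0).eval s1) r
                              drawn := s1.drawn + 1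
                              time := s1.time + ((NExpr.const 0).cost +
                                (NExpr.add (nvar 13) (.const 1)).cost + 1) } with hs2
  have f2 : CoreFrame s s2 := ⟨(f1.setNat (a := 14) (i := 0) (v := r) (t := 0)).nat, f1.real⟩
  have env2 := env.of_frame f2
  have rep2 : CoreRep P c s2 := by
    refine ⟨e3, fun g hg => ?_, fun g hg => ?_, ?_, ?_, ?_, ?_⟩
    · simp [hs2, e12, rep.m g hg]
    · simp [hs2, e13, rep.pr g hg]
    · simp [hs2, e13', rep.total]
    · simp [hs2, e17, rep.dep]
    · simp [hs2, e18, rep.L]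
    · simp [hs2, e19, rep.cnt]
  have r14 : s2.nat 14 0 = r := by simp [hs2, NExpr.eval]
  have hU : 1 ≤ timeUnit d := (Nat.le_add_left 1 d).trans (le_timeUnit d)
  have key : Total f (.ite (.natLt (nvar 14) (nvar 13)) eventProg checkProg) s2 fun s' =>
      CoreRep P (c.step P r) s' ∧ CoreFrame s s' ∧ s'.calls + c.cnt = s.calls + (c.step P r).cnt ∧
      s'.time + 4000 * (timeUnit d * c.cnt) ≤
        s.time + 4000 * (timeUnit d * (c.step P r).cnt) - 200 := by
    have ht2 : s2.time = s1.time + 6 := rfl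
    have hc2 : s2.calls = s1.calls := rfl
    refine .ite (fun h => ?_) fun h => ?_
    · simp only [Cond.Holds, eval_nvar, r14, rep2.total] at h
      have hs0 := hsize _ (pick_spec h).1
      refine (Total.eventProg (s := s2.tick _) hP hpd hsize (env2.of_frame Frame.refl.tick)
        ⟨rep2.x, rep2.m, rep2.pr, rep2.total, rep2.dep, rep2.L, rep2.cnt⟩ hy hy0 r14 h).mono ?_
      rintro s' ⟨i1, i2, i3, i4⟩
      have hst : c.step P r = c.event P (pick c.m P.p r) := if_pos h
      have hcnt : (c.step P r).cnt = c.cnt + P.size (pick c.m P.p r) := by rw [hst]; rfl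
      refine ⟨by rw [hst]; exact i1, f2.tick.trans i2, ?_, ?_⟩
      · rw [hcnt, i3]; simp only [State.tick_calls]; omega
      · rw [hcnt, mul_add (timeUnit d)]
        have : timeUnit d ≤ timeUnit d * P.size (pick c.m P.p r) := Nat.le_mul_of_pos_right _ hs0
        simp only [State.tick_time, Cond.cost, cost_nvar] at i4
        omega
    · simp only [Cond.Holds, eval_nvar, r14, rep2.total] at h
      refine (Total.checkProg (s := s2.tick _) hP hpq hn1 (env2.of_frame Frame.refl.tick)
        ⟨rep2.x, rep2.m, rep2.pr, rep2.total, rep2.dep, rep2.L, rep2.cnt⟩ hy hy0).mono ?_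
      rintro s' ⟨i1, i2, i3, i4⟩
      have hst : c.step P r = c.check P := if_neg h
      have hcnt : (c.step P r).cnt = c.cnt + n := by
        rw [hst]; subst hP; rfl
      refine ⟨by rw [hst]; exact i1, f2.tick.trans i2, ?_, ?_⟩
      · rw [hcnt, i3]; simp only [State.tick_calls]; omega
      · rw [hcnt, mul_add (timeUnit d)]
        have : timeUnit d ≤ timeUnit d * n := Nat.le_mul_of_pos_right _ hn1
        simp only [State.tick_time, Cond.cost, cost_nvar] at i4
        omega
  refine .seq (key.mono ?_)
  rintro s3 ⟨b1, b2, b3, b4⟩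
  have env3 := env.of_frame b2
  have hpos : c.cnt + 1 ≤ (c.step P r).cnt :=
    Core.cnt_step_gt (by subst hP; exact hn1) hsize r
  have hpos' : timeUnit d * c.cnt + 1 ≤ timeUnit d * (c.step P r).cnt :=
    calc timeUnit d * c.cnt + 1 ≤ timeUnit d * c.cnt + timeUnit d := by omega
      _ = timeUnit d * (c.cnt + 1) := by ring
      _ ≤ _ := Nat.mul_le_mul_left _ hpos
  have hrep : ∀ v t, CoreRep P (c.step P r) { s3 with nat := upd s3.nat 20 0 v, time := t } :=
    fun v t => ⟨b1.x, by simpa using b1.m, b1.pr, by simpa using b1.total, b1.dep, b1.L,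
      by simpa using b1.cnt⟩
  refine .ite (fun h => .setNat ⟨hrep _ _, b2.tick.setNat, ?_, b3, ?_⟩)
    fun h => .setNat ⟨hrep _ _, b2.tick.setNat, ?_, b3, ?_⟩
  · simp only [Cond.Holds, RExpr.eval, eval_nvar, eval_rvar, b1.cnt, env3.lim] at h
    simp [NExpr.eval, goFlag, if_pos h, b1.total]
  · simp [NExpr.cost, RExpr.cost, Cond.cost]
    omega
  · simp only [Cond.Holds, RExpr.eval, eval_nvar, eval_rvar, b1.cnt, env3.lim] at h
    simp [NExpr.eval, goFlag, if_neg h]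
  · simp [NExpr.cost, RExpr.cost, Cond.cost]
    omega

/-- The loop of the core procedure. -/
def coreLoop : Prog := .while (.natLe (.const 1) (nvar 20)) coreBody

/-- The core procedure, started in `s`, has ended in `s'` with the abstract state `c`. -/
structure CoreExit (P : CoreData d) (β : Fin d → ℝ) (A κ lim : ℝ) (X : Set (Fin d → ℝ))
    (Y : ℕ → Set (Fin d → ℝ)) (s : State) (c : Core d) (s' : State) : Prop where
  rep : CoreRep P c s'
  inv : c.Inv P β A κ X Y
  frame : CoreFrame s s'
  calls : s'.calls = s.calls + c.cnt
  time : s'.time ≤ s.time + 4000 * (timeUnit d * c.cnt) + 10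
  cnt_le : (c.cnt : ℝ) ≤ max 0 lim + P.n
  cnt_pos : 0 < c.cnt
  done : c.total P = 0 ∨ lim < c.cnt

/-- Termination in every run is forced by the limit on the number of calls, which grows in each
iteration. The failure probability is the initial potential. The bound `hchk` makes the exponent of
a check at most δ, as the supermartingale property requires. -/
theorem Prob.coreLoop {P : CoreData d} {β : Fin d → ℝ} {A δ τ lim Λ Z : ℝ}
    {X : Set (Fin d → ℝ)} {Y : ℕ → Set (Fin d → ℝ)} {s : State}
    {p q : ℕ} {price : (Fin d → ℝ) → Fin d → ℝ} {floor cap T : ℝ}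
    (hP : P = coreData f p q price floor cap T) (V : Core.Valid P β A δ τ X Y) (hpd : P.p ≤ d)
    (hpq : n ≤ p * q) (hn1 : 0 < n) (hsize : ∀ g < P.p, 0 < P.size g) (hsize' : ∀ g < P.p, P.size g ≤ n)
    (env : CoreEnv P β A lim s) (rep : CoreRep P (Core.init d) s)
    (hgo : s.nat 20 0 = goFlag P lim (Core.init d)) (hlim : 0 ≤ lim) (hδ : δ ≤ 1 / 8) (hΛ : 0 < Λ)
    (hZ : 0 < Z) (hchk : ∀ c : Core d, c.checkVal P ≤ Λ) (hX : ∀ z ∈ X, 0 ≤ orderedNorm β z) :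
    Prob f coreLoop s (fun s' => ∃ c, CoreExit P β A (τ * (1 + δ)) lim X Y s c s')
      (fun s' => ∃ c, CoreExit P β A (τ * (1 + δ)) lim X Y s c s' ∧ c.pot P (δ / Λ) δ Z < 1)
      ((1 + P.p) / Z) := by
  have hη : 0 ≤ δ / Λ := div_nonneg V.δ_pos.le hΛ.le
  have hηV : ∀ c : Core d, δ / Λ * c.checkVal P ≤ δ := fun c => by
    rw [div_mul_eq_mul_div, div_le_iff₀ hΛ]
    exact mul_le_mul_of_nonneg_left (hchk c) V.δ_pos.le
  have hPn : P.n = n := by subst hP; rfl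
  rw [← Core.pot_init (P := P) (δ := δ) (η := δ / Λ)]
  refine Prob.while_potential (A := Core d) (R := fun c s' => CoreRep P c s' ∧
      c.Inv P β A (τ * (1 + δ)) X Y ∧ CoreFrame s s' ∧ s'.nat 20 0 = goFlag P lim c ∧
      s'.calls = s.calls + c.cnt ∧ s'.time ≤ s.time + 4000 * (timeUnit d * c.cnt) ∧
      (c.cnt : ℝ) ≤ max 0 lim + P.n ∧ (c = Core.init d ∨ 0 < c.cnt))
    (φ := fun c => c.pot P (δ / Λ) δ Z) (μ := fun c => ⌊lim⌋₊ + 1 - c.cnt)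
    (fun c s' _ => Core.pot_nonneg hZ.le) ?_ ?_ _ _ _ le_rfl ?_
  · rintro c s' ⟨h1, h2, h3, h4, h5, h6, h7, -⟩ hb
    simp only [Cond.Holds, NExpr.eval, eval_nvar, h4] at hb
    have hlim : (c.cnt : ℝ) ≤ lim := by
      by_contra hcon
      rw [goFlag, if_neg hcon] at hb
      omega
    rw [goFlag, if_pos hlim] at hb
    have hfl : c.cnt ≤ ⌊lim⌋₊ := Nat.le_floor hlim
    refine ⟨c.total P, c.step P, ?_, Core.sum_pot_le V hη hδ (hηV c) hZ⟩
    have env' := (env.of_frame h3).of_frame (s' := s'.tick _)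
      (Frame.refl.tick (c := (Cond.natLe (.const 1) (nvar 20)).cost))
    obtain ⟨g, hg1, hg2⟩ := Branch.coreBody (s := s'.tick _) hP V hpd hpq hn1 hsize env'
      ⟨h1.x, h1.m, h1.pr, h1.total, h1.dep, h1.L, h1.cnt⟩ (Core.mem_nonneg V h2)
    refine ⟨g, hg1, fun r hr => ?_⟩
    obtain ⟨i1, i2, i3, i4, i5⟩ := hg2 r hr
    have hstep := Core.cnt_step_gt (c := c) (by rw [hPn]; exact hn1) hsize r
    simp only [State.tick_calls, State.tick_time, Cond.cost, NExpr.cost, cost_nvar] at i4 i5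
    have hpos' : timeUnit d * c.cnt ≤ timeUnit d * (c.step P r).cnt :=
      Nat.mul_le_mul_left _ hstep.le
    have hle : (c.step P r).cnt ≤ c.cnt + P.n := by
      unfold Core.step
      split_ifs with hr'
      · have := hsize' _ (pick_spec hr').1
        simp only [Core.event]; omega
      · simp only [Core.check]; omega
    refine ⟨⟨i1, Core.inv_step V h2 (by omega) r, h3.tick.trans i2, i3, by omega, ?_, ?_, .inr (by omega)⟩,
      by omega⟩
    · have hU : 1 ≤ timeUnit d := (Nat.le_add_left 1 d).trans (le_timeUnit d)
      have hpos'' : timeUnit d * c.cnt + 1 ≤ timeUnit d * (c.step P r).cnt :=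
        calc timeUnit d * c.cnt + 1 ≤ timeUnit d * c.cnt + timeUnit d := by omega
          _ = timeUnit d * (c.cnt + 1) := by ring
          _ ≤ _ := Nat.mul_le_mul_left _ hstep
      omega
    · have : ((c.step P r).cnt : ℝ) ≤ c.cnt + P.n := by exact_mod_cast hle
      have := le_max_right 0 lim
      linarith
  · rintro c s' ⟨h1, h2, h3, h4, h5, h6, h7, h8⟩ hb
    simp only [Cond.Holds, NExpr.eval, eval_nvar, h4, not_le] at hb
    -- The loop cannot stop in the initial state, where all p ≥ 1 multiplicities are 1 and no call
    -- has been counted.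
    have hpos : 0 < c.cnt := h8.resolve_left fun h => by
      rw [h, goFlag, if_pos (by simpa [Core.init] using hlim)] at hb
      simp only [Core.total, Core.init, Finset.sum_const, Finset.card_range, smul_eq_mul] at hb
      have := V.p_pos
      omega
    have hexit : CoreExit P β A (τ * (1 + δ)) lim X Y s c
        (s'.tick (Cond.natLe (.const 1) (nvar 20)).cost) := by
      refine ⟨⟨h1.x, h1.m, h1.pr, h1.total, h1.dep, h1.L, h1.cnt⟩, h2, h3.tick, h5, ?_, h7, hpos, ?_⟩
      · simp only [State.tick_time, Cond.cost, NExpr.cost, cost_nvar]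
        omega
      · by_cases hlim : (c.cnt : ℝ) ≤ lim
        · rw [goFlag, if_pos hlim] at hb
          exact .inl (by omega)
        · exact .inr (not_le.1 hlim)
    refine ⟨⟨c, hexit⟩, ?_⟩
    by_cases hpot : c.pot P (δ / Λ) δ Z < 1
    · exact .inl ⟨c, hexit, hpot⟩
    · exact .inr (not_lt.1 hpot)
  · refine ⟨rep, Core.inv_init V hX, .refl, hgo, by simp [Core.init], by simp [Core.init], ?_, .inl rfl⟩
    have h1 := le_max_left 0 lim
    have h2 : (0 : ℝ) ≤ P.n := Nat.cast_nonneg _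
    simp only [Core.init, Nat.cast_zero]
    linarith

end RealRAM

/-! ## The optimum -/

variable {n d : ℕ}

/-- The infimum of the ordered norm over the feasible set. -/
def optimum (β : Fin d → ℝ) (X : Set (Fin d → ℝ)) : ℝ := sInf (orderedNorm β '' X)

theorem optimum_le {β : Fin d → ℝ} {X : Set (Fin d → ℝ)} (h0 : ∀ z ∈ X, 0 ≤ orderedNorm β z)
    {z : Fin d → ℝ} (hz : z ∈ X) : optimum β X ≤ orderedNorm β z :=
  csInf_le ⟨0, by rintro _ ⟨w, hw, rfl⟩; exact h0 w hw⟩ ⟨z, hz, rfl⟩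

/-- Working with the infimum avoids the need for a minimizer: a bound against every feasible point
passes to it. -/
theorem le_mul_optimum {β : Fin d → ℝ} {X : Set (Fin d → ℝ)} (hX : X.Nonempty) {κ t : ℝ}
    (hκ : 0 < κ) (h : ∀ z ∈ X, t ≤ κ * orderedNorm β z) : t ≤ κ * optimum β X := by
  rw [← div_le_iff₀' hκ]
  refine le_csInf (hX.image _) ?_
  rintro _ ⟨z, hz, rfl⟩
  rw [div_le_iff₀' hκ]
  exact h z hz

namespace RealRAM

variable {f : Fin n → (Fin d → ℝ) → Fin d → ℝ}

/-! ## The core procedure with its parameters -/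

/-- There are `p` non-empty groups of at most `q` customers. -/
structure IsGrouping (n d p q : ℕ) : Prop where
  lt : (p - 1) * q < n
  le : n ≤ p * q
  lower : n ≤ q * d
  upper : q * d < n + d

namespace IsGrouping

variable {p q : ℕ}

theorem pos (h : IsGrouping n d p q) : 0 < p := by
  rcases Nat.eq_zero_or_pos p with rfl | hp
  · have h1 := h.lt; have h2 := h.le; omega
  · exact hp

theorem q_pos (h : IsGrouping n d p q) : 0 < q := by
  rcases Nat.eq_zero_or_pos q with rfl | hp
  · have h1 := h.lt; have h2 := h.le; omega
  · exact hp

theorem p_le (h : IsGrouping n d p q) : p ≤ d := by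
  have h1 : (p - 1) * q < d * q := by rw [mul_comm d]; exact h.lt.trans_le h.lower
  have := Nat.lt_of_mul_lt_mul_right h1
  omega

theorem q_le (h : IsGrouping n d p q) (hd : 0 < d) : q ≤ n := by
  by_contra hc
  have h1 : n + 1 ≤ q := by omega
  have h2 := Nat.mul_le_mul_right d h1
  have h3 := h.upper
  have h4 : n ≤ n * d := Nat.le_mul_of_pos_right _ hd
  rw [add_mul] at h2
  omega

theorem mul_le (h : IsGrouping n d p q) (hd : 0 < d) : q * p ≤ 2 * n := by
  obtain ⟨k, rfl⟩ : ∃ k, p = k + 1 := ⟨p - 1, by have := h.pos; omega⟩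
  have h1 := h.lt
  have h2 := h.q_le hd
  simp only [Nat.add_sub_cancel] at h1
  rw [mul_add, mul_comm q k]
  omega

theorem size (h : IsGrouping n d p q) {g : ℕ} (hg : g < p) :
    0 < groupStart n q (g + 1) - groupStart n q g ∧
    groupStart n q (g + 1) - groupStart n q g ≤ q ∧
    groupStart n q (g + 1) - groupStart n q g ≤ n := by
  have h1 : g * q < n := (Nat.mul_le_mul_right q (by omega)).trans_lt h.lt
  have h2 := h.q_pos
  simp only [groupStart, add_mul, one_mul]
  omega

end IsGrouping

/-- The input, the sum of the weights, the logarithm and the `p` groups of size `q` are in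
memory. -/
structure Setup (n : ℕ) (β : Fin d → ℝ) (τ : ℝ) (p q : ℕ) (s : State) : Prop where
  input : InputRep n β s
  tau : s.real 1 1 = τ
  sum : s.real 25 0 = ∑ j, β j
  ell : s.real 26 0 = Real.log (n + d)
  groups : s.nat 11 0 = p
  start : ∀ g ≤ p, s.nat 22 g = groupStart n q g

theorem Setup.of_frame {β : Fin d → ℝ} {τ : ℝ} {p q : ℕ} {s s' : State} {N R : List ℕ}
    (h : Setup n β τ p q s) (hf : Frame N R s s')
    (hN : 0 ∉ N ∧ 11 ∉ N ∧ 22 ∉ N := by simp)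
    (hR : 0 ∉ R ∧ 1 ∉ R ∧ 25 ∉ R ∧ 26 ∉ R := by simp) : Setup n β τ p q s' := by
  obtain ⟨n0, n11, n22⟩ := hN
  obtain ⟨r0, r1, r25, r26⟩ := hR
  refine ⟨⟨?_, ?_, ?_⟩, ?_, ?_, ?_, ?_, ?_⟩
  · rw [hf.nat 0 n0]; exact h.input.count
  · rw [hf.nat 0 n0]; exact h.input.dim
  · rw [hf.real 0 r0]; exact h.input.weight
  · rw [hf.real 1 r1]; exact h.tau
  · rw [hf.real 25 r25]; exact h.sum
  · rw [hf.real 26 r26]; exact h.ell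
  · rw [hf.nat 11 n11]; exact h.groups
  · rw [hf.nat 22 n22]; exact h.start

/-- The scale of the progress for accuracy `δ`. -/
def horizon (n d : ℕ) (τ δ : ℝ) : ℝ := 40 * τ * Real.log (n + d) / (δ * δ)

/-- The largest number of oracle calls after which the core procedure continues. -/
def callLimit (n d : ℕ) (τ δ : ℝ) : ℝ := 200 * (τ * τ) * ((n + d) * horizon n d τ δ)

/-- Computes the parameters of the core procedure for the guess and the accuracy in the real
variables `22` and `23`. -/
def coreParams : Prog :=
  .seq (.setReal 16 (.const 0) (.div (.mul (.mul (rnum 40) (.get 1 (.const 1))) (rvar 26))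
    (.mul (rvar 23) (rvar 23))))
  (.seq (.setReal 11 (.const 0) (.div (.mul (rvar 23) (rvar 25)) (rvar 22)))
  (.seq (.setReal 12 (.const 0) (.div (.mul (rvar 23) (rvar 25)) (.ofNat (.get 0 (.const 1)))))
  (.seq (.setReal 15 (.const 0) (.div (rvar 22) (.ofNat (.get 0 (.const 1)))))
  (.seq (.setReal 19 (.const 0) (.mul (.mul (rnum 200) (.mul (.get 1 (.const 1)) (.get 1 (.const 1))))
    (.mul (.add (.ofNat (nvar 0)) (.ofNat (.get 0 (.const 1)))) (rvar 16))))
  (.seq (.setReal 17 (.const 0) (rnum 0))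
  (.seq (.setReal 18 (.const 0) (rnum 0))
  (forLoop 8 (.const 0) (.get 0 (.const 1)) (.setReal 3 (nvar 8) (rnum 0)))))))))

/-- The parameters of the core procedure for the guess `lam` and the accuracy `δ` are in memory, and
the load is `0`. -/
structure ParamRep (n : ℕ) (β : Fin d → ℝ) (τ lam δ : ℝ) (s : State) : Prop where
  A : s.real 11 0 = δ * (∑ j, β j) / lam
  floor : s.real 12 0 = δ * (∑ j, β j) / d
  cap : s.real 15 0 = lam / d
  T : s.real 16 0 = horizon n d τ δ
  lim : s.real 19 0 = callLimit n d τ δ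
  dep : s.real 17 0 = 0
  L : s.real 18 0 = 0
  x : ∀ j < d, s.real 3 j = 0

theorem Total.coreParams {β : Fin d → ℝ} {τ lam δ : ℝ} {p q : ℕ} {s : State}
    (h : Setup n β τ p q s) (hlam : s.real 22 0 = lam) (hδ : s.real 23 0 = δ) :
    Total f coreParams s fun s' => ParamRep n β τ lam δ s' ∧
      Frame [8] [3, 11, 12, 15, 16, 17, 18, 19] s s' ∧ s'.calls = s.calls ∧
      s'.time ≤ s.time + 200 * timeUnit d := by
  refine .seq (.setReal (.seq (.setReal (.seq (.setReal (.seq (.setReal (.seq (.setReal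
    (.seq (.setReal (.seq (.setReal ?_)))))))))))))
  refine (Total.forLoop (c := 20) (a := 0) (N := d) (I := fun k s' =>
    (s'.real 11 0 = δ * (∑ j, β j) / lam ∧ s'.real 12 0 = δ * (∑ j, β j) / d ∧
    s'.real 15 0 = lam / d ∧ s'.real 16 0 = horizon n d τ δ ∧
    s'.real 19 0 = callLimit n d τ δ ∧ s'.real 17 0 = 0 ∧ s'.real 18 0 = 0) ∧
    (∀ j < k, s'.real 3 j = 0) ∧ Frame [8] [3, 11, 12, 15, 16, 17, 18, 19] s s' ∧
    s'.calls = s.calls) rfl (Nat.zero_le _) ?_ ?_ ?_ ?_).mono ?_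
  · rintro k s' v t ⟨h1, h2, h3, h4⟩
    exact ⟨h1, h2, h3.setNat, h4⟩
  · rintro k s' ⟨-, -, h1, -⟩
    simp only [NExpr.eval, h1.nat 0 (by simp), h.input.dim]
  · rintro k s' - hk ⟨h1, h2, h3, h4⟩ h5
    refine .setReal ⟨⟨?_, fun j hj => ?_, h3.setReal, h4⟩, h5, ?_⟩
    · simpa using h1
    · simp only [eval_rnum, Nat.cast_zero, eval_nvar, h5, upd_same]
      rcases Nat.lt_succ_iff_lt_or_eq.1 hj with hj | rfl
      · rw [Function.update_of_ne (by omega), h2 j hj]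
      · rw [Function.update_self]
    · simp
  · have f1 : Frame [8] [3, 11, 12, 15, 16, 17, 18, 19] s s := .refl
    refine ⟨?_, by simp, f1.setReal.setReal.setReal.setReal.setReal.setReal.setReal, rfl⟩
    simp [RExpr.eval, NExpr.eval, h.input.count, h.input.dim, h.tau, h.sum, h.ell, hlam, hδ,
      horizon, callLimit]
  · rintro s' ⟨⟨⟨h1, h2, h3, h4, h5, h6, h7⟩, h8, h9, h10⟩, -, h11⟩
    refine ⟨⟨h1, h2, h3, h4, h5, h6, h7, h8⟩, h9, h10, ?_⟩
    have := le_timeUnit d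
    simp only [NExpr.cost, RExpr.cost, cost_nvar, cost_rvar, cost_rnum] at h11
    omega

/-- Resets the groups. -/
def resetGroups : Prog :=
  .seq (forLoop 8 (.const 0) (nvar 11)
    (.seq (.setNat 12 (nvar 8) (.const 1)) (.setReal 13 (nvar 8) (rnum 0))))
  (.seq (.setNat 13 (.const 0) (nvar 11))
  (.seq (.setNat 19 (.const 0) (.const 0))
  (.setNat 20 (.const 0) (nvar 11))))

theorem Total.resetGroups {p : ℕ} {s : State} (hp : s.nat 11 0 = p) (hpd : p ≤ d) :
    Total f resetGroups s fun s' => (∀ g < p, s'.nat 12 g = 1) ∧ (∀ g < p, s'.real 13 g = 0) ∧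
      s'.nat 13 0 = p ∧ s'.nat 19 0 = 0 ∧ s'.nat 20 0 = p ∧
      Frame [8, 12, 13, 19, 20] [13] s s' ∧ s'.calls = s.calls ∧
      s'.time ≤ s.time + 100 * timeUnit d := by
  refine .seq ((Total.forLoop (c := 20) (a := 0) (N := p) (I := fun k s' =>
    (∀ g < k, s'.nat 12 g = 1) ∧ (∀ g < k, s'.real 13 g = 0) ∧
    Frame [8, 12, 13, 19, 20] [13] s s' ∧ s'.calls = s.calls)
    rfl (Nat.zero_le _) ?_ ?_ ?_ ?_).mono ?_)
  · rintro k s' v t ⟨h1, h2, h3, h4⟩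
    exact ⟨by simpa using h1, h2, h3.setNat, h4⟩
  · rintro k s' ⟨-, -, h1, -⟩
    simp only [eval_nvar, h1.nat 11 (by simp), hp]
  · rintro k s' - hk ⟨h1, h2, h3, h4⟩ h5
    refine .seq (.setNat (.setReal ⟨⟨fun j hj => ?_, fun j hj => ?_, h3.setNat.setReal, h4⟩, ?_, ?_⟩))
    · simp only [NExpr.eval, eval_nvar, h5, upd_same]
      rcases Nat.lt_succ_iff_lt_or_eq.1 hj with hj | rfl
      · rw [Function.update_of_ne (by omega), h1 j hj]
      · rw [Function.update_self]
    · simp only [eval_rnum, Nat.cast_zero, eval_nvar, upd_of_ne _ _ _ _ (show (8 : ℕ) ≠ 12 by norm_num),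
        h5, upd_same]
      rcases Nat.lt_succ_iff_lt_or_eq.1 hj with hj | rfl
      · rw [Function.update_of_ne (by omega), h2 j hj]
      · rw [Function.update_self]
    · simpa using h5
    · simp [NExpr.cost]
  · exact ⟨by simp, by simp, .refl, rfl⟩
  rintro s1 ⟨⟨h1, h2, h3, h4⟩, -, h5⟩
  have e11 := h3.nat 11 (by simp)
  refine .seq (.setNat (.seq (.setNat (.setNat ⟨?_, h2, ?_, ?_, ?_,
    h3.setNat.setNat.setNat, h4, ?_⟩))))
  · simpa using h1
  · simp [e11, hp, NExpr.eval]
  · simp [NExpr.eval]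
  · simp [e11, hp, NExpr.eval]
  · have := le_timeUnit d
    simp only [NExpr.cost, cost_nvar, Nat.sub_zero] at h5 ⊢
    have : p * (20 + 2 + 20) ≤ d * (20 + 2 + 20) := Nat.mul_le_mul_right _ hpd
    omega

/-- The core procedure. -/
def coreProg : Prog := .seq coreParams (.seq resetGroups coreLoop)

/-- The bound on the ordered norm of the mean load that the core procedure gives. -/
def normBound (n d : ℕ) (τ lam δ : ℝ) (s : State) : ℝ :=
  (lam * Real.log d / δ + s.real 17 0) / horizon n d τ δ

/-- The result of the core procedure that has been started in `s`. -/
structure CoreResult (n : ℕ) (β : Fin d → ℝ) (τ lam δ : ℝ) (X : Set (Fin d → ℝ)) (s s' : State) :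
    Prop where
  frame : Frame [2, 3, 4, 5, 6, 7, 8, 9, 12, 13, 14, 15, 16, 17, 19, 20, 23, 24]
    [3, 4, 5, 6, 7, 8, 9, 10, 11, 12, 13, 14, 15, 16, 17, 18, 19] s s'
  calls_gt : s.calls < s'.calls
  calls_le : (s'.calls : ℝ) ≤ s.calls + callLimit n d τ δ + n
  time : s'.time + 4400 * (timeUnit d * s.calls) ≤ s.time + 4400 * (timeUnit d * s'.calls)
  T : s'.real 16 0 = horizon n d τ δ
  L : ∀ z ∈ X, s'.real 18 0 ≤ τ * (1 + δ) * orderedNorm β z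
  feasible : s'.nat 13 0 = 0 → (fun j : Fin d => s'.real 3 j / s'.real 16 0) ∈ X
  norm_le : orderedNorm β (fun j : Fin d => s'.real 3 j / s'.real 16 0) ≤ normBound n d τ lam δ s'

theorem log_count_pos (hn : 1 ≤ n) (hd : 1 ≤ d) : 1 / 2 ≤ Real.log (n + d : ℝ) := by
  have h1 : (2 : ℝ) ≤ n + d := by exact_mod_cast (by omega : 2 ≤ n + d)
  have := Real.log_le_log (by norm_num) h1
  linarith [Real.log_two_gt_d9]

theorem horizon_pos {τ δ : ℝ} (hn : 1 ≤ n) (hd : 1 ≤ d) (hτ : 0 < τ) (hδ : 0 < δ) :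
    0 < horizon n d τ δ := by
  have := log_count_pos hn hd
  exact div_pos (mul_pos (by linarith) (by linarith)) (mul_pos hδ hδ)

/-- With A = δ (∑ β)/lam the entropy loss is lam (log d)/δ. The factor 40 in the horizon makes it a
fraction δ/40 of the guess per unit of progress. -/
theorem entropy_le_horizon {τ δ lam : ℝ} (hd : 1 ≤ d) (hτ : 1 ≤ τ) (hδ : 0 < δ) (hlam : 0 < lam) :
    lam * Real.log d / δ ≤ δ * lam / 40 * horizon n d τ δ := by
  have hd0 : (1 : ℝ) ≤ d := by exact_mod_cast hd
  have hn0 : (0 : ℝ) ≤ n := Nat.cast_nonneg _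
  have hlog : Real.log d ≤ Real.log (n + d) := Real.log_le_log (by linarith) (by linarith)
  have hlog0 := Real.log_nonneg hd0
  have h1 : δ * lam / 40 * horizon n d τ δ = lam * (τ * Real.log (n + d)) / δ := by
    rw [horizon]; field_simp
  rw [h1]
  refine div_le_div_of_nonneg_right (mul_le_mul_of_nonneg_left (hlog.trans ?_) hlam.le) hδ.le
  nlinarith

theorem le_callLimit {τ δ : ℝ} (hn : 1 ≤ n) (hd : 1 ≤ d) (hτ : 1 ≤ τ) (hδ : 0 < δ) :
    (6 * n + 10 * (16 * (τ * τ) * (n + d))) * horizon n d τ δ ≤ callLimit n d τ δ := by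
  rw [callLimit, ← mul_assoc (200 * (τ * τ))]
  refine mul_le_mul_of_nonneg_right ?_ (horizon_pos hn hd (by linarith) hδ).le
  have h1 : 1 ≤ τ * τ := by nlinarith
  have h2 : (0 : ℝ) ≤ d := Nat.cast_nonneg _
  have h3 : (0 : ℝ) ≤ n := Nat.cast_nonneg _
  have h4 : (1 : ℝ) * (n + d) ≤ τ * τ * (n + d) := mul_le_mul_of_nonneg_right h1 (by linarith)
  linarith

/-- This is the bound qΛ ≤ W · cap of the call count, with W = 16 τ² (n + d). The choice of q gives
q d ≤ n + d, and 15 (1 + 1/40) ≤ 16. -/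
theorem group_value_le {τ δ lam o : ℝ} {q : ℕ} (hd : 1 ≤ d) (hτ : 1 ≤ τ) (hδ0 : 0 < δ)
    (hδ1 : δ ≤ 1 / 40) (hlam : 0 < lam) (hq : q * d ≤ n + d) (hopt : o ≤ 15 * τ * lam) :
    (q : ℝ) * (τ * (1 + δ) * o) ≤ (16 * (τ * τ) * (n + d)) * (lam / d) := by
  have hd0 : (0 : ℝ) < d := by exact_mod_cast hd
  have hq' : (q : ℝ) * d ≤ n + d := by exact_mod_cast hq
  have h1 : τ * (1 + δ) * o ≤ 16 * (τ * τ) * lam := by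
    calc τ * (1 + δ) * o ≤ τ * (1 + δ) * (15 * τ * lam) :=
          mul_le_mul_of_nonneg_left hopt (by positivity)
      _ = 15 * (1 + δ) * (τ * τ * lam) := by ring
      _ ≤ 16 * (τ * τ * lam) := mul_le_mul_of_nonneg_right (by linarith) (by positivity)
      _ = _ := by ring
  calc (q : ℝ) * (τ * (1 + δ) * o) ≤ q * (16 * (τ * τ) * lam) :=
        mul_le_mul_of_nonneg_left h1 (by positivity)
    _ = 16 * (τ * τ) * (q * d) * (lam / d) := by field_simp
    _ ≤ _ := by gcongr

-- The normalization of the potential is exp(δ² T) = exp(40 τ log(n+d)). Feasibility, the norm bound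
-- and the bound on L hold in every run. A guess that is not too small (`optimum ≤ 15 τ lam`)
-- additionally ensures, if the potential stays below 1, that all groups finish before the limit on
-- the calls and that the norm bound is close to L.
set_option maxHeartbeats 600000 in
theorem Prob.coreProg {β : Fin d → ℝ} {τ lam δ : ℝ} {p q : ℕ} {s : State}
    {X : Fin n → Set (Fin d → ℝ)} (hn : 1 ≤ n) (hd : 1 ≤ d) (hβ : IsOrderedWeight β)
    (hτ : 1 ≤ τ) (hc : ∀ c, Convex ℝ (X c)) (h0 : ∀ c, ∀ x ∈ X c, ∀ j, 0 ≤ x j)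
    (hf : ∀ c, IsLinMinOracle τ (X c) (f c)) (hX : (feasibleSet X).Nonempty)
    (ho : 0 < optimum β (feasibleSet X)) (hg : IsGrouping n d p q)
    (h : Setup n β τ p q s) (hlam : s.real 22 0 = lam) (hδ : s.real 23 0 = δ)
    (hlam0 : 0 < lam) (hδ0 : 0 < δ) (hδ1 : δ ≤ 1 / 40) :
    Prob f coreProg s (CoreResult n β τ lam δ (feasibleSet X) s)
      (fun s' => optimum β (feasibleSet X) ≤ 15 * τ * lam → s'.nat 13 0 = 0 ∧
        normBound n d τ lam δ s' ≤ (1 + 9 * δ) * s'.real 18 0 +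
          δ * (τ * (1 + δ) * optimum β (feasibleSet X)) + δ * lam / 40)
      ((1 + p) / Real.exp (40 * τ * Real.log (n + d))) := by
  have hd0 : (0 : ℝ) < d := by exact_mod_cast hd
  have hn0 : (0 : ℝ) < n := by exact_mod_cast hn
  have hB := hβ.sum_pos
  have hℓ := log_count_pos hn hd
  set o := optimum β (feasibleSet X) with ho'
  set A := δ * (∑ j, β j) / lam with hA
  have hA0 : 0 < A := by positivity
  choose price hprice using exists_isPrice hd hβ hA0
  set T := horizon n d τ δ with hT
  have hT0 : 0 < T := horizon_pos hn hd (by linarith) hδ0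
  set P : CoreData d := coreData f p q price (δ * (∑ j, β j) / d) (lam / d) T with hP
  have hlim0 : 0 < callLimit n d τ δ := by
    rw [callLimit]; have := hT0; positivity
  have hnorm : ∀ z ∈ feasibleSet X, 0 ≤ orderedNorm β z := fun z hz => by
    exact Finset.sum_nonneg fun i _ => mul_nonneg (hβ.nonneg i) (abs_nonneg _)
  have V : Core.Valid P β A δ τ (feasibleSet X)
      (fun g => rangeSet X (groupStart n q g) (groupStart n q (g + 1))) := by
    refine ⟨hβ, hd, isGroupOracle hc h0 hf hg.le, hprice, hA0, hδ0, by linarith, div_pos hlam0 hd0, hT0,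
      ?_, ?_, hg.pos, fun g hgp => (hg.size hgp).2.1⟩
    · show δ * (∑ j, β j) / d = A * (lam / d)
      rw [hA]; field_simp
    · show δ * (∑ j, β j) / d = δ * ((∑ j, β j) / d)
      rw [mul_div_assoc]
  have hδT : δ ^ 2 * T = 40 * τ * Real.log (n + d) := by
    rw [hT, horizon]; field_simp
  set Λ := τ * (1 + δ) * o with hΛ
  have hΛ0 : 0 < Λ := by positivity
  have hw : 0 ≤ (1 + p) / Real.exp (40 * τ * Real.log (n + d)) := by positivity
  refine .total_seq hw ((Total.coreParams h hlam hδ).mono ?_)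
  rintro s1 ⟨a1, a2, a3, a4⟩
  have S1 := h.of_frame a2
  refine .total_seq hw ((Total.resetGroups S1.groups hg.p_le).mono ?_)
  rintro s2 ⟨b1, b2, b3, b4, b5, b6, b7, b8⟩
  have S2 := S1.of_frame b6
  have env : CoreEnv P β A (callLimit n d τ δ) s2 := by
    refine ⟨S2.input, ?_, ?_, ?_, ?_, ?_, S2.start⟩
    · rw [b6.real 11 (by simp), a1.A]
    · rw [b6.real 12 (by simp), a1.floor]; rfl
    · rw [b6.real 15 (by simp), a1.cap]; rfl
    · rw [b6.real 16 (by simp), a1.T]; rfl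
    · rw [b6.real 19 (by simp), a1.lim]
  have htot : (Core.init d).total P = p := by simp [Core.total, Core.init, hP, coreData]
  have rep : CoreRep P (Core.init d) s2 := by
    refine ⟨fun j => ?_, b1, b2, by rw [b3, htot], ?_, ?_, b4⟩
    · rw [b6.real 3 (by simp), a1.x j j.2]; rfl
    · rw [b6.real 17 (by simp), a1.dep]; rfl
    · rw [b6.real 18 (by simp), a1.L]; rfl
  have hgo : s2.nat 20 0 = goFlag P (callLimit n d τ δ) (Core.init d) := by
    rw [b5, goFlag, if_pos (by simpa [Core.init] using hlim0.le), htot]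
  have hframe : ∀ {s'}, CoreFrame s2 s' → Frame
      [2, 3, 4, 5, 6, 7, 8, 9, 12, 13, 14, 15, 16, 17, 19, 20, 23, 24]
      [3, 4, 5, 6, 7, 8, 9, 10, 11, 12, 13, 14, 15, 16, 17, 18, 19] s s' := fun hfr =>
    ((Frame.refl.trans a2).trans b6).trans hfr
  refine (Prob.coreLoop (X := feasibleSet X) (Λ := Λ)
    (Z := Real.exp (40 * τ * Real.log (n + d))) hP V hg.p_le hg.le hn
    (fun g hgp => (hg.size hgp).1) (fun g hgp => (hg.size hgp).2.2) env rep hgo hlim0.le (by linarith) hΛ0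
    (Real.exp_pos _) (fun c => ?_) hnorm).mono ?_ ?_ le_rfl
  · exact le_mul_optimum hX (by positivity) fun z hz => V.checkVal_le c hz
  · rintro s' ⟨c, hc⟩
    have e16 : s'.real 16 0 = T := by
      rw [hc.frame.real 16 (by simp), env.T]; rfl
    have hx : (fun j : Fin d => s'.real 3 j / s'.real 16 0) = P.T⁻¹ • c.x := by
      funext j
      rw [e16, hc.rep.x j, Pi.smul_apply, smul_eq_mul, inv_mul_eq_div]; rfl
    have hcnt : 1 ≤ c.cnt := hc.cnt_pos
    refine ⟨hframe hc.frame, ?_, ?_, ?_, e16, ?_, fun hfin => ?_, ?_⟩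
    · rw [hc.calls, b7, a3]; omega
    · have := hc.cnt_le
      rw [max_eq_right hlim0.le] at this
      have hPn : (P.n : ℝ) = n := rfl
      rw [hc.calls, b7, a3]; push_cast; linarith
    · have := hc.time
      have hu : timeUnit d * 1 ≤ timeUnit d * c.cnt := Nat.mul_le_mul_left _ hcnt
      have := le_timeUnit d
      rw [hc.calls, b7, a3, mul_add]
      omega
    · intro z hz
      rw [hc.rep.L]; exact hc.inv.L_le z hz
    · rw [hx]
      exact Core.mem_of_finished V hc.inv (by rw [← hc.rep.total, hfin])
    · rw [hx, normBound, hc.rep.dep]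
      refine (Core.norm_le V hc.inv).trans_eq ?_
      show _ / T = _
      rw [hA]
      congr 2
      field_simp
  · rintro s' - ⟨c, hc, hpot⟩ hopt
    have e16 : s'.real 16 0 = T := by
      rw [hc.frame.real 16 (by simp), env.T]; rfl
    have hLΛ : c.L ≤ Λ := le_mul_optimum hX (by positivity) hc.inv.L_le
    rw [← hδT] at hpot
    -- Since log(n+d) ≥ 1/2, the product δ² T is at least 20, while δ ≤ 1/40.
    have hδT4 : 4 ≤ δ * T := by
      have h1 : δ * (δ * T) = 40 * τ * Real.log (n + d) := by rw [← hδT]; ring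
      have h2 : 20 ≤ 40 * τ * Real.log (n + d) := by nlinarith
      by_contra hcon
      nlinarith
    obtain ⟨g1, g2⟩ := Core.bounds_of_pot_lt V hc.inv hδ1 hδT4 hΛ0 hpot
    have hT1 : 1 ≤ T := by nlinarith
    have hW : (P.q : ℝ) * Λ ≤ (16 * (τ * τ) * (n + d)) * P.cap :=
      group_value_le hd hτ hδ0 hδ1 hlam0 hg.upper.le hopt
    have hcnt := Core.cnt_le_of_bounds V hc.inv hδ1 hT1 hLΛ (hg.mul_le hd) hW g1 g2
    -- Stopping at the limit is excluded, because the number of calls is at most the limit in this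
    -- event.
    have hfin : c.total P = 0 := by
      rcases hc.done with h1 | h1
      · exact h1
      · exact absurd (h1.trans_le hcnt) (le_callLimit hn hd hτ hδ0).not_gt
    refine ⟨by rw [hc.rep.total, hfin], ?_⟩
    rw [normBound, hc.rep.dep, hc.rep.L]
    show (lam * Real.log d / δ + c.dep) / T ≤ _
    rw [div_le_iff₀ hT0]
    have hdS := Core.dep_le_S V hc.inv
    have hlog := entropy_le_horizon (n := n) hd hτ hδ0 hlam0
    change c.S ≤ (1 + 9 * δ) * T * c.L + δ * T * Λ at g2
    have h5 : ((1 + 9 * δ) * c.L + δ * Λ + δ * lam / 40) * T =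
      (1 + 9 * δ) * T * c.L + δ * T * Λ + δ * lam / 40 * T := by ring
    linarith

end RealRAM

namespace RealRAM

variable {n d : ℕ} {f : Fin n → (Fin d → ℝ) → Fin d → ℝ}

/-! ## Initialization -/

/-- Divides the customers into groups. -/
def groupProg : Prog :=
  .seq (.setNat 21 (.const 0) (.const 0))
  (.seq (.setNat 10 (.const 0) (.const 0))
  (.seq (.while (.natLt (nvar 10) (nvar 0))
    (.seq (.setNat 10 (.const 0) (.add (nvar 10) (.get 0 (.const 1))))
      (.setNat 21 (.const 0) (.add (nvar 21) (.const 1)))))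
  (.seq (.setNat 22 (.const 0) (.const 0))
  (.seq (.setNat 11 (.const 0) (.const 0))
  (.while (.natLt (.get 22 (nvar 11)) (nvar 0))
    (.seq (.setNat 22 (.add (nvar 11) (.const 1))
        (.sub (.add (.get 22 (nvar 11)) (nvar 21))
          (.sub (.add (.get 22 (nvar 11)) (nvar 21)) (nvar 0))))
      (.setNat 11 (.const 0) (.add (nvar 11) (.const 1)))))))))

/-- The machine has no integer multiplication or division, so q = ⌈n/d⌉ is found by adding d
repeatedly. The group boundaries use that a - (a - n) is min a n for truncated subtraction. -/
theorem Total.groupProg {s : State} (hn : 1 ≤ n) (hd : 1 ≤ d) (h0 : s.nat 0 0 = n)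
    (h1 : s.nat 0 1 = d) :
    Total f groupProg s fun s' => (∃ p q, IsGrouping n d p q ∧ s'.nat 11 0 = p ∧
      ∀ g ≤ p, s'.nat 22 g = groupStart n q g) ∧ Frame [10, 11, 21, 22] [] s s' ∧
      s'.calls = s.calls ∧ s'.time ≤ s.time + 200 * n := by
  refine .seq (.setNat (.seq (.setNat (.seq ?_))))
  refine Total.mono (Q := fun s' => (∃ q, s'.nat 21 0 = q ∧ n ≤ q * d ∧ q * d < n + d) ∧
    Frame [10, 11, 21, 22] [] s s' ∧ s'.calls = s.calls ∧ s'.time ≤ s.time + 60 * n + 20) ?_ ?_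
  · refine Total.while_measure (I := fun k s' => ∃ q, s'.nat 21 0 = q ∧ s'.nat 10 0 = q * d ∧
      q * d < n + d ∧ q ≤ n ∧ k = n - q ∧ Frame [10, 11, 21, 22] [] s s' ∧
      s'.calls = s.calls ∧ s'.time ≤ s.time + 60 * q + 10)
      (fun k s' => ?_) (fun k s' => ?_) n _ ?_
    · rintro ⟨q, i1, i2, i3, i4, i5, i6, i7, i8⟩ hb
      have e0 := i6.nat 0 (by simp)
      simp only [Cond.Holds, eval_nvar, i2, e0, h0] at hb
      have hq : q ≤ q * d := Nat.le_mul_of_pos_right _ hd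
      refine .seq (.setNat (.setNat ⟨k - 1, by omega, q + 1, ?_, ?_, ?_, by omega, by omega,
        i6.tick.setNat.setNat, i7, ?_⟩))
      · simp [NExpr.eval, i1]
      · simp [NExpr.eval, i2, e0, h1, add_mul]
      · rw [add_mul]; omega
      · simp [NExpr.cost, Cond.cost]; omega
    · rintro ⟨q, i1, i2, i3, i4, i5, i6, i7, i8⟩ hb
      have e0 := i6.nat 0 (by simp)
      simp only [Cond.Holds, eval_nvar, i2, e0, h0, not_lt] at hb
      refine ⟨⟨q, i1, hb, i3⟩, i6.tick, i7, ?_⟩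
      simp [Cond.cost]; omega
    · have f1 : Frame [10, 11, 21, 22] [] s s := .refl
      refine ⟨0, by simp [NExpr.eval], by simp [NExpr.eval], by omega, by omega, by omega,
        f1.setNat.setNat, rfl, ?_⟩
      simp [NExpr.cost]
  rintro s1 ⟨⟨q, a1, a2, a3⟩, a4, a5, a6⟩
  have hq : 0 < q := Nat.pos_of_ne_zero fun h => by rw [h, zero_mul] at a2; omega
  refine .seq (.setNat (.seq (.setNat ?_)))
  refine Total.while_measure (I := fun k s' => ∃ p, s'.nat 11 0 = p ∧
    (∀ g ≤ p, s'.nat 22 g = groupStart n q g) ∧ (p - 1) * q < n ∧ p ≤ n ∧ k = n - p ∧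
    s'.nat 21 0 = q ∧ Frame [10, 11, 21, 22] [] s s' ∧ s'.calls = s.calls ∧
    s'.time ≤ s.time + 60 * n + 60 * p + 40) (fun k s' => ?_) (fun k s' => ?_) n _ ?_
  · rintro ⟨p, i1, i2, i3, i4, i5, i6, i7, i8, i9⟩ hb
    have e0 := i7.nat 0 (by simp)
    simp only [Cond.Holds, NExpr.eval, eval_nvar, i1, i2 p le_rfl, e0, h0, groupStart] at hb
    have hp : p ≤ p * q := Nat.le_mul_of_pos_right _ hq
    refine .seq (.setNat (.setNat ⟨k - 1, by omega, p + 1, ?_, fun g hg => ?_, ?_, by omega,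
      by omega, ?_, i7.tick.setNat.setNat, i8, ?_⟩))
    · simp [NExpr.eval, i1]
    · simp only [NExpr.eval, eval_nvar, State.tick_nat, i1, i2 p le_rfl, e0, h0, i6]
      rw [upd_of_ne _ _ _ _ (show (22 : ℕ) ≠ 11 by norm_num), upd_same]
      rcases Nat.lt_succ_iff_lt_or_eq.1 (Nat.lt_succ_of_le hg) with hg | rfl
      · rw [Function.update_of_ne (by omega), i2 g (by omega)]
      · rw [Function.update_self, groupStart, groupStart, add_mul, one_mul]
        omega
    · simp only [Nat.add_sub_cancel]; omega
    · simpa using i6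
    · simp [NExpr.cost, Cond.cost]; omega
  · rintro ⟨p, i1, i2, i3, i4, i5, i6, i7, i8, i9⟩ hb
    have e0 := i7.nat 0 (by simp)
    simp only [Cond.Holds, NExpr.eval, eval_nvar, i1, i2 p le_rfl, e0, h0, groupStart] at hb
    refine ⟨⟨p, q, ⟨i3, by omega, a2, a3⟩, i1, i2⟩, i7.tick, i8, ?_⟩
    simp [Cond.cost, NExpr.cost]; omega
  · refine ⟨0, by simp [NExpr.eval], fun g hg => ?_, by omega, by omega, by omega, by simpa using a1,
      a4.setNat.setNat, a5, ?_⟩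
    · obtain rfl : g = 0 := by omega
      simp [NExpr.eval, groupStart]
    · simp [NExpr.cost]; omega

theorem rangeLoad_mem_feasibleSet {τ : ℝ} {X : Fin n → Set (Fin d → ℝ)}
    (hf : ∀ c, IsLinMinOracle τ (X c) (f c)) {y : Fin d → ℝ} (hy : ∀ j, 0 ≤ y j) :
    rangeLoad f 0 n y ∈ feasibleSet X := by
  refine ⟨fun c => f c y, fun c => (hf c y hy).1, ?_⟩
  rw [rangeLoad, Nat.Ico_zero_eq_range, Finset.sum_range]
  exact Finset.sum_congr rfl fun c _ => by simp [oracleExt]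

theorem sum_rangeLoad_le {τ : ℝ} {X : Fin n → Set (Fin d → ℝ)} (hc : ∀ c, Convex ℝ (X c))
    (h0 : ∀ c, ∀ x ∈ X c, ∀ j, 0 ≤ x j) (hf : ∀ c, IsLinMinOracle τ (X c) (f c))
    {y z : Fin d → ℝ} (hy : ∀ j, 0 ≤ y j) (hz : z ∈ feasibleSet X) :
    ∑ j, rangeLoad f 0 n y j * y j ≤ τ * ∑ j, z j * y j := by
  have := (isGroupOracle hc h0 hf (p := 1) (q := n) (by simp)).le y hy z hz
  simpa [groupStart] using this

theorem convex_feasibleSet {X : Fin n → Set (Fin d → ℝ)} (hc : ∀ c, Convex ℝ (X c)) :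
    Convex ℝ (feasibleSet X) := by
  rintro x ⟨z, hz, rfl⟩ x' ⟨z', hz', rfl⟩ a b ha hb hab
  refine ⟨fun c => a • z c + b • z' c, fun c => hc c (hz c) (hz' c) ha hb hab, ?_⟩
  rw [Finset.smul_sum, Finset.smul_sum, ← Finset.sum_add_distrib]

theorem nonneg_of_mem_feasibleSet {X : Fin n → Set (Fin d → ℝ)}
    (h0 : ∀ c, ∀ x ∈ X c, ∀ j, 0 ≤ x j) {z : Fin d → ℝ} (hz : z ∈ feasibleSet X) (j : Fin d) :
    0 ≤ z j := by
  obtain ⟨w, hw, rfl⟩ := hz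
  rw [Finset.sum_apply]
  exact Finset.sum_nonneg fun c _ => h0 c _ (hw c) j

/-- Calls all oracles once and computes the first bounds on the optimum. -/
def initProg : Prog :=
  .seq (forLoop 8 (.const 0) (.get 0 (.const 1)) (.setReal 7 (nvar 8) (rnum 1)))
  (.seq callAll
  (.seq (.setReal 25 (.const 0) (rnum 0))
  (.seq (forLoop 8 (.const 0) (.get 0 (.const 1))
    (.setReal 25 (.const 0) (.add (rvar 25) (.get 0 (nvar 8)))))
  (.seq (.setReal 26 (.const 0) (.log (.add (.ofNat (nvar 0)) (.ofNat (.get 0 (.const 1))))))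
  (.seq (.setReal 20 (.const 0)
    (.div (.mul (.div (rvar 25) (.ofNat (.get 0 (.const 1)))) (rvar 10)) (.get 1 (.const 1))))
  (.seq (.setReal 24 (.const 0) (rvar 20))
  (.seq (.setReal 21 (.const 0) (.mul (rvar 0) (rvar 10)))
  groupProg)))))))

/-- The load and the bounds on the optimum after the initialization. -/
structure InitResult (f : Fin n → (Fin d → ℝ) → Fin d → ℝ) (β : Fin d → ℝ) (τ : ℝ) (s' : State) :
    Prop where
  load : ∀ j : Fin d, s'.real 8 j = rangeLoad f 0 n 1 j
  value : s'.real 10 0 = ∑ j, rangeLoad f 0 n 1 j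
  lo : s'.real 20 0 = (∑ j, β j) / d * (∑ j, rangeLoad f 0 n 1 j) / τ
  lo' : s'.real 24 0 = (∑ j, β j) / d * (∑ j, rangeLoad f 0 n 1 j) / τ
  hi : ∀ h : 0 < d, s'.real 21 0 = β ⟨0, h⟩ * ∑ j, rangeLoad f 0 n 1 j

theorem Total.initProg {s : State} {β : Fin d → ℝ} {τ : ℝ} (hn : 1 ≤ n) (hd : 1 ≤ d)
    (h : InputRep n β s) (hτ : s.real 1 1 = τ) :
    Total f initProg s fun s' => (∃ p q, IsGrouping n d p q ∧ Setup n β τ p q s') ∧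
      InitResult f β τ s' ∧ Frame [8, 10, 11, 16, 17, 21, 22, 23] [7, 8, 9, 10, 20, 21, 24, 25, 26] s s' ∧
      s'.calls = s.calls + n ∧ s'.time ≤ s.time + 1500 * (timeUnit d * n) := by
  refine .seq ((Total.forLoop (c := 10) (a := 0) (N := d) (I := fun k s' =>
    (∀ j < k, s'.real 7 j = 1) ∧ Frame [8] [7] s s' ∧ s'.calls = s.calls) rfl
      (Nat.zero_le _) ?_ ?_ ?_ ?_).mono ?_)
  · rintro k s' v t ⟨h1, h2, h3⟩
    exact ⟨h1, h2.setNat, h3⟩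
  · rintro k s' ⟨-, h1, -⟩
    simp only [NExpr.eval, h1.nat 0 (by simp), h.dim]
  · rintro k s' - hk ⟨h1, h2, h3⟩ h4
    refine .setReal ⟨⟨fun j hj => ?_, h2.setReal, h3⟩, h4, ?_⟩
    · simp only [eval_rnum, Nat.cast_one, eval_nvar, h4, upd_same]
      rcases Nat.lt_succ_iff_lt_or_eq.1 hj with hj | rfl
      · rw [Function.update_of_ne (by omega), h1 j hj]
      · rw [Function.update_self]
    · simp
  · exact ⟨by simp, .refl, rfl⟩
  rintro s1 ⟨⟨a1, a2, a3⟩, -, a4⟩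
  have e0 := a2.nat 0 (by simp)
  refine .seq ((Total.callAll (y := 1) (by rw [e0, h.count]) (by rw [e0, h.dim]) hn
    (fun j => a1 j j.2) (fun j => zero_le_one)).mono ?_)
  rintro s2 ⟨b1, b2, b3, b4, b5⟩
  simp only [Pi.one_apply, mul_one] at b2
  have f2 : Frame [8, 10, 11, 16, 17, 21, 22, 23] [7, 8, 9, 10, 20, 21, 24, 25, 26] s s2 :=
    (Frame.refl.trans a2).trans b3
  refine .seq (.setReal (.seq ?_))
  refine (Total.forLoop (c := 10) (a := 0) (N := d) (I := fun k s' =>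
    s'.real 25 0 = ∑ i ∈ Finset.range k, extendZero β i ∧ (∀ j : Fin d, s'.real 8 j = s2.real 8 j) ∧
    s'.real 10 0 = s2.real 10 0 ∧
    Frame [8, 10, 11, 16, 17, 21, 22, 23] [7, 8, 9, 10, 20, 21, 24, 25, 26] s s' ∧
    s'.calls = s2.calls) rfl (Nat.zero_le _) ?_ ?_ ?_ ?_).mono ?_
  · rintro k s' v t ⟨h1, h2, h3, h4, h5⟩
    exact ⟨h1, h2, h3, h4.setNat, h5⟩
  · rintro k s' ⟨-, -, -, h1, -⟩
    simp only [NExpr.eval, h1.nat 0 (by simp), h.dim]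
  · rintro k s' - hk ⟨h1, h2, h3, h4, h5⟩ h6
    have hw := h.weight ⟨k, hk⟩
    simp only at hw
    have hext : extendZero β k = β ⟨k, hk⟩ := by simp only [extendZero, dif_pos hk]
    refine .setReal ⟨⟨?_, ?_, ?_, h4.setReal, h5⟩, h6, ?_⟩
    · simp only [RExpr.eval, NExpr.eval, eval_nvar, eval_rvar, h6, upd_same, Function.update_self,
        h1, h4.real 0 (by simp), hw]
      rw [Finset.sum_range_succ, hext]
    · simpa using h2
    · simpa using h3
    · simp [RExpr.cost, NExpr.cost]
  · exact ⟨by simp [NExpr.eval], by simp, by simp, f2.setReal, rfl⟩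
  rintro s3 ⟨⟨c1, c2, c3, c4, c5⟩, -, c6⟩
  rw [sum_extendZero] at c1
  have n0 := c4.nat 0 (by simp)
  have r0 := c4.real 0 (by simp)
  have r1 := c4.real 1 (by simp)
  refine .seq (.setReal (.seq (.setReal (.seq (.setReal (.seq (.setReal ?_)))))))
  refine (Total.groupProg hn hd ?_ ?_).mono ?_
  · exact (congrFun n0 0).trans h.count
  · exact (congrFun n0 1).trans h.dim
  rintro s4 ⟨⟨p, q, d1, d2, d3⟩, d4, d5, d6⟩
  have f4 := ((c4.setReal (a := 26)).setReal (a := 20)).setReal (a := 24) |>.setReal (a := 21)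
    |>.trans d4
  have g0 := f4.nat 0 (by simp)
  have gr0 := f4.real 0 (by simp)
  refine ⟨⟨p, q, d1, ⟨⟨by rw [g0, h.count], by rw [g0, h.dim], fun j => by rw [gr0, h.weight]⟩,
    by rw [f4.real 1 (by simp), hτ], ?_, ?_, d2, d3⟩⟩, ⟨fun j => ?_, ?_, ?_, ?_, fun hd => ?_⟩, f4, ?_, ?_⟩
  · rw [d4.real 25 (by simp)]; simpa using c1
  · rw [d4.real 26 (by simp)]; simp [RExpr.eval, NExpr.eval, n0, h.count, h.dim]
  · rw [d4.real 8 (by simp)]; simpa [b1] using c2 j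
  · rw [d4.real 10 (by simp)]; simpa [b2] using c3
  · rw [d4.real 20 (by simp)]
    simp [RExpr.eval, NExpr.eval, n0, h.dim, r1, hτ, c1, c3, b2]
  · rw [d4.real 24 (by simp)]
    simp [RExpr.eval, NExpr.eval, n0, h.dim, r1, hτ, c1, c3, b2]
  · rw [d4.real 21 (by simp)]
    have := h.weight ⟨0, hd⟩
    simp only at this
    simp [RExpr.eval, NExpr.eval, r0, this, c3, b2]
  · rw [d5]; simp only [c5, b4, a3]
  · have h1 := le_timeUnit d
    have h2 : timeUnit d ≤ timeUnit d * n := Nat.le_mul_of_pos_right _ hn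
    have h3 : n ≤ timeUnit d * n := Nat.le_mul_of_pos_left _ (by omega)
    simp only [NExpr.cost, RExpr.cost, cost_nvar, cost_rvar, cost_rnum] at a4 c6 d6
    omega

end RealRAM

namespace RealRAM
open scoped Pointwise

variable {n d : ℕ} {f : Fin n → (Fin d → ℝ) → Fin d → ℝ}

/-! ## The deterministic procedure -/

/-- Writes the mean load to the output. -/
def writeMean : Prog :=
  forLoop 8 (.const 0) (.get 0 (.const 1)) (.setReal 2 (nvar 8) (.div (.get 3 (nvar 8)) (rvar 16)))

theorem Total.writeMean {s : State} (hd : s.nat 0 1 = d) :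
    Total f writeMean s fun s' => (∀ j < d, s'.real 2 j = s.real 3 j / s.real 16 0) ∧
      Frame [8] [2] s s' ∧ s'.calls = s.calls ∧ s'.time ≤ s.time + 50 * timeUnit d := by
  refine (Total.forLoop (c := 20) (a := 0) (N := d) (I := fun k s' =>
    (∀ j < k, s'.real 2 j = s.real 3 j / s.real 16 0) ∧
    Frame [8] [2] s s' ∧ s'.calls = s.calls) rfl (Nat.zero_le _) ?_ ?_ ?_ ?_).mono ?_
  · rintro k s' v t ⟨h1, h2, h3⟩
    exact ⟨h1, h2.setNat, h3⟩
  · rintro k s' ⟨-, h1, -⟩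
    simp only [NExpr.eval, h1.nat 0 (by simp), hd]
  · rintro k s' - hk ⟨h1, h3, h4⟩ h5
    have e3 := h3.real 3 (by simp)
    have e16 := h3.real 16 (by simp)
    refine .setReal ⟨⟨fun j hj => ?_, h3.setReal, h4⟩, h5, ?_⟩
    · simp only [RExpr.eval, eval_nvar, eval_rvar, h5, upd_same, e3, e16]
      rcases Nat.lt_succ_iff_lt_or_eq.1 hj with hj | rfl
      · rw [Function.update_of_ne (by omega), h1 j hj]
      · rw [Function.update_self]
    · simp [RExpr.cost]
  · exact ⟨by simp, .refl, rfl⟩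
  · rintro s' ⟨⟨h1, h2, h3⟩, -, h4⟩
    refine ⟨h1, h2, h3, ?_⟩
    have := le_timeUnit d
    simp only [NExpr.cost, Nat.sub_zero] at h4
    omega

/-- One step of the deterministic procedure: all customers make a deposit. -/
def sweepBody : Prog :=
  .seq priceProg (.seq callAll
  (.seq (.ite (.realLt (rvar 18) (rvar 10)) (.setReal 18 (.const 0) (rvar 10)) .skip)
  (.seq (.seq (.setReal 14 (.const 0) (.sub (rvar 16) (rvar 13)))
    (.ite (.realLt (rvar 15) (.mul (rvar 14) (rvar 10)))
      (.setReal 14 (.const 0) (.div (rvar 15) (rvar 10))) .skip))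
  (.seq depositLoad
  (.seq (.setReal 17 (.const 0) (.add (rvar 17) (.mul (rvar 14) (rvar 10))))
  (.setReal 13 (.const 0) (.add (rvar 13) (rvar 14))))))))

/-- The deterministic procedure. -/
def sweepProg : Prog :=
  .seq coreParams (.seq (.setReal 13 (.const 0) (rnum 0))
    (.while (.realLt (rvar 13) (rvar 16)) sweepBody))

abbrev SweepFrame (s s' : State) : Prop :=
  Frame [2, 3, 4, 5, 6, 7, 8, 9, 16, 17, 23] [3, 4, 5, 6, 7, 8, 9, 10, 13, 14, 17, 18] s s'

/-- The invariant of the deterministic procedure with load `x`, progress `g` and deposit `dep`. -/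
structure SweepInv (β : Fin d → ℝ) (A κ T : ℝ) (X : Set (Fin d → ℝ)) (x : Fin d → ℝ)
    (g dep L : ℝ) : Prop where
  g_nonneg : 0 ≤ g
  g_le : g ≤ T
  mem : x ∈ g • X
  value : ∀ y, IsPrice β A x y → entropicValue β A x y ≤ dep
  dep_le : dep ≤ g * L
  L_le : ∀ z ∈ X, L ≤ κ * orderedNorm β z

/-- The deterministic procedure is in the given state. -/
structure SweepRep (x : Fin d → ℝ) (g dep L : ℝ) (s : State) : Prop where
  x : ∀ j : Fin d, s.real 3 j = x j
  g : s.real 13 0 = g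
  dep : s.real 17 0 = dep
  L : s.real 18 0 = L

/-- The same price argument as in the core procedure, but all customers deposit together, so every
step is itself a check and the deposit is at most progress times L with certainty. -/
theorem SweepInv.step {β : Fin d → ℝ} {A κ T cap a v w g dep L : ℝ} {X : Set (Fin d → ℝ)}
    {x y l : Fin d → ℝ} (h : SweepInv β A κ T X x g dep L) (hA : 0 < A)
    (hβ : IsOrderedWeight β) (hX : Convex ℝ X) (hX0 : ∀ z ∈ X, ∀ j, 0 ≤ z j) (hl : l ∈ X)
    (hy : IsPrice β A x y) (hv : v = ∑ j, l j * (y j + w)) (hw : 0 < w) (ha : 0 ≤ a)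
    (haT : g + a ≤ T) (hav : a * v ≤ cap) (hcap : A * cap ≤ w)
    (hle : ∀ z ∈ X, v ≤ κ * orderedNorm β z) :
    SweepInv β A κ T X (x + a • l) (g + a) (dep + a * v) (max L v) where
  g_nonneg := add_nonneg h.g_nonneg ha
  g_le := haT
  mem := by
    rw [hX.add_smul h.g_nonneg ha]
    exact Set.add_mem_add h.mem (Set.smul_mem_smul_set hl)
  value := fun y' hy' => by
    rw [hv]
    refine (IsPrice.entropicValue_step hA hβ hy hy' (hX0 l hl) ha hw (hv ▸ hav) hcap).trans ?_
    have := h.value y hy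
    linarith
  dep_le := by
    have h1 : g * L ≤ g * max L v := mul_le_mul_of_nonneg_left (le_max_left _ _) h.g_nonneg
    have h2 : a * v ≤ a * max L v := mul_le_mul_of_nonneg_left (le_max_right _ _) ha
    have := h.dep_le
    rw [add_mul]; linarith
  L_le := fun z hz => max_le (h.L_le z hz) (hle z hz)

/-- The deposit is the rest of the progress, or less if its value would exceed the cap. In the
second case it is cap/v ≥ cap/M, where M bounds the answer values through one fixed feasible point.
-/
theorem Total.sweepBody {β : Fin d → ℝ} {τ δ A cap w T κ M g dep L : ℝ} {x : Fin d → ℝ} {s : State}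
    {X : Fin n → Set (Fin d → ℝ)} (hn : 1 ≤ n) (hd : 1 ≤ d) (hβ : IsOrderedWeight β)
    (hτ : 0 < τ) (hδ : 0 ≤ δ) (hc : ∀ c, Convex ℝ (X c)) (h0 : ∀ c, ∀ x ∈ X c, ∀ j, 0 ≤ x j)
    (hf : ∀ c, IsLinMinOracle τ (X c) (f c)) (hi : InputRep n β s)
    (e11 : s.real 11 0 = A) (e12 : s.real 12 0 = w) (e15 : s.real 15 0 = cap)
    (e16 : s.real 16 0 = T) (hA : 0 < A) (hw : w = δ * ((∑ j, β j) / d)) (hw0 : 0 < w) (hcap0 : 0 < cap)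
    (hcap : A * cap = w) (hκ : κ = τ * (1 + δ)) (hg : g < T) (rep : SweepRep x g dep L s)
    (inv : SweepInv β A κ T (feasibleSet X) x g dep L)
    (hM : ∃ z ∈ feasibleSet X, κ * orderedNorm β z ≤ M) :
    Total f sweepBody s fun s' => ∃ x' g' dep' L', SweepRep x' g' dep' L' s' ∧
      SweepInv β A κ T (feasibleSet X) x' g' dep' L' ∧ (g' = T ∨ g + cap / M ≤ g') ∧ SweepFrame s s' ∧
      s'.calls = s.calls + n ∧ s'.time ≤ s.time + 2800 * (timeUnit d * n) := by
  have hX0 : ∀ z ∈ feasibleSet X, ∀ j, 0 ≤ z j := fun z hz => nonneg_of_mem_feasibleSet h0 hz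
  have hx0 : ∀ j, 0 ≤ x j := fun j => by
    obtain ⟨z, hz, rfl⟩ := inv.mem
    exact mul_nonneg inv.g_nonneg (hX0 z hz j)
  refine .seq ((Total.priceProg hd hβ (by rw [e11]; exact hA) hi.dim hi.weight rep.x hx0).mono ?_)
  rintro s1 ⟨⟨y, a1, a2⟩, a3, a4, a5⟩
  rw [e11] at a1
  have f1 : SweepFrame s s1 := Frame.refl.trans a3
  have n0 := a3.nat 0 (by simp)
  have hy0 : ∀ j, 0 ≤ y j + w := fun j => (add_pos (a1.pos j) hw0).le
  refine .seq ((Total.callAll (y := fun j => y j + w) (by rw [n0, hi.count]) (by rw [n0, hi.dim]) hn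
    (fun j => by rw [a2, e12]) hy0).mono ?_)
  rintro s2 ⟨b1, b2, b3, b4, b5⟩
  have f2 : SweepFrame s s2 := f1.trans b3
  set l := rangeLoad f 0 n fun j => y j + w with hl
  set v := ∑ j, l j * (y j + w) with hv
  have hlX : l ∈ feasibleSet X := rangeLoad_mem_feasibleSet hf hy0
  have hle : ∀ z ∈ feasibleSet X, v ≤ κ * orderedNorm β z := fun z hz => by
    refine (sum_rangeLoad_le hc h0 hf hy0 hz).trans ?_
    rw [hκ, mul_assoc]
    refine mul_le_mul_of_nonneg_left ?_ hτ.le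
    rw [hw]
    exact IsPrice.sum_mul_add_le hβ hd a1 (hX0 z hz) hδ
  have hv0 : 0 ≤ v := Finset.sum_nonneg fun j _ => mul_nonneg (hX0 l hlX j) (hy0 j)
  have hvM : v ≤ M := by
    obtain ⟨z, hz, hzM⟩ := hM
    exact (hle z hz).trans hzM
  have e13 : s2.real 13 0 = g := by rw [b3.real 13 (by simp), a3.real 13 (by simp), rep.g]
  have e18 : s2.real 18 0 = L := by rw [b3.real 18 (by simp), a3.real 18 (by simp), rep.L]
  have e17 : s2.real 17 0 = dep := by rw [b3.real 17 (by simp), a3.real 17 (by simp), rep.dep]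
  have e3 : ∀ j : Fin d, s2.real 3 j = x j := fun j => by
    rw [b3.real 3 (by simp), a3.real 3 (by simp), rep.x]
  have k15 : s2.real 15 0 = cap := by rw [b3.real 15 (by simp), a3.real 15 (by simp), e15]
  have k16 : s2.real 16 0 = T := by rw [b3.real 16 (by simp), a3.real 16 (by simp), e16]
  have key : Total f (.ite (.realLt (rvar 18) (rvar 10)) (.setReal 18 (.const 0) (rvar 10)) .skip)
      s2 fun s' => s'.real 18 0 = max L v ∧ Frame [] [18] s2 s' ∧
        s'.calls = s2.calls ∧ s'.time ≤ s2.time + 20 := by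
    refine .ite (fun h => .setReal ⟨?_, Frame.refl.tick.setReal, rfl, ?_⟩)
      fun h => .skip ⟨?_, Frame.refl.tick, rfl, ?_⟩
    · simp only [Cond.Holds, eval_rvar, e18, b2] at h
      simp [NExpr.eval, b2, max_eq_right h.le]
    · simp [NExpr.cost, Cond.cost]
    · simp only [Cond.Holds, eval_rvar, e18, b2, not_lt] at h
      rw [max_eq_left h]; exact e18
    · simp [Cond.cost]
  refine .seq (key.mono ?_)
  rintro s3 ⟨c1, c2, c3, c4⟩
  have f3 : SweepFrame s s3 := f2.trans c2
  have hTg : 0 < T - g := sub_pos.2 hg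
  have key2 : Total f (.seq (.setReal 14 (.const 0) (.sub (rvar 16) (rvar 13)))
      (.ite (.realLt (rvar 15) (.mul (rvar 14) (rvar 10)))
        (.setReal 14 (.const 0) (.div (rvar 15) (rvar 10))) .skip)) s3 fun s' =>
      (0 ≤ s'.real 14 0 ∧ s'.real 14 0 * v ≤ cap ∧ g + s'.real 14 0 ≤ T ∧
        (g + s'.real 14 0 = T ∨ cap / M ≤ s'.real 14 0)) ∧
      Frame [] [14] s3 s' ∧ s'.calls = s3.calls ∧ s'.time ≤ s3.time + 40 := by
    have i10 : s3.real 10 0 = v := by rw [c2.real 10 (by simp), b2]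
    have i13 : s3.real 13 0 = g := by rw [c2.real 13 (by simp), e13]
    have i15 : s3.real 15 0 = cap := by rw [c2.real 15 (by simp), k15]
    have i16 : s3.real 16 0 = T := by rw [c2.real 16 (by simp), k16]
    refine .seq (.setReal (.ite (fun h => .setReal ⟨?_, (Frame.refl.setReal).tick.setReal, rfl, ?_⟩)
      fun h => .skip ⟨?_, (Frame.refl.setReal).tick, rfl, ?_⟩))
    · simp only [Cond.Holds, RExpr.eval, NExpr.eval, eval_rvar, i10, i13, i15, i16, upd_same,
        Function.update_self, upd_of_ne _ _ _ _ (show (15 : ℕ) ≠ 14 by norm_num),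
        upd_of_ne _ _ _ _ (show (10 : ℕ) ≠ 14 by norm_num)] at h
      have hvpos : 0 < v := lt_of_le_of_ne hv0 fun h' => by rw [← h'] at h; linarith
      have hq : cap / v < T - g := (div_lt_iff₀ hvpos).2 h
      simp only [State.tick_real, RExpr.eval, NExpr.eval, eval_rvar, i10, i15, upd_same,
        Function.update_self, upd_of_ne _ _ _ _ (show (15 : ℕ) ≠ 14 by norm_num),
        upd_of_ne _ _ _ _ (show (10 : ℕ) ≠ 14 by norm_num)]
      refine ⟨by positivity, (div_mul_cancel₀ _ hvpos.ne').le, by linarith, .inr ?_⟩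
      exact div_le_div_of_nonneg_left hcap0.le hvpos hvM
    · simp [NExpr.cost, RExpr.cost, Cond.cost]
    · simp only [Cond.Holds, RExpr.eval, NExpr.eval, eval_rvar, i10, i13, i15, i16, upd_same,
        Function.update_self, upd_of_ne _ _ _ _ (show (15 : ℕ) ≠ 14 by norm_num),
        upd_of_ne _ _ _ _ (show (10 : ℕ) ≠ 14 by norm_num), not_lt] at h
      simp only [State.tick_real, RExpr.eval, NExpr.eval, eval_rvar, i13, i16, upd_same,
        Function.update_self]
      exact ⟨hTg.le, h, by linarith, .inl (by ring)⟩
    · simp [NExpr.cost, RExpr.cost, Cond.cost]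
  refine .seq (key2.mono ?_)
  rintro s4 ⟨⟨p1, p2, p3, p4⟩, p5, p6, p7⟩
  have f4 : SweepFrame s s4 := f3.trans p5
  set a := s4.real 14 0 with ha
  refine .seq ((Total.depositLoad (d := d) (by rw [f4.nat 0 (by simp), hi.dim])).mono ?_)
  rintro s5 ⟨q1, q2, q3, q4⟩
  have f5 : SweepFrame s s5 := f4.trans q2
  have f35 : Frame [8] [3, 14, 18] s2 s5 :=
    ((Frame.refl.trans c2).trans p5).trans q2
  have g14 : s5.real 14 0 = a := by rw [q2.real 14 (by simp)]
  have g10 : s5.real 10 0 = v := by rw [f35.real 10 (by simp), b2]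
  have g17 : s5.real 17 0 = dep := by rw [f35.real 17 (by simp), e17]
  have g13 : s5.real 13 0 = g := by rw [f35.real 13 (by simp), e13]
  have g18 : s5.real 18 0 = max L v := by rw [q2.real 18 (by simp), p5.real 18 (by simp), c1]
  refine .seq (.setReal (.setReal ?_))
  refine ⟨x + a • l, g + a, dep + a * v, max L v, ⟨fun j => ?_, ?_, ?_, ?_⟩,
    inv.step hA hβ (convex_feasibleSet hc) hX0 hlX a1 hv hw0 p1 p3 p2 hcap.le hle, ?_,
    f5.setReal.setReal, ?_, ?_⟩
  · have h3 : s4.real 3 j = x j := by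
      rw [p5.real 3 (by simp), c2.real 3 (by simp), e3]
    have h8 : s4.real 8 j = l j := by
      rw [p5.real 8 (by simp), c2.real 8 (by simp), b1]
    have := q1 j j.2
    simp [this, h3, h8, ha]
  · simp [NExpr.eval, RExpr.eval, g13, g14]
  · simp [NExpr.eval, RExpr.eval, g17, g14, g10]
  · simpa using g18
  · exact p4.imp_right fun h => by linarith
  · simp only [q3, p6, c3, b4, a4]
  · have h1 := le_timeUnit d
    have h2 : timeUnit d ≤ timeUnit d * n := Nat.le_mul_of_pos_right _ hn
    simp only [NExpr.cost, RExpr.cost, cost_rvar]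
    omega

/-- A guess that is a true lower bound on the optimum turns the entropy loss into a relative error
δ/40 in every run. The progress per step is bounded from below, which yields termination; the number
of steps may be large, so only time per call is controlled. -/
theorem Total.sweepProg {β : Fin d → ℝ} {τ lam δ : ℝ} {p q : ℕ} {s : State}
    {X : Fin n → Set (Fin d → ℝ)} (hn : 1 ≤ n) (hd : 1 ≤ d) (hβ : IsOrderedWeight β)
    (hτ : 1 ≤ τ) (hc : ∀ c, Convex ℝ (X c)) (h0 : ∀ c, ∀ x ∈ X c, ∀ j, 0 ≤ x j)
    (hf : ∀ c, IsLinMinOracle τ (X c) (f c)) (hX : (feasibleSet X).Nonempty)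
    (h : Setup n β τ p q s) (hlam : s.real 22 0 = lam) (hδ : s.real 23 0 = δ)
    (hlam0 : 0 < lam) (hδ0 : 0 < δ) (hopt : lam ≤ optimum β (feasibleSet X)) :
    Total f sweepProg s fun s' => (fun j : Fin d => s'.real 3 j / s'.real 16 0) ∈ feasibleSet X ∧
      (∀ z ∈ feasibleSet X, orderedNorm β (fun j : Fin d => s'.real 3 j / s'.real 16 0) ≤
        (τ * (1 + δ) + δ / 40) * orderedNorm β z) ∧
      Frame [2, 3, 4, 5, 6, 7, 8, 9, 16, 17, 23]
        [3, 4, 5, 6, 7, 8, 9, 10, 11, 12, 13, 14, 15, 16, 17, 18, 19] s s' ∧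
      s.calls ≤ s'.calls ∧
      s'.time + 4400 * (timeUnit d * s.calls) ≤
        s.time + 4400 * (timeUnit d * s'.calls) + 300 * timeUnit d := by
  have hd0 : (0 : ℝ) < d := by exact_mod_cast hd
  have hB := hβ.sum_pos
  have hτ0 : 0 < τ := by linarith
  have hX0 : ∀ z ∈ feasibleSet X, ∀ j, 0 ≤ z j := fun z hz => nonneg_of_mem_feasibleSet h0 hz
  have hnorm : ∀ z ∈ feasibleSet X, 0 ≤ orderedNorm β z := fun z _ =>
    Finset.sum_nonneg fun i _ => mul_nonneg (hβ.nonneg i) (abs_nonneg _)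
  set A := δ * (∑ j, β j) / lam with hA
  have hA0 : 0 < A := by positivity
  set w := δ * (∑ j, β j) / d with hw
  have hw0 : 0 < w := by positivity
  set T := horizon n d τ δ with hT
  have hT0 : 0 < T := horizon_pos hn hd hτ0 hδ0
  set κ := τ * (1 + δ) with hκ
  have hκ0 : 0 < κ := by positivity
  obtain ⟨z₀, hz₀⟩ := hX
  set M := κ * orderedNorm β z₀ with hM
  have hM0 : 0 < M :=
    mul_pos hκ0 (hlam0.trans_le (hopt.trans (optimum_le hnorm hz₀)))
  refine .seq ((Total.coreParams h hlam hδ).mono ?_)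
  rintro s1 ⟨a1, a2, a3, a4⟩
  refine .seq (.setReal ?_)
  refine Total.while_measure (I := fun k s' => ∃ x g dep L, SweepRep x g dep L s' ∧
      SweepInv β A κ T (feasibleSet X) x g dep L ∧ T - g ≤ k * (lam / d / M) ∧ SweepFrame s1 s' ∧
      s.calls ≤ s'.calls ∧ s'.time + 4400 * (timeUnit d * s.calls) ≤
        s.time + 4400 * (timeUnit d * s'.calls) + 210 * timeUnit d)
    (fun k s' => ?_) (fun k s' => ?_) ⌈T / (lam / d / M)⌉₊ _ ?_
  · rintro ⟨x, g, dep, L, rep, inv, hk, fr, i1, i2⟩ hb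
    have S1 := (h.of_frame a2).of_frame fr
    have e16 : s'.real 16 0 = T := by rw [fr.real 16 (by simp), a1.T]
    have hg : g < T := by
      simpa only [Cond.Holds, eval_rvar, rep.g, e16] using hb
    have hc0 : 0 < lam / d / M := by positivity
    have hk0 : k ≠ 0 := by
      rintro rfl
      rw [Nat.cast_zero, zero_mul] at hk
      linarith
    refine (Total.sweepBody (s := s'.tick _) (A := A) (cap := lam / d) (w := w) (κ := κ) (M := M)
      (T := T) hn hd hβ hτ0 hδ0.le hc h0 hf ⟨S1.input.count, S1.input.dim, S1.input.weight⟩ ?_ ?_ ?_ e16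
      hA0 (mul_div_assoc _ _ _) hw0 (by positivity) ?_ rfl hg ⟨rep.x, rep.g, rep.dep, rep.L⟩ inv
      ⟨z₀, hz₀, le_rfl⟩).mono ?_
    · rw [State.tick_real, fr.real 11 (by simp), a1.A]
    · rw [State.tick_real, fr.real 12 (by simp), a1.floor]
    · rw [State.tick_real, fr.real 15 (by simp), a1.cap]
    · rw [hA, hw]; field_simp
    rintro s'' ⟨x', g', dep', L', j1, j2, j3, j4, j5, j6⟩
    refine ⟨k - 1, by omega, x', g', dep', L', j1, j2, ?_, fr.tick.trans j4, ?_, ?_⟩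
    · rw [Nat.cast_sub (by omega), Nat.cast_one]
      have hk1 : (1 : ℝ) ≤ k := by exact_mod_cast Nat.one_le_iff_ne_zero.2 hk0
      rcases j3 with j3 | j3
      · rw [j3, sub_self]
        exact mul_nonneg (by linarith) hc0.le
      · rw [sub_mul, one_mul]; linarith
    · rw [j5]; exact i1.trans (Nat.le_add_right _ _)
    · have h2 : timeUnit d ≤ timeUnit d * n := Nat.le_mul_of_pos_right _ hn
      have h3 := le_timeUnit d
      rw [j5, State.tick_calls, mul_add]
      simp only [State.tick_time, Cond.cost, cost_rvar] at j6
      omega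
  · rintro ⟨x, g, dep, L, rep, inv, hk, fr, i1, i2⟩ hb
    have e16 : s'.real 16 0 = T := by rw [fr.real 16 (by simp), a1.T]
    have hg : g = T := by
      simp only [Cond.Holds, eval_rvar, rep.g, e16, not_lt] at hb
      exact le_antisymm inv.g_le hb
    have hx : (fun j : Fin d => s'.real 3 j / s'.real 16 0) = T⁻¹ • x := by
      funext j
      rw [e16, rep.x j, Pi.smul_apply, smul_eq_mul, inv_mul_eq_div]
    have hmem : T⁻¹ • x ∈ feasibleSet X :=
      (Set.mem_smul_set_iff_inv_smul_mem₀ hT0.ne' _ _).1 (hg ▸ inv.mem)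
    have hx0 : ∀ j, 0 ≤ x j := fun j => by
      have := hX0 _ hmem j
      rw [Pi.smul_apply, smul_eq_mul] at this
      exact (mul_nonneg_iff_of_pos_left (inv_pos.2 hT0)).1 this
    simp only [State.tick_real]
    rw [hx]
    refine ⟨hmem, fun z hz => ?_, (Frame.refl.trans a2).trans fr.tick, i1, ?_⟩
    · obtain ⟨y, hy⟩ := exists_isPrice hd hβ hA0 x
      have h1 := IsPrice.le_entropicValue hA0 hβ hy hx0
      have h2 := inv.value y hy
      have h3 := inv.dep_le
      have h4 := inv.L_le z hz
      have h5 := entropy_le_horizon (n := n) hd hτ hδ0 hlam0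
      have h6 : (∑ j, β j) * Real.log d / A = lam * Real.log d / δ := by
        rw [hA]; field_simp
      have h7 := hopt.trans (optimum_le hnorm hz)
      rw [orderedNorm_smul β x (inv_nonneg.2 hT0.le), inv_mul_le_iff₀ hT0]
      rw [hg] at h3
      have h8 : T * L ≤ T * (κ * orderedNorm β z) := mul_le_mul_of_nonneg_left h4 hT0.le
      have h9 : δ * lam / 40 * T ≤ T * (δ / 40 * orderedNorm β z) := by
        rw [show δ * lam / 40 * T = T * (δ / 40 * lam) by ring]
        exact mul_le_mul_of_nonneg_left (mul_le_mul_of_nonneg_left h7 (by positivity)) hT0.le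
      rw [h6] at h1
      rw [add_mul, mul_add]
      linarith
    · have h3 := le_timeUnit d
      simp only [State.tick_time, State.tick_calls, Cond.cost, cost_rvar]
      omega
  · have f1 : SweepFrame s1 s1 := .refl
    refine ⟨0, 0, 0, 0, ⟨fun j => ?_, ?_, ?_, ?_⟩, ⟨le_rfl, hT0.le, ?_, fun y hy =>
      IsPrice.entropicValue_zero_le hA0 hβ hy, by simp, fun z hz => ?_⟩, ?_, f1.setReal, ?_, ?_⟩
    · simpa using a1.x j j.2
    · simp [NExpr.eval]
    · simpa using a1.dep
    · simpa using a1.L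
    · rw [Set.zero_smul_set ⟨z₀, hz₀⟩]; rfl
    · exact mul_nonneg hκ0.le (hnorm z hz)
    · rw [sub_zero, ← div_le_iff₀ (by positivity)]
      exact Nat.le_ceil _
    · exact a3.ge
    · have h3 := le_timeUnit d
      simp only [a3, NExpr.cost, cost_rnum]
      omega

end RealRAM

namespace RealRAM

variable {n d : ℕ} {f : Fin n → (Fin d → ℝ) → Fin d → ℝ}

theorem State.tick_tick (s : State) (a b : ℕ) : (s.tick a).tick b = s.tick (a + b) := by
  simp [State.tick, Nat.add_assoc]

/-! ## The search for the optimum -/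

/-- The assumptions on the problem. -/
structure IsProblem (τ : ℝ) (β : Fin d → ℝ) (X : Fin n → Set (Fin d → ℝ))
    (f : Fin n → (Fin d → ℝ) → Fin d → ℝ) : Prop where
  n_pos : 1 ≤ n
  d_pos : 1 ≤ d
  weight : IsOrderedWeight β
  tau : 1 ≤ τ
  convex : ∀ c, Convex ℝ (X c)
  nonneg : ∀ c, ∀ x ∈ X c, ∀ j, 0 ≤ x j
  oracle : ∀ c, IsLinMinOracle τ (X c) (f c)

namespace IsProblem

variable {τ : ℝ} {β : Fin d → ℝ} {X : Fin n → Set (Fin d → ℝ)}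

theorem norm_nonneg (H : IsProblem τ β X f) (z : Fin d → ℝ) : 0 ≤ orderedNorm β z :=
  Finset.sum_nonneg fun i _ => mul_nonneg (H.weight.nonneg i) (abs_nonneg _)

theorem load_mem (H : IsProblem τ β X f) : rangeLoad f 0 n 1 ∈ feasibleSet X :=
  rangeLoad_mem_feasibleSet H.oracle fun _ => zero_le_one

theorem nonempty (H : IsProblem τ β X f) : (feasibleSet X).Nonempty := ⟨_, H.load_mem⟩

theorem load_nonneg (H : IsProblem τ β X f) (j : Fin d) : 0 ≤ rangeLoad f 0 n 1 j :=
  nonneg_of_mem_feasibleSet H.nonneg H.load_mem j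

theorem optimum_le (H : IsProblem τ β X f) {z : Fin d → ℝ} (hz : z ∈ feasibleSet X) :
    optimum β (feasibleSet X) ≤ orderedNorm β z :=
  _root_.optimum_le (fun z _ => H.norm_nonneg z) hz

/-- At unit prices the answers have total at most τ ∑ z, and the norm is at least the mean weight
times the sum of the entries. -/
theorem lower_le_optimum (H : IsProblem τ β X f) :
    (∑ j, β j) / d * (∑ j, rangeLoad f 0 n 1 j) / τ ≤ optimum β (feasibleSet X) := by
  have hτ : 0 < τ := by linarith [H.tau]
  rw [← one_mul (optimum β (feasibleSet X))]
  refine le_mul_optimum H.nonempty one_pos fun z hz => ?_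
  have h1 := sum_rangeLoad_le H.convex H.nonneg H.oracle (y := 1) (fun _ => zero_le_one) hz
  simp only [Pi.one_apply, mul_one] at h1
  have h2 := mean_mul_sum_le_orderedNorm H.weight H.d_pos (nonneg_of_mem_feasibleSet H.nonneg hz)
  have h3 : 0 ≤ (∑ j, β j) / d := div_nonneg H.weight.sum_pos.le (Nat.cast_nonneg _)
  rw [one_mul, div_le_iff₀ hτ]
  calc (∑ j, β j) / d * ∑ j, rangeLoad f 0 n 1 j ≤ (∑ j, β j) / d * (τ * ∑ j, z j) :=
        mul_le_mul_of_nonneg_left h1 h3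
    _ = τ * ((∑ j, β j) / d * ∑ j, z j) := by ring
    _ ≤ τ * orderedNorm β z := mul_le_mul_of_nonneg_left h2 hτ.le
    _ = _ := mul_comm _ _

theorem optimum_le_upper (H : IsProblem τ β X f) :
    optimum β (feasibleSet X) ≤ β ⟨0, H.d_pos⟩ * ∑ j, rangeLoad f 0 n 1 j :=
  (H.optimum_le H.load_mem).trans (orderedNorm_le_mul_sum H.weight H.d_pos H.load_nonneg)

end IsProblem

/-- The probability that a run of the core procedure fails. -/
def failProb (n d p : ℕ) (τ : ℝ) : ℝ := (1 + p) / Real.exp (40 * τ * Real.log (n + d))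

theorem failProb_nonneg (n d p : ℕ) (τ : ℝ) : 0 ≤ failProb n d p τ := by
  unfold failProb; positivity

/-- The bound on the norm of the mean load as an expression. -/
def normBoundExpr : RExpr :=
  .div (.add (.div (.mul (rvar 22) (.log (.ofNat (.get 0 (.const 1))))) (rvar 23)) (rvar 17)) (rvar 16)

/-- One step of the search. -/
def searchBody : Prog :=
  .seq (.setReal 22 (.const 0) (.exp (.div (.add (.log (rvar 20)) (.log (rvar 21))) (rnum 2))))
  (.seq (.setReal 23 (.const 0) (.div (rnum 1) (.mul (rnum 40) (.get 1 (.const 1)))))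
  (.seq coreProg
  (.ite (.natLe (nvar 13) (.const 0))
    (.ite (.realLe normBoundExpr (.mul (.mul (rnum 15) (.get 1 (.const 1))) (rvar 22)))
      (.setReal 21 (.const 0) (rvar 22)) (.setReal 20 (.const 0) (rvar 22)))
    (.setReal 20 (.const 0) (rvar 22)))))

/-- The search for the optimum up to a constant factor. -/
def searchProg : Prog := .while (.realLt (.mul (rnum 2) (rvar 20)) (rvar 21)) searchBody

abbrev SearchFrame (s s' : State) : Prop :=
  Frame [2, 3, 4, 5, 6, 7, 8, 9, 12, 13, 14, 15, 16, 17, 19, 20, 23, 24]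
    [3, 4, 5, 6, 7, 8, 9, 10, 11, 12, 13, 14, 15, 16, 17, 18, 19, 20, 21, 22, 23] s s'

/-- The invariant of the search, with `k` steps left of `R` steps. -/
structure SearchInv (n d : ℕ) (τ o : ℝ) (R : ℕ) (s : State) (k : ℕ) (s' : State) : Prop where
  frame : SearchFrame s s'
  lo_pos : 0 < s'.real 20 0
  lo_le : s'.real 20 0 ≤ s'.real 21 0
  optimum_le : o ≤ 15 * τ * s'.real 21 0
  gap : Real.log (s'.real 21 0) - Real.log (s'.real 20 0) ≤ 2 ^ k * Real.log 2
  calls_ge : s.calls ≤ s'.calls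
  calls_le : s'.calls + k * (callLimit n d τ (1 / (40 * τ)) + n) ≤
    s.calls + R * (callLimit n d τ (1 / (40 * τ)) + n)
  time : s'.time + 4500 * (timeUnit d * s.calls) ≤ s.time + 4500 * (timeUnit d * s'.calls)

theorem sqrt_guess {a b : ℝ} (ha : 0 < a) (hab : a ≤ b) :
    a ≤ Real.exp ((Real.log a + Real.log b) / 2) ∧ Real.exp ((Real.log a + Real.log b) / 2) ≤ b := by
  have h := Real.log_le_log ha hab
  refine ⟨?_, ?_⟩
  · rw [← Real.log_le_iff_le_exp ha]; linarith
  · rw [← Real.le_log_iff_exp_le (ha.trans_le hab)]; linarith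

/-- If the guess exceeds the optimum, a successful run of the core procedure passes the test of the
search; the three terms are at most 4, 2 and 1/40 times τ lam, well below 15. -/
theorem search_bound {τ δ o lam L U : ℝ} (hτ : 1 ≤ τ) (hδ : 0 < δ) (hδ1 : δ ≤ 1 / 40) (ho : 0 < o)
    (hlam : o < lam) (hL : L ≤ τ * (1 + δ) * o)
    (hU : U ≤ (1 + 9 * δ) * L + δ * (τ * (1 + δ) * o) + δ * lam / 40) : U ≤ 15 * τ * lam := by
  have hκ : τ * (1 + δ) * o ≤ 2 * (τ * lam) := by
    have h1 : τ * o ≤ τ * lam := by gcongr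
    have h2 : (1 + δ) * (τ * o) ≤ 2 * (τ * o) := by
      refine mul_le_mul_of_nonneg_right (by linarith) (by positivity)
    linarith
  have h3 : (1 + 9 * δ) * L ≤ 2 * (2 * (τ * lam)) := by
    refine (mul_le_mul_of_nonneg_left (hL.trans hκ) (by positivity)).trans ?_
    have : 0 < lam := ho.trans hlam
    exact mul_le_mul_of_nonneg_right (by linarith) (by positivity)
  have h4 : δ * (τ * (1 + δ) * o) ≤ 1 * (2 * (τ * lam)) := by
    have : 0 < lam := ho.trans hlam
    exact mul_le_mul (by linarith) hκ (by positivity) (by norm_num)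
  have h5 : δ * lam ≤ 1 * lam := mul_le_mul_of_nonneg_right (by linarith) (by linarith)
  have h6 : lam ≤ τ * lam := le_mul_of_one_le_left (by linarith) hτ
  linarith

/-- The geometric mean of the bounds halves the logarithmic gap, whichever bound it replaces.
Lowering the upper bound is always justified, because a finished run exhibits a feasible load within
the tested norm bound. Raising the lower bound is justified if the run succeeds, by `search_bound`.
-/
theorem Prob.searchBody {τ : ℝ} {β : Fin d → ℝ} {X : Fin n → Set (Fin d → ℝ)} {p q R k : ℕ}
    {s s₀ : State} (H : IsProblem τ β X f) (ho : 0 < optimum β (feasibleSet X))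
    (hg : IsGrouping n d p q) (hs : Setup n β τ p q s₀)
    (I : SearchInv n d τ (optimum β (feasibleSet X)) R s₀ (k + 1) s) :
    Prob f searchBody (s.tick 8) (SearchInv n d τ (optimum β (feasibleSet X)) R s₀ k)
      (fun s' => s.real 20 0 ≤ optimum β (feasibleSet X) → s'.real 20 0 ≤ optimum β (feasibleSet X))
      (failProb n d p τ) := by
  have hτ := H.tau
  have S := hs.of_frame I.frame
  set o := optimum β (feasibleSet X) with ho'
  set lam := Real.exp ((Real.log (s.real 20 0) + Real.log (s.real 21 0)) / 2) with hlam
  have hlam0 : 0 < lam := Real.exp_pos _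
  have hloglam : Real.log lam = (Real.log (s.real 20 0) + Real.log (s.real 21 0)) / 2 := Real.log_exp _
  obtain ⟨g1, g2⟩ := sqrt_guess I.lo_pos I.lo_le
  have hgap := I.gap
  rw [pow_succ] at hgap
  set δ := 1 / (40 * τ) with hδ
  have hδ0 : 0 < δ := by positivity
  have hδ1 : δ ≤ 1 / 40 := one_div_le_one_div_of_le (by norm_num) (by linarith)
  have hw := failProb_nonneg n d p τ
  refine .total_seq hw (.setReal (.total_seq hw (.setReal ?_)))
  have e22 : (RExpr.exp (.div (.add (.log (rvar 20)) (.log (rvar 21))) (rnum 2))).eval (s.tick 8) = lam := by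
    simp [RExpr.eval, hlam]
  set s1 : State := { s.tick 8 with
    real := upd (s.tick 8).real 22 ((NExpr.const 0).eval (s.tick 8)) ((RExpr.exp (.div (.add (.log (rvar 20)) (.log (rvar 21))) (rnum 2))).eval (s.tick 8))
    time := (s.tick 8).time + ((NExpr.const 0).cost + (RExpr.exp (.div (.add (.log (rvar 20)) (.log (rvar 21))) (rnum 2))).cost + 1) } with hs1
  have e23 : (RExpr.div (rnum 1) (.mul (rnum 40) (.get 1 (.const 1)))).eval s1 = δ := by
    simp [RExpr.eval, NExpr.eval, hδ, hs1, S.tau]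
  set s2 : State := { s1 with
    real := upd s1.real 23 ((NExpr.const 0).eval s1) ((RExpr.div (rnum 1) (.mul (rnum 40) (.get 1 (.const 1)))).eval s1)
    time := s1.time + ((NExpr.const 0).cost + (RExpr.div (rnum 1) (.mul (rnum 40) (.get 1 (.const 1)))).cost + 1) } with hs2
  have fr2 : SearchFrame s s2 := by
    refine ⟨fun a ha => rfl, fun a ha => ?_⟩
    have h22 : a ≠ 22 := by rintro rfl; simp at ha
    have h23 : a ≠ 23 := by rintro rfl; simp at ha
    simp [hs2, hs1, h22, h23]
  have S2 := S.of_frame fr2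
  have k22 : s2.real 22 0 = lam := by
    simp only [hs2, upd_of_ne _ _ _ _ (show (22 : ℕ) ≠ 23 by norm_num), hs1, e22, upd_same]
    exact Function.update_self _ _ _
  have k23 : s2.real 23 0 = δ := by
    simp only [hs2, e23, upd_same]
    exact Function.update_self _ _ _
  have k20 : s2.real 20 0 = s.real 20 0 := by simp [hs2, hs1]
  have k21 : s2.real 21 0 = s.real 21 0 := by simp [hs2, hs1]
  have kc : s2.calls = s.calls := rfl
  have kt : s2.time ≤ s.time + 40 := by
    simp [hs2, hs1, NExpr.cost, RExpr.cost]
  have hcore := Prob.coreProg (f := f) H.n_pos H.d_pos H.weight hτ H.convex H.nonneg H.oracle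
    H.nonempty ho hg S2 k22 k23 hlam0 hδ0 hδ1
  rw [← add_zero (failProb n d p τ)]
  refine .seq le_rfl hcore fun s3 C => .of_total le_rfl ?_
  have fr3 : SearchFrame s s3 := fr2.trans C.frame
  have S3 := S.of_frame fr3
  have j22 : s3.real 22 0 = lam := by rw [C.frame.real 22 (by simp), k22]
  have j23 : s3.real 23 0 = δ := by rw [C.frame.real 23 (by simp), k23]
  have j20 : s3.real 20 0 = s.real 20 0 := by rw [C.frame.real 20 (by simp), k20]
  have j21 : s3.real 21 0 = s.real 21 0 := by rw [C.frame.real 21 (by simp), k21]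
  have jnb : ∀ t, normBoundExpr.eval (s3.tick t) = normBound n d τ lam δ s3 := fun t => by
    simp [normBoundExpr, RExpr.eval, NExpr.eval, normBound, C.T, j22, j23, S3.input.dim]
  have hUo : s3.nat 13 0 = 0 → o ≤ normBound n d τ lam δ s3 := fun h =>
    (H.optimum_le (C.feasible h)).trans C.norm_le
  have hLo : s3.real 18 0 ≤ τ * (1 + δ) * o := le_mul_optimum H.nonempty (by positivity) C.L
  have calls_ge : s₀.calls ≤ s3.calls := by have := I.calls_ge; have := C.calls_gt; omega
  have calls_le : s3.calls + k * (callLimit n d τ δ + n) ≤ s₀.calls + R * (callLimit n d τ δ + n) := by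
    have h1 := I.calls_le
    have h2 := C.calls_le
    rw [kc] at h2
    push_cast at h1
    rw [add_mul, one_mul] at h1
    linarith
  have htime : s3.time + 50 + 4500 * (timeUnit d * s₀.calls) ≤ s₀.time + 4500 * (timeUnit d * s3.calls) := by
    have h1 := I.time
    have h2 := C.time
    have h3 : timeUnit d * (s.calls + 1) ≤ timeUnit d * s3.calls :=
      Nat.mul_le_mul_left _ (by have := C.calls_gt; omega)
    have h4 := le_timeUnit d
    have h5 := H.d_pos
    rw [mul_add] at h3
    rw [kc] at h2
    omega
  -- Common treatment of the two reasons to raise the lower bound: an unfinished run and a failed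
  -- test.
  have lower : ∀ t, t ≤ 40 → (s3.nat 13 0 ≠ 0 ∨ 15 * τ * lam < normBound n d τ lam δ s3) →
      Total f (.setReal 20 (.const 0) (rvar 22)) (s3.tick t) fun s' => SearchInv n d τ o R s₀ k s' ∧
        ((o ≤ 15 * τ * lam → s3.nat 13 0 = 0 ∧ normBound n d τ lam δ s3 ≤
          (1 + 9 * δ) * s3.real 18 0 + δ * (τ * (1 + δ) * o) + δ * lam / 40) →
          s.real 20 0 ≤ o → s'.real 20 0 ≤ o) := fun t ht hbad => by
    refine .setReal ⟨⟨(I.frame.trans fr3).tick.setReal, ?_, ?_, ?_, ?_, calls_ge, calls_le, ?_⟩,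
      fun hgood hlo => ?_⟩
    · simpa [NExpr.eval, j22] using hlam0
    · simpa [NExpr.eval, j22, j21] using g2
    · simpa [j21] using I.optimum_le
    · simp only [NExpr.eval, eval_rvar, State.tick_real, j22, upd_same, Function.update_self,
        upd_of_ne _ _ _ _ (show (21 : ℕ) ≠ 20 by norm_num), j21, hloglam]
      linarith
    · simp only [State.tick_time, State.tick_calls, NExpr.cost, cost_rvar]; omega
    · simp only [NExpr.eval, eval_rvar, State.tick_real, j22, upd_same, Function.update_self]
      by_contra hcon
      rw [not_le] at hcon
      have h15 : o ≤ 15 * τ * lam := by nlinarith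
      obtain ⟨h1, h2⟩ := hgood h15
      exact absurd (search_bound hτ hδ0 hδ1 ho hcon hLo h2) (not_le.2 (hbad.resolve_left (not_not.2 h1)))
  have c1 : (Cond.natLe (nvar 13) (.const 0)).cost = 4 := rfl
  refine .ite (fun h13 => ?_) fun h13 => lower _ (by rw [c1]; norm_num) (.inl ?_)
  · have h13' : s3.nat 13 0 = 0 := by simpa [Cond.Holds, NExpr.eval] using h13
    have c2 : (Cond.realLe normBoundExpr
      (.mul (.mul (rnum 15) (.get 1 (.const 1))) (rvar 22))).cost = 25 := rfl
    refine .ite (fun hU => .setReal ⟨⟨(I.frame.trans fr3).tick.tick.setReal, ?_, ?_, ?_, ?_, calls_ge,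
      calls_le, ?_⟩, fun hgood hlo => ?_⟩) fun hU => ?_
    · simpa [j20] using I.lo_pos
    · simpa [NExpr.eval, j20, j22] using g1
    · simp only [Cond.Holds, jnb] at hU
      simp only [RExpr.eval, NExpr.eval, eval_rnum, eval_rvar, State.tick_real, j22, S3.tau] at hU
      simp only [NExpr.eval, eval_rvar, State.tick_real, j22, upd_same, Function.update_self]
      exact (hUo h13').trans (by exact_mod_cast hU)
    · simp only [NExpr.eval, eval_rvar, State.tick_real, j22, upd_same, Function.update_self,
        upd_of_ne _ _ _ _ (show (20 : ℕ) ≠ 21 by norm_num), j20, hloglam]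
      linarith
    · simp only [State.tick_time, State.tick_calls, NExpr.cost, cost_rvar, c1, c2]; omega
    · simpa [j20] using hlo
    · simp only [Cond.Holds, jnb] at hU
      simp only [RExpr.eval, NExpr.eval, eval_rnum, eval_rvar, State.tick_real, j22, S3.tau] at hU
      rw [State.tick_tick]
      exact lower _ (by rw [c1, c2]; norm_num) (.inr (not_le.1 (by exact_mod_cast hU)))
  · simpa [Cond.Holds, NExpr.eval] using h13

/-- That the optimum is at most 15 τ times the final guess holds in every run; that the guess is at
most twice the optimum holds if all R runs of the core procedure succeed. -/
theorem Prob.searchProg {τ : ℝ} {β : Fin d → ℝ} {X : Fin n → Set (Fin d → ℝ)} {p q R : ℕ}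
    {s : State} (H : IsProblem τ β X f) (ho : 0 < optimum β (feasibleSet X))
    (hg : IsGrouping n d p q) (hs : Setup n β τ p q s) (hlo : 0 < s.real 20 0)
    (hlo' : s.real 20 0 ≤ optimum β (feasibleSet X))
    (hhi : optimum β (feasibleSet X) ≤ s.real 21 0)
    (hR : Real.log (s.real 21 0) - Real.log (s.real 20 0) ≤ 2 ^ R * Real.log 2) :
    Prob f searchProg s (fun s' => SearchFrame s s' ∧ 0 < s'.real 21 0 ∧
        optimum β (feasibleSet X) ≤ 15 * τ * s'.real 21 0 ∧ s.calls ≤ s'.calls ∧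
        s'.calls ≤ s.calls + R * (callLimit n d τ (1 / (40 * τ)) + n) ∧
        s'.time + 4500 * (timeUnit d * s.calls) ≤ s.time + 4500 * (timeUnit d * s'.calls) + 10)
      (fun s' => s'.real 21 0 ≤ 2 * optimum β (feasibleSet X)) (R * failProb n d p τ) := by
  have hτ := H.tau
  have hlim : 0 ≤ callLimit n d τ (1 / (40 * τ)) := by
    have := horizon_pos H.n_pos H.d_pos (by linarith) (show 0 < 1 / (40 * τ) by positivity)
    rw [callLimit]; positivity
  have hcost : (Cond.realLt (.mul (rnum 2) (rvar 20)) (rvar 21)).cost = 8 := rfl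
  refine (Prob.while_count (I := SearchInv n d τ (optimum β (feasibleSet X)) R s)
    (G := fun _ s' => s'.real 20 0 ≤ optimum β (feasibleSet X))
    (G' := fun s' => s'.real 21 0 ≤ 2 * optimum β (feasibleSet X)) (failProb_nonneg n d p τ)
    (fun k s' I hb => ?_) (fun k s' I hk => ?_) R s ?_).mono (fun s' h => h)
    (fun s' _ h => h hlo') le_rfl
  · rw [hcost]
    exact Prob.searchBody H ho hg hs I
  · have hnot : ¬ (Cond.realLt (.mul (rnum 2) (rvar 20)) (rvar 21)).Holds s' := by
      rcases hk with rfl | hk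
      -- After R rounds the logarithmic gap is at most log 2, so the bounds differ by a factor of at
      -- most 2 and the loop has ended.
      · have hgap := I.gap
        have hhi0 := I.lo_pos.trans_le I.lo_le
        rw [pow_zero, one_mul, sub_le_iff_le_add, ← Real.log_mul (by norm_num) I.lo_pos.ne',
          Real.log_le_log_iff hhi0 (by have := I.lo_pos; positivity)] at hgap
        simpa [Cond.Holds, RExpr.eval] using hgap
      · exact hk
    refine ⟨hnot, ⟨I.frame.tick, I.lo_pos.trans_le I.lo_le, I.optimum_le, I.calls_ge, ?_, ?_⟩,
      fun hG => ?_⟩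
    · have := I.calls_le
      have : 0 ≤ k * (callLimit n d τ (1 / (40 * τ)) + n) := by positivity
      simp only [State.tick_calls]
      linarith
    · have := I.time
      simp only [State.tick_time, State.tick_calls, hcost]
      omega
    · simp only [Cond.Holds, RExpr.eval, eval_rnum, eval_rvar, not_lt] at hnot
      simp only [State.tick_real]
      push_cast at hnot
      linarith
  · refine ⟨.refl, hlo, hlo'.trans hhi, ?_, hR, le_rfl, le_rfl, le_rfl⟩
    have : 0 ≤ s.real 21 0 := by linarith
    nlinarith

end RealRAM

namespace RealRAM

variable {n d : ℕ} {f : Fin n → (Fin d → ℝ) → Fin d → ℝ}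

/-! ## The complete program -/

/-- The deterministic procedure with the first lower bound on the optimum. -/
def fallbackProg : Prog :=
  .seq (.setReal 22 (.const 0) (rvar 24)) (.seq sweepProg writeMean)

/-- Sets the parameters of the last run of the core procedure. -/
def finalParams : Prog :=
  .seq (.setReal 22 (.const 0) (rvar 21))
  (.seq (.ite (.realLe (.get 1 (.const 0)) (rnum 1)) (.setReal 28 (.const 0) (.get 1 (.const 0)))
    (.setReal 28 (.const 0) (rnum 1)))
  (.setReal 23 (.const 0) (.div (rvar 28) (.mul (rnum 40) (.get 1 (.const 1))))))

/-- The last run of the core procedure, after which the result is checked. -/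
def finalProg : Prog :=
  .seq finalParams (.seq coreProg
  (.ite (.natLe (nvar 13) (.const 0))
    (.ite (.realLe (.mul normBoundExpr (.add (rnum 1) (rvar 23))) (.mul (.add (rnum 1) (rvar 28)) (rvar 18)))
      writeMean fallbackProg)
    fallbackProg))

/-- Writes the answer of the first oracle calls to the output. -/
def writeLoad : Prog :=
  forLoop 8 (.const 0) (.get 0 (.const 1)) (.setReal 2 (nvar 8) (.get 8 (nvar 8)))

/-- The complete program. -/
def mainProg : Prog :=
  .seq initProg (.ite (.realLe (rvar 10) (rnum 0)) writeLoad (.seq searchProg finalProg))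

theorem Total.writeLoad {s : State} (hd : s.nat 0 1 = d) :
    Total f writeLoad s fun s' => (∀ j < d, s'.real 2 j = s.real 8 j) ∧
      s'.calls = s.calls ∧ s'.time ≤ s.time + 50 * timeUnit d := by
  refine (Total.forLoop (c := 20) (a := 0) (N := d) (I := fun k s' =>
    (∀ j < k, s'.real 2 j = s.real 8 j) ∧
    Frame [8] [2] s s' ∧ s'.calls = s.calls) rfl (Nat.zero_le _) ?_ ?_ ?_ ?_).mono ?_
  · rintro k s' v t ⟨h1, h2, h3⟩
    exact ⟨h1, h2.setNat, h3⟩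
  · rintro k s' ⟨-, h1, -⟩
    simp only [NExpr.eval, h1.nat 0 (by simp), hd]
  · rintro k s' - hk ⟨h1, h3, h4⟩ h5
    have e8 := h3.real 8 (by simp)
    refine .setReal ⟨⟨fun j hj => ?_, h3.setReal, h4⟩, h5, ?_⟩
    · simp only [RExpr.eval, eval_nvar, h5, upd_same, e8]
      rcases Nat.lt_succ_iff_lt_or_eq.1 hj with hj | rfl
      · rw [Function.update_of_ne (by omega), h1 j hj]
      · rw [Function.update_self]
    · simp [RExpr.cost]
  · exact ⟨by simp, .refl, rfl⟩
  · rintro s' ⟨⟨h1, h2, h3⟩, -, h4⟩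
    refine ⟨h1, h3, ?_⟩
    have := le_timeUnit d
    simp only [NExpr.cost, Nat.sub_zero] at h4
    omega

/-- The guess is the lower bound from the first oracle calls, which is valid in every run, unlike
the lower end of the search interval. -/
theorem Total.fallbackProg {τ δ : ℝ} {β : Fin d → ℝ} {X : Fin n → Set (Fin d → ℝ)} {p q : ℕ}
    {s : State} (H : IsProblem τ β X f) (hs : Setup n β τ p q s) (hδ : s.real 23 0 = δ) (hδ0 : 0 < δ)
    (hlo : 0 < s.real 24 0) (hopt : s.real 24 0 ≤ optimum β (feasibleSet X)) :
    Total f fallbackProg s fun s' => IsApproxSolution β X (τ * (1 + δ) + δ / 40) (s'.output d) ∧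
      s.calls ≤ s'.calls ∧
      s'.time + 4400 * (timeUnit d * s.calls) ≤
        s.time + 4400 * (timeUnit d * s'.calls) + 400 * timeUnit d := by
  have f0 : Frame [] [22] s s := .refl
  refine .seq (.setReal (.seq ((Total.sweepProg (lam := s.real 24 0) (δ := δ) (p := p) (q := q)
    H.n_pos H.d_pos H.weight H.tau H.convex H.nonneg H.oracle H.nonempty (hs.of_frame f0.setReal)
    ?_ ?_ hlo hδ0 hopt).mono ?_)))
  · simp [NExpr.eval]
  · simpa using hδ
  rintro s1 ⟨a1, a2, a3, a4, a5⟩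
  have f1 : Frame [2, 3, 4, 5, 6, 7, 8, 9, 16, 17, 23]
      [3, 4, 5, 6, 7, 8, 9, 10, 11, 12, 13, 14, 15, 16, 17, 18, 19, 22] s s := .refl
  have S1 := hs.of_frame (f1.setReal.trans a3)
  refine (Total.writeMean (d := d) S1.input.dim).mono ?_
  rintro s2 ⟨b1, b2, b3, b4⟩
  have hout : s2.output d = fun j : Fin d => s1.real 3 j / s1.real 16 0 := by
    funext j
    exact b1 j j.2
  rw [hout]
  refine ⟨⟨a1, a2⟩, b3 ▸ a4, ?_⟩
  have := le_timeUnit d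
  simp only [NExpr.cost, cost_rvar] at a5
  rw [b3]
  omega

theorem Total.finalParams {s : State} {ε τ : ℝ} (hε : s.real 1 0 = ε) (hτ : s.real 1 1 = τ) :
    Total f finalParams s fun s' => s'.real 22 0 = s.real 21 0 ∧ s'.real 28 0 = min ε 1 ∧
      s'.real 23 0 = min ε 1 / (40 * τ) ∧ Frame [] [22, 23, 28] s s' ∧ s'.calls = s.calls ∧
      s'.time ≤ s.time + 50 := by
  refine .seq (.setReal (.seq (.ite (fun h => .setReal (.setReal ⟨?_, ?_, ?_, ?_, rfl, ?_⟩))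
    fun h => .setReal (.setReal ⟨?_, ?_, ?_, ?_, rfl, ?_⟩))))
  all_goals
    simp only [Cond.Holds, RExpr.eval, NExpr.eval, eval_rnum, eval_rvar,
      upd_of_ne _ _ _ _ (show (1 : ℕ) ≠ 22 by norm_num), hε, Nat.cast_one, not_le] at h
  · simp [NExpr.eval]
  · simp [NExpr.eval, RExpr.eval, hε, min_eq_left h]
  · simp [NExpr.eval, RExpr.eval, hε, hτ, min_eq_left h]
  · exact ((Frame.refl.setReal).tick.setReal).setReal
  · simp [NExpr.cost, RExpr.cost, Cond.cost]
  · simp [NExpr.eval]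
  · simp [NExpr.eval, min_eq_right h.le]
  · simp [NExpr.eval, RExpr.eval, hτ, min_eq_right h.le]
  · exact ((Frame.refl.setReal).tick.setReal).setReal
  · simp [NExpr.cost, RExpr.cost, Cond.cost]

/-- After a successful search and a successful last run the final test succeeds. Since τ δ = e/40,
all errors are small multiples of e, and o ≤ U lets those proportional to the optimum be absorbed
into U. -/
theorem final_bound {τ e o hi L U : ℝ} (hτ : 1 ≤ τ) (he : 0 < e) (he1 : e ≤ 1) (ho : 0 < o)
    (hhi : hi ≤ 2 * o) (hoU : o ≤ U)
    (hU : U ≤ (1 + 9 * (e / (40 * τ))) * L +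
      e / (40 * τ) * (τ * (1 + e / (40 * τ)) * o) + e / (40 * τ) * hi / 40) (hL : 0 ≤ L) :
    U * (1 + e / (40 * τ)) ≤ (1 + e) * L := by
  have hδ : e / (40 * τ) ≤ e / 40 := div_le_div_of_nonneg_left he.le (by norm_num) (by linarith)
  have hδτ : e / (40 * τ) * τ = e / 40 := by field_simp
  have hδ0 : 0 < e / (40 * τ) := by positivity
  set δ := e / (40 * τ)
  have h1 : (1 + 9 * δ) * L ≤ (1 + 9 * (e / 40)) * L := mul_le_mul_of_nonneg_right (by linarith) hL
  have h2 : δ * (τ * (1 + δ) * o) ≤ e / 40 * (1 + 1 / 40) * o := by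
    rw [show δ * (τ * (1 + δ) * o) = δ * τ * (1 + δ) * o by ring, hδτ]
    gcongr
    linarith
  have h3 : δ * hi ≤ e / 40 * (2 * o) :=
    (mul_le_mul_of_nonneg_left hhi hδ0.le).trans (mul_le_mul_of_nonneg_right hδ (by linarith))
  have h4 : e * o ≤ e * U := mul_le_mul_of_nonneg_left hoU he.le
  -- The constant is (1/40)(41/40) + (1/40)(2/40) = 43/1600, from the two error terms that are
  -- proportional to the optimum.
  have h5 : U * (1 - 43 / 1600 * e) ≤ (1 + 9 / 40 * e) * L := by linarith
  have h6 : U * (1 + δ) ≤ U * (1 + e / 40) := mul_le_mul_of_nonneg_left (by linarith) (by linarith)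
  have h7 : 0 < 1 - 43 / 1600 * e := by linarith
  refine h6.trans (le_of_mul_le_mul_right ?_ h7)
  calc U * (1 + e / 40) * (1 - 43 / 1600 * e) = U * (1 - 43 / 1600 * e) * (1 + e / 40) := by ring
    _ ≤ (1 + 9 / 40 * e) * L * (1 + e / 40) := mul_le_mul_of_nonneg_right h5 (by positivity)
    _ = (1 + 9 / 40 * e) * (1 + e / 40) * L := by ring
    _ ≤ (1 + e) * (1 - 43 / 1600 * e) * L := mul_le_mul_of_nonneg_right (by nlinarith) hL
    _ = _ := by ring

/-- The correctness and the running time of a run that ends in `s'`. -/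
def IsCorrect (τ ε : ℝ) (β : Fin d → ℝ) (X : Fin n → Set (Fin d → ℝ)) (s' : State) : Prop :=
  IsApproxSolution β X (τ * (1 + ε)) (s'.output d) ∧ s'.time ≤ 7000 * (timeUnit d * s'.calls)

/-- Passing the test U (1+δ) ≤ (1+e) L proves the approximation ratio, because L ≤ τ(1+δ)‖z‖ for all
feasible z: the two factors 1 + δ cancel. If the test fails, the fallback has ratio τ(1+δ) + δ/40 ≤
τ(1+ε). Hence the answer is correct in every run, and only the number of calls depends on success.
-/
theorem Prob.finalProg {τ ε : ℝ} {β : Fin d → ℝ} {X : Fin n → Set (Fin d → ℝ)} {p q : ℕ}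
    {s : State} (H : IsProblem τ β X f) (ho : 0 < optimum β (feasibleSet X))
    (hg : IsGrouping n d p q) (hs : Setup n β τ p q s) (hε : s.real 1 0 = ε) (hε0 : 0 < ε)
    (hhi : 0 < s.real 21 0) (hhi' : optimum β (feasibleSet X) ≤ 15 * τ * s.real 21 0)
    (hlo : 0 < s.real 24 0) (hopt : s.real 24 0 ≤ optimum β (feasibleSet X))
    (ht : s.time ≤ 6000 * (timeUnit d * s.calls)) (hcalls : 1 ≤ s.calls) :
    Prob f finalProg s (IsCorrect τ ε β X)
      (fun s' => s.real 21 0 ≤ 2 * optimum β (feasibleSet X) →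
        (s'.calls : ℝ) ≤ s.calls + callLimit n d τ (min ε 1 / (40 * τ)) + n)
      (failProb n d p τ) := by
  have hτ := H.tau
  have hw := failProb_nonneg n d p τ
  set o := optimum β (feasibleSet X) with ho'
  set e := min ε 1 with he
  have he0 : 0 < e := lt_min hε0 one_pos
  have he1 : e ≤ 1 := min_le_right _ _
  have heε : e ≤ ε := min_le_left _ _
  set δ := e / (40 * τ) with hδ
  have hδ0 : 0 < δ := by positivity
  have hδe : δ ≤ e / 40 := div_le_div_of_nonneg_left he0.le (by norm_num) (by linarith)
  have hδτ : τ * δ = e / 40 := by rw [hδ]; field_simp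
  refine .total_seq hw ((Total.finalParams hε hs.tau).mono ?_)
  rintro s1 ⟨a1, a2, a3, a4, a5, a6⟩
  have S1 := hs.of_frame a4
  have hcore := Prob.coreProg (f := f) H.n_pos H.d_pos H.weight hτ H.convex H.nonneg H.oracle
    H.nonempty ho hg S1 a1 a3 hhi hδ0 (by linarith)
  rw [← add_zero (failProb n d p τ)]
  refine .seq le_rfl hcore fun s2 C => .of_total le_rfl ?_
  have S2 := S1.of_frame C.frame
  have k22 : s2.real 22 0 = s.real 21 0 := by rw [C.frame.real 22 (by simp), a1]
  have k23 : s2.real 23 0 = δ := by rw [C.frame.real 23 (by simp), a3]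
  have k24 : s2.real 24 0 = s.real 24 0 := by rw [C.frame.real 24 (by simp), a4.real 24 (by simp)]
  have k28 : s2.real 28 0 = e := by rw [C.frame.real 28 (by simp), a2]
  have jnb : ∀ t, normBoundExpr.eval (s2.tick t) = normBound n d τ (s.real 21 0) δ s2 := fun t => by
    simp [normBoundExpr, RExpr.eval, NExpr.eval, normBound, C.T, k22, k23, S2.input.dim]
    rfl
  set U := normBound n d τ (s.real 21 0) δ s2 with hU
  set L := s2.real 18 0 with hL
  have hU' : timeUnit d ≤ timeUnit d * s.calls := Nat.le_mul_of_pos_right _ hcalls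
  have hUc : timeUnit d * (s.calls + 1) ≤ timeUnit d * s2.calls :=
    Nat.mul_le_mul_left _ (by have := C.calls_gt; omega)
  rw [mul_add, mul_one] at hUc
  have htime := C.time
  have h1U := le_timeUnit d
  rw [a5] at htime
  have good : (s.real 21 0 ≤ 2 * o) → (o ≤ 15 * τ * s.real 21 0 → s2.nat 13 0 = 0 ∧
      U ≤ (1 + 9 * δ) * L + δ * (τ * (1 + δ) * o) + δ * s.real 21 0 / 40) →
      s2.nat 13 0 = 0 ∧ U * (1 + δ) ≤ (1 + e) * L := fun h2 hgood => by
    obtain ⟨g1, g2⟩ := hgood hhi'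
    refine ⟨g1, ?_⟩
    have hoU : o ≤ U := (H.optimum_le (C.feasible g1)).trans C.norm_le
    refine final_bound hτ he0 he1 ho h2 hoU g2 ?_
    -- A negative L would force U ≤ o/4 + o/20 < o, which contradicts that U bounds the norm of a
    -- feasible load.
    by_contra hL0
    rw [not_le] at hL0
    have h3 : (1 + 9 * δ) * L ≤ 0 := mul_nonpos_of_nonneg_of_nonpos (by positivity) hL0.le
    have h4 : δ * (τ * (1 + δ) * o) ≤ o / 4 := by
      rw [show δ * (τ * (1 + δ) * o) = τ * δ * (1 + δ) * o by ring, hδτ]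
      have : e / 40 * (1 + δ) ≤ 1 / 4 := by nlinarith
      nlinarith
    have h5 : δ * s.real 21 0 ≤ 1 * (2 * o) :=
      mul_le_mul (by linarith) h2 hhi.le zero_le_one
    linarith
  have fallback : ∀ t ≤ 60, (s2.nat 13 0 ≠ 0 ∨ (1 + e) * L < U * (1 + δ)) →
      Total f RealRAM.fallbackProg (s2.tick t) fun s' => IsCorrect τ ε β X s' ∧
        ((o ≤ 15 * τ * s.real 21 0 → s2.nat 13 0 = 0 ∧
          U ≤ (1 + 9 * δ) * L + δ * (τ * (1 + δ) * o) + δ * s.real 21 0 / 40) →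
          s.real 21 0 ≤ 2 * o → (s'.calls : ℝ) ≤ s.calls + callLimit n d τ δ + n) := fun t ht hbad => by
    refine (Total.fallbackProg (s := s2.tick t) H (S2.of_frame (Frame.refl (N := []) (R := [])).tick) k23 hδ0
      (by rw [State.tick_real, k24]; exact hlo) (by rw [State.tick_real, k24]; exact hopt)).mono ?_
    rintro s' ⟨⟨b1, b2⟩, b4, b3⟩
    refine ⟨⟨⟨b1, fun z hz => (b2 z hz).trans ?_⟩, ?_⟩, fun hgood h2 => ?_⟩
    · refine mul_le_mul_of_nonneg_right ?_ (H.norm_nonneg z)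
      have : τ * ε ≥ 1 * ε := mul_le_mul_of_nonneg_right hτ hε0.le
      rw [mul_add, mul_add, hδτ]
      linarith
    · have h5 := Nat.mul_le_mul_left (timeUnit d) b4
      simp only [State.tick_calls, State.tick_time] at b3 h5
      omega
    · obtain ⟨g1, g2⟩ := good h2 hgood
      exact absurd g2 (not_le.2 (hbad.resolve_left (not_not.2 g1)))
  have c1 : (Cond.natLe (nvar 13) (.const 0)).cost = 4 := rfl
  have c2 : (Cond.realLe (.mul normBoundExpr (.add (rnum 1) (rvar 23)))
    (.mul (.add (rnum 1) (rvar 28)) (rvar 18))).cost = 31 := rfl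
  refine .ite (fun h13 => ?_) fun h13 => fallback _ (by rw [c1]; norm_num) (.inl ?_)
  · have h13' : s2.nat 13 0 = 0 := by simpa [Cond.Holds, NExpr.eval] using h13
    have hiff : (Cond.realLe (.mul normBoundExpr (.add (rnum 1) (rvar 23)))
        (.mul (.add (rnum 1) (rvar 28)) (rvar 18))).Holds
        (s2.tick (Cond.natLe (nvar 13) (.const 0)).cost) ↔ U * (1 + δ) ≤ (1 + e) * L := by
      have hk : RExpr.eval (s2.tick (Cond.natLe (nvar 13) (.const 0)).cost) (rnum 1) = 1 := by simp
      simp only [Cond.Holds, RExpr.eval, jnb, eval_rvar, State.tick_real, k23, k28, hk]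
      rfl
    refine .ite (fun h => ?_) fun h => ?_
    · rw [hiff] at h
      rw [State.tick_tick]
      refine (Total.writeMean (s := s2.tick _) (d := d) S2.input.dim).mono ?_
      rintro s' ⟨b1, b2, b3, b4⟩
      have hout : s'.output d = fun j : Fin d => s2.real 3 j / s2.real 16 0 := by
        funext j
        exact b1 j j.2
      refine ⟨⟨?_, ?_⟩, fun _ _ => ?_⟩
      · rw [hout]
        refine ⟨C.feasible h13', fun z hz => C.norm_le.trans ?_⟩
        have h3 := C.L z hz
        have h4 : U * (1 + δ) ≤ (1 + e) * (τ * orderedNorm β z) * (1 + δ) := by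
          refine h.trans ((mul_le_mul_of_nonneg_left h3 (by linarith)).trans_eq ?_)
          ring
        refine (le_of_mul_le_mul_right h4 (by linarith)).trans ?_
        rw [show τ * (1 + ε) * orderedNorm β z = (1 + ε) * (τ * orderedNorm β z) by ring]
        exact mul_le_mul_of_nonneg_right (by linarith)
          (mul_nonneg (by linarith) (H.norm_nonneg z))
      · simp only [State.tick_calls, State.tick_time, c1, c2] at b3 b4
        rw [b3]
        omega
      · have := C.calls_le
        rw [a5] at this
        rw [b3]
        exact this
    · rw [hiff, not_le] at h
      rw [State.tick_tick]
      exact fallback _ (by rw [c1, c2]; norm_num) (.inr h)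
  · simpa [Cond.Holds, NExpr.eval] using h13

/-- If the first answer has value at most 0 at unit prices, its norm is 0 and it is optimal.
Otherwise the initial bounds on the optimum are positive and their ratio is at most dτ, so R rounds
suffice. The R searches and the last run contribute R + 1 failure probabilities. -/
theorem Prob.mainProg {τ ε : ℝ} {β : Fin d → ℝ} {X : Fin n → Set (Fin d → ℝ)} {R : ℕ}
    (H : IsProblem τ β X f) (hε : 0 < ε) (hR : Real.log (d * τ) ≤ 2 ^ R * Real.log 2) :
    Prob f mainProg (inputState n β ε τ) (IsCorrect τ ε β X)
      (fun s' => (s'.calls : ℝ) ≤ 2 * n + R * (callLimit n d τ (1 / (40 * τ)) + n) +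
        callLimit n d τ (min ε 1 / (40 * τ)))
      ((R + 1) * ((1 + d) / Real.exp (40 * τ * Real.log (n + d)))) := by
  have hτ := H.tau
  have hd0 : (0 : ℝ) < d := by exact_mod_cast H.d_pos
  have hB := H.weight.sum_pos
  have hlim : ∀ δ, 0 < δ → 0 ≤ callLimit n d τ δ := fun δ hδ => by
    have := horizon_pos H.n_pos H.d_pos (by linarith : 0 < τ) hδ
    exact mul_nonneg (mul_nonneg (by norm_num) (mul_self_nonneg τ)) (mul_nonneg (by positivity) this.le)
  have hlim1 := hlim (1 / (40 * τ)) (by positivity)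
  have hlim2 := hlim (min ε 1 / (40 * τ)) (div_pos (lt_min hε one_pos) (by positivity))
  set w := (1 + d) / Real.exp (40 * τ * Real.log (n + d)) with hw
  have hw0 : 0 ≤ w := by positivity
  refine .total_seq (by positivity) ((Total.initProg (β := β) (τ := τ) H.n_pos H.d_pos
    ⟨rfl, rfl, fun j => by simp [inputState]⟩ rfl).mono ?_)
  rintro s1 ⟨⟨p, q, hg, S1⟩, r, a1, a2, a3⟩
  have hc0 : (inputState n β ε τ).calls = 0 := rfl
  have ht0 : (inputState n β ε τ).time = 0 := rfl
  have hU := le_timeUnit d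
  have hUn : timeUnit d ≤ timeUnit d * n := Nat.le_mul_of_pos_right _ H.n_pos
  rw [hc0, zero_add] at a2
  rw [ht0, zero_add] at a3
  set V := ∑ j, rangeLoad f 0 n 1 j with hV
  have cV : (Cond.realLe (rvar 10) (rnum 0)).cost = 5 := rfl
  refine .ite (fun h => ?_) fun h => ?_
  · have hV0 : V ≤ 0 := by
      simpa [Cond.Holds, r.value] using h
    refine .of_total (by positivity) ((Total.writeLoad (s := s1.tick _) (d := d) S1.input.dim).mono ?_)
    rintro s2 ⟨b1, b2, b3⟩
    have hout : s2.output d = rangeLoad f 0 n 1 := by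
      funext j
      exact (b1 j j.2).trans (r.load j)
    refine ⟨⟨?_, ?_⟩, ?_⟩
    · rw [hout]
      refine ⟨H.load_mem, fun z _ => ?_⟩
      refine (orderedNorm_le_mul_sum H.weight H.d_pos H.load_nonneg).trans ?_
      refine (mul_nonpos_of_nonneg_of_nonpos (H.weight.nonneg _) hV0).trans ?_
      exact mul_nonneg (by positivity) (H.norm_nonneg z)
    · simp only [State.tick_time, State.tick_calls] at b2 b3
      rw [b2, a2]
      omega
    · simp only [State.tick_calls] at b2
      rw [b2, a2]
      have : 0 ≤ R * (callLimit n d τ (1 / (40 * τ)) + n) := by positivity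
      have : (0 : ℝ) ≤ n := Nat.cast_nonneg _
      linarith
  have hV0 : 0 < V := by
    simpa [Cond.Holds, r.value] using h
  have hlo0 : 0 < (∑ j, β j) / d * V / τ := by positivity
  have ho := hlo0.trans_le H.lower_le_optimum
  have hβ0 := H.weight.first_pos H.d_pos
  have hwp : failProb n d p τ ≤ w := by
    have : (p : ℝ) ≤ d := by exact_mod_cast hg.p_le
    rw [failProb, hw]
    gcongr
  have hsearch := Prob.searchProg (s := s1.tick (Cond.realLe (rvar 10) (rnum 0)).cost) (R := R) H ho hg
    (S1.of_frame (Frame.refl (N := []) (R := [])).tick) (by rw [State.tick_real, r.lo]; exact hlo0)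
    (by rw [State.tick_real, r.lo]; exact H.lower_le_optimum)
    (by rw [State.tick_real, r.hi H.d_pos]; exact H.optimum_le_upper) (by
      refine le_trans ?_ hR
      rw [State.tick_real, r.lo, r.hi H.d_pos, ← Real.log_div (by positivity) hlo0.ne']
      refine Real.log_le_log (by positivity) ?_
      rw [div_le_iff₀ hlo0]
      have h1 : β ⟨0, H.d_pos⟩ ≤ ∑ j, β j :=
        Finset.single_le_sum (fun i _ => H.weight.nonneg i) (Finset.mem_univ _)
      calc β ⟨0, H.d_pos⟩ * V ≤ (∑ j, β j) * V := mul_le_mul_of_nonneg_right h1 hV0.le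
        _ = _ := by field_simp)
  have hsum : R * failProb n d p τ + failProb n d p τ ≤ (R + 1) * w := by
    have : R * failProb n d p τ ≤ R * w := mul_le_mul_of_nonneg_left hwp (Nat.cast_nonneg _)
    linarith
  refine Prob.mono ?_ (fun _ h => h) (fun _ _ h => h) hsum
  refine Prob.seq (failProb_nonneg n d p τ) hsearch fun s2 ⟨b1, b2, b3, b4, b5, b6⟩ => ?_
  have S2 := S1.of_frame (Frame.of_tick b1)
  have e24 : s2.real 24 0 = (∑ j, β j) / d * V / τ := by
    rw [b1.real 24 (by simp), State.tick_real, r.lo']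
  have e1 : s2.real 1 0 = ε := by
    rw [b1.real 1 (by simp), State.tick_real, a1.real 1 (by simp)]; simp [inputState]
  simp only [State.tick_calls, State.tick_time, cV, a2] at b4 b5 b6
  have hUc : timeUnit d * n ≤ timeUnit d * s2.calls := Nat.mul_le_mul_left _ b4
  have hn := H.n_pos
  refine (Prob.finalProg H ho hg S2 e1 hε b2 b3 (by rw [e24]; exact hlo0)
    (by rw [e24]; exact H.lower_le_optimum) (by omega) (by omega)).mono (fun _ h => h)
    (fun s3 _ h h2 => ?_) le_rfl
  have := h h2
  linarith

end RealRAM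

namespace RealRAM

/-! ## Bounds on the number of calls, the running time and the failure probability -/

theorem half_le_log_two : 1 / 2 ≤ Real.log 2 := by linarith [Real.log_two_gt_d9]

/-- The linear term is absorbed for d ≥ 2 by log d ≥ 1/2, and for d = 1 by the summand 1. -/
theorem timeUnit_le {d : ℕ} (hd : 1 ≤ d) : (timeUnit d : ℝ) ≤ 4 * (1 + d * Real.log d) := by
  have hd1 : (1 : ℝ) ≤ d := by exact_mod_cast hd
  have hlog := Real.log_nonneg hd1
  have h2 := half_le_log_two
  have h3 : (Nat.log 2 d : ℝ) ≤ 2 * Real.log d := by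
    have h4 : ((2 : ℝ) ^ Nat.log 2 d) ≤ d := by
      exact_mod_cast Nat.pow_log_le_self 2 (by omega)
    have h5 := Real.log_le_log (by positivity) h4
    rw [Real.log_pow] at h5
    have h6 : (Nat.log 2 d : ℝ) * (1 / 2) ≤ Nat.log 2 d * Real.log 2 :=
      mul_le_mul_of_nonneg_left h2 (Nat.cast_nonneg _)
    linarith
  have h7 : (d : ℝ) ≤ 1 + 2 * (d * Real.log d) := by
    rcases Nat.eq_or_lt_of_le hd with rfl | hlt
    · simp
    · have h8 : (2 : ℝ) ≤ d := by exact_mod_cast hlt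
      have h9 := Real.log_le_log (by norm_num) h8
      have : (d : ℝ) * (1 / 2) ≤ d * Real.log d := mul_le_mul_of_nonneg_left (h2.trans h9) (by linarith)
      linarith
  have h10 : (d : ℝ) * Nat.log 2 d ≤ d * (2 * Real.log d) := mul_le_mul_of_nonneg_left h3 (by linarith)
  unfold timeUnit
  push_cast
  rw [mul_add]
  linarith

/-- The number of rounds of the search. -/
theorem exists_rounds {τ : ℝ} (hτ : 1 ≤ τ) : ∃ C : ℝ, 1 ≤ C ∧ ∀ d : ℕ, 1 ≤ d → ∃ R : ℕ,
    Real.log (d * τ) ≤ 2 ^ R * Real.log 2 ∧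
    (R + 1 : ℝ) ≤ C * Real.log (Real.log (max d 3 : ℕ)) ∧ (R + 1 : ℝ) ≤ 4 * (d * τ) := by
  have hl2 := half_le_log_two
  have hlogτ := Real.log_nonneg hτ
  have h3 : 1 < Real.log 3 := by
    rw [Real.lt_log_iff_exp_lt (by norm_num)]
    linarith [Real.exp_one_lt_d9]
  have ha : 0 < Real.log (Real.log 3) := Real.log_pos h3
  set b := Real.log (2 * (1 + Real.log τ)) with hb
  have hb0 : 0 ≤ b := Real.log_nonneg (by linarith)
  -- The number of rounds is about log₂ log₂ (dτ), hence at most 2 log log D + 2 + 2b. Dividing by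
  -- log log 3 > 0 turns the additive constant into a factor, which is why d is replaced by max d 3.
  refine ⟨2 + (2 + 2 * b) / Real.log (Real.log 3), ?_, fun d hd => ?_⟩
  · have : 0 ≤ (2 + 2 * b) / Real.log (Real.log 3) := by positivity
    linarith
  have hd1 : (1 : ℝ) ≤ d := by exact_mod_cast hd
  have hdτ : 1 ≤ d * τ := one_le_mul_of_one_le_of_one_le hd1 hτ
  set D : ℝ := ((max d 3 : ℕ) : ℝ) with hD
  have hD3 : (3 : ℝ) ≤ D := by rw [hD]; exact_mod_cast le_max_right d 3
  have hDd : (d : ℝ) ≤ D := by rw [hD]; exact_mod_cast le_max_left d 3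
  have hlogD : Real.log 3 ≤ Real.log D := Real.log_le_log (by norm_num) hD3
  have hLL : Real.log (Real.log 3) ≤ Real.log (Real.log D) := Real.log_le_log (by linarith) hlogD
  set r := Real.log (d * τ) / Real.log 2 with hr
  have hr0 : 0 ≤ r := div_nonneg (Real.log_nonneg hdτ) (by linarith)
  have hr2 : r ≤ 2 * Real.log (d * τ) := by
    rw [hr, div_le_iff₀ (by linarith)]
    nlinarith [Real.log_nonneg hdτ]
  set x := Real.log r / Real.log 2 with hx
  have hR : (⌈x⌉₊ : ℝ) ≤ max x 0 + 1 := by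
    rcases le_total x 0 with h | h
    · rw [Nat.ceil_eq_zero.2 h, max_eq_right h]; norm_num
    · rw [max_eq_left h]; exact (Nat.ceil_lt_add_one h).le
  have hxle : ∀ y, 0 ≤ y → Real.log r ≤ y → max x 0 ≤ 2 * y := fun y hy h => by
    refine max_le ?_ (by linarith)
    rw [hx, div_le_iff₀ (by linarith)]
    nlinarith
  refine ⟨⌈x⌉₊, ?_, ?_, ?_⟩
  · have : r ≤ 2 ^ ⌈x⌉₊ := by
      rcases hr0.eq_or_lt with h | h
      · rw [← h]; positivity
      · rw [← Real.log_le_log_iff h (by positivity), Real.log_pow]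
        have := Nat.le_ceil x
        rw [hx, div_le_iff₀ (by linarith)] at this
        exact this
    rwa [hr, div_le_iff₀ (by linarith)] at this
  · have h5 : Real.log r ≤ Real.log (Real.log D) + b := by
      -- For dτ = 1 one has r = 0, and the logarithm takes its default value 0.
      rcases hr0.eq_or_lt with h | h
      · rw [← h, Real.log_zero]; linarith
      · rw [hb, ← Real.log_mul (by linarith) (by linarith)]
        refine Real.log_le_log h (hr2.trans ?_)
        rw [Real.log_mul (by linarith) (by linarith)]
        have h6 : Real.log d ≤ Real.log D := Real.log_le_log (by linarith) hDd
        nlinarith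
    have h6 := hxle _ (by linarith) h5
    have h7 : 2 + 2 * b ≤ (2 + 2 * b) / Real.log (Real.log 3) * Real.log (Real.log D) := by
      rw [div_mul_eq_mul_div, le_div_iff₀ ha]
      exact mul_le_mul_of_nonneg_left hLL (by linarith)
    rw [add_mul]
    linarith
  · have h5 : Real.log r ≤ 2 * (d * τ - 1) := by
      have h6 : r ≤ 2 * (d * τ - 1) := by
        have := Real.log_le_sub_one_of_pos (show 0 < d * τ by linarith)
        linarith
      rcases hr0.eq_or_lt with h | h
      · rw [← h, Real.log_zero]; linarith
      · have := Real.log_le_sub_one_of_pos h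
        linarith
    have h6 := hxle _ (by linarith) h5
    linarith

/-- With N = n + d, Bernoulli's inequality gives exp(40 τ log N) ≥ N^40 τ. The factors r (1 + d)
cost 4 N² τ, and (nd)^18 ≤ (N²/4)^18, so N² is left over. -/
theorem failure_le {n d : ℕ} (hn : 1 ≤ n) (hd : 1 ≤ d) {τ : ℝ} (hτ : 1 ≤ τ) {r : ℝ}
    (hr : r ≤ 4 * (d * τ)) :
    r * ((1 + d) / Real.exp (40 * τ * Real.log (n + d))) ≤ ((n * d : ℝ) ^ 18)⁻¹ := by
  have hn1 : (1 : ℝ) ≤ n := by exact_mod_cast hn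
  have hd1 : (1 : ℝ) ≤ d := by exact_mod_cast hd
  have hℓ := log_count_pos hn hd
  set N : ℝ := n + d with hN
  have hN0 : 0 < N := by linarith
  have hexp : N ^ 40 * τ ≤ Real.exp (40 * τ * Real.log N) := by
    rw [show 40 * τ * Real.log N = (40 : ℕ) * Real.log N + 40 * (τ - 1) * Real.log N by
      push_cast; ring, Real.exp_add, Real.exp_nat_mul, Real.exp_log hN0]
    refine mul_le_mul_of_nonneg_left ?_ (by positivity)
    have := Real.add_one_le_exp (40 * (τ - 1) * Real.log N)
    nlinarith
  have hnd : (n : ℝ) * d ≤ N ^ 2 / 4 := by nlinarith [sq_nonneg ((n : ℝ) - d)]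
  have hpow : ((n : ℝ) * d) ^ 18 ≤ N ^ 36 / 4 ^ 18 := by
    calc ((n : ℝ) * d) ^ 18 ≤ (N ^ 2 / 4) ^ 18 := pow_le_pow_left₀ (by positivity) hnd 18
      _ = _ := by ring
  rw [← mul_div_assoc, div_le_iff₀ (Real.exp_pos _), inv_mul_eq_div, le_div_iff₀ (by positivity)]
  refine le_trans ?_ hexp
  have h1 : r * (1 + d) ≤ 4 * (N * τ) * N := by
    refine mul_le_mul (hr.trans ?_) (by linarith) (by positivity) (by positivity)
    gcongr
    linarith
  calc r * (1 + d) * (n * d : ℝ) ^ 18 ≤ 4 * (N * τ) * N * (N ^ 36 / 4 ^ 18) :=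
        mul_le_mul h1 hpow (by positivity) (by positivity)
    _ = N ^ 38 * τ * (4 / 4 ^ 18) := by ring
    _ ≤ N ^ 38 * τ * N ^ 2 := by
        refine mul_le_mul_of_nonneg_left ?_ (by positivity)
        have : 1 ≤ N ^ 2 := one_le_pow₀ (by linarith)
        norm_num
        linarith
    _ = _ := by ring

/-- For accuracy e/(40τ) the call limit is 200 τ² · 40 τ · 1600 τ² = 12800000 τ^5 times (n+d)
log(n+d)/e². The search uses e = 1, so it only adds a multiple of its number of rounds; replacing ε
by min ε 1 costs an additive 1. -/
theorem calls_bound {n d R : ℕ} (hn : 1 ≤ n) (hd : 1 ≤ d) {τ ε C l : ℝ} (hτ : 1 ≤ τ) (hε : 0 < ε)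
    (hC : 1 ≤ C) (hR : (R + 1 : ℝ) ≤ C * l) :
    2 * n + R * (callLimit n d τ (1 / (40 * τ)) + n) + callLimit n d τ (min ε 1 / (40 * τ)) ≤
      (12800000 * τ ^ 5 + 4) * C * ((n + d) * ((ε ^ 2)⁻¹ + l) * Real.log (n + d)) := by
  have hℓ := log_count_pos hn hd
  have hd0 : (0 : ℝ) ≤ d := Nat.cast_nonneg _
  have hn0 : (0 : ℝ) ≤ n := Nat.cast_nonneg _
  set ℓ := Real.log (n + d : ℝ) with hℓ'
  set c := 12800000 * τ ^ 5 with hc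
  have hc0 : 0 ≤ c := by positivity
  set M := (n + d : ℝ) * ℓ with hM
  have hM0 : 0 ≤ M := by positivity
  have hnM : n ≤ 2 * M := by nlinarith
  have hlim : ∀ e, 0 < e → callLimit n d τ (e / (40 * τ)) = c * M * (e ^ 2)⁻¹ := fun e he => by
    rw [callLimit, horizon, hc, hM, ← hℓ']
    field_simp
    ring
  have he0 : 0 < min ε 1 := lt_min hε one_pos
  have he : ((min ε 1) ^ 2)⁻¹ ≤ (ε ^ 2)⁻¹ + 1 := by
    have : 0 < (ε ^ 2)⁻¹ := by positivity
    rcases min_choice ε 1 with h | h <;> rw [h]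
    · linarith
    · rw [one_pow, inv_one]; linarith
  have h1 : callLimit n d τ (min ε 1 / (40 * τ)) ≤ c * M * ((ε ^ 2)⁻¹ + 1) := by
    rw [hlim _ he0]
    exact mul_le_mul_of_nonneg_left he (by positivity)
  have h2 : (R : ℝ) * (callLimit n d τ (1 / (40 * τ)) + n) ≤ R * (c * M + 2 * M) := by
    rw [hlim 1 one_pos]
    refine mul_le_mul_of_nonneg_left ?_ (Nat.cast_nonneg _)
    norm_num
    exact hnM
  have hE : 0 < (ε ^ 2)⁻¹ := by positivity
  have hR0 : (0 : ℝ) ≤ R := Nat.cast_nonneg _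
  have h3 : (ε ^ 2)⁻¹ + (R + 1) ≤ C * ((ε ^ 2)⁻¹ + l) := by
    rw [mul_add]
    nlinarith
  calc 2 * n + R * (callLimit n d τ (1 / (40 * τ)) + n) + callLimit n d τ (min ε 1 / (40 * τ))
      ≤ 4 * M + R * (c * M + 2 * M) + c * M * ((ε ^ 2)⁻¹ + 1) := by linarith
    _ ≤ (c + 4) * M * ((ε ^ 2)⁻¹ + (R + 1)) := by
        have h4 : 0 ≤ M * R := by positivity
        have h5 : 0 ≤ M * (ε ^ 2)⁻¹ := by positivity
        have : (c + 4) * M * ((ε ^ 2)⁻¹ + (R + 1)) = 4 * M + R * (c * M + 2 * M) +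
          c * M * ((ε ^ 2)⁻¹ + 1) + 2 * (M * R) + 4 * (M * (ε ^ 2)⁻¹) := by ring
        linarith
    _ ≤ (c + 4) * M * (C * ((ε ^ 2)⁻¹ + l)) := mul_le_mul_of_nonneg_left h3 (by positivity)
    _ = _ := by rw [hM]; ring

end RealRAM

end

theorem theorem1 :
    ∃ P : RealRAM.Prog, ∀ τ : ℝ, 1 ≤ τ → ∃ K : ℝ,
      ∀ (n d : ℕ), 1 ≤ n → 1 ≤ d →
      ∀ β : Fin d → ℝ, IsOrderedWeight β →
      ∀ X : Fin n → Set (Fin d → ℝ),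
        (∀ c, IsClosed (X c)) → (∀ c, Convex ℝ (X c)) → (∀ c, ∀ x ∈ X c, ∀ j, 0 ≤ x j) →
      ∀ f : Fin n → (Fin d → ℝ) → Fin d → ℝ, (∀ c, IsLinMinOracle τ (X c) (f c)) →
      ∀ ε : ℝ, 0 < ε →
        (∀ ω : ℕ → unitInterval, ∃ s : RealRAM.State,
          RealRAM.Exec f ω P (RealRAM.inputState n β ε τ) s ∧
          IsApproxSolution β X (τ * (1 + ε)) (s.output d) ∧
          (s.time : ℝ) ≤ K * (1 + d * Real.log d) * s.calls) ∧
        RealRAM.tapeMeasure {ω | ∃ s : RealRAM.State,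
          RealRAM.Exec f ω P (RealRAM.inputState n β ε τ) s ∧
          K * ((n + d) * ((ε ^ 2)⁻¹ + Real.log (Real.log (max d 3 : ℕ))) * Real.log (n + d))
            < (s.calls : ℝ)}
          ≤ ENNReal.ofReal (((n * d : ℝ) ^ 18)⁻¹) := by
  refine ⟨RealRAM.mainProg, fun τ hτ => ?_⟩
  obtain ⟨C, hC, hrounds⟩ := RealRAM.exists_rounds hτ
  -- The first summand bounds the calls. The second is 7000 · 4, from the time per call and from
  -- `timeUnit_le`.
  refine ⟨(12800000 * τ ^ 5 + 4) * C + 28000, fun n d hn hd β hβ X _ hconv hnonneg f hf ε hε => ?_⟩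
  obtain ⟨R, hR1, hR2, hR3⟩ := hrounds d hd
  have hK : 0 ≤ (12800000 * τ ^ 5 + 4) * C := by positivity
  have hd1 : (1 : ℝ) ≤ d := by exact_mod_cast hd
  obtain ⟨h1, h2⟩ := (RealRAM.Prob.mainProg (X := X)
    ⟨hn, hd, hβ, hτ, hconv, hnonneg, hf⟩ hε hR1).sound
  refine ⟨fun ω => ?_, ?_⟩
  · obtain ⟨s, hs, hs1, hs2⟩ := h1 ω
    refine ⟨s, hs, hs1, ?_⟩
    have h3 : (s.time : ℝ) ≤ 7000 * (RealRAM.timeUnit d * s.calls) := by exact_mod_cast hs2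
    have h4 : (RealRAM.timeUnit d : ℝ) * s.calls ≤ 4 * (1 + d * Real.log d) * s.calls :=
      mul_le_mul_of_nonneg_right (RealRAM.timeUnit_le hd) (Nat.cast_nonneg _)
    have h5 : 0 ≤ (1 + d * Real.log d) * s.calls := by
      have := Real.log_nonneg hd1
      positivity
    have h6 := mul_nonneg hK h5
    linarith
  · refine (measure_mono fun ω hω => ?_).trans
      (h2.trans (ENNReal.ofReal_le_ofReal (RealRAM.failure_le hn hd hτ hR3)))
    obtain ⟨s, hs, hcalls⟩ := hω
    refine ⟨s, hs, fun hcon => ?_⟩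
    have h3 := RealRAM.calls_bound hn hd hτ hε hC hR2
    have h4 : 0 ≤ (n + d : ℝ) * ((ε ^ 2)⁻¹ + Real.log (Real.log (max d 3 : ℕ))) *
        Real.log (n + d) := by
      have h5 := RealRAM.log_count_pos hn hd
      have h6 : 0 ≤ Real.log (Real.log (max d 3 : ℕ)) := by
        by_contra h
        have : (0 : ℝ) ≤ R := Nat.cast_nonneg _
        nlinarith
      positivity
    linarith
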